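/- Let $\varphi\in(0,\pi/2)$ and $\rho>1$. Let $\mathcal W_{\mathbb R,\rho}$ be the Banach space of Laurent series $u(\lambda)=\sum_{k\in\mathbb Z}u_k\lambda^k$ with real coefficients and norm $\|u\|=\sum_k|u_k|\rho^{|k|}<\infty$. Put $p_1=e^{i\varphi}$, $p_2=-e^{-i\varphi}$, $p_3=-e^{i\varphi}$, $p_4=e^{-i\varphi}$, $$\mathfrak m_1=\begin{pmatrix} i&0\\0&-i\end{pmatrix},\quad \mathfrak m_2=\begin{pmatrix}0&1\\1&0\end{pmatrix},\quad \mathfrak m_3=\begin{pmatrix}0&i\\-i&0\end{pmatrix},\quad C=\begin{pmatrix}0&i\\i&0\end{pmatrix},\quad D=\begin{pmatrix}i&0\\0&-i\end{pmatrix},$$ and $\omega_j=\sum_{l=1}^4\frac{\epsilon_{jl}}{z-p_l}\,dz$ with signs $\epsilon_1=(+,-,+,-)$, $\epsilon_2=(+,-,-,+)$, $\epsilon_3=(+,+,-,-)$. For real $t$, real $r>0$ and $x=(x_1,x_2,x_3)\in(\mathcal W_{\mathbb R,\rho})^3$ such that each $x_j$ has at most a simple pole at $\lambda=0$ (all coefficients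 of $\lambda^k$, $k<-1$, vanish), with $\lambda^{-1}$-coefficients $\tfrac12,\ -\tfrac12\sin\varphi,\ -\tfrac12\cos\varphi$ for $j=1,2,3$ respectively, let $$\eta=r\,t\sum_{j=1}^3x_j(\lambda)\,\mathfrak m_j\,\omega_j(z),$$ and for $0<|\lambda|<\rho$ let $\Phi$ be the solution of $d\Phi=\Phi\eta$, $\Phi(z=0)=\mathrm{Id}$, on $\mathbb C$ minus the four rays from $p_j$ radially to $\infty$. Set $\mathcal P=\Phi(z=1)$, $\mathcal Q=\Phi(z=i)$, $L_1=\mathcal QCD\mathcal Q^{-1}$, $L_2=D$, $L_3=\mathcal PC\mathcal P^{-1}$, and $$\mathfrak p=\tfrac12\operatorname{tr}(L_2L_3),\quad \mathfrak q=-\tfrac12\operatorname{tr}(L_1L_2),\quad \mathcal K=r^2(-x_1^2+x_2^2+x_3^2),\quad \Delta=4(1-\mathfrak p^2)(1-\mathfrak q^2)-4\cos^2(2\pi t),$$ all functions of $\lambda$. The tuple $(x_1,x_2,x_3,r)$ is said to solve the monodromy problem at $t$ if $\mathfrak p(\lambda)$ and $\mathfrak q(\lambda)$ are real for all $|\lambda|=1$,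 $\mathfrak q(1)=0$, and $\mathcal K(\lambda)=1$ for all $0<|\lambda|<\rho$. Then there are $\varepsilon>0$, depending only on $\varphi$ and $\rho$, and a real-analytic map $$(-\varepsilon,\varepsilon)\to(\mathcal W_{\mathbb R,\rho})^3\times\mathbb R,\qquad t\mapsto(x_1(t),x_2(t),x_3(t),r(t)),$$ such that for every $t\in[0,\varepsilon)$ the tuple $(x_1(t),x_2(t),x_3(t),r(t))$ (which in particular has $r(t)>0$ and the prescribed pole parts) solves the monodromy problem at $t$, and for every $t\in(0,\varepsilon)$ (in particular for $t=\tfrac1{2k}$ with $k$ large) it satisfies $\Delta(i)>0$ and is the only solution of the monodromy problem at $t$ with $\Delta(i)>0$. Moreover, at $t=0$, $$x_1(0)=\frac{1-\lambda^2}{2\lambda},\quad x_2(0)=-\sin(\varphi)\frac{(\lambda-1)^2}{2\lambda},\quad x_3(0)=-\frac1{\cos\varphi}-\cos(\varphi)\frac{(\lambda-1)^2}{2\lambda},\quad r(0)=\cos\varphi.$$ -/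

import Mathlib

open Complex Set Matrix

/-- Two-sided real sequences `u` with `∑ |u k| ρ^|k| < ∞`. -/
def wienerSubmodule (ρ : ℝ) : Submodule ℝ (ℤ → ℝ) where
  carrier := {u | Summable fun k : ℤ => |u k| * ρ ^ k.natAbs}
  zero_mem' := by simp
  add_mem' := by
    intro u v hu hv
    have hu' : Summable fun k : ℤ => |u k| * |ρ ^ k.natAbs| := by
      simpa [abs_mul] using hu.abs
    have hv' : Summable fun k : ℤ => |v k| * |ρ ^ k.natAbs| := by
      simpa [abs_mul] using hv.abs
    refine Summable.of_norm_bounded (hu'.add hv') fun k => ?_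
    rw [Real.norm_eq_abs, abs_mul, abs_abs, ← add_mul]
    exact mul_le_mul_of_nonneg_right (abs_add_le _ _) (abs_nonneg _)
  smul_mem' := by
    intro c u hu
    have h := Summable.mul_left |c| hu
    simpa [abs_mul, mul_assoc] using h

/-- The Wiener space `𝒲_{ℝ,ρ}` of Laurent series `∑ u k λ^k` with real coefficients and
`∑ |u k| ρ^|k| < ∞`. -/
def WienerSpace (ρ : ℝ) : Type := wienerSubmodule ρ

namespace WienerSpace

instance (ρ : ℝ) : AddCommGroup (WienerSpace ρ) := inferInstanceAs (AddCommGroup (wienerSubmodule ρ))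

instance (ρ : ℝ) : Module ℝ (WienerSpace ρ) := inferInstanceAs (Module ℝ (wienerSubmodule ρ))

/-- The `k`-th Laurent coefficient. -/
def coeff {ρ : ℝ} (u : WienerSpace ρ) (k : ℤ) : ℝ := u.1 k

theorem summable_coeff {ρ : ℝ} (u : WienerSpace ρ) :
    Summable fun k : ℤ => |u.coeff k| * ρ ^ k.natAbs := u.2

theorem coeff_add {ρ : ℝ} (u v : WienerSpace ρ) (k : ℤ) :
    (u + v).coeff k = u.coeff k + v.coeff k := rfl

theorem coeff_neg {ρ : ℝ} (u : WienerSpace ρ) (k : ℤ) : (-u).coeff k = -u.coeff k := rfl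

theorem coeff_smul {ρ : ℝ} (c : ℝ) (u : WienerSpace ρ) (k : ℤ) :
    (c • u).coeff k = c * u.coeff k := rfl

theorem coeff_zero {ρ : ℝ} (k : ℤ) : (0 : WienerSpace ρ).coeff k = 0 := rfl

theorem ext_coeff {ρ : ℝ} {u v : WienerSpace ρ} (h : ∀ k, u.coeff k = v.coeff k) : u = v :=
  Subtype.ext (funext h)

/-- The Wiener norm `‖u‖ = ∑ |u k| ρ^|k|`. -/
noncomputable def wienerNorm (ρ : ℝ) [hρ : Fact (1 < ρ)] : AddGroupNorm (WienerSpace ρ) where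
  toFun u := ∑' k : ℤ, |u.coeff k| * ρ ^ k.natAbs
  map_zero' := by simp [coeff_zero]
  add_le' u v := by
    have h0 : (0 : ℝ) ≤ ρ := by linarith [hρ.out]
    rw [← u.summable_coeff.tsum_add v.summable_coeff]
    refine Summable.tsum_le_tsum (fun k => ?_) (u + v).summable_coeff
      (u.summable_coeff.add v.summable_coeff)
    rw [coeff_add, ← add_mul]
    exact mul_le_mul_of_nonneg_right (abs_add_le _ _) (pow_nonneg h0 _)
  neg' u := by simp [coeff_neg]
  eq_zero_of_map_eq_zero' u hu := by
    have h0 : (0 : ℝ) < ρ := by linarith [hρ.out]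
    refine ext_coeff fun k => ?_
    have h1 := (u.summable_coeff.hasSum_iff.2 hu)
    have h2 := (hasSum_zero_iff_of_nonneg
      (fun k => mul_nonneg (abs_nonneg _) (pow_nonneg h0.le _))).1 h1
    have h3 := congrFun h2 k
    have h4 : ρ ^ k.natAbs ≠ 0 := (pow_pos h0 _).ne'
    simpa [h4, coeff_zero] using h3

noncomputable instance (ρ : ℝ) [Fact (1 < ρ)] : NormedAddCommGroup (WienerSpace ρ) :=
  (wienerNorm ρ).toNormedAddCommGroup

theorem norm_eq {ρ : ℝ} [Fact (1 < ρ)] (u : WienerSpace ρ) :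
    ‖u‖ = ∑' k : ℤ, |u.coeff k| * ρ ^ k.natAbs := rfl

noncomputable instance (ρ : ℝ) [Fact (1 < ρ)] : NormedSpace ℝ (WienerSpace ρ) where
  norm_smul_le c u := by
    rw [norm_eq, norm_eq, Real.norm_eq_abs, ← tsum_mul_left]
    refine le_of_eq (tsum_congr fun k => ?_)
    rw [coeff_smul, abs_mul, mul_assoc]

/-- The value `u(λ) = ∑ u k λ^k`. -/
noncomputable def eval {ρ : ℝ} (u : WienerSpace ρ) (l : ℂ) : ℂ :=
  ∑' k : ℤ, (u.coeff k : ℂ) * l ^ k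

end WienerSpace

namespace Lawson

/-- The punctures `e^{iφ}, -e^{-iφ}, -e^{iφ}, e^{-iφ}`. -/
noncomputable def puncture (φ : ℝ) : Fin 4 → ℂ :=
  ![exp (φ * I), -exp (-(φ * I)), -exp (φ * I), exp (-(φ * I))]

/-- The coefficients (with respect to `dz`) of the three meromorphic `1`-forms
`ω₁, ω₂, ω₃` on the punctured sphere. -/
noncomputable def omega (φ : ℝ) (z : ℂ) : Fin 3 → ℂ :=
  let p := puncture φ
  ![1 / (z - p 0) - 1 / (z - p 1) + 1 / (z - p 2) - 1 / (z - p 3),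
    1 / (z - p 0) - 1 / (z - p 1) - 1 / (z - p 2) + 1 / (z - p 3),
    1 / (z - p 0) + 1 / (z - p 1) - 1 / (z - p 2) - 1 / (z - p 3)]

/-- The matrices `𝔪₁, 𝔪₂, 𝔪₃`. -/
def mMat : Fin 3 → Matrix (Fin 2) (Fin 2) ℂ :=
  ![!![I, 0; 0, -I], !![0, 1; 1, 0], !![0, I; -I, 0]]

/-- The DPW potential `η(z,λ) = r t ∑ⱼ xⱼ(λ) 𝔪ⱼ ωⱼ(z)` (coefficient of `dz`). -/
noncomputable def potential {ρ : ℝ} (φ t : ℝ) (x : Fin 3 → WienerSpace ρ) (r : ℝ) (l z : ℂ) :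
    Matrix (Fin 2) (Fin 2) ℂ :=
  ((r : ℂ) * (t : ℂ)) • ∑ j : Fin 3, ((x j).eval l * omega φ z j) • mMat j

/-- The plane minus the four rays from the punctures to infinity. It is star-shaped about `0`
and contains `1` and `i` when `0 < φ < π/2`. -/
def slitDomain (φ : ℝ) : Set ℂ :=
  {z | ∀ j : Fin 4, ∀ s : ℝ, 1 ≤ s → z ≠ s * puncture φ j}

/-- `F` is, on the slit plane, the solution of `dF = F η(·,λ)` with `F(0) = Id`. -/
structure IsFrame {ρ : ℝ} (φ t : ℝ) (x : Fin 3 → WienerSpace ρ) (r : ℝ) (l : ℂ)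
    (F : ℂ → Matrix (Fin 2) (Fin 2) ℂ) : Prop where
  init : F 0 = 1
  ode : ∀ z ∈ slitDomain φ, ∀ a b : Fin 2,
    HasDerivAt (fun w => F w a b) ((F z * potential φ t x r l z) a b) z

def matC : Matrix (Fin 2) (Fin 2) ℂ := !![0, I; I, 0]

def matD : Matrix (Fin 2) (Fin 2) ℂ := !![I, 0; 0, -I]

/-- `L₁ = 𝒬 C D 𝒬⁻¹` with `𝒬 = F(i)`. -/
noncomputable def L₁ (F : ℂ → Matrix (Fin 2) (Fin 2) ℂ) : Matrix (Fin 2) (Fin 2) ℂ :=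
  F I * matC * matD * (F I)⁻¹

/-- `L₂ = D`. -/
def L₂ : Matrix (Fin 2) (Fin 2) ℂ := matD

/-- `L₃ = 𝒫 C 𝒫⁻¹` with `𝒫 = F(1)`. -/
noncomputable def L₃ (F : ℂ → Matrix (Fin 2) (Fin 2) ℂ) : Matrix (Fin 2) (Fin 2) ℂ :=
  F 1 * matC * (F 1)⁻¹

/-- The half-trace coordinate `𝔭 = ½ tr(L₂ L₃)`. -/
noncomputable def halfTraceP (F : ℂ → Matrix (Fin 2) (Fin 2) ℂ) : ℂ :=
  (1 / 2) * (L₂ * L₃ F).trace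

/-- The half-trace coordinate `𝔮 = -½ tr(L₁ L₂)`. -/
noncomputable def halfTraceQ (F : ℂ → Matrix (Fin 2) (Fin 2) ℂ) : ℂ :=
  -(1 / 2) * (L₁ F * L₂).trace

/-- `𝒦 = r² (-x₁² + x₂² + x₃²)`. -/
noncomputable def calK {ρ : ℝ} (x : Fin 3 → WienerSpace ρ) (r : ℝ) (l : ℂ) : ℂ :=
  (r : ℂ) ^ 2 * (-(x 0).eval l ^ 2 + (x 1).eval l ^ 2 + (x 2).eval l ^ 2)

/-- The Fricke discriminant `Δ = 4(1 - 𝔭²)(1 - 𝔮²) - 4 cos²(2πt)`. -/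
noncomputable def frickeDiscriminant (t : ℝ) (F : ℂ → Matrix (Fin 2) (Fin 2) ℂ) : ℂ :=
  4 * (1 - halfTraceP F ^ 2) * (1 - halfTraceQ F ^ 2) - 4 * Real.cos (2 * Real.pi * t) ^ 2

/-- The prescribed residues at `λ = 0` of `x₁, x₂, x₃`. -/
noncomputable def poleCoeff (φ : ℝ) : Fin 3 → ℝ :=
  ![1 / 2, -(1 / 2) * Real.sin φ, -(1 / 2) * Real.cos φ]

/-- `(x₁, x₂, x₃, r)` is an admissible choice of parameters solving the monodromy problem at `t`.
The family `F l` of frames, `l = λ` in the punctured disk of radius `ρ`, is determined on the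
slit plane by the other data. -/
structure IsMonodromySolution {ρ : ℝ} (φ t : ℝ) (x : Fin 3 → WienerSpace ρ) (r : ℝ)
    (F : ℂ → ℂ → Matrix (Fin 2) (Fin 2) ℂ) : Prop where
  r_pos : 0 < r
  pole_order : ∀ j, ∀ k : ℤ, k < -1 → (x j).coeff k = 0
  residue : ∀ j, (x j).coeff (-1) = poleCoeff φ j
  frame : ∀ l : ℂ, 0 < ‖l‖ → ‖l‖ < ρ → IsFrame φ t x r l (F l)
  p_real : ∀ l : ℂ, ‖l‖ = 1 → (halfTraceP (F l)).im = 0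
  q_real : ∀ l : ℂ, ‖l‖ = 1 → (halfTraceQ (F l)).im = 0
  q_one : halfTraceQ (F 1) = 0
  calK_eq : ∀ l : ℂ, 0 < ‖l‖ → ‖l‖ < ρ → calK x r l = 1

end Lawson

/-! Put `X = r x`. The potential depends on `X` and `t` only through `t X`, and `r` survives only as
the scale of the residues of `X` at `λ = 0`. Below, `X₁, X₂, X₃` are `X 0`, `X 1`, `X 2`.

Existence. Along the real and the imaginary axis the linear system makes sense over any commutative
Banach algebra, in particular over the Wiener algebra, and its solution is analytic in the
parameters. The half traces vanish at `t = 0`; the quotients `𝔭 / t` and `𝔮 / t` are analytic in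
`(t, X)` and equal `2π X₃` and `2π X₂` at `t = 0`. Since all coefficients are real, reality on the
unit circle means invariance under `λ ↦ 1/λ`. The whole problem becomes one analytic equation `monEq
= 0`, quadratic in `X` at `t = 0` and solved there by `centralX`. Its linearization is bijective
(`monLin_injective`, `monLin_surjective`): the second and third components are solved
coefficientwise up to two real numbers, which are fixed by the values at `λ = ±1`, the zeros of the
first central component; the first component then follows by division. The implicit function theorem
gives the branch and uniqueness near `centralX` (`exists_analytic_branch`).

Uniqueness. The symmetries `z ↦ -z` and `z ↦ 1/z` express the local monodromy at `p₁` by the two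
half-axis transports (`upFun_mul_loFun_add`). It follows that `-Δ = v²` with `v` in the Wiener
algebra (`vFun_sq`), and `v / t` is `4π X₁` at `t = 0`. As `v²` is invariant under `λ ↦ 1/λ` and the
algebra is a domain, `v` is symmetric or antisymmetric; `Δ(i) > 0` excludes the first (`refl_vFun`).
Hence `v(1) = 0`, and `v` is imaginary on the circle, so that `Δ ≥ 0` there.

At `λ = 1` both `𝔮` and `v` vanish, and the monodromy is intertwined with that of a system with
parameter `(0, 0, ±t)`. Residues with small eigenvalues are determined by the monodromy: an
intertwiner has removable singularities and is constant by Liouville (`eta_mul_eq`). This gives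
`X₁(1) = X₂(1) = 0` and `X₃(1) = ±1` (`eq_zero_of_qFun_eq_zero`). From there `Δ ≥ 0` bounds `𝔭` and
`𝔮` by `|sin 2πt|`, and a continuity argument bounds `X` on the circle (`exists_circle_bound`). The
maximum principle and the symmetry of the traces carry the bound to the annulus, where `X` is almost
(anti)symmetric (`exists_almost_symmetric`). A simple pole leaves only the residues and the constant
terms to control; the values at `1` and the `λ⁻¹` coefficient of `𝒦 = 1` do so. Thus every solution
is close to `centralX` in a slightly smaller annulus (`exists_near_central`), where local uniqueness
applies. -/

/-! ### Linear differential equations on the unit interval in a Banach algebra -/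

section Transport

set_option linter.unusedSectionVars false

open unitInterval ContDiff

variable {B : Type*} [NormedRing B] [NormedAlgebra ℝ B] [CompleteSpace B]
variable (𝕜 : Type*) [NontriviallyNormedField 𝕜] [NormedAlgebra 𝕜 B] [SMulCommClass ℝ 𝕜 B]

/-- Extension of a continuous function on `[0,1]` by constants. -/
noncomputable def unitExtend (f : C(I, B)) : ℝ → B := IccExtend zero_le_one f

theorem continuous_unitExtend (f : C(I, B)) : Continuous (unitExtend f) :=
  f.continuous.Icc_extend'

theorem unitExtend_coe (f : C(I, B)) (s : I) : unitExtend f s = f s :=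
  IccExtend_val zero_le_one f s

theorem unitExtend_of_mem (f : C(I, B)) {s : ℝ} (hs : s ∈ Icc (0 : ℝ) 1) :
    unitExtend f s = f ⟨s, hs⟩ :=
  IccExtend_of_mem zero_le_one f hs

/-- Integration from the left end point, as an operator on continuous functions. -/
noncomputable def primitiveCLM : C(I, B) →L[𝕜] C(I, B) :=
  LinearMap.mkContinuous
    { toFun := fun f =>
        ⟨fun s => ∫ u in (0 : ℝ)..s, unitExtend f u,
          (intervalIntegral.continuous_primitive
            (fun a b => (continuous_unitExtend f).intervalIntegrable a b) 0).comp
            continuous_subtype_val⟩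
      map_add' := fun f g => by
        ext s
        exact intervalIntegral.integral_add ((continuous_unitExtend f).intervalIntegrable _ _)
          ((continuous_unitExtend g).intervalIntegrable _ _)
      map_smul' := fun c f => by
        ext s
        exact intervalIntegral.integral_smul c (unitExtend f) }
    1 (fun f => by
      rw [one_mul, ContinuousMap.norm_le _ (norm_nonneg f)]
      intro s
      refine (intervalIntegral.norm_integral_le_of_norm_le_const (C := ‖f‖)
        (fun u _ => f.norm_coe_le_norm _)).trans ?_
      rw [sub_zero, abs_of_nonneg s.2.1]
      exact mul_le_of_le_one_right (norm_nonneg f) s.2.2)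

theorem primitiveCLM_apply (f : C(I, B)) (s : I) :
    primitiveCLM 𝕜 f s = ∫ u in (0 : ℝ)..s, unitExtend f u := rfl

/-- The Volterra operator `f ↦ ∫ f b`. -/
noncomputable def volterra (b : C(I, B)) : C(I, B) →L[𝕜] C(I, B) :=
  (primitiveCLM 𝕜).comp ((ContinuousLinearMap.mul 𝕜 C(I, B)).flip b)

theorem volterra_apply (b f : C(I, B)) (s : I) :
    volterra 𝕜 b f s = ∫ u in (0 : ℝ)..s, unitExtend (f * b) u := rfl

/-- The `n`-fold iterated integral runs over a simplex of volume `s ^ n / n!`, with one factor `‖b‖`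
per integration. The induction needs the bound at every `s`, not only in norm. -/
theorem norm_volterra_pow_apply_le (b f : C(I, B)) (n : ℕ) (s : I) :
    ‖(volterra 𝕜 b ^ n) f s‖ ≤ (‖b‖ * s) ^ n / n.factorial * ‖f‖ := by
  induction n generalizing s with
  | zero => simpa using f.norm_coe_le_norm s
  | succ n ih =>
    rw [pow_succ', mul_apply_eq_comp, volterra_apply]
    have h1 : ∀ u ∈ Icc (0 : ℝ) s, ‖unitExtend ((volterra 𝕜 b ^ n) f * b) u‖ ≤
        u ^ n * (‖b‖ ^ (n + 1) / n.factorial * ‖f‖) := by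
      intro u hu
      have hu1 : u ∈ Icc (0 : ℝ) 1 := ⟨hu.1, hu.2.trans s.2.2⟩
      rw [unitExtend_of_mem _ hu1]
      refine (norm_mul_le _ _).trans ?_
      refine (mul_le_mul (ih ⟨u, hu1⟩) (b.norm_coe_le_norm _) (norm_nonneg _)
        (by have := hu.1; positivity)).trans (le_of_eq ?_)
      simp only
      ring
    refine (intervalIntegral.norm_integral_le_of_norm_le (μ := MeasureTheory.volume)
      (g := fun u => u ^ n * (‖b‖ ^ (n + 1) / n.factorial * ‖f‖)) s.2.1
      (Filter.Eventually.of_forall fun u hu => h1 u ⟨hu.1.le, hu.2⟩)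
      (Continuous.intervalIntegrable (by fun_prop) _ _)).trans (le_of_eq ?_)
    rw [intervalIntegral.integral_mul_const, integral_pow, Nat.factorial_succ]
    have : (n.factorial : ℝ) ≠ 0 := by positivity
    have h2 : ((n : ℝ) + 1) ≠ 0 := by positivity
    push_cast
    field_simp
    ring

/-- The Volterra operator `V` is quasinilpotent: some power has norm below one, and `1 - V ^ n` is
the product of the commuting factors `1 - V` and `∑ V ^ i`, so both are units. No smallness of `b`
is needed. -/
theorem isUnit_one_sub_volterra (b : C(I, B)) : IsUnit (1 - volterra 𝕜 b) := by
  have hlim := FloorSemiring.tendsto_pow_div_factorial_atTop ‖b‖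
  obtain ⟨n, hn⟩ := (hlim.eventually (gt_mem_nhds (show (0 : ℝ) < 1 / 2 by norm_num))).exists
  have hV : ‖volterra 𝕜 b ^ n‖ < 1 := by
    refine lt_of_le_of_lt (ContinuousLinearMap.opNorm_le_bound _ (M := 1 / 2) (by norm_num) ?_)
      (by norm_num)
    intro f
    rw [ContinuousMap.norm_le _ (by positivity)]
    intro s
    refine (norm_volterra_pow_apply_le 𝕜 b f n s).trans ?_
    refine mul_le_mul_of_nonneg_right (le_trans ?_ hn.le) (norm_nonneg f)
    have : (‖b‖ * s) ^ n ≤ ‖b‖ ^ n :=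
      pow_le_pow_left₀ (mul_nonneg (norm_nonneg _) s.2.1)
        (mul_le_of_le_one_right (norm_nonneg _) s.2.2) n
    gcongr
  have h1 : IsUnit (1 - volterra 𝕜 b ^ n) := isUnit_one_sub_of_norm_lt_one (R := C(I, B) →L[𝕜] C(I, B)) hV
  have h2 : IsUnit ((1 - volterra 𝕜 b) * ∑ i ∈ Finset.range n, volterra 𝕜 b ^ i) := by
    rw [mul_neg_geom_sum (volterra 𝕜 b) n]
    exact h1
  have hc : Commute (1 - volterra 𝕜 b) (∑ i ∈ Finset.range n, volterra 𝕜 b ^ i) := by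
    exact (mul_neg_geom_sum (volterra 𝕜 b) n).trans (geom_sum_mul_neg (volterra 𝕜 b) n).symm
  exact (hc.isUnit_mul_iff.1 h2).1

/-- The solution of `f' = f b`, `f 0 = 1` on `[0,1]`. -/
noncomputable def odeSol (b : C(I, B)) : C(I, B) := Ring.inverse (1 - volterra ℝ b) 1

theorem eq_of_volterra_eq {b f g : C(I, B)} (h : f - volterra ℝ b f = g - volterra ℝ b g) :
    f = g := by
  obtain ⟨u, hu⟩ := isUnit_one_sub_volterra ℝ b
  have h2 : ∀ f : C(I, B), f = u⁻¹.1 (f - volterra ℝ b f) := by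
    intro f
    have h3 : (u⁻¹.1 * u.1) f = f := by rw [Units.inv_mul]; rfl
    rw [hu] at h3
    exact h3.symm
  rw [h2 f, h, ← h2 g]

theorem odeSol_sub_volterra (b : C(I, B)) : odeSol b - volterra 𝕜 b (odeSol b) = 1 := by
  have h := Ring.mul_inverse_cancel _ (isUnit_one_sub_volterra ℝ b)
  exact DFunLike.congr_fun h (1 : C(I, B))

/-- `odeSol` is built from operators over `ℝ`; the same integral equation solved over `𝕜` has the
same solution, so regularity over `ℂ` becomes available too. -/
theorem odeSol_eq (b : C(I, B)) :
    odeSol b = (Ring.inverse (1 - volterra 𝕜 b) : C(I, B) →L[𝕜] C(I, B)) 1 := by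
  have h := DFunLike.congr_fun (Ring.mul_inverse_cancel _ (isUnit_one_sub_volterra 𝕜 b))
    (1 : C(I, B))
  exact eq_of_volterra_eq ((odeSol_sub_volterra ℝ b).trans h.symm)

/-- Analytic dependence on the coefficient is analyticity of inversion in the Banach algebra of
operators, composed with the bounded linear map from `b` to its Volterra operator. -/
theorem contDiff_odeSol : ContDiff 𝕜 ω (odeSol : C(I, B) → C(I, B)) := by
  have h0 : (odeSol : C(I, B) → C(I, B)) =
      fun b => (Ring.inverse (1 - volterra 𝕜 b) : C(I, B) →L[𝕜] C(I, B)) 1 :=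
    funext (odeSol_eq 𝕜)
  have h1 : ContDiff 𝕜 ω fun b : C(I, B) => 1 - volterra 𝕜 b := by
    have : IsBoundedLinearMap 𝕜 (fun b : C(I, B) => volterra 𝕜 b) :=
      ((ContinuousLinearMap.compL 𝕜 _ _ _ (primitiveCLM 𝕜)).comp
        (ContinuousLinearMap.mul 𝕜 C(I, B)).flip).isBoundedLinearMap
    exact contDiff_const.sub this.contDiff
  rw [h0, contDiff_iff_contDiffAt]
  intro b
  have h2 : ContDiffAt 𝕜 ω (fun b : C(I, B) => Ring.inverse (1 - volterra 𝕜 b)) b := by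
    have h3 := contDiffAt_ringInverse 𝕜 (R := C(I, B) →L[𝕜] C(I, B)) (n := ω)
      (isUnit_one_sub_volterra 𝕜 b).unit
    exact ContDiffAt.comp b (by simpa using h3) h1.contDiffAt
  exact h2.clm_apply contDiffAt_const

theorem odeSol_apply (b : C(I, B)) (s : I) :
    odeSol b s = 1 + ∫ u in (0 : ℝ)..s, unitExtend (odeSol b * b) u := by
  have h := DFunLike.congr_fun (odeSol_sub_volterra ℝ b) s
  rw [ContinuousMap.sub_apply, sub_eq_iff_eq_add] at h
  exact h

theorem odeSol_zero (b : C(I, B)) : odeSol b 0 = 1 := by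
  rw [odeSol_apply]; simp

theorem hasDerivWithinAt_odeSol (b : C(I, B)) (s : I) :
    HasDerivWithinAt (unitExtend (odeSol b)) (odeSol b s * b s) (Icc 0 1) s := by
  have h1 : HasDerivAt (fun x : ℝ => 1 + ∫ u in (0 : ℝ)..x, unitExtend (odeSol b * b) u)
      (odeSol b s * b s) (s : ℝ) := by
    have := (continuous_unitExtend (odeSol b * b)).integral_hasStrictDerivAt 0 (s : ℝ)
    rw [unitExtend_coe] at this
    exact this.hasDerivAt.const_add 1
  refine h1.hasDerivWithinAt.congr (fun x hx => ?_) ?_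
  · rw [unitExtend_of_mem _ hx, odeSol_apply]
  · rw [unitExtend_coe, odeSol_apply]

/-- Solutions of the linear equation `Φ' = Φ b` are left multiples of `odeSol b`. -/
theorem eq_mul_odeSol {b : C(I, B)} {Φ : ℝ → B}
    (h : ∀ s : I, HasDerivWithinAt Φ (Φ s * b s) (Icc 0 1) s) (s : I) :
    Φ s = Φ 0 * odeSol b s := by
  have hc : ContinuousOn Φ (Icc 0 1) := fun s hs => (h ⟨s, hs⟩).continuousWithinAt
  let g : C(I, B) := ⟨fun s => Φ s, continuousOn_iff_continuous_domRestrict.1 hc⟩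
  have hg : ∀ s : I, g s = Φ 0 + ∫ u in (0 : ℝ)..s, unitExtend (g * b) u := by
    intro s
    have hint : IntervalIntegrable (unitExtend (g * b)) MeasureTheory.volume 0 (s : ℝ) :=
      (continuous_unitExtend _).intervalIntegrable _ _
    have := intervalIntegral.integral_eq_sub_of_hasDeriv_right_of_le (f := Φ) (a := 0) (b := s)
      s.2.1 (hc.mono (Icc_subset_Icc_right s.2.2)) (f' := unitExtend (g * b))
      (fun x hx => by
        have hx1 : x ∈ Ico (0 : ℝ) 1 := ⟨hx.1.le, hx.2.trans_le s.2.2⟩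
        rw [unitExtend_of_mem _ ⟨hx1.1, hx1.2.le⟩]
        exact (h ⟨x, hx1.1, hx1.2.le⟩).mono_of_mem_nhdsWithin
          (Filter.mem_of_superset (Icc_mem_nhdsGT_of_mem hx1) fun _ hy => hy)) hint
    rw [this]
    exact (add_sub_cancel _ _).symm
  -- `k` is the claimed formula; it satisfies the same integral equation as `g`, with the same
  -- initial value.
  let k : C(I, B) := ContinuousMap.const I (Φ 0) * odeSol b
  have hk : ∀ s : I, k s = Φ 0 + ∫ u in (0 : ℝ)..s, unitExtend (k * b) u := by
    intro s
    have : ∀ u, unitExtend (k * b) u = Φ 0 * unitExtend (odeSol b * b) u := by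
      intro u
      simp only [unitExtend, IccExtend, Function.comp]
      simp [k, mul_assoc]
    simp only [this]
    rw [show ∫ u in (0 : ℝ)..s, Φ 0 * unitExtend (odeSol b * b) u =
      Φ 0 * ∫ u in (0 : ℝ)..s, unitExtend (odeSol b * b) u from
      (ContinuousLinearMap.mul ℝ B (Φ 0)).intervalIntegral_comp_comm
        ((continuous_unitExtend _).intervalIntegrable _ _)]
    simp only [k, ContinuousMap.mul_apply, ContinuousMap.const_apply]
    conv_lhs => rw [odeSol_apply, mul_add, mul_one]
  have : g = k := by
    refine eq_of_volterra_eq (b := b) ?_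
    ext s
    rw [ContinuousMap.sub_apply, ContinuousMap.sub_apply, volterra_apply, volterra_apply]
    conv_lhs => rw [hg s]
    conv_rhs => rw [hk s]
    simp
  exact DFunLike.congr_fun this s

theorem odeSol_eq_of_hasDerivWithinAt {b : C(I, B)} {Φ : ℝ → B} (h0 : Φ 0 = 1)
    (h : ∀ s : I, HasDerivWithinAt Φ (Φ s * b s) (Icc 0 1) s) (s : I) :
    odeSol b s = Φ s := by
  rw [eq_mul_odeSol h s, h0, one_mul]

/-- Bounded algebra homomorphisms map solutions to solutions. -/
theorem map_odeSol {B' : Type*} [NormedRing B'] [NormedAlgebra ℝ B'] [CompleteSpace B']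
    (f : B →L[ℝ] B') (h1 : f 1 = 1) (hm : ∀ x y, f (x * y) = f x * f y) (b : C(I, B))
    (b' : C(I, B')) (hb : ∀ s, b' s = f (b s)) (s : I) : f (odeSol b s) = odeSol b' s := by
  have := odeSol_eq_of_hasDerivWithinAt (b := b') (Φ := fun s => f (unitExtend (odeSol b) s))
    (by
      have : unitExtend (odeSol b) 0 = 1 := by
        rw [← odeSol_zero b, ← unitExtend_coe]; rfl
      rw [this, h1])
    (fun s => by
      have := f.hasFDerivAt.comp_hasDerivWithinAt (s : ℝ) (hasDerivWithinAt_odeSol b s)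
      rw [hm, ← hb] at this
      rw [unitExtend_coe]
      exact this) s
  rw [this, unitExtend_coe]

/-- The first order term: `odeSol (τ b) = 1 + τ R(τ, b)`. -/
noncomputable def odeRem (τ : 𝕜) (b : C(I, B)) : C(I, B) := volterra 𝕜 b (odeSol (τ • b))

/-- The integral equation itself is an exact first order expansion, because the Volterra operator is
linear in `b`. The quotient `odeRem` stays analytic at `τ = 0`, which later allows the trace
equations to be divided by `t`. -/
theorem odeSol_smul (τ : 𝕜) (b : C(I, B)) :
    odeSol (τ • b) = 1 + τ • odeRem 𝕜 τ b := by
  have h := odeSol_sub_volterra 𝕜 (τ • b)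
  rw [sub_eq_iff_eq_add] at h
  have h2 : volterra 𝕜 (τ • b) = τ • volterra 𝕜 b := by
    rw [volterra, volterra, map_smul, ContinuousLinearMap.comp_smul]
  rw [h2] at h
  exact h

theorem contDiff_odeRem :
    ContDiff 𝕜 ω fun p : 𝕜 × C(I, B) => odeRem 𝕜 p.1 p.2 := by
  have : IsBoundedLinearMap 𝕜 (fun b : C(I, B) => volterra 𝕜 b) :=
    ((ContinuousLinearMap.compL 𝕜 _ _ _ (primitiveCLM 𝕜)).comp
      (ContinuousLinearMap.mul 𝕜 C(I, B)).flip).isBoundedLinearMap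
  have h1 : ContDiff 𝕜 ω fun p : 𝕜 × C(I, B) => volterra 𝕜 p.2 := this.contDiff.comp (g := fun b : C(I, B) => volterra 𝕜 b) contDiff_snd
  exact h1.clm_apply ((contDiff_odeSol 𝕜).comp (contDiff_fst.smul contDiff_snd))

theorem odeSol_const_zero : odeSol (0 : C(I, B)) = 1 := by
  have h := odeSol_sub_volterra ℝ (0 : C(I, B))
  have h2 : volterra ℝ (0 : C(I, B)) = 0 := by
    rw [volterra, map_zero, ContinuousLinearMap.comp_zero]
  rw [h2] at h
  simpa using h

theorem odeRem_zero (b : C(I, B)) : odeRem 𝕜 0 b = primitiveCLM 𝕜 b := by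
  rw [odeRem, show (0 : 𝕜) • b = 0 from zero_smul 𝕜 b, odeSol_const_zero]
  ext s
  rw [volterra_apply, one_mul, primitiveCLM_apply]

end Transport

/-! ### The Banach algebra of 2 × 2 matrices -/

section Mat

set_option linter.unusedSectionVars false

open ContDiff unitInterval

/-- `2 × 2` matrices with the row-sum norm. -/
def Mat (A : Type*) : Type _ := Matrix (Fin 2) (Fin 2) A

namespace Mat

attribute [local instance] Matrix.linftyOpNormedRing Matrix.linftyOpNormedAlgebra in
noncomputable instance {A : Type*} [NormedCommRing A] : NormedRing (Mat A) :=
  inferInstanceAs (NormedRing (Matrix (Fin 2) (Fin 2) A))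

attribute [local instance] Matrix.linftyOpNormedRing Matrix.linftyOpNormedAlgebra in
noncomputable instance {A : Type*} [NormedCommRing A] {𝕜 : Type*} [NormedField 𝕜]
    [NormedAlgebra 𝕜 A] : NormedAlgebra 𝕜 (Mat A) :=
  inferInstanceAs (NormedAlgebra 𝕜 (Matrix (Fin 2) (Fin 2) A))

attribute [local instance] Matrix.linftyOpNormedRing Matrix.linftyOpNormedAlgebra in
instance {A : Type*} [NormedCommRing A] [CompleteSpace A] : CompleteSpace (Mat A) :=
  inferInstanceAs (CompleteSpace (Matrix (Fin 2) (Fin 2) A))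

variable {A : Type*} [NormedCommRing A]

@[ext] theorem ext {M N : Mat A} (h : ∀ i j, M i j = N i j) : M = N := Matrix.ext h

theorem add_apply (M N : Mat A) (i j : Fin 2) : (M + N) i j = M i j + N i j := rfl

theorem smul_apply {𝕜 : Type*} [NormedField 𝕜] [NormedAlgebra 𝕜 A] (c : 𝕜) (M : Mat A)
    (i j : Fin 2) : (c • M) i j = c • M i j := rfl

theorem mul_apply (M N : Mat A) (i j : Fin 2) :
    (M * N) i j = M i 0 * N 0 j + M i 1 * N 1 j := by
  refine (Matrix.mul_apply (M := (M : Matrix (Fin 2) (Fin 2) A)) (N := N)).trans ?_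
  rw [Fin.sum_univ_two]

theorem one_apply (i j : Fin 2) : (1 : Mat A) i j = if i = j then 1 else 0 :=
  Matrix.one_apply

instance {𝕜 : Type*} [NormedField 𝕜] [NormedAlgebra 𝕜 A] [NormedAlgebra ℝ A]
    [SMulCommClass ℝ 𝕜 A] : SMulCommClass ℝ 𝕜 (Mat A) where
  smul_comm c d M := Mat.ext fun i j => smul_comm c d (M i j)

theorem norm_le_iff (M : Mat A) {C : ℝ} : ‖M‖ ≤ C ↔ ∀ i, ‖M i 0‖ + ‖M i 1‖ ≤ C := by
  have h : ‖M‖ = ((Finset.univ : Finset (Fin 2)).sup fun i => ∑ j, ‖M i j‖₊ : NNReal) :=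
    Matrix.linfty_opNorm_def (M : Matrix (Fin 2) (Fin 2) A)
  rcases lt_or_ge C 0 with hC | hC
  · constructor
    · intro h'; exact absurd (norm_nonneg M) (by linarith)
    · intro h'; have := h' 0
      linarith [norm_nonneg (M 0 0), norm_nonneg (M 0 1)]
  lift C to NNReal using hC
  rw [h, NNReal.coe_le_coe, Finset.sup_le_iff]
  simp only [Finset.mem_univ, true_imp_iff, Fin.sum_univ_two, ← NNReal.coe_le_coe,
    NNReal.coe_add, coe_nnnorm]

theorem norm_entry_le (M : Mat A) (i j : Fin 2) : ‖M i j‖ ≤ ‖M‖ := by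
  have h := (norm_le_iff M).1 le_rfl i
  have h0 := norm_nonneg (M i 0)
  have h1 := norm_nonneg (M i 1)
  fin_cases j
  · exact (le_add_of_nonneg_right h1).trans h
  · exact (le_add_of_nonneg_left h0).trans h

/-- Entries as continuous linear maps. -/
noncomputable def entry (𝕜 : Type*) [NontriviallyNormedField 𝕜] [NormedAlgebra 𝕜 A] (i j : Fin 2) :
    Mat A →L[𝕜] A :=
  LinearMap.mkContinuous
    { toFun := fun M => M i j
      map_add' := fun M N => add_apply M N i j
      map_smul' := fun c M => smul_apply c M i j } 1
    (fun M => (norm_entry_le M i j).trans (one_mul ‖M‖).ge)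

/-- The matrix with given entries. -/
def of4 (a b c d : A) : Mat A := (!![a, b; c, d] : Matrix (Fin 2) (Fin 2) A)

@[simp] theorem of4_00 (a b c d : A) : of4 a b c d 0 0 = a := rfl
@[simp] theorem of4_01 (a b c d : A) : of4 a b c d 0 1 = b := rfl
@[simp] theorem of4_10 (a b c d : A) : of4 a b c d 1 0 = c := rfl
@[simp] theorem of4_11 (a b c d : A) : of4 a b c d 1 1 = d := rfl

theorem ext4 {M N : Mat A} (h00 : M 0 0 = N 0 0) (h01 : M 0 1 = N 0 1) (h10 : M 1 0 = N 1 0)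
    (h11 : M 1 1 = N 1 1) : M = N := by
  ext i j
  fin_cases i <;> fin_cases j <;> assumption

/-- `of4` as a continuous linear map. -/
noncomputable def of4CLM (𝕜 : Type*) [NontriviallyNormedField 𝕜] [NormedAlgebra 𝕜 A] :
    (A × A × A × A) →L[𝕜] Mat A :=
  LinearMap.mkContinuous
    { toFun := fun v => of4 v.1 v.2.1 v.2.2.1 v.2.2.2
      map_add' := fun u v => by apply ext4 <;> rfl
      map_smul' := fun c v => by apply ext4 <;> rfl } 2
    (fun v => by
      rw [norm_le_iff]
      have h1 := norm_fst_le v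
      have h2 := (norm_fst_le v.2).trans (norm_snd_le v)
      have h3 := (norm_fst_le v.2.2).trans ((norm_snd_le v.2).trans (norm_snd_le v))
      have h4 := (norm_snd_le v.2.2).trans ((norm_snd_le v.2).trans (norm_snd_le v))
      intro i
      fin_cases i
      · change ‖v.1‖ + ‖v.2.1‖ ≤ _; linarith
      · change ‖v.2.2.1‖ + ‖v.2.2.2‖ ≤ _; linarith)

theorem of4_eta (M : Mat A) : of4 (M 0 0) (M 0 1) (M 1 0) (M 1 1) = M := by
  apply ext4 <;> rfl

theorem hasDerivWithinAt_iff {𝕜 : Type*} [NontriviallyNormedField 𝕜] [NormedAlgebra 𝕜 A]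
    {F : 𝕜 → Mat A} {F' : Mat A} {s : Set 𝕜} {x : 𝕜} :
    HasDerivWithinAt F F' s x ↔ ∀ i j, HasDerivWithinAt (fun w => F w i j) (F' i j) s x := by
  constructor
  · intro h i j
    exact (entry 𝕜 (A := A) i j).hasFDerivAt.comp_hasDerivWithinAt x h
  · intro h
    have h2 := (h 0 0).prodMk ((h 0 1).prodMk ((h 1 0).prodMk (h 1 1)))
    have h3 := (of4CLM 𝕜 (A := A)).hasFDerivAt.comp_hasDerivWithinAt x h2
    have e : (fun w => of4CLM 𝕜 (A := A) (F w 0 0, F w 0 1, F w 1 0, F w 1 1)) = F :=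
      funext fun w => of4_eta (F w)
    have e' : of4CLM 𝕜 (A := A) (F' 0 0, F' 0 1, F' 1 0, F' 1 1) = F' := of4_eta F'
    rw [e'] at h3
    rw [← e]
    exact h3

theorem hasDerivAt_iff {𝕜 : Type*} [NontriviallyNormedField 𝕜] [NormedAlgebra 𝕜 A]
    {F : 𝕜 → Mat A} {F' : Mat A} {x : 𝕜} :
    HasDerivAt F F' x ↔ ∀ i j, HasDerivAt (fun w => F w i j) (F' i j) x := by
  simp only [← hasDerivWithinAt_univ]
  exact hasDerivWithinAt_iff

end Mat

end Mat

/-! ### Evaluation and Cauchy estimates in the Wiener space -/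

namespace WienerSpace

variable {ρ : ℝ}

theorem mul_pow_natAbs_le [hρ : Fact (1 < ρ)] (k m : ℤ) :
    ρ ^ (k + m).natAbs ≤ ρ ^ k.natAbs * ρ ^ m.natAbs := by
  rw [← pow_add]
  exact pow_le_pow_right₀ hρ.out.le (Int.natAbs_add_le k m)

theorem norm_zpow_le [hρ : Fact (1 < ρ)] {l : ℂ} (h1 : ρ⁻¹ ≤ ‖l‖) (h2 : ‖l‖ ≤ ρ) (k : ℤ) :
    ‖l ^ k‖ ≤ ρ ^ k.natAbs := by
  have h0 : (0 : ℝ) < ρ := by linarith [hρ.out]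
  have hl : 0 < ‖l‖ := lt_of_lt_of_le (inv_pos.2 h0) h1
  rw [norm_zpow]
  obtain ⟨n, rfl | rfl⟩ := k.eq_nat_or_neg
  · simpa using pow_le_pow_left₀ hl.le h2 n
  · have : ‖l‖⁻¹ ≤ ρ := inv_le_of_inv_le₀ h0 h1
    simpa using pow_le_pow_left₀ (inv_nonneg.2 hl.le) this n

/-- `l` lies in the closed annulus of convergence. -/
def InAnnulus (ρ : ℝ) (l : ℂ) : Prop := ρ⁻¹ ≤ ‖l‖ ∧ ‖l‖ ≤ ρ

theorem inAnnulus_of_norm_one [hρ : Fact (1 < ρ)] {l : ℂ} (hl : ‖l‖ = 1) : InAnnulus ρ l :=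
  ⟨by rw [hl]; exact inv_le_one_of_one_le₀ hρ.out.le, by rw [hl]; exact hρ.out.le⟩

theorem InAnnulus.ne_zero [hρ : Fact (1 < ρ)] {l : ℂ} (hl : InAnnulus ρ l) : l ≠ 0 := by
  have h0 : (0 : ℝ) < ρ := by linarith [hρ.out]
  exact norm_pos_iff.1 (lt_of_lt_of_le (inv_pos.2 h0) hl.1)

theorem InAnnulus.inv [hρ : Fact (1 < ρ)] {l : ℂ} (hl : InAnnulus ρ l) : InAnnulus ρ l⁻¹ := by
  have h0 : (0 : ℝ) < ρ := by linarith [hρ.out]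
  have h1 := norm_pos_iff.2 hl.ne_zero
  rw [InAnnulus, norm_inv]
  exact ⟨inv_anti₀ h1 hl.2, inv_le_of_inv_le₀ h0 hl.1⟩

variable [hρ : Fact (1 < ρ)]

theorem rho_pos : (0 : ℝ) < ρ := by linarith [hρ.out]

theorem norm_term_le (u : WienerSpace ρ) {l : ℂ} (hl : InAnnulus ρ l) (k : ℤ) :
    ‖(u.coeff k : ℂ) * l ^ k‖ ≤ |u.coeff k| * ρ ^ k.natAbs := by
  rw [norm_mul, Complex.norm_real, Real.norm_eq_abs]
  exact mul_le_mul_of_nonneg_left (norm_zpow_le hl.1 hl.2 k) (abs_nonneg _)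

theorem summable_norm_term (u : WienerSpace ρ) {l : ℂ} (hl : InAnnulus ρ l) :
    Summable fun k : ℤ => ‖(u.coeff k : ℂ) * l ^ k‖ :=
  Summable.of_nonneg_of_le (fun _ => norm_nonneg _) (u.norm_term_le hl) u.summable_coeff

theorem hasSum_eval (u : WienerSpace ρ) {l : ℂ} (hl : InAnnulus ρ l) :
    HasSum (fun k : ℤ => (u.coeff k : ℂ) * l ^ k) (u.eval l) :=
  (u.summable_norm_term hl).of_norm.hasSum

theorem norm_eval_le (u : WienerSpace ρ) {l : ℂ} (hl : InAnnulus ρ l) : ‖u.eval l‖ ≤ ‖u‖ := by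
  rw [norm_eq]
  exact tsum_of_norm_bounded u.summable_coeff.hasSum (u.norm_term_le hl)

theorem abs_coeff_mul_le_norm (u : WienerSpace ρ) (k : ℤ) : |u.coeff k| * ρ ^ k.natAbs ≤ ‖u‖ := by
  rw [norm_eq]
  exact u.summable_coeff.le_tsum k
    (fun j _ => mul_nonneg (abs_nonneg _) (pow_nonneg rho_pos.le _))

theorem eval_add (u v : WienerSpace ρ) {l : ℂ} (hl : InAnnulus ρ l) :
    (u + v).eval l = u.eval l + v.eval l := by
  refine ((u.hasSum_eval hl).add (v.hasSum_eval hl)).unique ?_ |>.symm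
  convert! (u + v).hasSum_eval hl using 2 with k
  rw [coeff_add]; push_cast; ring

theorem eval_smul (c : ℝ) (u : WienerSpace ρ) {l : ℂ} (hl : InAnnulus ρ l) :
    (c • u).eval l = c * u.eval l := by
  refine ((u.hasSum_eval hl).mul_left (c : ℂ)).unique ?_ |>.symm
  convert! (c • u).hasSum_eval hl using 2 with k
  rw [coeff_smul]; push_cast; ring

/-- Cauchy's estimate on a circle inside the closed annulus of convergence. -/
theorem abs_coeff_mul_zpow_le (u : WienerSpace ρ) {R M : ℝ} (hR1 : ρ⁻¹ ≤ R) (hR2 : R ≤ ρ)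
    (hM : ∀ l : ℂ, ‖l‖ = R → ‖u.eval l‖ ≤ M) (n : ℤ) : |u.coeff n| * R ^ n ≤ M := by
  have hR : 0 < R := lt_of_lt_of_le (inv_pos.2 rho_pos) hR1
  have hnorm : ∀ θ : ℝ, ‖(R : ℂ) * exp (θ * I)‖ = R := fun θ => by
    rw [norm_mul, norm_exp_ofReal_mul_I, mul_one, norm_real, Real.norm_eq_abs, abs_of_pos hR]
  have hann : ∀ θ : ℝ, InAnnulus ρ ((R : ℂ) * exp (θ * I)) := fun θ => by
    rw [InAnnulus, hnorm]; exact ⟨hR1, hR2⟩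
  -- The series on the circle of radius `R` is integrated termwise against `e^{-inθ}`; only the term
  -- `k = n` survives.
  let F : ℤ → ℝ → ℂ := fun k θ =>
    (u.coeff k : ℂ) * ((R : ℂ) * exp (θ * I)) ^ k * exp (-(n * (θ * I)))
  have hne : ∀ n : ℤ, ∀ θ : ℝ, ‖exp (-(n * (θ * I)))‖ = 1 := fun n θ => by
    have : -((n : ℂ) * (θ * I)) = ((-(n * θ) : ℝ) : ℂ) * I := by push_cast; ring
    rw [this, norm_exp_ofReal_mul_I]
  have hF : ∀ k : ℤ, F k = fun θ : ℝ =>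
      ((u.coeff k : ℂ) * (R : ℂ) ^ k) * exp ((((k - n : ℤ) : ℂ) * I) * θ) := fun k => by
    funext θ
    simp only [F]
    rw [mul_zpow, ← Complex.exp_int_mul, mul_assoc, mul_assoc, mul_assoc, ← Complex.exp_add]
    congr 3
    push_cast; ring
  have hint : ∀ k : ℤ, ∫ θ in (0 : ℝ)..(2 * Real.pi), F k θ =
      if k = n then 2 * Real.pi * ((u.coeff n : ℂ) * (R : ℂ) ^ n) else 0 := fun k => by
    rw [hF, intervalIntegral.integral_const_mul]
    split_ifs with h
    · subst h
      simp
      ring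
    · have hk : (((k - n : ℤ) : ℂ) * I) ≠ 0 :=
        mul_ne_zero (Int.cast_ne_zero.2 (sub_ne_zero.2 h)) I_ne_zero
      rw [integral_exp_mul_complex hk]
      have : ((k - n : ℤ) : ℂ) * I * ((2 * Real.pi : ℝ) : ℂ) = ((k - n : ℤ) : ℂ) * (2 * Real.pi * I) := by
        push_cast; ring
      rw [this, Complex.exp_int_mul_two_pi_mul_I]
      simp
  have hsum := intervalIntegral.hasSum_integral_of_dominated_convergence
    (μ := MeasureTheory.volume) (a := 0) (b := 2 * Real.pi) (F := F)
    (f := fun θ => u.eval ((R : ℂ) * exp (θ * I)) * exp (-(n * (θ * I))))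
    (fun k _ => |u.coeff k| * ρ ^ k.natAbs)
    (fun k => by
      rw [hF]
      exact Continuous.aestronglyMeasurable (by fun_prop))
    (fun k => Filter.Eventually.of_forall fun θ _ => by
      simp only [F]
      rw [norm_mul, hne, mul_one]
      exact u.norm_term_le (hann θ) k)
    (Filter.Eventually.of_forall fun θ _ => u.summable_coeff)
    (by simp)
    (Filter.Eventually.of_forall fun θ _ => (u.hasSum_eval (hann θ)).mul_right _)
  simp only [hint] at hsum
  have h2 := hsum.unique (hasSum_ite_eq n (2 * Real.pi * ((u.coeff n : ℂ) * (R : ℂ) ^ n)))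
  have h3 := intervalIntegral.norm_integral_le_of_norm_le_const (a := 0) (b := 2 * Real.pi)
    (f := fun θ => u.eval ((R : ℂ) * exp (θ * I)) * exp (-(n * (θ * I)))) (C := M)
    (fun θ _ => by
      rw [norm_mul, hne, mul_one]
      exact hM _ (hnorm θ))
  have h4 : ‖(2 * (Real.pi : ℂ))‖ = 2 * Real.pi := by
    rw [norm_mul, norm_real, Real.norm_eq_abs, abs_of_pos Real.pi_pos]; simp
  have h5 : ‖(u.coeff n : ℂ) * (R : ℂ) ^ n‖ = |u.coeff n| * R ^ n := by
    rw [norm_mul, norm_zpow, norm_real, norm_real, Real.norm_eq_abs, Real.norm_eq_abs,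
      abs_of_pos hR]
  rw [h2, norm_mul, h4, h5, sub_zero, abs_of_pos Real.two_pi_pos] at h3
  nlinarith [Real.pi_pos]

theorem eq_of_eval_eq_on_circle {u v : WienerSpace ρ} {R : ℝ} (hR1 : ρ⁻¹ ≤ R) (hR2 : R ≤ ρ)
    (h : ∀ l : ℂ, ‖l‖ = R → u.eval l = v.eval l) : u = v := by
  have hR : 0 < R := lt_of_lt_of_le (inv_pos.2 rho_pos) hR1
  refine ext_coeff fun k => ?_
  have h1 := (u + (-1 : ℝ) • v).abs_coeff_mul_zpow_le (M := 0) hR1 hR2 (fun l hl => by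
    have hann : InAnnulus ρ l := ⟨by rwa [hl], by rwa [hl]⟩
    rw [eval_add _ _ hann, eval_smul _ _ hann, h l hl]; simp) k
  have h2 : 0 < R ^ k := zpow_pos hR k
  have h3 : |(u + (-1 : ℝ) • v).coeff k| ≤ 0 := by
    by_contra h; push Not at h; nlinarith [mul_pos h h2]
  have h4 := abs_eq_zero.1 (le_antisymm h3 (abs_nonneg _))
  rw [coeff_add, coeff_smul] at h4
  linarith

/-- Identities between Laurent series are checked by evaluation on the unit circle, so that the ring
axioms below reduce to those of `ℂ`. -/
theorem eq_of_eval_eq_on_unit_circle {u v : WienerSpace ρ}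
    (h : ∀ l : ℂ, ‖l‖ = 1 → u.eval l = v.eval l) : u = v :=
  eq_of_eval_eq_on_circle (inv_le_one_of_one_le₀ hρ.out.le) hρ.out.le h

/-! ### Completeness -/

instance : CompleteSpace (WienerSpace ρ) := by
  have h1 : (0 : ℝ) < (1 : ENNReal).toReal := by simp
  -- Weighting the coefficients by `ρ ^ |k|` is an isometry onto `ℓ¹(ℤ)`, which is complete.
  let e : WienerSpace ρ ≃ lp (fun _ : ℤ => ℝ) 1 :=
    { toFun := fun u => ⟨fun k => u.coeff k * ρ ^ k.natAbs, by
        refine (memℓp_gen_iff h1).2 ?_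
        refine u.summable_coeff.congr fun k => ?_
        simp [abs_of_pos (rho_pos (ρ := ρ))]⟩
      invFun := fun w => ⟨fun k => w k / ρ ^ k.natAbs, by
        have := (memℓp_gen_iff h1).1 w.2
        refine this.congr fun k => ?_
        have : ρ ^ k.natAbs ≠ 0 := pow_ne_zero _ rho_pos.ne'
        simp [abs_div, abs_of_pos (rho_pos (ρ := ρ)), this]⟩
      left_inv := fun u => ext_coeff fun k => by
        have : ρ ^ k.natAbs ≠ 0 := pow_ne_zero _ rho_pos.ne'
        change u.coeff k * ρ ^ k.natAbs / ρ ^ k.natAbs = u.coeff k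
        field_simp
      right_inv := fun w => by
        ext k
        have : ρ ^ k.natAbs ≠ 0 := pow_ne_zero _ rho_pos.ne'
        change w k / ρ ^ k.natAbs * ρ ^ k.natAbs = w k
        field_simp }
  have he : Isometry e := by
    refine Isometry.of_dist_eq fun u v => ?_
    rw [dist_eq_norm, dist_eq_norm, lp.norm_eq_tsum_rpow h1, norm_eq]
    simp only [ENNReal.toReal_one, Real.rpow_one, div_one]
    refine tsum_congr fun k => ?_
    change |u.coeff k * ρ ^ k.natAbs - v.coeff k * ρ ^ k.natAbs| =
      |(u - v).coeff k| * ρ ^ k.natAbs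
    have : (u - v).coeff k = u.coeff k - v.coeff k := rfl
    rw [← sub_mul, abs_mul, this, abs_of_pos (pow_pos rho_pos k.natAbs)]
  exact (completeSpace_congr he.isUniformEmbedding).2 inferInstance

end WienerSpace

namespace WienerSpace

set_option linter.unusedSectionVars false

variable {ρ : ℝ} [hρ : Fact (1 < ρ)]

/-! ### The convolution product -/

/-- `(n, k) ↦ (k, n - k)`. -/
def convEquiv : ℤ × ℤ ≃ ℤ × ℤ where
  toFun p := (p.2, p.1 - p.2)
  invFun p := (p.1 + p.2, p.1)
  left_inv p := by ext <;> simp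
  right_inv p := by ext <;> simp

theorem summable_conv (u v : WienerSpace ρ) :
    Summable fun p : ℤ × ℤ =>
      (|u.coeff p.2| * ρ ^ p.2.natAbs) * (|v.coeff (p.1 - p.2)| * ρ ^ (p.1 - p.2).natAbs) :=
  convEquiv.summable_iff.2 (u.summable_coeff.mul_of_nonneg v.summable_coeff
    (fun _ => mul_nonneg (abs_nonneg _) (pow_nonneg rho_pos.le _))
    (fun _ => mul_nonneg (abs_nonneg _) (pow_nonneg rho_pos.le _)))

/-- The weight is submultiplicative since `|n| ≤ |k| + |n - k|`; this makes the norm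
submultiplicative for convolution. -/
theorem conv_term_le (u v : WienerSpace ρ) (n k : ℤ) :
    |u.coeff k * v.coeff (n - k)| * ρ ^ n.natAbs ≤
      (|u.coeff k| * ρ ^ k.natAbs) * (|v.coeff (n - k)| * ρ ^ (n - k).natAbs) := by
  have h := mul_pow_natAbs_le (ρ := ρ) k (n - k)
  rw [add_sub_cancel] at h
  rw [abs_mul]
  calc |u.coeff k| * |v.coeff (n - k)| * ρ ^ n.natAbs
      ≤ |u.coeff k| * |v.coeff (n - k)| * (ρ ^ k.natAbs * ρ ^ (n - k).natAbs) :=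
        mul_le_mul_of_nonneg_left h (by positivity)
    _ = _ := by ring

theorem summable_conv_weighted (u v : WienerSpace ρ) (n : ℤ) :
    Summable fun k : ℤ => |u.coeff k * v.coeff (n - k)| * ρ ^ n.natAbs :=
  Summable.of_nonneg_of_le (fun _ => mul_nonneg (abs_nonneg _) (pow_nonneg rho_pos.le _))
    (fun k => conv_term_le u v n k) ((u.summable_conv v).prod_factor n)

theorem summable_conv_coeff (u v : WienerSpace ρ) (n : ℤ) :
    Summable fun k : ℤ => |u.coeff k * v.coeff (n - k)| := by
  have h : ρ ^ n.natAbs ≠ 0 := pow_ne_zero _ rho_pos.ne'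
  exact (summable_mul_right_iff h).1 (summable_conv_weighted u v n)

theorem abs_conv_le (u v : WienerSpace ρ) (n : ℤ) :
    |∑' k : ℤ, u.coeff k * v.coeff (n - k)| * ρ ^ n.natAbs ≤
      ∑' k : ℤ, (|u.coeff k| * ρ ^ k.natAbs) *
        (|v.coeff (n - k)| * ρ ^ (n - k).natAbs) := by
  have h1 : |∑' k : ℤ, u.coeff k * v.coeff (n - k)| ≤ ∑' k : ℤ, |u.coeff k * v.coeff (n - k)| := by
    simpa only [Real.norm_eq_abs] using
      norm_tsum_le_tsum_norm (f := fun k : ℤ => u.coeff k * v.coeff (n - k))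
        (summable_conv_coeff u v n)
  refine (mul_le_mul_of_nonneg_right h1 (pow_nonneg rho_pos.le _)).trans ?_
  rw [← tsum_mul_right]
  exact (summable_conv_weighted u v n).tsum_le_tsum (conv_term_le u v n)
    ((u.summable_conv v).prod_factor n)

/-- The product of Laurent series. -/
noncomputable def conv (u v : WienerSpace ρ) : WienerSpace ρ :=
  ⟨fun n => ∑' k : ℤ, u.coeff k * v.coeff (n - k),
    Summable.of_nonneg_of_le (fun _ => mul_nonneg (abs_nonneg _) (pow_nonneg rho_pos.le _))
      (abs_conv_le u v) (u.summable_conv v).prod⟩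

theorem coeff_conv (u v : WienerSpace ρ) (n : ℤ) :
    (conv u v).coeff n = ∑' k : ℤ, u.coeff k * v.coeff (n - k) := rfl

theorem norm_conv_le (u v : WienerSpace ρ) : ‖conv u v‖ ≤ ‖u‖ * ‖v‖ := by
  rw [norm_eq (conv u v)]
  refine ((conv u v).summable_coeff.tsum_le_tsum (abs_conv_le u v)
    (u.summable_conv v).prod).trans (le_of_eq ?_)
  have h1 : Summable fun k : ℤ => ‖|u.coeff k| * ρ ^ k.natAbs‖ := u.summable_coeff.norm
  have h2 : Summable fun k : ℤ => ‖|v.coeff k| * ρ ^ k.natAbs‖ := v.summable_coeff.norm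
  rw [← (u.summable_conv v).tsum_prod, norm_eq u, norm_eq v, tsum_mul_tsum_of_summable_norm h1 h2]
  exact convEquiv.tsum_eq (fun p : ℤ × ℤ =>
    |u.coeff p.1| * ρ ^ p.1.natAbs * (|v.coeff p.2| * ρ ^ p.2.natAbs))

theorem eval_conv (u v : WienerSpace ρ) {l : ℂ} (hl : InAnnulus ρ l) :
    (conv u v).eval l = u.eval l * v.eval l := by
  have h0 := hl.ne_zero
  rw [eval, eval, eval,
    tsum_mul_tsum_of_summable_norm (u.summable_norm_term hl) (v.summable_norm_term hl)]
  have hs := summable_mul_of_summable_norm (u.summable_norm_term hl) (v.summable_norm_term hl)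
  have hs2 := convEquiv.summable_iff.2 hs
  rw [← convEquiv.tsum_eq]
  refine Eq.trans ?_ hs2.tsum_prod.symm
  refine tsum_congr fun n => ?_
  rw [coeff_conv, Complex.ofReal_tsum, ← tsum_mul_right]
  refine tsum_congr fun k => ?_
  change _ = (u.coeff k : ℂ) * l ^ k * ((v.coeff (n - k) : ℂ) * l ^ (n - k))
  rw [zpow_sub₀ h0]
  have : l ^ k ≠ 0 := zpow_ne_zero _ h0
  push_cast
  field_simp

/-- The monomial `a λ^k`. -/
def single (k : ℤ) (a : ℝ) : WienerSpace ρ :=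
  ⟨Pi.single k a, summable_of_ne_finset_zero (s := {k}) fun j hj => by
    simp only [Finset.mem_singleton] at hj
    simp [Pi.single_eq_of_ne hj]⟩

theorem coeff_single (k : ℤ) (a : ℝ) (j : ℤ) :
    (single k a : WienerSpace ρ).coeff j = if j = k then a else 0 :=
  Pi.single_apply k a j

theorem eval_single (k : ℤ) (a : ℝ) (l : ℂ) :
    (single k a : WienerSpace ρ).eval l = a * l ^ k := by
  rw [eval, tsum_eq_single k]
  · rw [coeff_single, if_pos rfl]
  · intro j hj
    rw [coeff_single, if_neg hj]; simp

theorem norm_single (k : ℤ) (a : ℝ) : ‖(single k a : WienerSpace ρ)‖ = |a| * ρ ^ k.natAbs := by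
  rw [norm_eq, tsum_eq_single k]
  · rw [coeff_single, if_pos rfl]
  · intro j hj
    rw [coeff_single, if_neg hj]; simp

noncomputable scoped instance : NormedCommRing (WienerSpace ρ) :=
  { (inferInstance : NormedAddCommGroup (WienerSpace ρ)) with
    mul := conv
    one := single 0 1
    mul_assoc := fun u v w => eq_of_eval_eq_on_unit_circle fun l hl => by
      have h := inAnnulus_of_norm_one (ρ := ρ) hl
      change (conv (conv u v) w).eval l = (conv u (conv v w)).eval l
      rw [eval_conv _ _ h, eval_conv _ _ h, eval_conv _ _ h, eval_conv _ _ h, mul_assoc]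
    mul_comm := fun u v => eq_of_eval_eq_on_unit_circle fun l hl => by
      have h := inAnnulus_of_norm_one (ρ := ρ) hl
      change (conv u v).eval l = (conv v u).eval l
      rw [eval_conv _ _ h, eval_conv _ _ h, mul_comm]
    one_mul := fun u => eq_of_eval_eq_on_unit_circle fun l hl => by
      have h := inAnnulus_of_norm_one (ρ := ρ) hl
      change (conv (single 0 1) u).eval l = _
      rw [eval_conv _ _ h, eval_single]; simp
    mul_one := fun u => eq_of_eval_eq_on_unit_circle fun l hl => by
      have h := inAnnulus_of_norm_one (ρ := ρ) hl
      change (conv u (single 0 1)).eval l = _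
      rw [eval_conv _ _ h, eval_single]; simp
    left_distrib := fun u v w => eq_of_eval_eq_on_unit_circle fun l hl => by
      have h := inAnnulus_of_norm_one (ρ := ρ) hl
      change (conv u (v + w)).eval l = (conv u v + conv u w).eval l
      rw [eval_conv _ _ h, eval_add _ _ h, eval_add _ _ h, eval_conv _ _ h, eval_conv _ _ h,
        mul_add]
    right_distrib := fun u v w => eq_of_eval_eq_on_unit_circle fun l hl => by
      have h := inAnnulus_of_norm_one (ρ := ρ) hl
      change (conv (u + v) w).eval l = (conv u w + conv v w).eval l
      rw [eval_conv _ _ h, eval_add _ _ h, eval_add _ _ h, eval_conv _ _ h, eval_conv _ _ h,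
        add_mul]
    zero_mul := fun u => eq_of_eval_eq_on_unit_circle fun l hl => by
      have h := inAnnulus_of_norm_one (ρ := ρ) hl
      change (conv 0 u).eval l = _
      rw [eval_conv _ _ h]; simp [eval, coeff_zero]
    mul_zero := fun u => eq_of_eval_eq_on_unit_circle fun l hl => by
      have h := inAnnulus_of_norm_one (ρ := ρ) hl
      change (conv u 0).eval l = _
      rw [eval_conv _ _ h]; simp [eval, coeff_zero]
    dist_eq := NormedAddGroup.dist_eq
    norm_mul_le := norm_conv_le }

theorem coeff_mul (u v : WienerSpace ρ) (n : ℤ) :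
    (u * v).coeff n = ∑' k : ℤ, u.coeff k * v.coeff (n - k) := rfl

theorem eval_mul (u v : WienerSpace ρ) {l : ℂ} (hl : InAnnulus ρ l) :
    (u * v).eval l = u.eval l * v.eval l := eval_conv u v hl

theorem one_def : (1 : WienerSpace ρ) = single 0 1 := rfl

theorem eval_one (l : ℂ) : (1 : WienerSpace ρ).eval l = 1 := by
  rw [one_def, eval_single]; simp

noncomputable scoped instance : NormedAlgebra ℝ (WienerSpace ρ) :=
  { Algebra.ofModule (R := ℝ) (A := WienerSpace ρ)
      (fun c u v => eq_of_eval_eq_on_unit_circle fun l hl => by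
        have h := inAnnulus_of_norm_one (ρ := ρ) hl
        rw [eval_mul _ _ h, eval_smul _ _ h, eval_smul _ _ h, eval_mul _ _ h, mul_assoc])
      (fun c u v => eq_of_eval_eq_on_unit_circle fun l hl => by
        have h := inAnnulus_of_norm_one (ρ := ρ) hl
        rw [eval_mul _ _ h, eval_smul _ _ h, eval_smul _ _ h, eval_mul _ _ h]
        ring) with
    norm_smul_le := fun c u => (norm_smul_le c u) }


end WienerSpace

/-! ### Evaluation functionals and coefficient operators -/

namespace WienerSpace

set_option linter.unusedSectionVars false

variable {ρ : ℝ} [hρ : Fact (1 < ρ)]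

theorem coeff_sub (u v : WienerSpace ρ) (k : ℤ) : (u - v).coeff k = u.coeff k - v.coeff k := rfl

theorem coeff_one (k : ℤ) : (1 : WienerSpace ρ).coeff k = if k = 0 then 1 else 0 :=
  coeff_single 0 1 k

/-- Evaluation at a point of the closed annulus, as a continuous linear map. -/
noncomputable def evalCLM (l : ℂ) (hl : InAnnulus ρ l) : WienerSpace ρ →L[ℝ] ℂ :=
  LinearMap.mkContinuous
    { toFun := fun u => u.eval l
      map_add' := fun u v => eval_add u v hl
      map_smul' := fun c u => by
        rw [eval_smul c u hl, RingHom.id_apply, Complex.real_smul] } 1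
    (fun u => by rw [one_mul]; exact norm_eval_le u hl)

theorem evalCLM_apply (l : ℂ) (hl : InAnnulus ρ l) (u : WienerSpace ρ) :
    evalCLM l hl u = u.eval l := rfl

theorem eval_sub (u v : WienerSpace ρ) {l : ℂ} (hl : InAnnulus ρ l) :
    (u - v).eval l = u.eval l - v.eval l := map_sub (evalCLM l hl) u v

theorem eval_neg (u : WienerSpace ρ) {l : ℂ} (hl : InAnnulus ρ l) :
    (-u).eval l = -u.eval l := map_neg (evalCLM l hl) u

theorem eval_pow (u : WienerSpace ρ) {l : ℂ} (hl : InAnnulus ρ l) (n : ℕ) :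
    (u ^ n).eval l = u.eval l ^ n := by
  induction n with
  | zero => simp [eval_one]
  | succ n ih => rw [pow_succ, pow_succ, eval_mul _ _ hl, ih]

theorem eval_zero (l : ℂ) : (0 : WienerSpace ρ).eval l = 0 := by
  simp [eval, coeff_zero]

theorem eval_conj (u : WienerSpace ρ) (l : ℂ) :
    u.eval ((starRingEnd ℂ) l) = (starRingEnd ℂ) (u.eval l) := by
  rw [eval, eval, Complex.conj_tsum]
  refine tsum_congr fun k => ?_
  rw [map_mul, map_zpow₀, Complex.conj_ofReal]

/-- Weighted substitution on the coefficients. -/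
noncomputable def coeffMap (w : ℤ → ℝ) (σ : ℤ → ℤ) (hσ : Function.Injective σ) (C : ℝ)
    (hC : ∀ k, |w k| * ρ ^ k.natAbs ≤ C * ρ ^ (σ k).natAbs) : WienerSpace ρ →L[ℝ] WienerSpace ρ :=
  have hb : ∀ (u : WienerSpace ρ) (k : ℤ), |w k * u.coeff (σ k)| * ρ ^ k.natAbs ≤
      C * (|u.coeff (σ k)| * ρ ^ (σ k).natAbs) := fun u k => by
    rw [abs_mul]
    nlinarith [mul_le_mul_of_nonneg_right (hC k) (abs_nonneg (u.coeff (σ k)))]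
  have hs : ∀ u : WienerSpace ρ, Summable fun k => C * (|u.coeff (σ k)| * ρ ^ (σ k).natAbs) :=
    fun u => (u.summable_coeff.comp_injective hσ).mul_left C
  LinearMap.mkContinuous
    { toFun := fun u => ⟨fun k => w k * u.coeff (σ k),
        Summable.of_nonneg_of_le (fun k => mul_nonneg (abs_nonneg _) (pow_nonneg rho_pos.le _))
          (hb u) (hs u)⟩
      map_add' := fun u v => ext_coeff fun k => mul_add (w k) (u.coeff (σ k)) (v.coeff (σ k))
      map_smul' := fun c u => ext_coeff fun k => mul_left_comm (w k) c (u.coeff (σ k)) } C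
    (fun u => by
      have h0 : 0 ≤ C := by
        have h1 := hC 0
        have h2 : 0 < ρ ^ (σ 0).natAbs := pow_pos rho_pos _
        have h3 : 0 ≤ |w 0| * ρ ^ (0 : ℤ).natAbs :=
          mul_nonneg (abs_nonneg _) (pow_nonneg rho_pos.le _)
        by_contra h
        nlinarith
      rw [norm_eq, norm_eq]
      refine ((Summable.of_nonneg_of_le
        (fun k => mul_nonneg (abs_nonneg _) (pow_nonneg rho_pos.le _)) (hb u)
        (hs u)).tsum_le_tsum (hb u) (hs u)).trans ?_
      rw [tsum_mul_left]
      refine mul_le_mul_of_nonneg_left ?_ h0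
      exact (u.summable_coeff.comp_injective hσ).tsum_le_tsum_of_inj σ hσ
        (fun k _ => mul_nonneg (abs_nonneg _) (pow_nonneg rho_pos.le _)) (fun k => le_rfl)
        u.summable_coeff)

theorem coeff_coeffMap (w : ℤ → ℝ) (σ : ℤ → ℤ) (hσ : Function.Injective σ) (C : ℝ)
    (hC : ∀ k, |w k| * ρ ^ k.natAbs ≤ C * ρ ^ (σ k).natAbs) (u : WienerSpace ρ) (k : ℤ) :
    (coeffMap w σ hσ C hC u).coeff k = w k * u.coeff (σ k) := rfl

/-- The reflection `u(λ) ↦ u(λ⁻¹)`. -/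
noncomputable def refl : WienerSpace ρ →L[ℝ] WienerSpace ρ :=
  coeffMap (fun _ => 1) (fun k => -k) neg_injective 1 (fun k => by simp)

theorem coeff_refl (u : WienerSpace ρ) (k : ℤ) : (refl u).coeff k = u.coeff (-k) := by
  rw [refl, coeff_coeffMap, one_mul]

theorem eval_refl (u : WienerSpace ρ) (l : ℂ) : (refl u).eval l = u.eval l⁻¹ := by
  rw [eval, eval, ← (Equiv.neg ℤ).tsum_eq]
  refine tsum_congr fun k => ?_
  rw [Equiv.neg_apply, coeff_refl, neg_neg, _root_.inv_zpow, _root_.zpow_neg]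

/-- The part with negative exponents. -/
noncomputable def negPart : WienerSpace ρ →L[ℝ] WienerSpace ρ :=
  coeffMap (fun k => if k < 0 then 1 else 0) id Function.injective_id 1 (fun k => by
    have : 0 ≤ ρ ^ k.natAbs := pow_nonneg rho_pos.le _
    by_cases h : k < 0 <;> simp [h, this])

theorem coeff_negPart (u : WienerSpace ρ) (k : ℤ) :
    (negPart u).coeff k = if k < 0 then u.coeff k else 0 := by
  rw [negPart, coeff_coeffMap]; split_ifs <;> simp

/-- The part with nonnegative exponents. -/
noncomputable def nonnegPart : WienerSpace ρ →L[ℝ] WienerSpace ρ :=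
  coeffMap (fun k => if 0 ≤ k then 1 else 0) id Function.injective_id 1 (fun k => by
    have : 0 ≤ ρ ^ k.natAbs := pow_nonneg rho_pos.le _
    by_cases h : 0 ≤ k <;> simp [h, this])

theorem coeff_nonnegPart (u : WienerSpace ρ) (k : ℤ) :
    (nonnegPart u).coeff k = if 0 ≤ k then u.coeff k else 0 := by
  rw [nonnegPart, coeff_coeffMap]; split_ifs <;> simp

/-- The value at `1`. -/
noncomputable def sumCLM : WienerSpace ρ →L[ℝ] ℝ :=
  Complex.reCLM.comp (evalCLM 1 (inAnnulus_of_norm_one (by simp)))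

theorem eval_ofReal (u : WienerSpace ρ) (a : ℝ) : u.eval a = ((u.eval a).re : ℂ) := by
  have := eval_conj u a
  rw [Complex.conj_ofReal] at this
  exact (Complex.conj_eq_iff_re.1 this.symm).symm

theorem ofReal_sumCLM (u : WienerSpace ρ) : (sumCLM u : ℂ) = u.eval 1 := by
  have := eval_ofReal u 1
  rw [Complex.ofReal_one] at this
  exact this.symm

/-- The coefficient functionals. -/
noncomputable def coeffCLM (k : ℤ) : WienerSpace ρ →L[ℝ] ℝ :=
  LinearMap.mkContinuous
    { toFun := fun u => u.coeff k
      map_add' := fun u v => coeff_add u v k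
      map_smul' := fun c u => coeff_smul c u k } 1
    (fun u => by
      rw [one_mul]
      refine le_trans ?_ (u.abs_coeff_mul_le_norm k)
      exact le_mul_of_one_le_right (abs_nonneg _) (one_le_pow₀ hρ.out.le))

theorem coeffCLM_apply (k : ℤ) (u : WienerSpace ρ) : coeffCLM k u = u.coeff k := rfl

theorem coeff_single_mul (m : ℤ) (a : ℝ) (u : WienerSpace ρ) (k : ℤ) :
    (single m a * u).coeff k = a * u.coeff (k - m) := by
  rw [coeff_mul, tsum_eq_single m]
  · rw [coeff_single, if_pos rfl]
  · intro j hj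
    rw [coeff_single, if_neg hj, zero_mul]

theorem single_mul_single (m n : ℤ) (a b : ℝ) :
    (single m a * single n b : WienerSpace ρ) = single (m + n) (a * b) := by
  refine ext_coeff fun k => ?_
  rw [coeff_single_mul, coeff_single, coeff_single]
  by_cases h : k = m + n
  · rw [if_pos (by omega), if_pos h]
  · rw [if_neg (by omega), if_neg h, mul_zero]

/-! ### Zero divisors -/

theorem analyticOnNhd_eval_exp (u : WienerSpace ρ) :
    AnalyticOnNhd ℂ (fun w => u.eval (exp w)) {w : ℂ | |w.re| < Real.log ρ} := by
  have hopen : IsOpen {w : ℂ | |w.re| < Real.log ρ} :=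
    isOpen_lt (continuous_abs.comp Complex.continuous_re) continuous_const
  refine DifferentiableOn.analyticOnNhd ?_ hopen
  refine Complex.differentiableOn_tsum_of_summable_norm u.summable_coeff (fun k => ?_) hopen
    (fun k w hw => u.norm_term_le ?_ k)
  · have : (fun w : ℂ => (u.coeff k : ℂ) * exp w ^ k) = fun w => (u.coeff k : ℂ) * exp (k * w) := by
      funext w; rw [Complex.exp_int_mul]
    rw [this]
    fun_prop
  · have h := abs_lt.1 (show |w.re| < Real.log ρ from hw)
    rw [InAnnulus, Complex.norm_exp, ← Real.exp_log (rho_pos (ρ := ρ)), ← Real.exp_neg]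
    exact ⟨Real.exp_le_exp.2 h.1.le, Real.exp_le_exp.2 h.2.le⟩

/-- With `λ = e^w` the open annulus becomes a strip, which is convex and hence connected; analytic
functions on a connected set have no zero divisors. -/
theorem eq_zero_or_eq_zero_of_mul {u v : WienerSpace ρ} (h : u * v = 0) : u = 0 ∨ v = 0 := by
  have hconv : Convex ℝ {w : ℂ | |w.re| < Real.log ρ} := by
    have : {w : ℂ | |w.re| < Real.log ρ} = Complex.reLm ⁻¹' (Ioo (-Real.log ρ) (Real.log ρ)) := by
      ext w; exact abs_lt (a := w.re) (b := Real.log ρ)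
    rw [this]
    exact (convex_Ioo _ _).linear_preimage _
  have hlog := Real.log_pos hρ.out
  have hz : ∀ u : WienerSpace ρ, (∀ w ∈ {w : ℂ | |w.re| < Real.log ρ}, u.eval (exp w) = 0) →
      u = 0 := fun u hu => eq_of_eval_eq_on_unit_circle fun l hl => by
    have hl0 : l ≠ 0 := by rintro rfl; simp at hl
    rw [eval_zero, ← Complex.exp_log hl0]
    refine hu _ ?_
    change |(Complex.log l).re| < Real.log ρ
    rw [Complex.log_re, hl, Real.log_one, abs_zero]
    exact hlog
  refine (AnalyticOnNhd.eq_zero_or_eq_zero_of_mul_eq_zero u.analyticOnNhd_eval_exp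
    v.analyticOnNhd_eval_exp (fun w hw => ?_) hconv.isPreconnected).imp (hz u) (hz v)
  have hann : InAnnulus ρ (exp w) := by
    have h := abs_lt.1 (show |w.re| < Real.log ρ from hw)
    rw [InAnnulus, Complex.norm_exp, ← Real.exp_log (rho_pos (ρ := ρ)), ← Real.exp_neg]
    exact ⟨Real.exp_le_exp.2 h.1.le, Real.exp_le_exp.2 h.2.le⟩
  rw [← eval_mul _ _ hann, h, eval_zero]

/-! ### Division by linear factors -/

theorem hasSum_single_coeff (u : WienerSpace ρ) :
    HasSum (fun k => (single k (u.coeff k) : WienerSpace ρ)) u := by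
  have h1 : Summable fun k => (single k (u.coeff k) : WienerSpace ρ) := by
    refine Summable.of_norm ?_
    simp only [norm_single]
    exact u.summable_coeff
  convert! h1.hasSum using 1
  refine ext_coeff fun k => ?_
  rw [← coeffCLM_apply k (∑' _, _), (coeffCLM k).map_tsum h1, tsum_eq_single k]
  · rw [coeffCLM_apply, coeff_single, if_pos rfl]
  · intro j hj
    rw [coeffCLM_apply, coeff_single, if_neg hj.symm]

/-- Since `u(a) = 0`, one has `u = ∑ u_k (λ^k - a^k)`. Each term is divisible by `λ - a` with
quotient `∑ λ^i a^(k-1-i)`, of norm at most `ρ^k / (ρ - 1)` because `|a| = 1`. So the quotient lies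
in the space of the same radius. -/
theorem exists_mul_eq_of_eval_eq_zero {u : WienerSpace ρ} (hu : ∀ k < 0, u.coeff k = 0) {a : ℝ}
    (ha : |a| = 1) (h0 : u.eval a = 0) :
    ∃ v : WienerSpace ρ, (∀ k < 0, v.coeff k = 0) ∧ (single 1 1 - single 0 a) * v = u := by
  have hane : InAnnulus ρ (a : ℂ) := inAnnulus_of_norm_one (by simpa using ha)
  let d : ℤ → WienerSpace ρ := fun k =>
    u.coeff k • ∑ i ∈ Finset.range k.toNat, single 1 1 ^ i * single 0 a ^ (k.toNat - 1 - i)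
  have hsingle : ‖(single 1 1 : WienerSpace ρ)‖ = ρ := by simp [norm_single]
  have hsingle0 : ‖(single 0 a : WienerSpace ρ)‖ = 1 := by simp [norm_single, ha]
  have hρ1 : 0 < ρ - 1 := sub_pos.2 hρ.out
  have hnone : ‖(1 : WienerSpace ρ)‖ = 1 := by simp [one_def, norm_single]
  have : NormOneClass (WienerSpace ρ) := ⟨hnone⟩
  have hd : ∀ k, ‖d k‖ ≤ (|u.coeff k| * ρ ^ k.natAbs) * (ρ - 1)⁻¹ := by
    intro k
    rcases lt_or_ge k 0 with hk | hk
    · simp [d, hu k hk]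
    · obtain ⟨n, rfl⟩ := Int.eq_ofNat_of_zero_le hk
      simp only [d, Int.toNat_natCast, Int.natAbs_natCast]
      rw [norm_smul, Real.norm_eq_abs, mul_assoc]
      refine mul_le_mul_of_nonneg_left ?_ (abs_nonneg _)
      refine (norm_sum_le_of_le (f := fun i => (single 1 1 : WienerSpace ρ) ^ i *
        single 0 a ^ (n - 1 - i)) (n := fun i => ρ ^ i) _ (fun i _ => ?_)).trans ?_
      · refine (norm_mul_le _ _).trans ?_
        have h1 := norm_pow_le (single 1 1 : WienerSpace ρ) i
        have h2 := norm_pow_le (single 0 a : WienerSpace ρ) (n - 1 - i)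
        rw [hsingle] at h1
        rw [hsingle0, one_pow] at h2
        exact (mul_le_mul h1 h2 (norm_nonneg _) (pow_nonneg rho_pos.le _)).trans (mul_one _).le
      · rw [geom_sum_eq hρ.out.ne', div_eq_mul_inv]
        exact mul_le_mul_of_nonneg_right (by linarith) (inv_nonneg.2 hρ1.le)
  have hsd : Summable d := Summable.of_norm
    (Summable.of_nonneg_of_le (fun _ => norm_nonneg _) hd (u.summable_coeff.mul_right _))
  refine ⟨∑' k, d k, fun k hk => ?_, ?_⟩
  · rw [← coeffCLM_apply, (coeffCLM k).map_tsum hsd]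
    convert! tsum_zero with j
    simp only [d, map_smul, map_sum, coeffCLM_apply]
    rw [Finset.sum_eq_zero, smul_zero]
    intro i _
    have hp1 : ∀ i : ℕ, (single 1 1 : WienerSpace ρ) ^ i = single i 1 := fun i => by
      induction i with
      | zero => simp [one_def]
      | succ i ih => rw [pow_succ, ih, single_mul_single]; push_cast; rw [one_mul]
    have hp2 : ∀ i : ℕ, (single 0 a : WienerSpace ρ) ^ i = single 0 (a ^ i) := fun i => by
      induction i with
      | zero => simp [one_def]
      | succ i ih => rw [pow_succ, ih, single_mul_single, pow_succ, zero_add]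
    rw [hp1, hp2, single_mul_single, coeff_single, if_neg (by omega)]
  · rw [← hsd.tsum_mul_left]
    have h1 : ∀ k, (single 1 1 - single 0 a) * d k =
        single k (u.coeff k) - (u.coeff k * a ^ k) • (1 : WienerSpace ρ) := by
      intro k
      rcases lt_or_ge k 0 with hk | hk
      · simp only [d, hu k hk, zero_smul, mul_zero, zero_mul, sub_zero]
        refine ext_coeff fun j => ?_
        rw [coeff_single, coeff_zero, ite_self]
      · obtain ⟨n, rfl⟩ := Int.eq_ofNat_of_zero_le hk
        simp only [d, Int.toNat_natCast]
        rw [mul_smul_comm, mul_comm, Commute.geom_sum₂_mul (Commute.all _ _)]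
        refine eq_of_eval_eq_on_unit_circle fun l hl => ?_
        have h := inAnnulus_of_norm_one (ρ := ρ) hl
        rw [eval_smul _ _ h, eval_sub _ _ h, eval_pow _ h, eval_pow _ h, eval_sub _ _ h,
          eval_smul _ _ h, eval_single, eval_single, eval_single, eval_one]
        simp
        ring
    have h2 : HasSum (fun k : ℤ => u.coeff k * a ^ k) 0 := by
      have := u.hasSum_eval hane
      rw [h0] at this
      rw [← Complex.hasSum_ofReal]
      convert! this using 2 with k
      push_cast; rfl
    have h3 := u.hasSum_single_coeff.sub (h2.smul_const (1 : WienerSpace ρ))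
    rw [zero_smul, sub_zero] at h3
    rw [tsum_congr h1]
    exact h3.tsum_eq

/-! ### Inclusion into a space of smaller radius -/

theorem summable_incl {ρ' : ℝ} [hρ' : Fact (1 < ρ')] (h : ρ' ≤ ρ) (u : WienerSpace ρ) :
    Summable fun k : ℤ => |u.coeff k| * ρ' ^ k.natAbs :=
  Summable.of_nonneg_of_le
    (fun _ => mul_nonneg (abs_nonneg _) (pow_nonneg rho_pos.le _))
    (fun _ => mul_le_mul_of_nonneg_left (pow_le_pow_left₀ rho_pos.le h _)
      (abs_nonneg _)) u.summable_coeff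

/-- The Laurent series with given summable coefficients. -/
def ofCoeff (f : ℤ → ℝ) (hf : Summable fun k : ℤ => |f k| * ρ ^ k.natAbs) : WienerSpace ρ := ⟨f, hf⟩

theorem coeff_ofCoeff (f : ℤ → ℝ) (hf : Summable fun k : ℤ => |f k| * ρ ^ k.natAbs) (k : ℤ) :
    (ofCoeff f hf).coeff k = f k := rfl

/-- The inclusion `𝒲_ρ → 𝒲_ρ'` for `ρ' ≤ ρ`. -/
def incl {ρ' : ℝ} [hρ' : Fact (1 < ρ')] (h : ρ' ≤ ρ) (u : WienerSpace ρ) : WienerSpace ρ' :=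
  ofCoeff u.coeff (summable_incl h u)

theorem coeff_incl {ρ' : ℝ} [hρ' : Fact (1 < ρ')] (h : ρ' ≤ ρ) (u : WienerSpace ρ) (k : ℤ) :
    (incl h u : WienerSpace ρ').coeff k = u.coeff k := by
  rw [incl, coeff_ofCoeff]

theorem eval_incl {ρ' : ℝ} [hρ' : Fact (1 < ρ')] (h : ρ' ≤ ρ) (u : WienerSpace ρ) (l : ℂ) :
    (incl h u : WienerSpace ρ').eval l = u.eval l := by
  simp only [eval, coeff_incl]

theorem summable_ratio_pow {ρ' : ℝ} [hρ' : Fact (1 < ρ')] (h : ρ' < ρ) :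
    Summable fun k : ℤ => (ρ' / ρ) ^ k.natAbs := by
  have h0 : 0 ≤ ρ' / ρ := div_nonneg rho_pos.le rho_pos.le
  have h1 := summable_geometric_of_lt_one h0 ((div_lt_one rho_pos).2 h)
  exact Summable.of_nat_of_neg (by simpa using h1) (by simpa using h1)

/-- A sup bound on the boundary circles bounds the norm in a smaller annulus. -/
theorem norm_incl_le {ρ' : ℝ} [hρ' : Fact (1 < ρ')] (h : ρ' < ρ) (u : WienerSpace ρ) {M : ℝ}
    (hM : ∀ l, InAnnulus ρ l → ‖u.eval l‖ ≤ M) :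
    ‖(incl h.le u : WienerSpace ρ')‖ ≤ M * ∑' k : ℤ, (ρ' / ρ) ^ k.natAbs := by
  have hρ0 := rho_pos (ρ := ρ)
  have hρ0' := rho_pos (ρ := ρ')
  have hinv : ρ⁻¹ ≤ ρ := (inv_le_one_of_one_le₀ hρ.out.le).trans hρ.out.le
  -- Cauchy's estimate on the outer circle serves the nonnegative exponents, on the inner circle the
  -- negative ones. The ratio `ρ' / ρ < 1` then makes the sum converge.
  have hk : ∀ k : ℤ, |u.coeff k| * ρ ^ k.natAbs ≤ M := by
    intro k
    obtain ⟨n, rfl | rfl⟩ := k.eq_nat_or_neg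
    · have := u.abs_coeff_mul_zpow_le (M := M) hinv le_rfl
        (fun l hl => hM l ⟨by rw [hl]; exact hinv, hl.le⟩) n
      simpa using this
    · have := u.abs_coeff_mul_zpow_le (M := M) le_rfl hinv
        (fun l hl => hM l ⟨hl.ge, by rw [hl]; exact hinv⟩) (-n)
      simpa using this
  rw [norm_eq, ← tsum_mul_left]
  simp only [coeff_incl]
  refine (summable_incl h.le u).tsum_le_tsum (fun k => ?_) ((summable_ratio_pow h).mul_left M)
  rw [div_pow]
  have h1 : 0 < ρ ^ k.natAbs := pow_pos hρ0 _
  have h2 : 0 < ρ' ^ k.natAbs := pow_pos hρ0' _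
  calc |u.coeff k| * ρ' ^ k.natAbs = (|u.coeff k| * ρ ^ k.natAbs) * (ρ' ^ k.natAbs / ρ ^ k.natAbs) := by
        field_simp
    _ ≤ _ := mul_le_mul_of_nonneg_right (hk k) (by positivity)

/-! ### Products of series with simple poles -/

theorem coeff_mul_of_pole {u v : WienerSpace ρ} (hu : ∀ k < -1, u.coeff k = 0)
    (hv : ∀ k < -1, v.coeff k = 0) :
    (∀ k < -2, (u * v).coeff k = 0) ∧
    (u * v).coeff (-2) = u.coeff (-1) * v.coeff (-1) ∧
    (u * v).coeff (-1) = u.coeff (-1) * v.coeff 0 + u.coeff 0 * v.coeff (-1) ∧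
    (u * v).coeff 0 = u.coeff (-1) * v.coeff 1 + u.coeff 0 * v.coeff 0 +
      u.coeff 1 * v.coeff (-1) := by
  have key : ∀ n k : ℤ, (k < -1 ∨ n + 1 < k) → u.coeff k * v.coeff (n - k) = 0 := by
    rintro n k (hk | hk)
    · rw [hu k hk, zero_mul]
    · rw [hv (n - k) (by omega), mul_zero]
  refine ⟨fun n hn => ?_, ?_, ?_, ?_⟩
  · rw [coeff_mul]
    convert! tsum_zero with k
    exact key n k (by omega)
  · rw [coeff_mul, tsum_eq_single (-1) (fun k hk => key _ k (by omega))]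
    norm_num
  · rw [coeff_mul, tsum_eq_sum (s := {-1, 0})
      (fun k hk => key _ k (by simp at hk; omega))]
    rw [Finset.sum_pair (by norm_num)]
    norm_num
  · rw [coeff_mul, tsum_eq_sum (s := {-1, 0, 1})
      (fun k hk => key _ k (by simp at hk; omega))]
    rw [Finset.sum_insert (by norm_num), Finset.sum_pair (by norm_num)]
    norm_num
    ring

theorem eval_single_mul (u : WienerSpace ρ) {l : ℂ} (hl : l ≠ 0) :
    (single 1 1 * u).eval l = l * u.eval l := by
  rw [eval, eval, ← tsum_mul_left, ← (Equiv.addRight (1 : ℤ)).tsum_eq]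
  refine tsum_congr fun k => ?_
  rw [Equiv.coe_addRight, coeff_single_mul, add_sub_cancel_right, one_mul, zpow_add₀ hl, zpow_one]
  ring

theorem differentiableOn_eval {v : WienerSpace ρ} (hv : ∀ k < 0, v.coeff k = 0) :
    DifferentiableOn ℂ (fun l => v.eval l) (Metric.ball 0 ρ) := by
  refine Complex.differentiableOn_tsum_of_summable_norm v.summable_coeff (fun k => ?_)
    Metric.isOpen_ball (fun k w hw => ?_)
  · rcases lt_or_ge k 0 with hk | hk
    · rw [hv k hk]; simp
    · exact (differentiableOn_zpow k _ (Or.inr hk)).const_mul _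
  · rcases lt_or_ge k 0 with hk | hk
    · rw [hv k hk]; simp
    · obtain ⟨n, rfl⟩ := Int.eq_ofNat_of_zero_le hk
      rw [norm_mul, norm_real, Real.norm_eq_abs]
      refine mul_le_mul_of_nonneg_left ?_ (abs_nonneg _)
      have : ‖w‖ ≤ ρ := (by simpa using hw : ‖w‖ < ρ).le
      simpa using pow_le_pow_left₀ (norm_nonneg _) this n

theorem coeff_single_mul_of_pole {u : WienerSpace ρ} (hu : ∀ k < -1, u.coeff k = 0) (k : ℤ)
    (hk : k < 0) : (single 1 1 * u).coeff k = 0 := by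
  rw [coeff_single_mul, hu _ (by omega), mul_zero]

/-- The maximum principle for series with a simple pole. -/
theorem norm_mul_eval_le_of_pole {u : WienerSpace ρ} (hu : ∀ k < -1, u.coeff k = 0) {M : ℝ}
    (hM : ∀ l : ℂ, ‖l‖ = 1 → ‖u.eval l‖ ≤ M) {l : ℂ} (h1 : ‖l‖ ≤ 1) (h0 : l ≠ 0) :
    ‖l * u.eval l‖ ≤ M := by
  have hd := differentiableOn_eval (coeff_single_mul_of_pole hu)
  have hev : ∀ l : ℂ, l ≠ 0 → (single 1 1 * u).eval l = l * u.eval l := fun l => eval_single_mul u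
  set v : WienerSpace ρ := single 1 1 * u with hv
  have hd1 : DiffContOnCl ℂ (fun l => v.eval l) (Metric.ball 0 1) := by
    refine DifferentiableOn.diffContOnCl (hd.mono ?_)
    rw [closure_ball _ one_ne_zero]
    exact Metric.closedBall_subset_ball hρ.out
  rw [← hev l h0]
  refine Complex.norm_le_of_forall_mem_frontier_norm_le Metric.isBounded_ball hd1 (fun z hz => ?_) ?_
  · rw [frontier_ball _ one_ne_zero, mem_sphere_zero_iff_norm] at hz
    have hz0 : z ≠ 0 := by rintro rfl; simp at hz
    rw [hev z hz0, norm_mul, hz, one_mul]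
    exact hM z hz
  · rw [closure_ball _ one_ne_zero]
    simpa using h1

end WienerSpace

namespace Lawson

open unitInterval ContDiff

set_option linter.unusedSectionVars false

/-! ### The real system on a half axis -/

/-- The common denominator of the forms on the real axis. -/
noncomputable def axisDen (φ s : ℝ) : ℝ := (s ^ 2 - 1) ^ 2 + 4 * Real.sin φ ^ 2 * s ^ 2

theorem axisDen_pos {φ : ℝ} (hφ : 0 < Real.sin φ) (s : ℝ) : 0 < axisDen φ s := by
  rw [axisDen]
  by_cases hs : s = 0
  · subst hs; norm_num
  · have : 0 < s ^ 2 := by positivity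
    have h2 : 0 < 4 * Real.sin φ ^ 2 * s ^ 2 := by positivity
    linarith [sq_nonneg (s ^ 2 - 1)]

/-- The forms `ω₁, ω₂, ω₃` on the real axis, up to constant factors. -/
noncomputable def axisForm (φ : ℝ) (j : Fin 3) (s : ℝ) : ℝ :=
  ![8 * Real.sin φ * Real.cos φ * s, 4 * Real.cos φ * (s ^ 2 - 1), 4 * Real.sin φ * (s ^ 2 + 1)] j /
    axisDen φ s

open Classical in
/-- The forms `ω₁, ω₂, ω₃` on the unit interval, up to constant factors. -/
noncomputable def unitForm (φ : ℝ) (j : Fin 3) : C(I, ℝ) :=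
  if h : 0 < Real.sin φ then
    ⟨fun s => axisForm φ j s, by
      have hc : Continuous (axisForm φ j) := by
        refine Continuous.div ?_ (by unfold axisDen; fun_prop) (fun s => (axisDen_pos h s).ne')
        fin_cases j
        · exact (by fun_prop : Continuous fun s : ℝ => 8 * Real.sin φ * Real.cos φ * s)
        · exact (by fun_prop : Continuous fun s : ℝ => 4 * Real.cos φ * (s ^ 2 - 1))
        · exact (by fun_prop : Continuous fun s : ℝ => 4 * Real.sin φ * (s ^ 2 + 1))
      exact hc.comp continuous_subtype_val⟩
  else 0

theorem unitForm_apply {φ : ℝ} (h : 0 < Real.sin φ) (j : Fin 3) (s : I) :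
    unitForm φ j s = axisForm φ j s := by
  rw [unitForm, dif_pos h]; rfl

/-! ### Integrals of the forms over the unit interval -/

section Integrals

variable {φ : ℝ}

/-- Each factor collects a pair of complex conjugate punctures; partial fractions then integrate the
third form to arctangents. -/
theorem axisDen_eq (φ s : ℝ) : axisDen φ s =
    ((s - Real.cos φ) ^ 2 + Real.sin φ ^ 2) * ((s + Real.cos φ) ^ 2 + Real.sin φ ^ 2) := by
  have h := Real.sin_sq_add_cos_sq φ
  have h2 : Real.cos φ ^ 2 = 1 - Real.sin φ ^ 2 := by linarith
  rw [axisDen]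
  have : ((s - Real.cos φ) ^ 2 + Real.sin φ ^ 2) * ((s + Real.cos φ) ^ 2 + Real.sin φ ^ 2) =
      (s ^ 2 - Real.cos φ ^ 2) ^ 2 + Real.sin φ ^ 2 * (2 * s ^ 2 + 2 * Real.cos φ ^ 2) +
      Real.sin φ ^ 4 := by ring
  rw [this, h2]; ring

/-- A primitive of the third form. -/
noncomputable def thirdPrimitive (φ s : ℝ) : ℝ :=
  2 * (Real.arctan ((s - Real.cos φ) / Real.sin φ) + Real.arctan ((s + Real.cos φ) / Real.sin φ))

theorem hasDerivAt_thirdPrimitive (hs : 0 < Real.sin φ) (s : ℝ) :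
    HasDerivAt (thirdPrimitive φ) (axisForm φ 2 s) s := by
  have h1 : HasDerivAt (fun s => (s - Real.cos φ) / Real.sin φ) (1 / Real.sin φ) s :=
    ((hasDerivAt_id s).sub_const _).div_const _
  have h2 : HasDerivAt (fun s => (s + Real.cos φ) / Real.sin φ) (1 / Real.sin φ) s :=
    ((hasDerivAt_id s).add_const _).div_const _
  have h3 := (h1.arctan.add h2.arctan).const_mul 2
  refine h3.congr_deriv ?_
  have e1 : (s - Real.cos φ) ^ 2 + Real.sin φ ^ 2 ≠ 0 := by positivity
  have e2 : (s + Real.cos φ) ^ 2 + Real.sin φ ^ 2 ≠ 0 := by positivity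
  have e3 : 1 + ((s - Real.cos φ) / Real.sin φ) ^ 2 ≠ 0 := by positivity
  have e4 : 1 + ((s + Real.cos φ) / Real.sin φ) ^ 2 ≠ 0 := by positivity
  have h0 : Real.sin φ ≠ 0 := hs.ne'
  have hc : Real.cos φ ^ 2 = 1 - Real.sin φ ^ 2 := by linarith [Real.sin_sq_add_cos_sq φ]
  have g1 : 1 / (1 + ((s - Real.cos φ) / Real.sin φ) ^ 2) * (1 / Real.sin φ) =
      Real.sin φ / ((s - Real.cos φ) ^ 2 + Real.sin φ ^ 2) := by
    rw [div_pow, ← mul_div_mul_left _ _ (pow_ne_zero 2 h0)]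
    field_simp
    ring
  have g2 : 1 / (1 + ((s + Real.cos φ) / Real.sin φ) ^ 2) * (1 / Real.sin φ) =
      Real.sin φ / ((s + Real.cos φ) ^ 2 + Real.sin φ ^ 2) := by
    rw [div_pow, ← mul_div_mul_left _ _ (pow_ne_zero 2 h0)]
    field_simp
    ring
  rw [g1, g2, axisForm, axisDen_eq, div_add_div _ _ e1 e2, ← mul_div_assoc]
  congr 1
  change _ = 4 * Real.sin φ * (s ^ 2 + 1)
  have : 2 * (Real.sin φ * ((s + Real.cos φ) ^ 2 + Real.sin φ ^ 2) +
    ((s - Real.cos φ) ^ 2 + Real.sin φ ^ 2) * Real.sin φ) =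
    4 * Real.sin φ * (s ^ 2 + (Real.sin φ ^ 2 + Real.cos φ ^ 2)) := by ring
  rw [this, Real.sin_sq_add_cos_sq]

/-- At `1` the two arguments are `(1 ∓ cos φ) / sin φ`, which are reciprocal, so their arctangents
add up to `π/2`; at `0` the two terms cancel. That the result does not depend on `φ` is why `𝔭` and
`𝔮` have the same leading factor `2π`. -/
theorem thirdPrimitive_one_sub (hφ : φ ∈ Ioo 0 (Real.pi / 2)) :
    thirdPrimitive φ 1 - thirdPrimitive φ 0 = Real.pi := by
  have hs : 0 < Real.sin φ := Real.sin_pos_of_pos_of_lt_pi hφ.1 (by linarith [hφ.2, Real.pi_pos])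
  have hc : Real.cos φ < 1 := by
    have := Real.sin_sq_add_cos_sq φ
    nlinarith
  have h1 : 0 < (1 - Real.cos φ) / Real.sin φ := div_pos (by linarith) hs
  have h2 : (1 + Real.cos φ) / Real.sin φ = ((1 - Real.cos φ) / Real.sin φ)⁻¹ := by
    rw [inv_div, div_eq_div_iff hs.ne' (by linarith)]
    nlinarith [Real.sin_sq_add_cos_sq φ]
  have h3 : (0 - Real.cos φ) / Real.sin φ = -(Real.cos φ / Real.sin φ) := by ring
  rw [thirdPrimitive, thirdPrimitive, h2, Real.arctan_inv_of_pos h1, h3, Real.arctan_neg, zero_add]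
  ring

theorem integral_axisForm_two (hφ : φ ∈ Ioo 0 (Real.pi / 2)) :
    ∫ s in (0 : ℝ)..1, axisForm φ 2 s = Real.pi := by
  have hs : 0 < Real.sin φ := Real.sin_pos_of_pos_of_lt_pi hφ.1 (by linarith [hφ.2, Real.pi_pos])
  rw [intervalIntegral.integral_eq_sub_of_hasDerivAt
    (fun s _ => hasDerivAt_thirdPrimitive hs s), thirdPrimitive_one_sub hφ]
  refine Continuous.intervalIntegrable ?_ _ _
  exact Continuous.div (by fun_prop : Continuous fun s : ℝ => 4 * Real.sin φ * (s ^ 2 + 1))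
    (by unfold axisDen; fun_prop) (fun s => (axisDen_pos hs s).ne')

/-- In the variable `s²` the denominator is `(s² - cos 2φ)² + (sin 2φ)²`, so the primitive is again
an arctangent, with end values `2φ` and `2(2φ - π/2)`. -/
theorem integral_axisForm_zero (hφ : φ ∈ Ioo 0 (Real.pi / 2)) :
    ∫ s in (0 : ℝ)..1, axisForm φ 0 s = Real.pi - 2 * φ := by
  have hs : 0 < Real.sin φ := Real.sin_pos_of_pos_of_lt_pi hφ.1 (by linarith [hφ.2, Real.pi_pos])
  have hc : 0 < Real.cos φ := Real.cos_pos_of_mem_Ioo ⟨by linarith [hφ.1, Real.pi_pos], hφ.2⟩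
  set w := 2 * Real.sin φ * Real.cos φ with hw
  have hw0 : 0 < w := by positivity
  have hder : ∀ s ∈ uIcc (0 : ℝ) 1, HasDerivAt
      (fun s => 2 * Real.arctan ((s ^ 2 - (1 - 2 * Real.sin φ ^ 2)) / w)) (axisForm φ 0 s) s := by
    intro s _
    have h1 : HasDerivAt (fun s : ℝ => (s ^ 2 - (1 - 2 * Real.sin φ ^ 2)) / w) (2 * s / w) s := by
      have := ((hasDerivAt_pow 2 s).sub_const (1 - 2 * Real.sin φ ^ 2)).div_const w
      simpa using this
    refine (h1.arctan.const_mul 2).congr_deriv ?_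
    have hden : axisDen φ s = (s ^ 2 - (1 - 2 * Real.sin φ ^ 2)) ^ 2 + w ^ 2 := by
      have h2 : Real.cos φ ^ 2 = 1 - Real.sin φ ^ 2 := by linarith [Real.sin_sq_add_cos_sq φ]
      rw [axisDen, hw, mul_pow, mul_pow, h2]; ring
    have e1 : 1 + ((s ^ 2 - (1 - 2 * Real.sin φ ^ 2)) / w) ^ 2 ≠ 0 := by positivity
    have e2 : (s ^ 2 - (1 - 2 * Real.sin φ ^ 2)) ^ 2 + w ^ 2 ≠ 0 := by positivity
    rw [axisForm, hden]
    change _ = 8 * Real.sin φ * Real.cos φ * s / _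
    have : 8 * Real.sin φ * Real.cos φ * s = 4 * w * s := by rw [hw]; ring
    rw [this]
    field_simp
    ring
  rw [intervalIntegral.integral_eq_sub_of_hasDerivAt hder]
  · have h1 : ((1 : ℝ) ^ 2 - (1 - 2 * Real.sin φ ^ 2)) / w = Real.tan φ := by
      rw [hw, Real.tan_eq_sin_div_cos]; field_simp; ring
    have h2 : ((0 : ℝ) ^ 2 - (1 - 2 * Real.sin φ ^ 2)) / w = Real.tan (2 * φ - Real.pi / 2) := by
      rw [Real.tan_eq_sin_div_cos, Real.sin_sub_pi_div_two, Real.cos_sub_pi_div_two,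
        Real.sin_two_mul, Real.cos_two_mul, hw]
      have h2 : Real.cos φ ^ 2 = 1 - Real.sin φ ^ 2 := by linarith [Real.sin_sq_add_cos_sq φ]
      rw [h2]; ring
    rw [h1, h2, Real.arctan_tan (by linarith [hφ.1, Real.pi_pos]) hφ.2,
      Real.arctan_tan (by linarith [hφ.1]) (by linarith [hφ.2])]
    ring
  · refine Continuous.intervalIntegrable ?_ _ _
    exact Continuous.div (by fun_prop : Continuous fun s : ℝ => 8 * Real.sin φ * Real.cos φ * s)
      (by unfold axisDen; fun_prop) (fun s => (axisDen_pos hs s).ne')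

end Integrals

end Lawson

namespace Lawson

open unitInterval ContDiff

set_option linter.unusedSectionVars false

/-! ### Transport along a half axis over a commutative Banach algebra -/

section HalfMonodromy

variable {A : Type*} [NormedCommRing A] [NormedAlgebra ℝ A] [CompleteSpace A]
variable (𝕜 : Type*) [NontriviallyNormedField 𝕜] [NormedAlgebra 𝕜 A] [SMulCommClass ℝ 𝕜 A]

/-- The map `M ↦ f M` for a real function `f` on the unit interval. -/
noncomputable def scaleCLM (f : C(I, ℝ)) : Mat A →L[𝕜] C(I, Mat A) :=
  LinearMap.mkContinuous
    { toFun := fun M => ⟨fun s => f s • M, by fun_prop⟩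
      map_add' := fun M N => by ext1 s; exact smul_add (f s) M N
      map_smul' := fun c M => by ext1 s; exact smul_comm (f s) c M } ‖f‖
    (fun M => by
      rw [ContinuousMap.norm_le _ (by positivity)]
      intro s
      refine (norm_smul_le (f s) M).trans ?_
      gcongr
      exact f.norm_coe_le_norm s)

/-- The three coefficient matrices of the real system. -/
noncomputable def axisMat : Fin 3 → (A →L[𝕜] Mat A) :=
  ![(Mat.of4CLM 𝕜 (A := A)).comp (.prod (-.id 𝕜 A) (.prod 0 (.prod 0 (.id 𝕜 A)))),
    (Mat.of4CLM 𝕜 (A := A)).comp (.prod 0 (.prod (.id 𝕜 A) (.prod (.id 𝕜 A) 0))),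
    (Mat.of4CLM 𝕜 (A := A)).comp (.prod 0 (.prod (-.id 𝕜 A) (.prod (.id 𝕜 A) 0)))]

/-- The coefficient of the real system on the unit interval. -/
noncomputable def axisCoeff (φ : ℝ) : (Fin 3 → A) →L[𝕜] C(I, Mat A) :=
  ∑ j, ((scaleCLM (A := A) 𝕜 (unitForm φ j)).comp (axisMat (A := A) 𝕜 j)).comp (ContinuousLinearMap.proj j)

theorem axisCoeff_apply (φ : ℝ) (a : Fin 3 → A) (s : I) :
    axisCoeff 𝕜 φ a s = Mat.of4 (-(unitForm φ 0 s • a 0))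
      (unitForm φ 1 s • a 1 - unitForm φ 2 s • a 2) (unitForm φ 1 s • a 1 + unitForm φ 2 s • a 2)
      (unitForm φ 0 s • a 0) := by
  have h : axisCoeff 𝕜 φ a s = unitForm φ 0 s • Mat.of4 (-a 0) 0 0 (a 0) +
      unitForm φ 1 s • Mat.of4 0 (a 1) (a 1) 0 + unitForm φ 2 s • Mat.of4 0 (-a 2) (a 2) 0 := by
    rw [axisCoeff, Fin.sum_univ_three]; rfl
  rw [h]
  apply Mat.ext4 <;> simp only [Mat.add_apply, Mat.smul_apply, Mat.of4_00, Mat.of4_01, Mat.of4_10,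
    Mat.of4_11, smul_zero, smul_neg] <;> abel

theorem contDiff_axisCoeff (φ : ℝ) :
    ContDiff 𝕜 ω (fun a : Fin 3 → A => (axisCoeff 𝕜 φ a : C(I, Mat A))) :=
  (axisCoeff (A := A) 𝕜 φ).contDiff

theorem contDiff_evalOne : ContDiff 𝕜 ω (fun f : C(I, Mat A) => f 1) :=
  (ContinuousMap.evalCLM (M := Mat A) 𝕜 (1 : I)).contDiff

theorem contDiff_entry (i j : Fin 2) : ContDiff 𝕜 ω (fun M : Mat A => M i j) :=
  (Mat.entry (A := A) 𝕜 i j).contDiff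

theorem axisCoeff_eq_real (φ : ℝ) (a : Fin 3 → A) : axisCoeff 𝕜 φ a = axisCoeff ℝ φ a := by
  ext1 s
  rw [axisCoeff_apply, axisCoeff_apply]

/-- The value at `1` of the solution of the real system. -/
noncomputable def halfMon (φ : ℝ) (a : Fin 3 → A) : Mat A := odeSol (axisCoeff ℝ φ a) 1

/-- The parameters of the system on the imaginary axis. -/
def swapParam (a : Fin 3 → A) : Fin 3 → A := ![-a 0, a 2, a 1]

/-- The half trace `𝔭` as a function of the parameters. -/
noncomputable def pFun (φ : ℝ) (a : Fin 3 → A) : A :=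
  halfMon φ a 0 0 * halfMon φ a 1 0 - halfMon φ a 0 1 * halfMon φ a 1 1

/-- The upper entry of `L₃`, up to a factor. -/
noncomputable def upFun (φ : ℝ) (a : Fin 3 → A) : A := halfMon φ a 0 0 ^ 2 - halfMon φ a 0 1 ^ 2

/-- The lower entry of `L₃`, up to a factor. -/
noncomputable def loFun (φ : ℝ) (a : Fin 3 → A) : A := halfMon φ a 1 1 ^ 2 - halfMon φ a 1 0 ^ 2

/-- The half trace `𝔮` as a function of the parameters. -/
noncomputable def qFun (φ : ℝ) (a : Fin 3 → A) : A := pFun (Real.pi / 2 - φ) (swapParam a)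

/-- Twice the square root of the negative Fricke discriminant. -/
noncomputable def vFun (φ : ℝ) (a : Fin 3 → A) : A :=
  upFun (Real.pi / 2 - φ) (swapParam a) * loFun φ a -
    upFun φ a * loFun (Real.pi / 2 - φ) (swapParam a)

/-! ### Functoriality -/

section Functoriality

variable {A' : Type*} [NormedCommRing A'] [NormedAlgebra ℝ A'] [CompleteSpace A']
variable (f : A →L[ℝ] A') (h1 : f 1 = 1) (hm : ∀ x y, f (x * y) = f x * f y)

-- Evaluation at a point `λ` is a bounded homomorphism from the Wiener algebra to `ℂ`. By naturality
-- the transport computed over the Wiener algebra specializes to the transport of the complex system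
-- at each `λ`.
include h1 hm in
theorem map_halfMon (φ : ℝ) (a : Fin 3 → A) (i j : Fin 2) :
    f (halfMon φ a i j) = halfMon φ (fun k => f (a k)) i j := by
  let F : Mat A →L[ℝ] Mat A' := (Mat.of4CLM ℝ).comp
    (.prod (f.comp (Mat.entry ℝ 0 0)) (.prod (f.comp (Mat.entry ℝ 0 1))
      (.prod (f.comp (Mat.entry ℝ 1 0)) (f.comp (Mat.entry ℝ 1 1)))))
  have hF : ∀ M : Mat A, F M = Mat.of4 (f (M 0 0)) (f (M 0 1)) (f (M 1 0)) (f (M 1 1)) :=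
    fun M => rfl
  have hFij : ∀ (M : Mat A) (i j : Fin 2), F M i j = f (M i j) := by
    intro M i j
    rw [hF]
    fin_cases i <;> fin_cases j <;> rfl
  have hF1 : F 1 = 1 := by
    ext i j
    rw [hFij, Mat.one_apply, Mat.one_apply]
    split_ifs
    · exact h1
    · exact map_zero f
  have hFm : ∀ M N, F (M * N) = F M * F N := by
    intro M N
    ext i j
    rw [hFij, Mat.mul_apply, Mat.mul_apply, map_add, hm, hm, hFij, hFij, hFij, hFij]
  have := map_odeSol F hF1 hFm (axisCoeff ℝ φ a) (axisCoeff ℝ φ fun k => f (a k)) (fun s => by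
    rw [axisCoeff_apply, axisCoeff_apply, hF]
    simp only [Mat.of4_00, Mat.of4_01, Mat.of4_10, Mat.of4_11, map_neg, map_sub, map_add, map_smul]) 1
  rw [← hFij]
  exact congrFun (congrFun this i) j

include h1 hm in
theorem map_pFun (φ : ℝ) (a : Fin 3 → A) : f (pFun φ a) = pFun φ (fun k => f (a k)) := by
  simp only [pFun, map_sub, hm, map_halfMon f h1 hm]

include hm in
theorem map_sq (x : A) : f (x ^ 2) = f x ^ 2 := by rw [sq, sq, hm]

include h1 hm in
theorem map_upFun (φ : ℝ) (a : Fin 3 → A) : f (upFun φ a) = upFun φ (fun k => f (a k)) := by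
  simp only [upFun, map_sub, map_sq f hm, map_halfMon f h1 hm]

include h1 hm in
theorem map_loFun (φ : ℝ) (a : Fin 3 → A) : f (loFun φ a) = loFun φ (fun k => f (a k)) := by
  simp only [loFun, map_sub, map_sq f hm, map_halfMon f h1 hm]

theorem map_swapParam (a : Fin 3 → A) :
    (fun k => f (swapParam a k)) = swapParam (fun k => f (a k)) := by
  funext k
  fin_cases k
  · exact map_neg f (a 0)
  · rfl
  · rfl

include h1 hm in
theorem map_qFun (φ : ℝ) (a : Fin 3 → A) : f (qFun φ a) = qFun φ (fun k => f (a k)) := by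
  rw [qFun, map_pFun f h1 hm, map_swapParam, qFun]

include h1 hm in
theorem map_vFun (φ : ℝ) (a : Fin 3 → A) : f (vFun φ a) = vFun φ (fun k => f (a k)) := by
  simp only [vFun, map_sub, hm, map_upFun f h1 hm, map_loFun f h1 hm, map_swapParam]

end Functoriality

/-! ### First order expansion -/

/-- `halfMon φ (τ a) = 1 + τ R(τ, a)`. -/
noncomputable def halfRem (φ : ℝ) (τ : 𝕜) (a : Fin 3 → A) : Mat A :=
  odeRem 𝕜 τ (axisCoeff 𝕜 φ a) 1

theorem halfMon_smul (φ : ℝ) (τ : 𝕜) (a : Fin 3 → A) :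
    halfMon φ (τ • a) = 1 + τ • halfRem 𝕜 φ τ a := by
  have h1 : axisCoeff ℝ φ (τ • a) = τ • axisCoeff 𝕜 φ a := by
    rw [← axisCoeff_eq_real 𝕜]
    exact (axisCoeff 𝕜 φ).map_smul τ a
  have h2 : odeSol (τ • axisCoeff 𝕜 φ a) 1 =
      (1 + τ • odeRem 𝕜 τ (axisCoeff 𝕜 φ a) : C(I, Mat A)) 1 := by
    rw [odeSol_smul]
  rw [halfMon, h1, h2, halfRem]
  exact ContinuousMap.add_apply _ _ _

theorem contDiff_halfRem (φ : ℝ) :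
    ContDiff 𝕜 ω fun x : 𝕜 × (Fin 3 → A) => halfRem 𝕜 φ x.1 x.2 := by
  have h0 : ContDiff 𝕜 ω fun x : 𝕜 × (Fin 3 → A) => (x.1, axisCoeff 𝕜 φ x.2) :=
    contDiff_fst.prodMk ((contDiff_axisCoeff 𝕜 φ).comp contDiff_snd)
  have h1 : ContDiff 𝕜 ω ((fun p : 𝕜 × C(I, Mat A) => odeRem 𝕜 p.1 p.2) ∘
    fun x : 𝕜 × (Fin 3 → A) => (x.1, axisCoeff 𝕜 φ x.2)) := (contDiff_odeRem 𝕜).comp h0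
  exact (contDiff_evalOne 𝕜).comp h1

/-- The first order term is the integral of the coefficient. In the difference of the off-diagonal
entries the second form cancels and the third one is doubled, which leaves `2π`. -/
theorem halfRem_zero {φ : ℝ} (hφ : φ ∈ Ioo 0 (Real.pi / 2)) (a : Fin 3 → A) :
    halfRem 𝕜 φ 0 a 0 0 = -((Real.pi - 2 * φ) • a 0) ∧
    halfRem 𝕜 φ 0 a 1 1 = (Real.pi - 2 * φ) • a 0 ∧
    halfRem 𝕜 φ 0 a 1 0 - halfRem 𝕜 φ 0 a 0 1 = (2 * Real.pi) • a 2 := by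
  have hs : 0 < Real.sin φ := Real.sin_pos_of_pos_of_lt_pi hφ.1 (by linarith [hφ.2, Real.pi_pos])
  have h0 : halfRem 𝕜 φ 0 a =
      ∫ s in (0 : ℝ)..1, unitExtend (axisCoeff 𝕜 φ a) s := by
    rw [halfRem, odeRem_zero, primitiveCLM_apply]; rfl
  have hij : ∀ i j, halfRem 𝕜 φ 0 a i j =
      ∫ s in (0 : ℝ)..1, (unitExtend (axisCoeff 𝕜 φ a) s) i j := by
    intro i j
    rw [h0]
    exact ((Mat.entry ℝ (A := A) i j).intervalIntegral_comp_comm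
      ((continuous_unitExtend _).intervalIntegrable _ _)).symm
  have hval : ∀ s ∈ uIcc (0 : ℝ) 1, unitExtend (axisCoeff 𝕜 φ a) s =
      Mat.of4 (-(axisForm φ 0 s • a 0)) (axisForm φ 1 s • a 1 - axisForm φ 2 s • a 2)
        (axisForm φ 1 s • a 1 + axisForm φ 2 s • a 2) (axisForm φ 0 s • a 0) := by
    intro s hsI
    rw [uIcc_of_le zero_le_one] at hsI
    rw [unitExtend_of_mem _ hsI, axisCoeff_apply, unitForm_apply hs, unitForm_apply hs,
      unitForm_apply hs]
  refine ⟨?_, ?_, ?_⟩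
  · rw [hij, intervalIntegral.integral_congr
      (g := fun s => -(axisForm φ 0 s • a 0)) (fun s hsI => by simp only [hval s hsI]; rfl),
      intervalIntegral.integral_neg, intervalIntegral.integral_smul_const,
      integral_axisForm_zero hφ]
  · rw [hij, intervalIntegral.integral_congr
      (g := fun s => axisForm φ 0 s • a 0) (fun s hsI => by simp only [hval s hsI]; rfl),
      intervalIntegral.integral_smul_const, integral_axisForm_zero hφ]
  · have hi : ∀ i j, IntervalIntegrable (fun s => (unitExtend (axisCoeff 𝕜 φ a) s) i j)
        MeasureTheory.volume 0 1 := fun i j =>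
      ((Mat.entry ℝ (A := A) i j).continuous.comp
        (continuous_unitExtend (axisCoeff 𝕜 φ a))).intervalIntegrable (μ := MeasureTheory.volume) 0 1
    rw [hij, hij, ← intervalIntegral.integral_sub (hi 1 0) (hi 0 1),
      intervalIntegral.integral_congr
      (g := fun s => axisForm φ 2 s • ((2 : ℝ) • a 2)) (fun s hsI => by
        simp only [hval s hsI, Mat.of4_10, Mat.of4_01]
        rw [smul_smul, mul_comm, mul_smul, two_smul]
        abel),
      intervalIntegral.integral_smul_const, integral_axisForm_two hφ, smul_smul, mul_comm]

/-- The quotient `pFun φ (τ a) / τ`. -/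
noncomputable def pRem (φ : ℝ) (τ : 𝕜) (a : Fin 3 → A) : A :=
  halfRem 𝕜 φ τ a 1 0 - halfRem 𝕜 φ τ a 0 1 +
    τ • (halfRem 𝕜 φ τ a 0 0 * halfRem 𝕜 φ τ a 1 0 - halfRem 𝕜 φ τ a 0 1 * halfRem 𝕜 φ τ a 1 1)

theorem pFun_smul (φ : ℝ) (τ : 𝕜) (a : Fin 3 → A) : pFun φ (τ • a) = τ • pRem 𝕜 φ τ a := by
  rw [pFun, halfMon_smul 𝕜, pRem]
  simp only [Mat.add_apply, Mat.smul_apply, Mat.one_apply]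
  simp only [if_true, Fin.isValue, one_ne_zero, zero_ne_one, if_false, zero_add]
  simp only [add_mul, mul_add, one_mul, mul_one, smul_sub, smul_add, smul_mul_assoc,
    mul_smul_comm]
  abel

theorem pRem_zero {φ : ℝ} (hφ : φ ∈ Ioo 0 (Real.pi / 2)) (a : Fin 3 → A) :
    pRem 𝕜 φ 0 a = (2 * Real.pi) • a 2 := by
  rw [pRem, zero_smul, add_zero, (halfRem_zero 𝕜 hφ a).2.2]

theorem contDiff_entry_halfRem (φ : ℝ) (i j : Fin 2) :
    ContDiff 𝕜 ω fun x : 𝕜 × (Fin 3 → A) => halfRem 𝕜 φ x.1 x.2 i j :=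
  (contDiff_entry 𝕜 i j).comp (contDiff_halfRem 𝕜 φ)

theorem contDiff_pRem (φ : ℝ) : ContDiff 𝕜 ω fun x : 𝕜 × (Fin 3 → A) => pRem 𝕜 φ x.1 x.2 := by
  have h := contDiff_entry_halfRem (A := A) 𝕜 φ
  exact ((h 1 0).sub (h 0 1)).add
    (contDiff_fst.smul (((h 0 0).mul (h 1 0)).sub ((h 0 1).mul (h 1 1))))

theorem contDiff_swapParam : ContDiff 𝕜 ω (swapParam : (Fin 3 → A) → (Fin 3 → A)) := by
  rw [contDiff_pi]
  intro k
  fin_cases k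
  · exact (contDiff_apply 𝕜 A (0 : Fin 3)).neg
  · exact contDiff_apply 𝕜 A (2 : Fin 3)
  · exact contDiff_apply 𝕜 A (1 : Fin 3)

/-- The quotient `qFun φ (τ a) / τ`. -/
noncomputable def qRem (φ : ℝ) (τ : 𝕜) (a : Fin 3 → A) : A :=
  pRem 𝕜 (Real.pi / 2 - φ) τ (swapParam a)

theorem swapParam_smul (τ : 𝕜) (a : Fin 3 → A) : swapParam (τ • a) = τ • swapParam a := by
  funext k
  fin_cases k
  · exact (smul_neg τ (a 0)).symm
  · rfl
  · rfl

theorem qFun_smul (φ : ℝ) (τ : 𝕜) (a : Fin 3 → A) : qFun φ (τ • a) = τ • qRem 𝕜 φ τ a := by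
  rw [qFun, swapParam_smul, pFun_smul, qRem]

theorem compl_mem {φ : ℝ} (hφ : φ ∈ Ioo 0 (Real.pi / 2)) :
    Real.pi / 2 - φ ∈ Ioo 0 (Real.pi / 2) := ⟨by linarith [hφ.2], by linarith [hφ.1]⟩

theorem qRem_zero {φ : ℝ} (hφ : φ ∈ Ioo 0 (Real.pi / 2)) (a : Fin 3 → A) :
    qRem 𝕜 φ 0 a = (2 * Real.pi) • a 1 := by
  rw [qRem, pRem_zero 𝕜 (compl_mem hφ)]; rfl

theorem contDiff_qRem (φ : ℝ) : ContDiff 𝕜 ω fun x : 𝕜 × (Fin 3 → A) => qRem 𝕜 φ x.1 x.2 := by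
  have h1 := contDiff_pRem (A := A) 𝕜 (Real.pi / 2 - φ)
  have h2 : ContDiff 𝕜 ω fun x : 𝕜 × (Fin 3 → A) => (x.1, swapParam x.2) :=
    contDiff_fst.prodMk ((contDiff_swapParam 𝕜).comp contDiff_snd)
  have h3 : ContDiff 𝕜 ω ((fun x : 𝕜 × (Fin 3 → A) => pRem 𝕜 (Real.pi / 2 - φ) x.1 x.2) ∘
    fun x : 𝕜 × (Fin 3 → A) => (x.1, swapParam x.2)) := h1.comp h2
  exact h3

end HalfMonodromy

end Lawson

/-! ### Operators measuring the asymmetry under inversion of λ -/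

namespace WienerSpace

variable {ρ : ℝ} [hρ : Fact (1 < ρ)]

/-- `u ↦ ∑_{k ≥ 1} (u_k - u_{-k}) λ^k`. -/
noncomputable def antiPart : WienerSpace ρ →L[ℝ] WienerSpace ρ :=
  coeffMap (fun k => if 0 < k then 1 else 0) id Function.injective_id 1 (fun k => by
    have : 0 ≤ ρ ^ k.natAbs := pow_nonneg rho_pos.le _
    by_cases h : 0 < k <;> simp [h, this]) -
  coeffMap (fun k => if 0 < k then 1 else 0) (fun k => -k) neg_injective 1 (fun k => by
    have : 0 ≤ ρ ^ k.natAbs := pow_nonneg rho_pos.le _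
    by_cases h : 0 < k <;> simp [h, this])

theorem coeff_antiPart (u : WienerSpace ρ) (k : ℤ) :
    (antiPart u).coeff k = if 0 < k then u.coeff k - u.coeff (-k) else 0 := by
  have : (antiPart u).coeff k = (if 0 < k then 1 else 0) * u.coeff k -
    (if 0 < k then 1 else 0) * u.coeff (-k) := rfl
  rw [this]; split_ifs <;> ring

/-- `u ↦ ∑_{k ≥ 0} (u_{k+1} - u_{-k-1}) λ^k`. -/
noncomputable def shiftAntiPart : WienerSpace ρ →L[ℝ] WienerSpace ρ :=
  (ContinuousLinearMap.mul ℝ (WienerSpace ρ) (single (-1) 1)).comp antiPart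

theorem coeff_shiftAntiPart (u : WienerSpace ρ) (k : ℤ) :
    (shiftAntiPart u).coeff k = if 0 ≤ k then u.coeff (k + 1) - u.coeff (-k - 1) else 0 := by
  have : (shiftAntiPart u).coeff k = (single (-1) 1 * antiPart u).coeff k := rfl
  rw [this, coeff_single_mul, coeff_antiPart, one_mul]
  have e : k - -1 = k + 1 := by ring
  have e2 : -(k + 1) = -k - 1 := by ring
  rw [e, e2]
  by_cases h : 0 ≤ k
  · rw [if_pos h, if_pos (by omega)]
  · rw [if_neg h, if_neg (by omega)]

theorem refl_eq_iff (u : WienerSpace ρ) : refl u = u ↔ ∀ k > 0, u.coeff k - u.coeff (-k) = 0 := by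
  constructor
  · intro h k _
    have := congrArg (fun v => v.coeff k) h
    simp only [coeff_refl] at this
    rw [this, sub_self]
  · intro h
    refine ext_coeff fun k => ?_
    rw [coeff_refl]
    rcases lt_trichotomy k 0 with hk | rfl | hk
    · have := h (-k) (by omega)
      rw [neg_neg] at this
      linarith
    · simp
    · linarith [h k hk]

/-- The Laurent polynomial `a λ⁻¹ + b + d λ`. -/
noncomputable def tri (a b d : ℝ) : WienerSpace ρ := single (-1) a + single 0 b + single 1 d

theorem coeff_tri (a b d : ℝ) (k : ℤ) : (tri a b d : WienerSpace ρ).coeff k =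
    if k = -1 then a else if k = 0 then b else if k = 1 then d else 0 := by
  rw [tri, coeff_add, coeff_add, coeff_single, coeff_single, coeff_single]
  by_cases h1 : k = -1
  · subst h1; simp
  by_cases h2 : k = 0
  · subst h2; simp
  by_cases h3 : k = 1
  · subst h3; simp
  simp [h1, h2, h3]

theorem coeff_tri_of_lt (a b d : ℝ) {k : ℤ} (hk : k < -1) :
    (tri a b d : WienerSpace ρ).coeff k = 0 := by
  rw [coeff_tri, if_neg (by omega), if_neg (by omega), if_neg (by omega)]

theorem eval_tri (a b d : ℝ) (l : ℂ) :
    (tri a b d : WienerSpace ρ).eval l = a * l⁻¹ + b + d * l := by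
  rw [eval, tsum_eq_sum (s := {-1, 0, 1}) (fun k hk => by
    simp only [Finset.mem_insert, Finset.mem_singleton, not_or] at hk
    rw [coeff_tri, if_neg hk.1, if_neg hk.2.1, if_neg hk.2.2]; simp),
    Finset.sum_insert (by norm_num), Finset.sum_pair (by norm_num)]
  simp only [coeff_tri]
  norm_num
  ring

end WienerSpace

/-! ### The monodromy equations as one analytic map -/

namespace Lawson

open unitInterval ContDiff WienerSpace

set_option linter.unusedSectionVars false

variable {ρ : ℝ} [hρ : Fact (1 < ρ)]

/-- The quadratic form `-X₁² + X₂² + X₃²`. -/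
def quadForm {A : Type*} [CommRing A] (X : Fin 3 → A) : A := -X 0 ^ 2 + X 1 ^ 2 + X 2 ^ 2

/-- The equations of the monodromy problem for `X = r x`. -/
noncomputable def monEq (φ : ℝ) (p : ℝ × ((Fin 3 → WienerSpace ρ) × ℝ)) :
    Fin 3 → WienerSpace ρ :=
  ![negPart (p.2.1 0) - (p.2.2 * poleCoeff φ 0) • single (-1) 1 +
      nonnegPart (single 1 1 * (quadForm p.2.1 - 1)),
    negPart (p.2.1 1) - (p.2.2 * poleCoeff φ 1) • single (-1) 1 +
      (antiPart (qRem ℝ φ p.1 p.2.1) + sumCLM (qRem ℝ φ p.1 p.2.1) • 1),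
    negPart (p.2.1 2) - (p.2.2 * poleCoeff φ 2) • single (-1) 1 +
      shiftAntiPart (pRem ℝ φ p.1 p.2.1)]

theorem coeff_smul_single (c : ℝ) (k j : ℤ) :
    (c • (single k 1 : WienerSpace ρ)).coeff j = if j = k then c else 0 := by
  rw [coeff_smul, coeff_single]; split_ifs <;> simp

/-- The prescribed residues form an isotropic vector, so `𝒦` has no double pole at `λ = 0`. -/
theorem poleCoeff_quad (φ : ℝ) : -poleCoeff φ 0 * poleCoeff φ 0 + poleCoeff φ 1 * poleCoeff φ 1 +
    poleCoeff φ 2 * poleCoeff φ 2 = 0 := by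
  have := Real.sin_sq_add_cos_sq φ
  change -(1 / 2) * (1 / 2) + (-(1 / 2) * Real.sin φ) * (-(1 / 2) * Real.sin φ) +
    (-(1 / 2) * Real.cos φ) * (-(1 / 2) * Real.cos φ) = (0 : ℝ)
  linarith

/-- Laurent series with simple poles and residues `r` times the prescribed ones. -/
def HasPoles (φ : ℝ) (X : Fin 3 → WienerSpace ρ) (r : ℝ) : Prop :=
  (∀ j, ∀ k < -1, (X j).coeff k = 0) ∧ ∀ j, (X j).coeff (-1) = r * poleCoeff φ j

/-- Only the coefficient of `λ⁻²` needs an argument: it is `r r'` times the quadratic form of the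
isotropic residue vector. -/
theorem coeff_mul_sum_of_hasPoles {φ r r' : ℝ} {X Y : Fin 3 → WienerSpace ρ} (hX : HasPoles φ X r)
    (hY : HasPoles φ Y r') {k : ℤ} (hk : k < -1) :
    (-(X 0 * Y 0) + X 1 * Y 1 + X 2 * Y 2).coeff k = 0 := by
  have h := fun j => coeff_mul_of_pole (hX.1 j) (hY.1 j)
  rw [coeff_add, coeff_add, coeff_neg]
  rcases eq_or_lt_of_le (Int.le_sub_one_of_lt hk) with h2 | h2
  · rw [h2]
    norm_num
    rw [(h 0).2.1, (h 1).2.1, (h 2).2.1]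
    simp only [hX.2, hY.2]
    linear_combination (r * r') * poleCoeff_quad φ
  · have h3 : k < -2 := by omega
    rw [(h 0).1 k h3, (h 1).1 k h3, (h 2).1 k h3]
    ring

theorem quadForm_eq {A : Type*} [CommRing A] (X : Fin 3 → A) :
    quadForm X = -(X 0 * X 0) + X 1 * X 1 + X 2 * X 2 := by rw [quadForm]; ring

/-- In each component the negative coefficients carry the pole condition and the nonnegative ones
carry a further equation, so nothing is counted twice. The first component sees `quadForm X - 1`
shifted by one, from `λ⁻¹` upwards; lower coefficients vanish by isotropy. The constant coefficient
of the second component, free in the symmetry of `𝔮`, carries `𝔮(1) = 0`. The symmetry of `𝔭`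
concerns the exponents `k ≥ 1` and is shifted down to start at `0`. -/
theorem monEq_eq_zero_iff (φ t r : ℝ) (X : Fin 3 → WienerSpace ρ) :
    monEq φ (t, X, r) = 0 ↔ HasPoles φ X r ∧ quadForm X = 1 ∧
      refl (pRem ℝ φ t X) = pRem ℝ φ t X ∧ refl (qRem ℝ φ t X) = qRem ℝ φ t X ∧
      sumCLM (qRem ℝ φ t X) = 0 := by
  have h0 : ∀ k, (monEq φ (t, X, r) 0).coeff k = (if k < 0 then (X 0).coeff k else 0) -
      (if k = -1 then r * poleCoeff φ 0 else 0) +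
      if 0 ≤ k then (quadForm X - 1).coeff (k - 1) else 0 := fun k => by
    change (negPart (X 0) - (r * poleCoeff φ 0) • single (-1) 1 +
      nonnegPart (single 1 1 * (quadForm X - 1))).coeff k = _
    rw [coeff_add, coeff_sub, coeff_negPart, coeff_smul_single, coeff_nonnegPart, coeff_single_mul,
      one_mul]
  have h1 : ∀ k, (monEq φ (t, X, r) 1).coeff k = (if k < 0 then (X 1).coeff k else 0) -
      (if k = -1 then r * poleCoeff φ 1 else 0) +
      ((if 0 < k then (qRem ℝ φ t X).coeff k - (qRem ℝ φ t X).coeff (-k) else 0) +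
      if k = 0 then sumCLM (qRem ℝ φ t X) else 0) := fun k => by
    change (negPart (X 1) - (r * poleCoeff φ 1) • single (-1) 1 +
      (antiPart (qRem ℝ φ t X) + sumCLM (qRem ℝ φ t X) • single 0 1)).coeff k = _
    rw [coeff_add, coeff_sub, coeff_negPart, coeff_smul_single, coeff_add, coeff_antiPart,
      coeff_smul_single]
  have h2 : ∀ k, (monEq φ (t, X, r) 2).coeff k = (if k < 0 then (X 2).coeff k else 0) -
      (if k = -1 then r * poleCoeff φ 2 else 0) +
      (if 0 ≤ k then (pRem ℝ φ t X).coeff (k + 1) - (pRem ℝ φ t X).coeff (-k - 1) else 0) :=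
    fun k => by
    change (negPart (X 2) - (r * poleCoeff φ 2) • single (-1) 1 +
      shiftAntiPart (pRem ℝ φ t X)).coeff k = _
    rw [coeff_add, coeff_sub, coeff_negPart, coeff_smul_single, coeff_shiftAntiPart]
  constructor
  · intro h
    have g0 : ∀ j k, (monEq φ (t, X, r) j).coeff k = 0 := fun j k => by rw [h]; rfl
    have hneg : ∀ j, ∀ k < 0, (X j).coeff k = if k = -1 then r * poleCoeff φ j else 0 := by
      intro j k hk
      fin_cases j
      · have := (h0 k).symm.trans (g0 0 k)
        rw [if_pos hk, if_neg (not_le.2 hk)] at this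
        exact sub_eq_zero.1 ((add_zero _).symm.trans this)
      · have := (h1 k).symm.trans (g0 1 k)
        rw [if_pos hk, if_neg (not_lt.2 hk.le), if_neg hk.ne, add_zero] at this
        exact sub_eq_zero.1 ((add_zero _).symm.trans this)
      · have := (h2 k).symm.trans (g0 2 k)
        rw [if_pos hk, if_neg (not_le.2 hk)] at this
        exact sub_eq_zero.1 ((add_zero _).symm.trans this)
    have hP : HasPoles φ X r := ⟨fun j k hk => by rw [hneg j k (by omega), if_neg (by omega)],
      fun j => by rw [hneg j (-1) (by omega), if_pos rfl]⟩
    refine ⟨hP, ?_, ?_, ?_, ?_⟩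
    · refine ext_coeff fun k => ?_
      rcases lt_or_ge k (-1) with hk | hk
      · rw [quadForm_eq, coeff_mul_sum_of_hasPoles hP hP hk, coeff_one, if_neg (by omega)]
      · have := (h0 (k + 1)).symm.trans (g0 0 (k + 1))
        rw [if_neg (by omega), if_neg (by omega), if_pos (by omega), add_sub_cancel_right,
          coeff_sub] at this
        linarith
    · rw [refl_eq_iff]
      intro k hk
      have := (h2 (k - 1)).symm.trans (g0 2 (k - 1))
      rw [if_neg (by omega), if_neg (by omega), if_pos (by omega)] at this
      have e1 : k - 1 + 1 = k := by ring
      have e2 : -(k - 1) - 1 = -k := by ring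
      rw [e1, e2] at this
      linarith
    · rw [refl_eq_iff]
      intro k hk
      have := (h1 k).symm.trans (g0 1 k)
      rw [if_neg (by omega), if_neg (by omega), if_pos (by omega), if_neg (by omega)] at this
      linarith
    · have := (h1 0).symm.trans (g0 1 0)
      simpa using this
  · rintro ⟨hP, hK, hp, hq, hs⟩
    rw [refl_eq_iff] at hp hq
    have hneg : ∀ j, ∀ k, (if k < 0 then (X j).coeff k else 0) -
        (if k = -1 then r * poleCoeff φ j else 0) = 0 := by
      intro j k
      by_cases h : k = -1
      · subst h
        simp [hP.2 j]
      · rw [if_neg h, sub_zero]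
        by_cases h' : k < 0
        · rw [if_pos h', hP.1 j k (by omega)]
        · rw [if_neg h']
    funext j
    refine ext_coeff fun k => ?_
    fin_cases j
    · refine (h0 k).trans ?_
      rw [hneg, hK, sub_self]
      simp [coeff_zero]
    · refine (h1 k).trans ?_
      rw [hneg, hs, ite_self]
      by_cases h : 0 < k
      · rw [if_pos h, hq k h]; simp [coeff_zero]
      · rw [if_neg h]; simp [coeff_zero]
    · refine (h2 k).trans ?_
      rw [hneg]
      by_cases h : 0 ≤ k
      · have := hp (k + 1) (by omega)
        have e2 : -(k + 1) = -k - 1 := by ring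
        rw [e2] at this
        rw [if_pos h, this]; simp [coeff_zero]
      · rw [if_neg h]; simp [coeff_zero]

theorem contDiff_quadForm : ContDiff ℝ ω (fun X : Fin 3 → WienerSpace ρ => quadForm X) := by
  have h : ∀ j, ContDiff ℝ ω fun X : Fin 3 → WienerSpace ρ => X j :=
    fun j => contDiff_apply ℝ (WienerSpace ρ) j
  exact ((((h 0).pow 2).neg).add ((h 1).pow 2)).add ((h 2).pow 2)

theorem contDiff_clm_comp {E F G : Type*} [NormedAddCommGroup E] [NormedSpace ℝ E]
    [NormedAddCommGroup F] [NormedSpace ℝ F] [NormedAddCommGroup G] [NormedSpace ℝ G]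
    (L : F →L[ℝ] G) {f : E → F} (hf : ContDiff ℝ ω f) : ContDiff ℝ ω fun x => L (f x) :=
  L.contDiff.comp hf

theorem contDiff_pRem_param (φ : ℝ) : ContDiff ℝ ω
    fun p : ℝ × ((Fin 3 → WienerSpace ρ) × ℝ) => pRem ℝ φ p.1 p.2.1 := by
  have htX : ContDiff ℝ ω fun p : ℝ × ((Fin 3 → WienerSpace ρ) × ℝ) => (p.1, p.2.1) :=
    contDiff_fst.prodMk (contDiff_fst.comp contDiff_snd)
  have h : ContDiff ℝ ω ((fun x : ℝ × (Fin 3 → WienerSpace ρ) => pRem ℝ φ x.1 x.2) ∘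
      fun p : ℝ × ((Fin 3 → WienerSpace ρ) × ℝ) => (p.1, p.2.1)) := (contDiff_pRem ℝ φ).comp htX
  exact h

theorem contDiff_qRem_param (φ : ℝ) : ContDiff ℝ ω
    fun p : ℝ × ((Fin 3 → WienerSpace ρ) × ℝ) => qRem ℝ φ p.1 p.2.1 := by
  have htX : ContDiff ℝ ω fun p : ℝ × ((Fin 3 → WienerSpace ρ) × ℝ) => (p.1, p.2.1) :=
    contDiff_fst.prodMk (contDiff_fst.comp contDiff_snd)
  have h : ContDiff ℝ ω ((fun x : ℝ × (Fin 3 → WienerSpace ρ) => qRem ℝ φ x.1 x.2) ∘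
      fun p : ℝ × ((Fin 3 → WienerSpace ρ) × ℝ) => (p.1, p.2.1)) := (contDiff_qRem ℝ φ).comp htX
  exact h

theorem contDiff_monEq_zero : ContDiff ℝ ω
    fun p : ℝ × ((Fin 3 → WienerSpace ρ) × ℝ) => single 1 1 * (quadForm p.2.1 - 1) := by
  have hX : ContDiff ℝ ω fun p : ℝ × ((Fin 3 → WienerSpace ρ) × ℝ) => p.2.1 :=
    contDiff_fst.comp contDiff_snd
  have h : ContDiff ℝ ω ((fun X : Fin 3 → WienerSpace ρ => quadForm X) ∘
      fun p : ℝ × ((Fin 3 → WienerSpace ρ) × ℝ) => p.2.1) := contDiff_quadForm.comp hX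
  have h2 : ContDiff ℝ ω fun p : ℝ × ((Fin 3 → WienerSpace ρ) × ℝ) => quadForm p.2.1 := h
  exact contDiff_const.mul (h2.sub contDiff_const)

theorem contDiff_negPart_param (φ : ℝ) (j : Fin 3) : ContDiff ℝ ω
    fun p : ℝ × ((Fin 3 → WienerSpace ρ) × ℝ) =>
      negPart (p.2.1 j) - (p.2.2 * poleCoeff φ j) • (single (-1) 1 : WienerSpace ρ) := by
  have hX : ContDiff ℝ ω fun p : ℝ × ((Fin 3 → WienerSpace ρ) × ℝ) => p.2.1 :=
    contDiff_fst.comp contDiff_snd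
  have hr : ContDiff ℝ ω fun p : ℝ × ((Fin 3 → WienerSpace ρ) × ℝ) => p.2.2 :=
    contDiff_snd.comp contDiff_snd
  have hXj : ContDiff ℝ ω fun p : ℝ × ((Fin 3 → WienerSpace ρ) × ℝ) => p.2.1 j :=
    contDiff_clm_comp (ContinuousLinearMap.proj (R := ℝ) (φ := fun _ : Fin 3 => WienerSpace ρ) j) hX
  exact (contDiff_clm_comp negPart hXj).sub ((hr.mul contDiff_const).smul contDiff_const)

theorem contDiff_monEq (φ : ℝ) : ContDiff ℝ ω (monEq (ρ := ρ) φ) := by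
  have hq := contDiff_qRem_param (ρ := ρ) φ
  have h0 := (contDiff_negPart_param (ρ := ρ) φ 0).add
    (contDiff_clm_comp nonnegPart contDiff_monEq_zero)
  have h1 := (contDiff_negPart_param (ρ := ρ) φ 1).add ((contDiff_clm_comp antiPart hq).add
      ((contDiff_clm_comp sumCLM hq).smul (contDiff_const (c := (1 : WienerSpace ρ)))))
  have h2 := (contDiff_negPart_param (ρ := ρ) φ 2).add
    (contDiff_clm_comp shiftAntiPart (contDiff_pRem_param (ρ := ρ) φ))
  rw [contDiff_pi]
  intro j
  fin_cases j
  · exact h0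
  · exact h1
  · exact h2

end Lawson

/-! ### The central solution and the linearized equations -/

namespace WienerSpace

open unitInterval ContDiff Lawson

set_option linter.unusedSectionVars false

variable {ρ : ℝ} [hρ : Fact (1 < ρ)]

/-- The polar form of `quadForm`. -/
def quadPair {A : Type*} [CommRing A] (X Y : Fin 3 → A) : A := -(X 0 * Y 0) + X 1 * Y 1 + X 2 * Y 2

/-- The solution of the limit problem at `t = 0`. -/
noncomputable def centralX (φ : ℝ) : Fin 3 → WienerSpace ρ :=
  ![tri (Real.cos φ / 2) 0 (-Real.cos φ / 2),
    tri (-(Real.cos φ * Real.sin φ) / 2) (Real.cos φ * Real.sin φ)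
      (-(Real.cos φ * Real.sin φ) / 2),
    tri (-Real.cos φ ^ 2 / 2) (Real.cos φ ^ 2 - 1) (-Real.cos φ ^ 2 / 2)]

theorem eval_centralX_zero (φ : ℝ) (l : ℂ) : (centralX φ 0 : WienerSpace ρ).eval l =
    Real.cos φ / 2 * l⁻¹ - Real.cos φ / 2 * l := by
  change (tri _ _ _ : WienerSpace ρ).eval l = _
  rw [eval_tri]; push_cast; ring

theorem eval_centralX_one (φ : ℝ) (l : ℂ) : (centralX φ 1 : WienerSpace ρ).eval l =
    -(Real.cos φ * Real.sin φ) / 2 * (l⁻¹ - 2 + l) := by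
  change (tri _ _ _ : WienerSpace ρ).eval l = _
  rw [eval_tri]; push_cast; ring

theorem eval_centralX_two (φ : ℝ) (l : ℂ) : (centralX φ 2 : WienerSpace ρ).eval l =
    -1 - Real.cos φ ^ 2 / 2 * (l⁻¹ - 2 + l) := by
  change (tri _ _ _ : WienerSpace ρ).eval l = _
  rw [eval_tri]; push_cast; ring

theorem hasPoles_centralX (φ : ℝ) : HasPoles φ (centralX φ : Fin 3 → WienerSpace ρ) (Real.cos φ) := by
  constructor
  · intro j k hk
    fin_cases j <;> exact coeff_tri_of_lt _ _ _ hk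
  · intro j
    fin_cases j
    · refine (coeff_tri _ _ _ _).trans ?_
      rw [if_pos rfl]; change _ = _ * (1 / 2); ring
    · refine (coeff_tri _ _ _ _).trans ?_
      rw [if_pos rfl]; change _ = _ * (-(1 / 2) * _); ring
    · refine (coeff_tri _ _ _ _).trans ?_
      rw [if_pos rfl]; change _ = _ * (-(1 / 2) * _); ring

theorem eval_quadForm (X : Fin 3 → WienerSpace ρ) {l : ℂ} (hl : InAnnulus ρ l) :
    (quadForm X).eval l = quadForm fun j => (X j).eval l := by
  simp only [quadForm, eval_add _ _ hl, eval_neg _ hl, eval_pow _ hl]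

theorem eval_quadPair (X Y : Fin 3 → WienerSpace ρ) {l : ℂ} (hl : InAnnulus ρ l) :
    (quadPair X Y).eval l = quadPair (fun j => (X j).eval l) fun j => (Y j).eval l := by
  simp only [quadPair, eval_add _ _ hl, eval_neg _ hl, eval_mul _ _ hl]

theorem quadForm_centralX (φ : ℝ) : quadForm (centralX φ : Fin 3 → WienerSpace ρ) = 1 := by
  refine eq_of_eval_eq_on_unit_circle fun l hl => ?_
  have h0 : l ≠ 0 := by rintro rfl; simp at hl
  rw [eval_quadForm _ (inAnnulus_of_norm_one hl), eval_one, quadForm, eval_centralX_zero,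
    eval_centralX_one, eval_centralX_two]
  have hs : (Real.sin φ : ℂ) ^ 2 = 1 - Real.cos φ ^ 2 := by
    rw [eq_sub_iff_add_eq]; exact_mod_cast Real.sin_sq_add_cos_sq φ
  have hl1 : l * l⁻¹ = 1 := mul_inv_cancel₀ h0
  linear_combination ((Real.cos φ : ℂ) ^ 2 / 4 * (l⁻¹ - 2 + l) ^ 2) * hs +
    (Real.cos φ : ℂ) ^ 2 * hl1

theorem refl_tri (a b : ℝ) : refl (tri a b a : WienerSpace ρ) = tri a b a := by
  refine ext_coeff fun k => ?_
  rw [coeff_refl, coeff_tri, coeff_tri]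
  by_cases h1 : k = -1
  · subst h1; norm_num
  by_cases h2 : k = 1
  · subst h2; norm_num
  rw [if_neg (by omega), if_neg h1]
  congr 1
  · simp
  · rw [if_neg (by omega), if_neg h2]

theorem monEq_centralX {φ : ℝ} (hφ : φ ∈ Ioo 0 (Real.pi / 2)) :
    monEq φ (0, (centralX φ : Fin 3 → WienerSpace ρ), Real.cos φ) = 0 := by
  rw [monEq_eq_zero_iff, pRem_zero ℝ hφ, qRem_zero ℝ hφ]
  refine ⟨hasPoles_centralX φ, quadForm_centralX φ, ?_, ?_, ?_⟩
  · rw [map_smul]; congr 1; exact refl_tri _ _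
  · rw [map_smul]; congr 1; exact refl_tri _ _
  · rw [map_smul]
    have : sumCLM (centralX φ 1 : WienerSpace ρ) = 0 := by
      apply Complex.ofReal_injective
      rw [ofReal_sumCLM, eval_centralX_one]; norm_num
    rw [this, smul_zero]

/-- The derivative of `monEq` in the unknowns `(X, r)` at the central solution. -/
noncomputable def monLin (φ : ℝ) (v : (Fin 3 → WienerSpace ρ) × ℝ) : Fin 3 → WienerSpace ρ :=
  ![negPart (v.1 0) - (v.2 * poleCoeff φ 0) • single (-1) 1 +
      nonnegPart (single 1 2 * quadPair (centralX φ) v.1),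
    negPart (v.1 1) - (v.2 * poleCoeff φ 1) • single (-1) 1 +
      (antiPart ((2 * Real.pi) • v.1 1) + sumCLM ((2 * Real.pi) • v.1 1) • 1),
    negPart (v.1 2) - (v.2 * poleCoeff φ 2) • single (-1) 1 +
      shiftAntiPart ((2 * Real.pi) • v.1 2)]

theorem single_one_two : (single 1 2 : WienerSpace ρ) = 2 * single 1 1 := by
  refine ext_coeff fun k => ?_
  rw [two_mul, coeff_add, coeff_single, coeff_single]
  split_ifs <;> norm_num

/-- At `t = 0` the trace quotients are linear in `X`, so `monEq` restricted to a line is an explicit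
quadratic polynomial whose linear term is the derivative. -/
theorem monEq_line {φ : ℝ} (hφ : φ ∈ Ioo 0 (Real.pi / 2))
    (v : (Fin 3 → WienerSpace ρ) × ℝ) (s : ℝ) :
    monEq φ (0, centralX φ + s • v.1, Real.cos φ + s * v.2) =
      monEq φ (0, centralX φ, Real.cos φ) + s • monLin φ v +
        s ^ 2 • ![nonnegPart (single 1 1 * quadForm v.1), 0, 0] := by
  have hq : quadForm (centralX φ + s • v.1) - 1 = (quadForm (centralX φ) - 1) +
      (s • (2 * quadPair (centralX φ) v.1) + s ^ 2 • quadForm v.1) := by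
    simp only [quadForm, quadPair, Pi.add_apply, Pi.smul_apply]
    simp only [Algebra.smul_def, map_pow]
    ring
  have hl : single 1 1 * (quadForm (centralX φ + s • v.1) - 1) =
      single 1 1 * (quadForm (centralX φ) - 1) + (s • (single 1 2 * quadPair (centralX φ) v.1) +
        s ^ 2 • (single 1 1 * quadForm v.1)) := by
    rw [hq, mul_add, mul_add, mul_smul_comm, mul_smul_comm, single_one_two]
    congr 3
    ring
  funext j
  fin_cases j
  · change negPart (centralX φ 0 + s • v.1 0) -
        ((Real.cos φ + s * v.2) * poleCoeff φ 0) • single (-1) 1 +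
      nonnegPart (single 1 1 * (quadForm (centralX φ + s • v.1) - 1)) =
      negPart (centralX φ 0) - (Real.cos φ * poleCoeff φ 0) • single (-1) 1 +
      nonnegPart (single 1 1 * (quadForm (centralX φ) - 1)) +
      s • (negPart (v.1 0) - (v.2 * poleCoeff φ 0) • single (-1) 1 +
      nonnegPart (single 1 2 * quadPair (centralX φ) v.1)) +
      s ^ 2 • nonnegPart (single 1 1 * quadForm v.1)
    rw [hl]
    simp only [map_add, map_smul]
    module
  · change negPart (centralX φ 1 + s • v.1 1) -
        ((Real.cos φ + s * v.2) * poleCoeff φ 1) • single (-1) 1 +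
      (antiPart (qRem ℝ φ 0 (centralX φ + s • v.1)) +
        sumCLM (qRem ℝ φ 0 (centralX φ + s • v.1)) • 1) =
      negPart (centralX φ 1) - (Real.cos φ * poleCoeff φ 1) • single (-1) 1 +
      (antiPart (qRem ℝ φ 0 (centralX φ)) + sumCLM (qRem ℝ φ 0 (centralX φ)) • 1) +
      s • (negPart (v.1 1) - (v.2 * poleCoeff φ 1) • single (-1) 1 +
      (antiPart ((2 * Real.pi) • v.1 1) + sumCLM ((2 * Real.pi) • v.1 1) • 1)) + s ^ 2 • 0
    rw [qRem_zero ℝ hφ, qRem_zero ℝ hφ]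
    simp only [Pi.add_apply, Pi.smul_apply, map_add, map_smul, smul_eq_mul]
    module
  · change negPart (centralX φ 2 + s • v.1 2) -
        ((Real.cos φ + s * v.2) * poleCoeff φ 2) • single (-1) 1 +
      shiftAntiPart (pRem ℝ φ 0 (centralX φ + s • v.1)) =
      negPart (centralX φ 2) - (Real.cos φ * poleCoeff φ 2) • single (-1) 1 +
      shiftAntiPart (pRem ℝ φ 0 (centralX φ)) +
      s • (negPart (v.1 2) - (v.2 * poleCoeff φ 2) • single (-1) 1 +
      shiftAntiPart ((2 * Real.pi) • v.1 2)) + s ^ 2 • 0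
    rw [pRem_zero ℝ hφ, pRem_zero ℝ hφ]
    simp only [Pi.add_apply, Pi.smul_apply, map_add, map_smul]
    module

theorem fderiv_monEq_inr {φ : ℝ} (hφ : φ ∈ Ioo 0 (Real.pi / 2))
    (v : (Fin 3 → WienerSpace ρ) × ℝ) :
    fderiv ℝ (monEq φ) (0, (centralX φ : Fin 3 → WienerSpace ρ), Real.cos φ) (0, v) =
      monLin φ v := by
  have hd := ((contDiff_monEq (ρ := ρ) φ).differentiable (by simp)
    (0, (centralX φ : Fin 3 → WienerSpace ρ), Real.cos φ)).hasFDerivAt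
  have h1 := hd.hasLineDerivAt (0, v)
  have h2 : HasDerivAt (fun s : ℝ => monEq φ (0, centralX φ, Real.cos φ) + s • monLin φ v +
        s ^ 2 • ![nonnegPart (single 1 1 * quadForm v.1), 0, 0]) (monLin φ v) 0 := by
    have h := (((hasDerivAt_id (0 : ℝ)).smul_const (monLin φ v)).const_add
      (monEq φ (0, centralX φ, Real.cos φ))).add (((hasDerivAt_id (0 : ℝ)).pow 2).smul_const
        ![nonnegPart (single 1 1 * quadForm v.1), 0, 0])
    convert! h using 1
    simp
  refine HasDerivAt.unique (f := fun s : ℝ =>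
    monEq φ ((0, (centralX φ : Fin 3 → WienerSpace ρ), Real.cos φ) + s • (0, v))) h1 ?_
  convert! h2 using 1
  funext s
  rw [← monEq_line hφ v s]
  congr 1
  ext <;> simp

end WienerSpace

/-! ### Bijectivity of the linearization and the implicit function theorem -/

namespace WienerSpace

open unitInterval ContDiff Lawson

set_option linter.unusedSectionVars false

variable {ρ : ℝ} [hρ : Fact (1 < ρ)]

theorem coeff_monLin_of_neg (φ : ℝ) (v : (Fin 3 → WienerSpace ρ) × ℝ) (j : Fin 3) {k : ℤ}
    (hk : k < 0) : (monLin φ v j).coeff k =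
      (v.1 j).coeff k - if k = -1 then v.2 * poleCoeff φ j else 0 := by
  fin_cases j
  · change (negPart (v.1 0) - (v.2 * poleCoeff φ 0) • single (-1) 1 +
      nonnegPart (single 1 2 * quadPair (centralX φ) v.1)).coeff k = _
    rw [coeff_add, coeff_sub, coeff_negPart, coeff_smul_single, coeff_nonnegPart, if_pos hk,
      if_neg (not_le.2 hk), add_zero]
    rfl
  · change (negPart (v.1 1) - (v.2 * poleCoeff φ 1) • single (-1) 1 +
      (antiPart ((2 * Real.pi) • v.1 1) + sumCLM ((2 * Real.pi) • v.1 1) • single 0 1)).coeff k = _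
    rw [coeff_add, coeff_sub, coeff_negPart, coeff_smul_single, coeff_add, coeff_antiPart,
      coeff_smul_single, if_pos hk, if_neg (not_lt.2 hk.le), if_neg hk.ne, add_zero, add_zero]
    rfl
  · change (negPart (v.1 2) - (v.2 * poleCoeff φ 2) • single (-1) 1 +
      shiftAntiPart ((2 * Real.pi) • v.1 2)).coeff k = _
    rw [coeff_add, coeff_sub, coeff_negPart, coeff_smul_single, coeff_shiftAntiPart, if_pos hk,
      if_neg (not_le.2 hk), add_zero]
    rfl

theorem coeff_monLin_zero (φ : ℝ) (v : (Fin 3 → WienerSpace ρ) × ℝ) {k : ℤ} (hk : 0 ≤ k) :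
    (monLin φ v 0).coeff k = (single 1 2 * quadPair (centralX φ) v.1).coeff k := by
  change (negPart (v.1 0) - (v.2 * poleCoeff φ 0) • single (-1) 1 +
      nonnegPart (single 1 2 * quadPair (centralX φ) v.1)).coeff k = _
  rw [coeff_add, coeff_sub, coeff_negPart, coeff_smul_single, coeff_nonnegPart,
    if_neg (not_lt.2 hk), if_neg (by omega), if_pos hk, sub_zero, zero_add]

theorem coeff_monLin_one (φ : ℝ) (v : (Fin 3 → WienerSpace ρ) × ℝ) {k : ℤ} (hk : 0 < k) :
    (monLin φ v 1).coeff k = 2 * Real.pi * ((v.1 1).coeff k - (v.1 1).coeff (-k)) := by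
  change (negPart (v.1 1) - (v.2 * poleCoeff φ 1) • single (-1) 1 +
      (antiPart ((2 * Real.pi) • v.1 1) + sumCLM ((2 * Real.pi) • v.1 1) • single 0 1)).coeff k = _
  rw [coeff_add, coeff_sub, coeff_negPart, coeff_smul_single, coeff_add, coeff_antiPart,
    coeff_smul_single, if_neg (by omega), if_neg (by omega), if_pos hk, if_neg (by omega),
    coeff_smul, coeff_smul]
  ring

theorem coeff_monLin_one_zero (φ : ℝ) (v : (Fin 3 → WienerSpace ρ) × ℝ) :
    (monLin φ v 1).coeff 0 = 2 * Real.pi * sumCLM (v.1 1) := by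
  change (negPart (v.1 1) - (v.2 * poleCoeff φ 1) • single (-1) 1 +
      (antiPart ((2 * Real.pi) • v.1 1) + sumCLM ((2 * Real.pi) • v.1 1) • single 0 1)).coeff 0 = _
  rw [coeff_add, coeff_sub, coeff_negPart, coeff_smul_single, coeff_add, coeff_antiPart,
    coeff_smul_single, map_smul]
  simp

theorem coeff_monLin_two (φ : ℝ) (v : (Fin 3 → WienerSpace ρ) × ℝ) {k : ℤ} (hk : 0 ≤ k) :
    (monLin φ v 2).coeff k = 2 * Real.pi * ((v.1 2).coeff (k + 1) - (v.1 2).coeff (-(k + 1))) := by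
  change (negPart (v.1 2) - (v.2 * poleCoeff φ 2) • single (-1) 1 +
      shiftAntiPart ((2 * Real.pi) • v.1 2)).coeff k = _
  rw [coeff_add, coeff_sub, coeff_negPart, coeff_smul_single, coeff_shiftAntiPart,
    if_neg (by omega), if_neg (by omega), if_pos hk, coeff_smul, coeff_smul, neg_add']
  ring

/-- A simple pole at `0` bounds the exponents from below and the symmetry then bounds them from
above. -/
theorem eq_tri {u : WienerSpace ρ} (h : ∀ k < -1, u.coeff k = 0)
    (hs : ∀ k > 0, u.coeff k = u.coeff (-k)) :
    u = tri (u.coeff (-1)) (u.coeff 0) (u.coeff (-1)) := by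
  refine ext_coeff fun k => ?_
  rw [coeff_tri]
  by_cases h1 : k = -1
  · rw [if_pos h1, h1]
  by_cases h2 : k = 0
  · rw [if_neg h1, if_pos h2, h2]
  by_cases h3 : k = 1
  · rw [if_neg h1, if_neg h2, if_pos h3, h3, hs 1 one_pos]
  rw [if_neg h1, if_neg h2, if_neg h3]
  rcases lt_or_ge k 0 with hk | hk
  · exact h k (by omega)
  · rw [hs k (by omega)]
    exact h _ (by omega)

theorem sumCLM_tri (a b d : ℝ) : sumCLM (tri a b d : WienerSpace ρ) = a + b + d := by
  apply Complex.ofReal_injective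
  rw [ofReal_sumCLM, eval_tri]
  push_cast
  simp

theorem neg_one_inAnnulus : InAnnulus ρ (-1 : ℂ) := inAnnulus_of_norm_one (by simp)

theorem one_inAnnulus : InAnnulus ρ (1 : ℂ) := inAnnulus_of_norm_one (by simp)

theorem sin_sq_cast (φ : ℝ) : (Real.sin φ : ℂ) ^ 2 = 1 - (Real.cos φ : ℂ) ^ 2 := by
  rw [eq_sub_iff_add_eq]; exact_mod_cast Real.sin_sq_add_cos_sq φ

/-- The symmetric family of perturbations with prescribed residues. -/
noncomputable def polePert (φ d g : ℝ) : Fin 3 → WienerSpace ρ :=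
  ![tri (d * poleCoeff φ 0) 0 0,
    tri (d * poleCoeff φ 1) (-2 * (d * poleCoeff φ 1)) (d * poleCoeff φ 1),
    tri (d * poleCoeff φ 2) g (d * poleCoeff φ 2)]

theorem hasPoles_polePert (φ d g : ℝ) : HasPoles φ (polePert φ d g : Fin 3 → WienerSpace ρ) d := by
  constructor
  · intro j k hk
    fin_cases j <;> exact coeff_tri_of_lt _ _ _ hk
  · intro j
    fin_cases j
    · exact (coeff_tri _ _ _ _).trans (if_pos rfl)
    · exact (coeff_tri _ _ _ _).trans (if_pos rfl)
    · exact (coeff_tri _ _ _ _).trans (if_pos rfl)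

theorem poleCoeff_two_cast (φ : ℝ) : (poleCoeff φ 2 : ℂ) = -(1 / 2) * Real.cos φ := by
  change ((-(1 / 2) * Real.cos φ : ℝ) : ℂ) = _
  push_cast; ring

theorem poleCoeff_one_cast (φ : ℝ) : (poleCoeff φ 1 : ℂ) = -(1 / 2) * Real.sin φ := by
  change ((-(1 / 2) * Real.sin φ : ℝ) : ℂ) = _
  push_cast; ring

theorem eval_quadPair_central_one (φ : ℝ) (Y : Fin 3 → WienerSpace ρ) :
    (quadPair (centralX φ) Y).eval 1 = -(Y 2).eval 1 := by
  rw [eval_quadPair _ _ one_inAnnulus, quadPair, eval_centralX_zero, eval_centralX_one,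
    eval_centralX_two]
  norm_num

theorem eval_quadPair_central_neg_one (φ : ℝ) (Y : Fin 3 → WienerSpace ρ) :
    (quadPair (centralX φ) Y).eval (-1) = 2 * Real.cos φ * Real.sin φ * (Y 1).eval (-1) +
      (2 * Real.cos φ ^ 2 - 1) * (Y 2).eval (-1) := by
  rw [eval_quadPair _ _ neg_one_inAnnulus, quadPair, eval_centralX_zero, eval_centralX_one,
    eval_centralX_two]
  norm_num
  ring

theorem eval_quadPair_polePert_one (φ d g : ℝ) :
    (quadPair (centralX φ) (polePert φ d g : Fin 3 → WienerSpace ρ)).eval 1 =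
      d * Real.cos φ - g := by
  rw [eval_quadPair_central_one]
  change -(tri _ _ _ : WienerSpace ρ).eval 1 = _
  rw [eval_tri]
  push_cast [poleCoeff_two_cast]
  ring

theorem eval_quadPair_polePert_neg_one (φ d g : ℝ) :
    (quadPair (centralX φ) (polePert φ d g : Fin 3 → WienerSpace ρ)).eval (-1) =
      d * (3 * Real.cos φ - 2 * Real.cos φ ^ 3) + (2 * Real.cos φ ^ 2 - 1) * g := by
  rw [eval_quadPair_central_neg_one]
  change _ * (tri _ _ _ : WienerSpace ρ).eval (-1) + _ * (tri _ _ _ : WienerSpace ρ).eval (-1) = _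
  rw [eval_tri, eval_tri]
  push_cast [poleCoeff_two_cast, poleCoeff_one_cast, -Complex.ofReal_cos, -Complex.ofReal_sin]
  norm_num [-Complex.ofReal_cos, -Complex.ofReal_sin]
  linear_combination (4 * d * Real.cos φ : ℂ) * sin_sq_cast φ

/-- In the kernel the second and third components are symmetric with simple poles, hence given by
the two numbers `d = v.2` and `g`. The pairing with `centralX` vanishes. At `λ = ±1` the first
central component is zero, so these values do not involve `v.1 0` and read `d cos φ = g` and, after
substitution, `2 d cos φ = 0`. Then `centralX φ 0 * v.1 0 = 0`, and there are no zero divisors. -/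
theorem monLin_injective {φ : ℝ} (hc : Real.cos φ ≠ 0) (v : (Fin 3 → WienerSpace ρ) × ℝ)
    (hv : monLin φ v = 0) : v = 0 := by
  have hz : ∀ j k, (monLin φ v j).coeff k = 0 := fun j k => by rw [hv]; rfl
  have hneg : ∀ j, ∀ k < 0, (v.1 j).coeff k = if k = -1 then v.2 * poleCoeff φ j else 0 := by
    intro j k hk
    have := coeff_monLin_of_neg φ v j hk
    rw [hz] at this
    linarith
  have hP : HasPoles φ v.1 v.2 :=
    ⟨fun j k hk => by rw [hneg j k (by omega), if_neg (by omega)],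
      fun j => by rw [hneg j (-1) (by omega), if_pos rfl]⟩
  have hpi : (2 * Real.pi) ≠ 0 := by positivity
  have h1 : v.1 1 = _ := eq_tri (hP.1 1) fun k hk => by
    have := coeff_monLin_one φ v hk
    rw [hz, zero_eq_mul] at this
    exact sub_eq_zero.1 (this.resolve_left hpi)
  have h2 : v.1 2 = _ := eq_tri (hP.1 2) fun k hk => by
    have := coeff_monLin_two φ v (k := k - 1) (by omega)
    rw [hz, zero_eq_mul, sub_add_cancel] at this
    exact sub_eq_zero.1 (this.resolve_left hpi)
  have hs : sumCLM (v.1 1) = 0 := by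
    have := coeff_monLin_one_zero φ v
    rw [hz, zero_eq_mul] at this
    exact this.resolve_left hpi
  rw [h1, sumCLM_tri] at hs
  have h1' : v.1 1 = polePert φ v.2 ((v.1 2).coeff 0) 1 := by
    refine h1.trans ?_
    change _ = tri _ _ _
    rw [hP.2 1] at hs ⊢
    congr 1
    linarith
  have h2' : v.1 2 = polePert φ v.2 ((v.1 2).coeff 0) 2 := by
    refine h2.trans ?_
    rw [hP.2 2]
    rfl
  have hpair : quadPair (centralX φ) v.1 = 0 := by
    refine ext_coeff fun k => ?_
    rcases lt_or_ge k (-1) with hk | hk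
    · exact coeff_mul_sum_of_hasPoles (hasPoles_centralX φ) hP hk
    · have := coeff_monLin_zero φ v (k := k + 1) (by omega)
      rw [hz, coeff_single_mul, add_sub_cancel_right] at this
      rw [coeff_zero]
      linarith
  generalize hg' : (v.1 2).coeff 0 = g at h1' h2'
  have e1 := eval_quadPair_central_one φ v.1
  have e2 := eval_quadPair_central_neg_one φ v.1
  rw [h2', ← eval_quadPair_central_one φ (polePert φ v.2 _), eval_quadPair_polePert_one, hpair,
    eval_zero] at e1
  rw [h1', h2', ← eval_quadPair_central_neg_one φ (polePert φ v.2 _),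
    eval_quadPair_polePert_neg_one, hpair, eval_zero] at e2
  have hg : v.2 * Real.cos φ = g := by
    have := e1.symm
    rw [sub_eq_zero] at this
    exact_mod_cast this
  have hd : v.2 = 0 := by
    have h3 : (v.2 : ℂ) * Real.cos φ = (g : ℝ) := by exact_mod_cast hg
    rw [← h3] at e2
    have h4 : (v.2 : ℂ) * (2 * Real.cos φ) = 0 := by linear_combination -e2
    have h5 : v.2 * (2 * Real.cos φ) = 0 := by exact_mod_cast h4
    exact (mul_eq_zero.1 h5).resolve_right (by simpa using hc)
  have hg0 : g = 0 := by rw [← hg, hd, zero_mul]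
  have ht : (tri 0 0 0 : WienerSpace ρ) = 0 := ext_coeff fun k => by
    rw [coeff_tri, coeff_zero]; simp
  have h1z : v.1 1 = 0 := by
    rw [h1', hd, hg0]
    change tri _ _ _ = _
    simp [ht]
  have h2z : v.1 2 = 0 := by
    rw [h2', hd, hg0]
    change tri _ _ _ = _
    simp [ht]
  have h0z : v.1 0 = 0 := by
    rw [quadPair, h1z, h2z, mul_zero, mul_zero, add_zero, add_zero, neg_eq_zero] at hpair
    refine (eq_zero_or_eq_zero_of_mul hpair).resolve_left fun h => ?_
    have := (hasPoles_centralX (ρ := ρ) φ).2 0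
    rw [h, coeff_zero] at this
    have h6 : Real.cos φ * (1 / 2) = 0 := this.symm
    exact hc (by linarith)
  refine Prod.ext (funext fun j => ?_) hd
  fin_cases j
  · exact h0z
  · exact h1z
  · exact h2z

/-- The first central component has exactly the simple zeros `λ = ±1`; division by it is therefore
division by two linear factors of unit modulus root. -/
theorem single_mul_centralX_zero (φ : ℝ) : (single 1 2 * centralX φ 0 : WienerSpace ρ) =
    -Real.cos φ • ((single 1 1 - single 0 1) * (single 1 1 - single 0 (-1))) := by
  refine eq_of_eval_eq_on_unit_circle fun l hl => ?_
  have h0 : l ≠ 0 := by rintro rfl; simp at hl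
  have ha := inAnnulus_of_norm_one (ρ := ρ) hl
  rw [eval_mul _ _ ha, eval_smul _ _ ha, eval_mul _ _ ha, eval_sub _ _ ha, eval_sub _ _ ha,
    eval_centralX_zero]
  simp only [eval_single]
  have hl1 : l * l⁻¹ = 1 := mul_inv_cancel₀ h0
  simp only [zpow_one, zpow_zero]
  push_cast [-Complex.ofReal_cos]
  linear_combination (Real.cos φ : ℂ) * hl1

theorem eval_ofReal_re (u : WienerSpace ρ) (a : ℝ) (l : ℂ) (h : l = a) :
    u.eval l = ((u.eval l).re : ℂ) := by rw [h]; exact eval_ofReal u a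

theorem quadPair_add {A : Type*} [CommRing A] (X Y Z : Fin 3 → A) :
    quadPair X (Y + Z) = quadPair X Y + quadPair X Z := by
  simp only [quadPair, Pi.add_apply]; ring

/-- The second and third equations are solved coefficientwise by `A₁` and `A₂`. The first asks for a
quotient by `2 λ` times the first central component, which exists once the dividend vanishes at
`±1`. Adding a member of the two-parameter family `polePert`, which does not disturb the other two
equations, achieves this. -/
theorem monLin_surjective {φ : ℝ} (hc : Real.cos φ ≠ 0) (f : Fin 3 → WienerSpace ρ) :
    ∃ v, monLin φ v = f := by
  have hpi : (2 * Real.pi) ≠ 0 := by positivity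
  -- The negative coefficients are prescribed by `f 1`; reflecting them and adding `f 1 / 2π` in
  -- positive degrees produces the required asymmetry. In `A₁` the constant term is then adjusted to
  -- give the required value at `1`.
  set B₁ : WienerSpace ρ := negPart (f 1) + (2 * Real.pi)⁻¹ • nonnegPart (f 1) + refl (negPart (f 1))
    with hB1
  set A₁ : WienerSpace ρ := B₁ + single 0 ((f 1).coeff 0 / (2 * Real.pi) - sumCLM B₁) with hA1
  set A₂ : WienerSpace ρ := negPart (f 2) + (2 * Real.pi)⁻¹ • (single 1 1 * nonnegPart (f 2)) +
    refl (negPart (f 2)) with hA2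
  set A : Fin 3 → WienerSpace ρ := ![negPart (f 0), A₁, A₂] with hA
  have cB1 : ∀ k, B₁.coeff k = (if k < 0 then (f 1).coeff k else 0) +
      (2 * Real.pi)⁻¹ * (if 0 ≤ k then (f 1).coeff k else 0) +
      (if -k < 0 then (f 1).coeff (-k) else 0) := fun k => by
    rw [hB1, coeff_add, coeff_add, coeff_negPart, coeff_smul, coeff_nonnegPart, coeff_refl,
      coeff_negPart]
  have cA1 : ∀ k ≠ 0, A₁.coeff k = B₁.coeff k := fun k hk => by
    rw [hA1, coeff_add, coeff_single, if_neg hk, add_zero]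
  have cA2 : ∀ k, A₂.coeff k = (if k < 0 then (f 2).coeff k else 0) +
      (2 * Real.pi)⁻¹ * (if 0 ≤ k - 1 then (f 2).coeff (k - 1) else 0) +
      (if -k < 0 then (f 2).coeff (-k) else 0) := fun k => by
    rw [hA2, coeff_add, coeff_add, coeff_negPart, coeff_smul, coeff_single_mul, coeff_nonnegPart,
      coeff_refl, coeff_negPart, one_mul]
  have sA1 : sumCLM A₁ = (f 1).coeff 0 / (2 * Real.pi) := by
    have h : sumCLM (single 0 ((f 1).coeff 0 / (2 * Real.pi) - sumCLM B₁) : WienerSpace ρ) =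
      (f 1).coeff 0 / (2 * Real.pi) - sumCLM B₁ := by
      apply Complex.ofReal_injective
      rw [ofReal_sumCLM, eval_single]
      simp
    rw [hA1, map_add, h]; ring
  clear_value A₁ A₂ B₁
  set G : WienerSpace ρ := nonnegPart (single 1 2 * quadPair (centralX φ) A) - nonnegPart (f 0)
    with hG
  set g₁ := (G.eval 1).re with hg1
  set g₂ := (G.eval (-1)).re with hg2
  -- `d` and `γ` solve the two linear equations `H(1) = 0` and `H(-1) = 0`; the determinant is a
  -- nonzero multiple of `cos φ`.
  set d := (g₂ - (2 * Real.cos φ ^ 2 - 1) * g₁) / (4 * Real.cos φ) with hd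
  set γ := d * Real.cos φ + g₁ / 2 with hγ
  set H : WienerSpace ρ := G + single 1 2 * quadPair (centralX φ) (polePert φ d γ) with hH
  have hd' : 4 * Real.cos φ * d = g₂ - (2 * Real.cos φ ^ 2 - 1) * g₁ := by
    rw [hd]; field_simp
  clear_value d
  have hcast1 : G.eval 1 = (g₁ : ℂ) := eval_ofReal_re G 1 1 (by simp)
  have hcast2 : G.eval (-1) = (g₂ : ℂ) := eval_ofReal_re G (-1) (-1) (by simp)
  have hH1 : H.eval 1 = 0 := by
    rw [hH, eval_add _ _ one_inAnnulus, eval_mul _ _ one_inAnnulus, hcast1, eval_single,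
      eval_quadPair_polePert_one, hγ]
    push_cast
    simp only [_root_.one_zpow]
    ring
  have hH2 : H.eval (-1) = 0 := by
    rw [hH, eval_add _ _ neg_one_inAnnulus, eval_mul _ _ neg_one_inAnnulus, hcast2, eval_single,
      eval_quadPair_polePert_neg_one, zpow_one]
    have h : g₂ - 2 * (d * (3 * Real.cos φ - 2 * Real.cos φ ^ 3) +
        (2 * Real.cos φ ^ 2 - 1) * γ) = 0 := by rw [hγ]; linear_combination -hd'
    have h' : (g₂ - 2 * (d * (3 * Real.cos φ - 2 * Real.cos φ ^ 3) +
        (2 * Real.cos φ ^ 2 - 1) * γ) : ℂ) = 0 := by exact_mod_cast h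
    push_cast at h' ⊢
    linear_combination h'
  have hHneg : ∀ k < 0, H.coeff k = 0 := fun k hk => by
    have : (quadPair (centralX φ) (polePert φ d γ) : WienerSpace ρ).coeff (k - 1) = 0 :=
      coeff_mul_sum_of_hasPoles (hasPoles_centralX φ) (hasPoles_polePert φ d γ) (by omega)
    rw [hH, coeff_add, coeff_single_mul, this, hG, coeff_sub, coeff_nonnegPart, coeff_nonnegPart,
      if_neg (by omega), if_neg (by omega)]
    ring
  obtain ⟨w₁, hw₁, e₁⟩ := exists_mul_eq_of_eval_eq_zero hHneg (a := 1) (by simp) (by simpa using hH1)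
  have hw₁' : w₁.eval (-1) = 0 := by
    rw [← e₁, eval_mul _ _ neg_one_inAnnulus, eval_sub _ _ neg_one_inAnnulus, eval_single,
      eval_single] at hH2
    refine (mul_eq_zero.1 hH2).resolve_left ?_
    norm_num
  obtain ⟨w₂, hw₂, e₂⟩ := exists_mul_eq_of_eval_eq_zero hw₁ (a := -1) (by simp) (by simpa using hw₁')
  set w : WienerSpace ρ := -(Real.cos φ)⁻¹ • w₂ with hw
  have hwH : single 1 2 * centralX φ 0 * w = H := by
    rw [single_mul_centralX_zero, hw, smul_mul_smul_comm, mul_assoc, e₂, e₁, neg_mul_neg,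
      mul_inv_cancel₀ hc, one_smul]
  have hwneg : ∀ k < 0, w.coeff k = 0 := fun k hk => by
    rw [hw, coeff_smul, hw₂ k hk, mul_zero]
  refine ⟨(A + polePert φ d γ + ![w, 0, 0], d), ?_⟩
  have hpole := hasPoles_polePert (ρ := ρ) φ d γ
  have hpneg : ∀ j, ∀ k < 0, (polePert φ d γ j : WienerSpace ρ).coeff k =
      if k = -1 then d * poleCoeff φ j else 0 := fun j k hk => by
    by_cases h : k = -1
    · rw [if_pos h, h, hpole.2]
    · rw [if_neg h, hpole.1 j k (by omega)]
  have hneg : ∀ j, ∀ k < 0, (A j + (![w, 0, 0] : Fin 3 → WienerSpace ρ) j).coeff k =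
      (f j).coeff k := fun j k hk => by
    fin_cases j
    · change (negPart (f 0) + w).coeff k = _
      rw [coeff_add, coeff_negPart, if_pos hk, hwneg k hk, add_zero]
      rfl
    · change (A₁ + 0).coeff k = _
      rw [add_zero, cA1 k hk.ne, cB1, if_pos hk, if_neg (by omega), if_neg (by omega)]
      simp
    · change (A₂ + 0).coeff k = _
      rw [add_zero, cA2, if_pos hk, if_neg (by omega), if_neg (by omega)]
      simp
  have hsym : ∀ a b k, (tri a b a : WienerSpace ρ).coeff k = (tri a b a : WienerSpace ρ).coeff (-k) :=
    fun a b k => by rw [← coeff_refl, refl_tri]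
  funext j
  refine ext_coeff fun k => ?_
  rcases lt_or_ge k 0 with hk | hk
  · rw [coeff_monLin_of_neg _ _ _ hk, ← hneg j k hk]
    simp only [Pi.add_apply]
    rw [coeff_add, coeff_add, coeff_add, hpneg j k hk]
    ring
  fin_cases j
  · refine (coeff_monLin_zero φ _ hk).trans ?_
    have hw0 : single 1 2 * quadPair (centralX φ) (![w, 0, 0] : Fin 3 → WienerSpace ρ) = -H := by
      rw [← hwH]
      change _ * (-(centralX φ 0 * w) + centralX φ 1 * 0 + centralX φ 2 * 0) = _
      ring
    rw [quadPair_add, quadPair_add, mul_add, mul_add, hw0, hH, hG]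
    simp only [coeff_add, coeff_neg, coeff_sub, coeff_nonnegPart, if_pos hk]
    simp
  · rcases eq_or_lt_of_le hk with rfl | hk
    · refine (coeff_monLin_one_zero φ _).trans ?_
      change 2 * Real.pi * sumCLM (A₁ + tri _ _ _ + 0) = (f 1).coeff 0
      rw [add_zero, map_add, sumCLM_tri, sA1]
      field_simp
      ring
    · refine (coeff_monLin_one φ _ hk).trans ?_
      change 2 * Real.pi * ((A₁ + tri _ _ _ + 0).coeff k - (A₁ + tri _ _ _ + 0).coeff (-k)) =
        (f 1).coeff k
      rw [add_zero, coeff_add, coeff_add, hsym, cA1 k hk.ne', cA1 (-k) (by omega), cB1, cB1,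
        if_neg (by omega), if_pos (by omega), if_pos (by omega),
        if_neg (by omega), if_neg (by omega)]
      field_simp
      ring
  · refine (coeff_monLin_two φ _ hk).trans ?_
    change 2 * Real.pi * ((A₂ + tri _ _ _ + 0).coeff (k + 1) -
      (A₂ + tri _ _ _ + 0).coeff (-(k + 1))) = (f 2).coeff k
    rw [add_zero, coeff_add, coeff_add, hsym, cA2, cA2,
      if_neg (by omega), if_pos (by omega), if_pos (by omega),
      if_neg (by omega), if_neg (by omega), add_sub_cancel_right]
    field_simp
    ring

/-- A bijective bounded operator between Banach spaces has a bounded inverse, so no estimate for the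
inverse is needed. -/
theorem isInvertible_fderiv_monEq {φ : ℝ} (hφ : φ ∈ Ioo 0 (Real.pi / 2)) :
    (fderiv ℝ (monEq φ) (0, (centralX φ : Fin 3 → WienerSpace ρ), Real.cos φ) ∘L
      .inr ℝ ℝ ((Fin 3 → WienerSpace ρ) × ℝ)).IsInvertible := by
  have hc : Real.cos φ ≠ 0 := (Real.cos_pos_of_mem_Ioo ⟨by linarith [hφ.1, Real.pi_pos], hφ.2⟩).ne'
  have happ : ∀ v, (fderiv ℝ (monEq φ) (0, (centralX φ : Fin 3 → WienerSpace ρ), Real.cos φ) ∘L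
      .inr ℝ ℝ ((Fin 3 → WienerSpace ρ) × ℝ)) v = monLin φ v := fun v => fderiv_monEq_inr hφ v
  refine ⟨ContinuousLinearEquiv.ofBijective _ (LinearMap.ker_eq_bot'.2 fun v hv => ?_)
    (LinearMap.range_eq_top.2 fun f => ?_), ContinuousLinearEquiv.coe_ofBijective _ _ _⟩
  · exact monLin_injective hc v ((happ v).symm.trans hv)
  · obtain ⟨v, hv⟩ := monLin_surjective hc f
    exact ⟨v, (happ v).trans hv⟩

/-- Analytic solution branch of `monEq`, with local uniqueness. -/
theorem exists_analytic_branch {φ : ℝ} (hφ : φ ∈ Ioo 0 (Real.pi / 2)) :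
    ∃ (ψ : ℝ → (Fin 3 → WienerSpace ρ) × ℝ) (ε δ : ℝ), 0 < ε ∧ 0 < δ ∧
      ψ 0 = (centralX φ, Real.cos φ) ∧ AnalyticOnNhd ℝ ψ (Ioo (-ε) ε) ∧
      (∀ t ∈ Ioo (-ε) ε, monEq φ (t, ψ t) = 0) ∧
      ∀ t ∈ Ioo (-ε) ε, ∀ v, ‖v - (centralX φ, Real.cos φ)‖ < δ → monEq φ (t, v) = 0 → ψ t = v := by
  have hcd : ContDiffAt ℝ ω (monEq φ) (0, (centralX φ : Fin 3 → WienerSpace ρ), Real.cos φ) :=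
    (contDiff_monEq φ).contDiffAt
  have hinv := isInvertible_fderiv_monEq (ρ := ρ) hφ
  have pn : (ω : WithTop ℕ∞) ≠ 0 := by simp
  have han : ∀ᶠ t in nhds (0 : ℝ), AnalyticAt ℝ (hcd.implicitFunction pn hinv) t :=
    (hcd.contDiffAt_implicitFunction pn hinv).analyticAt.eventually_analyticAt
  have hsol := hcd.eventually_apply_implicitFunction pn hinv
  have hun := hcd.eventually_apply_eq_iff_implicitFunction pn hinv
  rw [monEq_centralX hφ] at hsol hun
  obtain ⟨ε₁, h1, h1'⟩ := Metric.eventually_nhds_iff.1 (han.and hsol)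
  obtain ⟨δ, h2, h2'⟩ := Metric.eventually_nhds_iff.1 hun
  refine ⟨hcd.implicitFunction pn hinv, min ε₁ δ, δ, lt_min h1 h2, h2,
    hcd.implicitFunction_apply_self pn hinv, fun t ht => ?_, fun t ht => ?_, fun t ht v hv h0 => ?_⟩
  · exact (h1' (by rw [Real.dist_0_eq_abs]; exact (abs_lt.2 ht).trans_le (min_le_left _ _))).1
  · exact (h1' (by rw [Real.dist_0_eq_abs]; exact (abs_lt.2 ht).trans_le (min_le_left _ _))).2
  · refine (h2' (y := (t, v)) ?_).1 h0
    rw [Prod.dist_eq, max_lt_iff]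
    refine ⟨?_, ?_⟩
    · rw [Real.dist_0_eq_abs]; exact (abs_lt.2 ht).trans_le (min_le_right _ _)
    · rw [dist_eq_norm]; exact hv

end WienerSpace

namespace Lawson

open ContDiff

set_option linter.unusedSectionVars false
set_option linter.unusedSimpArgs false

/-! ### The frame on the slit plane -/

section Frame

instance : IsScalarTower ℝ ℂ (Mat ℂ) where
  smul_assoc c d M := Mat.ext fun i j => smul_assoc c d (M i j)

/-- The signs in the definition of the forms `ω_j`. -/
def formSign : Fin 4 → Fin 3 → ℂ := ![![1, 1, 1], ![-1, -1, 1], ![1, -1, -1], ![-1, 1, -1]]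

/-- The residues of the potential. -/
noncomputable def resid (a : Fin 3 → ℂ) (l : Fin 4) : Mat ℂ :=
  Mat.of4 (I * (formSign l 0 * a 0)) (formSign l 1 * a 1 + I * (formSign l 2 * a 2))
    (formSign l 1 * a 1 - I * (formSign l 2 * a 2)) (-(I * (formSign l 0 * a 0)))

/-- The potential with parameter `a`. -/
noncomputable def eta (φ : ℝ) (a : Fin 3 → ℂ) (z : ℂ) : Mat ℂ :=
  ∑ l, (z - puncture φ l)⁻¹ • resid a l

theorem eta_entries (φ : ℝ) (a : Fin 3 → ℂ) (z : ℂ) :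
    eta φ a z = Mat.of4 (I * (a 0 * omega φ z 0)) (a 1 * omega φ z 1 + I * (a 2 * omega φ z 2))
      (a 1 * omega φ z 1 - I * (a 2 * omega φ z 2)) (-(I * (a 0 * omega φ z 0))) := by
  rw [eta, Fin.sum_univ_four]
  apply Mat.ext4 <;>
  · simp [Mat.add_apply, Mat.smul_apply, resid, formSign, omega]
    ring

theorem potential_eq_eta {ρ : ℝ} (φ t : ℝ) (x : Fin 3 → WienerSpace ρ) (r : ℝ) (l z : ℂ) :
    potential φ t x r l z = eta φ (fun j => r * t * (x j).eval l) z := by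
  rw [eta_entries, potential, Fin.sum_univ_three]
  apply Matrix.ext
  intro i j
  fin_cases i <;> fin_cases j <;>
  · simp [mMat, Mat.of4]
    ring

theorem norm_puncture (φ : ℝ) (l : Fin 4) : ‖puncture φ l‖ = 1 := by
  have h1 : ‖exp (φ * I)‖ = 1 := norm_exp_ofReal_mul_I φ
  have h2 : ‖exp (-(φ * I))‖ = 1 := by
    have := norm_exp_ofReal_mul_I (-φ)
    rwa [ofReal_neg, neg_mul] at this
  fin_cases l
  · exact h1
  · exact (norm_neg _).trans h2
  · exact (norm_neg _).trans h1
  · exact h2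

theorem puncture_eq (φ : ℝ) : puncture φ = ![Real.cos φ + Real.sin φ * I, -Real.cos φ + Real.sin φ * I,
    -Real.cos φ - Real.sin φ * I, Real.cos φ - Real.sin φ * I] := by
  have h1 : exp (φ * I) = Real.cos φ + Real.sin φ * I := by
    rw [exp_mul_I, ofReal_cos, ofReal_sin]
  have h2 : exp (-(φ * I)) = Real.cos φ - Real.sin φ * I := by
    rw [← neg_mul, exp_mul_I, Complex.cos_neg, Complex.sin_neg, ofReal_cos, ofReal_sin]; ring
  rw [puncture, h1, h2]
  congr 1
  congr 1
  · ring
  congr 1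
  ring

theorem puncture_ne_zero (φ : ℝ) (l : Fin 4) : puncture φ l ≠ 0 := fun h => by
  simpa [h] using norm_puncture φ l

theorem isOpen_slitDomain (φ : ℝ) : IsOpen (slitDomain φ) := by
  have h : slitDomain φ = ⋂ j, ((fun s : ℝ => (s : ℂ) * puncture φ j) '' Ici 1)ᶜ := by
    ext z
    simp only [slitDomain, mem_iInter, mem_compl_iff, mem_image, mem_Ici, not_exists, not_and]
    exact ⟨fun h j s hs e => h j s hs e.symm, fun h j s hs e => h j s hs e.symm⟩
  rw [h]
  refine isOpen_iInter_of_finite fun j => ?_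
  rw [isOpen_compl_iff]
  refine (Isometry.isClosedEmbedding ?_).isClosedMap _ isClosed_Ici
  refine Isometry.of_dist_eq fun s s' => ?_
  rw [dist_eq_norm, ← sub_mul, norm_mul, norm_puncture, mul_one, ← ofReal_sub, norm_real,
    Real.dist_eq, Real.norm_eq_abs]

theorem mul_mem_slitDomain {φ : ℝ} {z : ℂ} (hz : z ∈ slitDomain φ) {s : ℝ} (hs : s ∈ Icc (0 : ℝ) 1) :
    (s : ℂ) * z ∈ slitDomain φ := by
  intro j σ hσ h
  have hs0 : s ≠ 0 := by
    rintro rfl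
    rw [ofReal_zero, zero_mul, zero_eq_mul] at h
    rcases h with h | h
    · rw [ofReal_eq_zero] at h; linarith
    · exact puncture_ne_zero φ j h
  have hs1 : 0 < s := lt_of_le_of_ne hs.1 (Ne.symm hs0)
  refine hz j (σ / s) ((one_le_div hs1).2 (hs.2.trans hσ)) ?_
  have : (s : ℂ) ≠ 0 := by exact_mod_cast hs0
  push_cast
  field_simp
  linear_combination h

theorem zero_mem_slitDomain (φ : ℝ) : (0 : ℂ) ∈ slitDomain φ := by
  intro j σ hσ h
  rw [zero_eq_mul] at h
  rcases h with h | h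
  · rw [ofReal_eq_zero] at h; linarith
  · exact puncture_ne_zero φ j h

theorem one_mem_slitDomain {φ : ℝ} (hφ : 0 < Real.sin φ) : (1 : ℂ) ∈ slitDomain φ := by
  intro j σ hσ h
  have h' := congrArg im h
  rw [puncture_eq] at h'
  fin_cases j <;> simp [← ofReal_cos, ← ofReal_sin, -ofReal_cos, -ofReal_sin] at h' <;>
    rcases h' with h' | h' <;> linarith

theorem I_mem_slitDomain {φ : ℝ} (hφ : 0 < Real.cos φ) : I ∈ slitDomain φ := by
  intro j σ hσ h
  have h' := congrArg re h
  rw [puncture_eq] at h'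
  fin_cases j <;> simp [← ofReal_cos, ← ofReal_sin, -ofReal_cos, -ofReal_sin] at h' <;>
    rcases h' with h' | h' <;> linarith

theorem ne_puncture_of_mem {φ : ℝ} {z : ℂ} (hz : z ∈ slitDomain φ) (l : Fin 4) :
    z ≠ puncture φ l := by
  have := hz l 1 le_rfl
  rwa [ofReal_one, one_mul] at this

/-- The function `s ↦ z / (s z - p)` on the unit interval. -/
noncomputable def unitRatio (p z : ℂ) : C(unitInterval, ℂ) :=
  z • Ring.inverse (z • (⟨fun s : unitInterval => ((s : ℝ) : ℂ), by fun_prop⟩ : C(unitInterval, ℂ)) - ContinuousMap.const unitInterval p)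

theorem isUnit_unitRatio {p z : ℂ} (h : ∀ s : unitInterval, ((s : ℝ) : ℂ) * z ≠ p) :
    IsUnit (z • (⟨fun s : unitInterval => ((s : ℝ) : ℂ), by fun_prop⟩ : C(unitInterval, ℂ)) - ContinuousMap.const unitInterval p) := by
  rw [ContinuousMap.isUnit_iff_forall_ne_zero]
  intro s
  change z * ((s : ℝ) : ℂ) - p ≠ 0
  rw [sub_ne_zero, mul_comm]
  exact h s

theorem unitRatio_apply {p z : ℂ} (h : ∀ s : unitInterval, ((s : ℝ) : ℂ) * z ≠ p) (s : unitInterval) :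
    unitRatio p z s = z * (s * z - p)⁻¹ := by
  have h1 := DFunLike.congr_fun (Ring.mul_inverse_cancel _ (isUnit_unitRatio h)) s
  change (z * ((s : ℝ) : ℂ) - p) * (Ring.inverse (_ : C(unitInterval, ℂ))) s = 1 at h1
  change z * (Ring.inverse (_ : C(unitInterval, ℂ))) s = _
  rw [eq_inv_of_mul_eq_one_right h1, mul_comm ((s : ℝ) : ℂ)]

/-- Because the ratio is written with the inverse in the Banach algebra of continuous functions on
`[0,1]`, differentiability in `z` holds in the supremum norm at once. -/
theorem differentiableAt_unitRatio {p z : ℂ} (h : ∀ s : unitInterval, ((s : ℝ) : ℂ) * z ≠ p) :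
    DifferentiableAt ℂ (unitRatio p) z := by
  have h1 : DifferentiableAt ℂ (fun w : ℂ =>
      w • (⟨fun s : unitInterval => ((s : ℝ) : ℂ), by fun_prop⟩ : C(unitInterval, ℂ)) - ContinuousMap.const unitInterval p) z :=
    (differentiableAt_id.smul_const _).sub_const _
  obtain ⟨u, hu⟩ := isUnit_unitRatio h
  have h2 : DifferentiableAt ℂ (Ring.inverse : C(unitInterval, ℂ) → C(unitInterval, ℂ))
      (z • (⟨fun s : unitInterval => ((s : ℝ) : ℂ), by fun_prop⟩ : C(unitInterval, ℂ)) - ContinuousMap.const unitInterval p) := by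
    rw [← hu]
    exact (hasFDerivAt_ringInverse (𝕜 := ℂ) u).differentiableAt
  have h3 := h2.comp z h1
  exact DifferentiableAt.fun_smul (𝕜 := ℂ) (c := fun w : ℂ => w) differentiableAt_fun_id h3

/-- The map `f ↦ f M` for a complex function `f` on the unit interval. -/
noncomputable def liftCLM (M : Mat ℂ) : C(unitInterval, ℂ) →L[ℂ] C(unitInterval, Mat ℂ) :=
  LinearMap.mkContinuous
    { toFun := fun f => ⟨fun s => f s • M, by fun_prop⟩
      map_add' := fun f g => by ext1 s; exact add_smul (f s) (g s) M
      map_smul' := fun c f => by ext1 s; exact smul_assoc c (f s) M } ‖M‖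
    (fun f => by
      rw [ContinuousMap.norm_le _ (by positivity)]
      intro s
      refine (norm_smul_le (f s) M).trans ?_
      rw [mul_comm]
      gcongr
      exact f.norm_coe_le_norm s)

theorem liftCLM_apply (M : Mat ℂ) (f : C(unitInterval, ℂ)) (s : unitInterval) : liftCLM M f s = f s • M := rfl

/-- The coefficient of the system along the ray from `0` to `z`. -/
noncomputable def rayCoeff (φ : ℝ) (a : Fin 3 → ℂ) (z : ℂ) : C(unitInterval, Mat ℂ) :=
  ∑ l, liftCLM (resid a l) (unitRatio (puncture φ l) z)

theorem mul_ne_puncture {φ : ℝ} {z : ℂ} (hz : z ∈ slitDomain φ) (l : Fin 4) (s : unitInterval) :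
    ((s : ℝ) : ℂ) * z ≠ puncture φ l :=
  ne_puncture_of_mem (mul_mem_slitDomain hz s.2) l

theorem rayCoeff_apply {φ : ℝ} (a : Fin 3 → ℂ) {z : ℂ} (hz : z ∈ slitDomain φ) (s : unitInterval) :
    rayCoeff φ a z s = z • eta φ a (s * z) := by
  rw [rayCoeff, ContinuousMap.sum_apply, eta, Finset.smul_sum]
  refine Finset.sum_congr rfl fun l _ => ?_
  rw [liftCLM_apply, unitRatio_apply (mul_ne_puncture hz l), smul_smul]

theorem differentiableAt_rayCoeff {φ : ℝ} (a : Fin 3 → ℂ) {z : ℂ} (hz : z ∈ slitDomain φ) :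
    DifferentiableAt ℂ (rayCoeff φ a) z := by
  have h : ∀ l, DifferentiableAt ℂ (fun z => liftCLM (resid a l) (unitRatio (puncture φ l) z)) z :=
    fun l => (liftCLM (resid a l)).differentiableAt.comp z
      (differentiableAt_unitRatio (mul_ne_puncture hz l))
  exact DifferentiableAt.fun_sum fun l _ => h l

/-- The frame of the system with parameter `a`. -/
noncomputable def frame (φ : ℝ) (a : Fin 3 → ℂ) (z : ℂ) : Mat ℂ := odeSol (rayCoeff φ a z) 1

theorem differentiableAt_frame {φ : ℝ} (a : Fin 3 → ℂ) {z : ℂ} (hz : z ∈ slitDomain φ) :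
    DifferentiableAt ℂ (frame φ a) z := by
  have h1 : DifferentiableAt ℂ (fun z => odeSol (rayCoeff φ a z)) z :=
    ((contDiff_odeSol (B := Mat ℂ) ℂ).differentiable (by simp) _).comp z
      (differentiableAt_rayCoeff a hz)
  exact (ContinuousMap.evalCLM (M := Mat ℂ) ℂ (1 : unitInterval)).differentiableAt.comp z h1

theorem frame_zero (φ : ℝ) (a : Fin 3 → ℂ) : frame φ a 0 = 1 := by
  have h : rayCoeff φ a 0 = 0 := by
    ext1 s
    rw [rayCoeff_apply a (zero_mem_slitDomain φ), zero_smul]; rfl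
  rw [frame, h, odeSol_const_zero]; rfl

/-- The point `s z` lies on the same ray as `z`, so the solution along the shorter segment is a
reparametrization of the one along the longer segment. -/
theorem frame_mul {φ : ℝ} (a : Fin 3 → ℂ) {z : ℂ} (hz : z ∈ slitDomain φ) (s : unitInterval) :
    frame φ a (s * z) = odeSol (rayCoeff φ a z) s := by
  have hs := mul_mem_slitDomain hz s.2
  have h := odeSol_eq_of_hasDerivWithinAt (b := rayCoeff φ a (s * z))
    (Φ := fun σ => unitExtend (odeSol (rayCoeff φ a z)) (s * σ)) (by
      have := unitExtend_coe (odeSol (rayCoeff φ a z)) 0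
      rw [odeSol_zero] at this
      simpa using this) (fun σ => ?_) 1
  · rw [frame, h]
    simpa using unitExtend_coe (odeSol (rayCoeff φ a z)) s
  · have h1 := hasDerivWithinAt_odeSol (rayCoeff φ a z) (s * σ)
    have h2 : HasDerivWithinAt (fun σ : ℝ => (s : ℝ) * σ) (s : ℝ) (Icc 0 1) σ := by
      simpa using (hasDerivWithinAt_id (σ : ℝ) (Icc 0 1)).const_mul (s : ℝ)
    have h3 := h1.scomp (σ : ℝ) (h := fun σ : ℝ => (s : ℝ) * σ) h2 (fun x hx =>
      ⟨mul_nonneg s.2.1 hx.1, mul_le_one₀ s.2.2 hx.1 hx.2⟩)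
    convert! h3 using 1
    have e : unitExtend (odeSol (rayCoeff φ a z)) ((s : ℝ) * σ) = odeSol (rayCoeff φ a z) (s * σ) :=
      unitExtend_coe (odeSol (rayCoeff φ a z)) (s * σ)
    simp only [e]
    rw [rayCoeff_apply a hs, rayCoeff_apply a hz, ← mul_smul_comm]
    congr 1
    have e2 : ((s : ℝ) : ℂ) * z = (s : ℝ) • z := (Complex.real_smul).symm
    have e3 : ((σ : ℝ) : ℂ) * ((s : ℝ) * z) = (((s * σ : unitInterval) : ℝ) : ℂ) * z := by
      push_cast; ring
    rw [e3, e2, smul_assoc]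
    rfl

/-- The frame is already known to be complex differentiable, so its derivative is determined by the
derivative along a ray, where the equation holds by construction. -/
theorem hasDerivAt_frame {φ : ℝ} (hφ : 0 < Real.sin φ) (a : Fin 3 → ℂ) {z : ℂ}
    (hz : z ∈ slitDomain φ) : HasDerivAt (frame φ a) (frame φ a z * eta φ a z) z := by
  have key : ∀ w ∈ slitDomain φ, w ≠ 0 → ∀ s : unitInterval,
      deriv (frame φ a) (s * w) = frame φ a (s * w) * eta φ a (s * w) := by
    intro w hw hw0 s
    have h1 := (differentiableAt_frame a (mul_mem_slitDomain hw s.2)).hasDerivAt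
    have h2 : HasDerivWithinAt (fun σ : ℝ => (σ : ℂ) * w) w (Icc 0 1) s := by
      simpa using (ofRealCLM.hasDerivAt (x := (s : ℝ))).hasDerivWithinAt.mul_const w
    have h3 := h1.scomp_hasDerivWithinAt (s : ℝ) (h := fun σ : ℝ => (σ : ℂ) * w) h2
    have h4 := hasDerivWithinAt_odeSol (rayCoeff φ a w) s
    have h5 : HasDerivWithinAt (frame φ a ∘ fun σ : ℝ => (σ : ℂ) * w)
        (odeSol (rayCoeff φ a w) s * rayCoeff φ a w s) (Icc 0 1) s :=
      h4.congr (fun σ hσ => by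
        rw [unitExtend_of_mem _ hσ]
        exact frame_mul a hw ⟨σ, hσ⟩) (by
        rw [unitExtend_coe]
        exact frame_mul a hw s)
    have h6 := (uniqueDiffOn_Icc_zero_one (s : ℝ) s.2).eq_deriv _ h3 h5
    rw [rayCoeff_apply a hw, ← frame_mul a hw, mul_smul_comm] at h6
    exact smul_right_injective _ hw0 h6
  have hd := (differentiableAt_frame a hz).hasDerivAt
  by_cases h0 : z = 0
  · subst h0
    -- The origin is the point `s = 0` of the ray through `1`; its own ray is constant and carries
    -- no information.
    have := key 1 (one_mem_slitDomain hφ) one_ne_zero 0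
    simp only [Icc.coe_zero, ofReal_zero, zero_mul] at this
    rwa [this] at hd
  · have := key z hz h0 1
    simp only [Icc.coe_one, ofReal_one, one_mul] at this
    rwa [this] at hd

/-- The slit plane is star-shaped about `0`, so uniqueness reduces to the linear equation on the
segment from `0` to `z`. -/
theorem eq_frame {φ : ℝ} {a : Fin 3 → ℂ} {F : ℂ → Mat ℂ} (h0 : F 0 = 1)
    (h : ∀ z ∈ slitDomain φ, HasDerivAt F (F z * eta φ a z) z) {z : ℂ} (hz : z ∈ slitDomain φ) :
    F z = frame φ a z := by
  have h1 := odeSol_eq_of_hasDerivWithinAt (b := rayCoeff φ a z) (Φ := fun σ : ℝ => F (σ * z))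
    (by simpa using h0) (fun s => ?_) 1
  · rw [frame, h1]; simp
  · have h1 := h _ (mul_mem_slitDomain hz s.2)
    have h2 : HasDerivWithinAt (fun σ : ℝ => (σ : ℂ) * z) z (Icc 0 1) s := by
      simpa using (ofRealCLM.hasDerivAt (x := (s : ℝ))).hasDerivWithinAt.mul_const z
    have h3 := h1.scomp_hasDerivWithinAt (s : ℝ) (h := fun σ : ℝ => (σ : ℂ) * z) h2
    rw [← mul_smul_comm, ← rayCoeff_apply a hz] at h3
    exact h3

theorem isFrame_frame {ρ φ t r : ℝ} (hφ : 0 < Real.sin φ) (x : Fin 3 → WienerSpace ρ) (l : ℂ) :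
    IsFrame φ t x r l (frame φ fun j => r * t * (x j).eval l) where
  init := frame_zero _ _
  ode z hz i j := by
    rw [potential_eq_eta]
    exact Mat.hasDerivAt_iff.1 (hasDerivAt_frame hφ _ hz) i j

theorem IsFrame.eq_frame {ρ φ t r : ℝ} {x : Fin 3 → WienerSpace ρ} {l : ℂ}
    {F : ℂ → Matrix (Fin 2) (Fin 2) ℂ} (h : IsFrame φ t x r l F) {z : ℂ} (hz : z ∈ slitDomain φ) :
    F z = frame φ (fun j => r * t * (x j).eval l) z :=
  Lawson.eq_frame (F := F) h.init (fun w hw => Mat.hasDerivAt_iff.2 fun i j => by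
    have := h.ode w hw i j
    rwa [potential_eq_eta] at this) hz

end Frame

end Lawson

/-! ### Adjugates, determinants and conjugations -/

namespace Mat

variable {A : Type*} [NormedCommRing A]

theorem neg_apply (M : Mat A) (i j : Fin 2) : (-M) i j = -M i j := rfl

/-- The adjugate matrix. -/
def adj (M : Mat A) : Mat A := of4 (M 1 1) (-M 0 1) (-M 1 0) (M 0 0)

/-- The determinant. -/
def det2 (M : Mat A) : A := M 0 0 * M 1 1 - M 0 1 * M 1 0

theorem mul_adj {M : Mat A} (h : det2 M = 1) : M * adj M = 1 := by
  rw [det2] at h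
  apply ext4 <;> simp [mul_apply, adj, one_apply] <;> first | linear_combination h | ring

theorem adj_mul {M : Mat A} (h : det2 M = 1) : adj M * M = 1 := by
  rw [det2] at h
  apply ext4 <;> simp [mul_apply, adj, one_apply] <;> first | linear_combination h | ring

theorem det2_mul (M N : Mat A) : det2 (M * N) = det2 M * det2 N := by
  simp only [det2, mul_apply]; ring

/-- Conjugation by `diag(1, -1)`. -/
def flip (M : Mat A) : Mat A := of4 (M 0 0) (-M 0 1) (-M 1 0) (M 1 1)

theorem flip_mul (M N : Mat A) : flip (M * N) = flip M * flip N := by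
  apply ext4 <;> simp [mul_apply, flip] <;> ring

theorem flip_flip (M : Mat A) : flip (flip M) = M := by
  apply ext4 <;> simp [flip]

theorem flip_one : flip (1 : Mat A) = 1 := by
  apply ext4 <;> simp [flip, one_apply]

/-- The permutation matrix. -/
def swap : Mat A := of4 0 1 1 0

theorem swap_mul_swap : (swap * swap : Mat A) = 1 := by
  apply ext4 <;> simp [mul_apply, swap, one_apply]

/-- Liouville's formula: the determinant solves a scalar equation whose coefficient is the trace,
which is zero here. -/
theorem det2_odeSol [NormedAlgebra ℝ A] [CompleteSpace A] (b : C(unitInterval, Mat A))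
    (hb : ∀ s, b s 0 0 + b s 1 1 = 0) (s : unitInterval) : det2 (odeSol b s) = 1 := by
  have h : ∀ i j, ∀ s : unitInterval, HasDerivWithinAt (fun σ => unitExtend (odeSol b) σ i j)
      ((odeSol b s * b s) i j) (Icc 0 1) s := fun i j s =>
    hasDerivWithinAt_iff.1 (hasDerivWithinAt_odeSol b s) i j
  have h2 := eq_mul_odeSol (b := (0 : C(unitInterval, A)))
    (Φ := fun σ => det2 (unitExtend (odeSol b) σ)) (fun s => by
      have h3 := ((h 0 0 s).mul (h 1 1 s)).sub ((h 0 1 s).mul (h 1 0 s))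
      convert! h3 using 1
      simp only [unitExtend_coe, mul_apply]
      change _ * (0 : A) = _
      linear_combination (odeSol b s 0 1 * odeSol b s 1 0 - odeSol b s 0 0 * odeSol b s 1 1) * hb s)
    s
  have h0 := unitExtend_coe (odeSol b) 0
  rw [odeSol_zero] at h0
  have h4 : unitExtend (odeSol b) ((s : unitInterval) : ℝ) = odeSol b s := unitExtend_coe _ _
  rw [odeSol_const_zero] at h2
  simp only [h4] at h2
  rw [h2]
  change det2 (unitExtend (odeSol b) ((0 : unitInterval) : ℝ)) * 1 = 1
  rw [h0]
  simp [det2, one_apply]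

end Mat

namespace Lawson

open ContDiff

set_option linter.unusedSectionVars false

/-! ### Closed form of the three differential forms -/

section Omega

variable {φ : ℝ} {z : ℂ}

theorem cos_sq_add_sin_sq_cast (φ : ℝ) : (Real.cos φ : ℂ) ^ 2 + (Real.sin φ : ℂ) ^ 2 = 1 := by
  exact_mod_cast Real.cos_sq_add_sin_sq φ

/-- The denominator of the forms. -/
noncomputable def formDen (φ : ℝ) (z : ℂ) : ℂ := (z ^ 2 - 1) ^ 2 + 4 * Real.sin φ ^ 2 * z ^ 2

theorem formDen_eq (φ : ℝ) (z : ℂ) : formDen φ z =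
    (z - puncture φ 0) * (z - puncture φ 1) * (z - puncture φ 2) * (z - puncture φ 3) := by
  rw [puncture_eq, formDen]
  have h := cos_sq_add_sin_sq_cast φ
  simp only [cons_val_zero, cons_val_one, cons_val]
  generalize (Real.cos φ : ℂ) = c at *
  generalize (Real.sin φ : ℂ) = s at *
  linear_combination (2 * z ^ 2 - 1 - c ^ 2 - s ^ 2) * h + (2 * z ^ 2 * s ^ 2 + 2 * c ^ 2 * s ^ 2
    - s ^ 4 * I ^ 2 + s ^ 4) * I_sq

theorem formDen_ne_zero (h : ∀ l, z ≠ puncture φ l) : formDen φ z ≠ 0 := by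
  rw [formDen_eq]
  have h' := fun l => sub_ne_zero.2 (h l)
  exact mul_ne_zero (mul_ne_zero (mul_ne_zero (h' 0) (h' 1)) (h' 2)) (h' 3)

/-- Over the common denominator the behaviour under `z ↦ -z` and `z ↦ 1/z` is visible, and on the
real axis `ω₁` and `ω₃` are `i` times real forms while `ω₂` is real. Together with the factors `i`
in the matrices this gives real coefficient functions along the axis. -/
theorem omega_eq (h : ∀ l, z ≠ puncture φ l) : omega φ z =
    ![I * (8 * Real.sin φ * Real.cos φ * z / formDen φ z),
      4 * Real.cos φ * (z ^ 2 - 1) / formDen φ z,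
      I * (4 * Real.sin φ * (z ^ 2 + 1) / formDen φ z)] := by
  have hD := formDen_ne_zero h
  have e : ∀ l, 1 / (z - puncture φ l) =
      (∏ j ∈ Finset.univ.erase l, (z - puncture φ j)) / formDen φ z := fun l => by
    rw [eq_div_iff hD, div_mul_eq_mul_div, one_mul, div_eq_iff (sub_ne_zero.2 (h l)), mul_comm,
      Finset.mul_prod_erase _ (fun j => z - puncture φ j) (Finset.mem_univ l), formDen_eq, Fin.prod_univ_four]
  have e0 : (Finset.univ.erase 0 : Finset (Fin 4)) = {1, 2, 3} := rfl
  have e1 : (Finset.univ.erase 1 : Finset (Fin 4)) = {0, 2, 3} := rfl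
  have e2 : (Finset.univ.erase 2 : Finset (Fin 4)) = {0, 1, 3} := rfl
  have e3 : (Finset.univ.erase 3 : Finset (Fin 4)) = {0, 1, 2} := rfl
  have h1 := cos_sq_add_sin_sq_cast φ
  have hp := puncture_eq φ
  have hp0 : puncture φ 0 = Real.cos φ + Real.sin φ * I := by rw [hp]; rfl
  have hp1 : puncture φ 1 = -Real.cos φ + Real.sin φ * I := by rw [hp]; rfl
  have hp2 : puncture φ 2 = -Real.cos φ - Real.sin φ * I := by rw [hp]; rfl
  have hp3 : puncture φ 3 = Real.cos φ - Real.sin φ * I := by rw [hp]; rfl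
  simp only [omega, e, e0, e1, e2, e3, ← sub_div, ← add_div, ← mul_div_assoc]
  have p3 : ∀ a b c : Fin 4, a ≠ b → a ≠ c → b ≠ c → ∏ j ∈ ({a, b, c} : Finset (Fin 4)),
      (z - puncture φ j) = (z - puncture φ a) * ((z - puncture φ b) * (z - puncture φ c)) := by
    intro a b c hab hac hbc
    rw [Finset.prod_insert (by simp [hab, hac]), Finset.prod_pair hbc]
  rw [p3 1 2 3 (by decide) (by decide) (by decide), p3 0 2 3 (by decide) (by decide) (by decide),
    p3 0 1 3 (by decide) (by decide) (by decide), p3 0 1 2 (by decide) (by decide) (by decide),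
    hp0, hp1, hp2, hp3]
  generalize (Real.cos φ : ℂ) = c at *
  generalize (Real.sin φ : ℂ) = s at *
  have hI := I_sq
  congr 1
  · congr 1; ring
  congr 1
  · congr 1
    linear_combination (-4 * c) * h1 + (4 * c * s ^ 2) * hI
  congr 1
  congr 1
  linear_combination (4 * s * I) * h1 - (4 * s ^ 3 * I) * hI

end Omega

end Lawson

namespace Lawson

open ContDiff

set_option linter.unusedSectionVars false

/-! ### The half traces in terms of the transports along the two axes -/

section HalfTraces

variable {φ : ℝ}

theorem sin_pos_of_mem (hφ : φ ∈ Ioo 0 (Real.pi / 2)) : 0 < Real.sin φ :=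
  Real.sin_pos_of_pos_of_lt_pi hφ.1 (by linarith [hφ.2, Real.pi_pos])

theorem cos_pos_of_mem (hφ : φ ∈ Ioo 0 (Real.pi / 2)) : 0 < Real.cos φ :=
  Real.cos_pos_of_mem_Ioo ⟨by linarith [hφ.1, Real.pi_pos], hφ.2⟩

theorem formDen_ofReal (φ s : ℝ) : formDen φ s = axisDen φ s := by
  rw [formDen, axisDen]; push_cast; ring

/-- A quarter turn carries the punctures with angle `φ` to those with angle `π/2 - φ`. -/
theorem formDen_mul_I (φ s : ℝ) : formDen φ (s * I) = axisDen (Real.pi / 2 - φ) s := by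
  rw [formDen, axisDen, Real.sin_pi_div_two_sub, mul_pow, I_sq]
  push_cast [-ofReal_cos, -ofReal_sin]
  linear_combination (-4 * s ^ 2 : ℂ) * cos_sq_add_sin_sq_cast φ

theorem eta_ofReal (hφ : φ ∈ Ioo 0 (Real.pi / 2)) (a : Fin 3 → ℂ) (s : unitInterval) :
    eta φ a ((s : ℝ) : ℂ) = axisCoeff ℝ φ a s := by
  have hs : ∀ l, (((s : ℝ) : ℂ)) ≠ puncture φ l := fun l => by
    have := mul_ne_puncture (one_mem_slitDomain (sin_pos_of_mem hφ)) l s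
    rwa [mul_one] at this
  rw [eta_entries, axisCoeff_apply, omega_eq hs, formDen_ofReal]
  simp only [unitForm_apply (sin_pos_of_mem hφ), axisForm, Complex.real_smul, cons_val_zero,
    cons_val_one, cons_val]
  push_cast [-ofReal_cos, -ofReal_sin]
  apply Mat.ext4 <;> simp only [Mat.of4_00, Mat.of4_01, Mat.of4_10, Mat.of4_11]
  · linear_combination (a 0 * (8 * Real.sin φ * Real.cos φ * s / axisDen φ s)) * I_sq
  · linear_combination (a 2 * (4 * Real.sin φ * (s ^ 2 + 1) / axisDen φ s)) * I_sq
  · linear_combination -(a 2 * (4 * Real.sin φ * (s ^ 2 + 1) / axisDen φ s)) * I_sq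
  · linear_combination -(a 0 * (8 * Real.sin φ * Real.cos φ * s / axisDen φ s)) * I_sq

/-- Conjugation by `diag(1, i)`. -/
def twist (M : Mat ℂ) : Mat ℂ := Mat.of4 (M 0 0) (I * M 0 1) (-I * M 1 0) (M 1 1)

theorem twist_mul (M N : Mat ℂ) : twist (M * N) = twist M * twist N := by
  apply Mat.ext4 <;> simp only [twist, Mat.mul_apply, Mat.of4_00, Mat.of4_01, Mat.of4_10,
    Mat.of4_11]
  · linear_combination (M 0 1 * N 1 0) * I_sq
  · ring
  · ring
  · linear_combination (M 1 0 * N 0 1) * I_sq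

/-- On the imaginary axis the system is a constant conjugate of the real-axis system for the
complementary angle, with the second and third parameters exchanged and the sign of the first
reversed. Hence everything about `𝔮` follows from the facts about `𝔭`. -/
theorem eta_mul_I (hφ : φ ∈ Ioo 0 (Real.pi / 2)) (a : Fin 3 → ℂ) (s : unitInterval) :
    I • eta φ a ((s : ℝ) * I) = twist (axisCoeff ℝ (Real.pi / 2 - φ) (swapParam a) s) := by
  have hs : ∀ l, (((s : ℝ) : ℂ)) * I ≠ puncture φ l := fun l =>
    mul_ne_puncture (I_mem_slitDomain (cos_pos_of_mem hφ)) l s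
  rw [eta_entries, axisCoeff_apply, omega_eq hs, formDen_mul_I]
  simp only [unitForm_apply (sin_pos_of_mem (compl_mem hφ)), axisForm, Complex.real_smul,
    cons_val_zero, cons_val_one, cons_val, swapParam, Real.sin_pi_div_two_sub,
    Real.cos_pi_div_two_sub]
  push_cast [-ofReal_cos, -ofReal_sin]
  generalize (axisDen (Real.pi / 2 - φ) s : ℂ) = d
  have hI : I ^ 2 = -1 := I_sq
  generalize (Real.cos φ : ℂ) = c at *
  generalize (Real.sin φ : ℂ) = u at *
  generalize ((s : ℝ) : ℂ) = x at *
  apply Mat.ext4 <;> simp only [Mat.smul_apply, twist, smul_eq_mul, Mat.of4_00, Mat.of4_01,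
    Mat.of4_10, Mat.of4_11, div_eq_mul_inv]
  · linear_combination (a 0 * 8 * u * c * x * d⁻¹ * (I ^ 2 - 1)) * hI
  · linear_combination (I * (a 1 * 4 * c * x ^ 2 * d⁻¹) + a 2 * 4 * u * d⁻¹ * I * (1 + x ^ 2 * I ^ 2 - x ^ 2)) * hI
  · linear_combination (I * (a 1 * 4 * c * x ^ 2 * d⁻¹) - a 2 * 4 * u * d⁻¹ * I * (1 + x ^ 2 * I ^ 2 - x ^ 2)) * hI
  · linear_combination -(a 0 * 8 * u * c * x * d⁻¹ * (I ^ 2 - 1)) * hI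

theorem frame_one (hφ : φ ∈ Ioo 0 (Real.pi / 2)) (a : Fin 3 → ℂ) : frame φ a 1 = halfMon φ a := by
  have h : rayCoeff φ a 1 = axisCoeff ℝ φ a := by
    ext1 s
    rw [rayCoeff_apply a (one_mem_slitDomain (sin_pos_of_mem hφ)), one_smul, mul_one,
      eta_ofReal hφ]
  rw [frame, h, halfMon]

theorem frame_I (hφ : φ ∈ Ioo 0 (Real.pi / 2)) (a : Fin 3 → ℂ) :
    frame φ a I = twist (halfMon (Real.pi / 2 - φ) (swapParam a)) := by
  set b := axisCoeff ℝ (Real.pi / 2 - φ) (swapParam a)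
  refine odeSol_eq_of_hasDerivWithinAt (b := rayCoeff φ a I)
    (Φ := fun s => twist (unitExtend (odeSol b) s)) ?_ (fun s => ?_) 1 |>.trans ?_
  · have h0 := unitExtend_coe (odeSol b) 0
    rw [odeSol_zero] at h0
    change twist (unitExtend (odeSol b) ((0 : unitInterval) : ℝ)) = 1
    rw [h0]
    apply Mat.ext4 <;> simp [twist, Mat.one_apply]
  · have hI := I_mem_slitDomain (cos_pos_of_mem hφ)
    rw [rayCoeff_apply a hI, eta_mul_I hφ, ← twist_mul]
    have h := Mat.hasDerivWithinAt_iff.1 (hasDerivWithinAt_odeSol b s)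
    rw [Mat.hasDerivWithinAt_iff]
    have e : unitExtend (odeSol b) s = odeSol b s := unitExtend_coe _ _
    intro i j
    rw [e]
    fin_cases i <;> fin_cases j
    · exact h 0 0
    · exact (h 0 1).const_mul I
    · exact (h 1 0).const_mul (-I)
    · exact h 1 1
  · rw [unitExtend_coe]; rfl

theorem det2_halfMon (φ : ℝ) (a : Fin 3 → ℂ) : Mat.det2 (halfMon φ a) = 1 := by
  refine Mat.det2_odeSol _ (fun s => ?_) 1
  rw [axisCoeff_apply]
  simp

theorem eta_trace (φ : ℝ) (a : Fin 3 → ℂ) (z : ℂ) : eta φ a z 0 0 + eta φ a z 1 1 = 0 := by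
  rw [eta_entries]; simp

theorem det2_frame {z : ℂ} (a : Fin 3 → ℂ) (hz : z ∈ slitDomain φ) : Mat.det2 (frame φ a z) = 1 := by
  refine Mat.det2_odeSol _ (fun s => ?_) 1
  rw [rayCoeff_apply a hz, Mat.smul_apply, Mat.smul_apply, ← smul_add, eta_trace, smul_zero]

theorem inv_eq_adj (M : Matrix (Fin 2) (Fin 2) ℂ) (h : M 0 0 * M 1 1 - M 0 1 * M 1 0 = 1) :
    M⁻¹ = !![M 1 1, -M 0 1; -M 1 0, M 0 0] := by
  refine Matrix.inv_eq_right_inv ?_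
  exact Mat.mul_adj (A := ℂ) h

theorem halfTraceP_entries {F : ℂ → Matrix (Fin 2) (Fin 2) ℂ}
    (h : F 1 0 0 * F 1 1 1 - F 1 0 1 * F 1 1 0 = 1) :
    halfTraceP F = F 1 0 0 * F 1 1 0 - F 1 0 1 * F 1 1 1 := by
  rw [halfTraceP, L₃, inv_eq_adj _ h, Matrix.trace_fin_two]
  simp only [Matrix.mul_apply, Fin.sum_univ_two, L₂, matD, matC, Matrix.of_apply, Matrix.cons_val',
    Matrix.cons_val_zero, Matrix.cons_val_one, Matrix.cons_val_fin_one]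
  linear_combination (F 1 0 1 * F 1 1 1 - F 1 0 0 * F 1 1 0) * I_sq

theorem halfTraceQ_entries {F : ℂ → Matrix (Fin 2) (Fin 2) ℂ}
    (h : F I 0 0 * F I 1 1 - F I 0 1 * F I 1 0 = 1) :
    halfTraceQ F = I * (F I 0 0 * F I 1 0 + F I 0 1 * F I 1 1) := by
  rw [halfTraceQ, L₁, inv_eq_adj _ h, Matrix.trace_fin_two]
  simp only [Matrix.mul_apply, Fin.sum_univ_two, L₂, matD, matC, Matrix.of_apply, Matrix.cons_val',
    Matrix.cons_val_zero, Matrix.cons_val_one, Matrix.cons_val_fin_one]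
  linear_combination (- I * (F I 0 0 * F I 1 0 + F I 0 1 * F I 1 1)) * I_sq

theorem halfTraceP_eq {F : ℂ → Matrix (Fin 2) (Fin 2) ℂ} (hφ : φ ∈ Ioo 0 (Real.pi / 2))
    {a : Fin 3 → ℂ} (h : F 1 = frame φ a 1) : halfTraceP F = pFun φ a := by
  rw [frame_one hφ] at h
  have e : ∀ i j, F 1 i j = halfMon φ a i j := fun i j => congrFun (congrFun h i) j
  have hd := det2_halfMon φ a
  rw [Mat.det2] at hd
  rw [halfTraceP_entries (by simp only [e]; exact hd), pFun]
  simp only [e]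

theorem halfTraceQ_eq {F : ℂ → Matrix (Fin 2) (Fin 2) ℂ} (hφ : φ ∈ Ioo 0 (Real.pi / 2))
    {a : Fin 3 → ℂ} (h : F I = frame φ a I) : halfTraceQ F = qFun φ a := by
  rw [frame_I hφ] at h
  have hd := det2_halfMon (Real.pi / 2 - φ) (swapParam a)
  rw [Mat.det2] at hd
  rw [qFun, pFun]
  generalize halfMon (Real.pi / 2 - φ) (swapParam a) = M at *
  have e00 : F I 0 0 = M 0 0 := congrFun (congrFun h 0) 0
  have e01 : F I 0 1 = I * M 0 1 := congrFun (congrFun h 0) 1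
  have e10 : F I 1 0 = -I * M 1 0 := congrFun (congrFun h 1) 0
  have e11 : F I 1 1 = M 1 1 := congrFun (congrFun h 1) 1
  rw [halfTraceQ_entries (by
    rw [e00, e01, e10, e11]; linear_combination hd + (M 0 1 * M 1 0) * I_sq), e00, e01, e10, e11]
  linear_combination (M 0 1 * M 1 1 - M 0 0 * M 1 0) * I_sq

end HalfTraces

/-! ### Symmetries under z ↦ -z and z ↦ 1/z -/

section Symmetries

variable {φ : ℝ} {z : ℂ}

theorem neg_puncture (φ : ℝ) (l : Fin 4) : -puncture φ l = puncture φ (![2, 3, 0, 1] l) := by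
  rw [puncture_eq]
  fin_cases l
  · change -(Real.cos φ + Real.sin φ * I : ℂ) = -Real.cos φ - Real.sin φ * I; ring
  · change -(-Real.cos φ + Real.sin φ * I : ℂ) = Real.cos φ - Real.sin φ * I; ring
  · change -(-Real.cos φ - Real.sin φ * I : ℂ) = Real.cos φ + Real.sin φ * I; ring
  · change -(Real.cos φ - Real.sin φ * I : ℂ) = -Real.cos φ + Real.sin φ * I; ring

theorem inv_puncture (φ : ℝ) (l : Fin 4) : (puncture φ l)⁻¹ = puncture φ (![3, 2, 1, 0] l) := by
  have hI := I_sq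
  have h := cos_sq_add_sin_sq_cast φ
  refine inv_eq_of_mul_eq_one_right ?_
  rw [puncture_eq]
  fin_cases l
  · change (Real.cos φ + Real.sin φ * I : ℂ) * (Real.cos φ - Real.sin φ * I) = 1
    linear_combination h - (Real.sin φ ^ 2 : ℂ) * hI
  · change (-Real.cos φ + Real.sin φ * I : ℂ) * (-Real.cos φ - Real.sin φ * I) = 1
    linear_combination h - (Real.sin φ ^ 2 : ℂ) * hI
  · change (-Real.cos φ - Real.sin φ * I : ℂ) * (-Real.cos φ + Real.sin φ * I) = 1
    linear_combination h - (Real.sin φ ^ 2 : ℂ) * hI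
  · change (Real.cos φ - Real.sin φ * I : ℂ) * (Real.cos φ + Real.sin φ * I) = 1
    linear_combination h - (Real.sin φ ^ 2 : ℂ) * hI

theorem neg_mem_slitDomain (hz : z ∈ slitDomain φ) : -z ∈ slitDomain φ := by
  intro j σ hσ h
  refine hz (![2, 3, 0, 1] j) σ hσ ?_
  rw [← neg_puncture, mul_neg, ← h, neg_neg]

theorem neg_ne_puncture (h : ∀ l, z ≠ puncture φ l) (l : Fin 4) : -z ≠ puncture φ l := fun e =>
  h (![2, 3, 0, 1] l) (by rw [← neg_puncture, ← e, neg_neg])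

theorem inv_ne_puncture (h : ∀ l, z ≠ puncture φ l) (l : Fin 4) : z⁻¹ ≠ puncture φ l := fun e =>
  h (![3, 2, 1, 0] l) (by rw [← inv_puncture, ← e, inv_inv])

/-- The pullback of the potential under `z ↦ -z` is its conjugate by `diag(1, -1)`; this transfers
statements to opposite sectors. -/
theorem eta_neg (a : Fin 3 → ℂ) (h : ∀ l, z ≠ puncture φ l) :
    -eta φ a (-z) = Mat.flip (eta φ a z) := by
  rw [eta_entries, eta_entries, omega_eq h, omega_eq (neg_ne_puncture h)]
  have e : formDen φ (-z) = formDen φ z := by rw [formDen, formDen]; ring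
  rw [e]
  apply Mat.ext4 <;> simp only [Mat.neg_apply, Mat.flip, Mat.of4_00, Mat.of4_01, Mat.of4_10,
    Mat.of4_11, cons_val_zero, cons_val_one, cons_val] <;> ring

/-- The pullback under `z ↦ 1/z` is conjugation by the permutation matrix. Therefore `outFrame`
solves the original equation, now in a neighbourhood of infinity. -/
theorem eta_inv (a : Fin 3 → ℂ) (h : ∀ l, z ≠ puncture φ l) (h0 : z ≠ 0) :
    (-(z ^ 2)⁻¹) • eta φ a z⁻¹ = Mat.swap * eta φ a z * Mat.swap := by
  have hD := formDen_ne_zero h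
  rw [eta_entries, eta_entries, omega_eq h, omega_eq (inv_ne_puncture h)]
  have e : formDen φ z⁻¹ = formDen φ z / z ^ 4 := by
    rw [formDen, formDen]; field_simp; ring
  rw [e]
  apply Mat.ext4 <;> simp only [Mat.smul_apply, Mat.mul_apply, Mat.swap, Mat.of4_00, Mat.of4_01,
    Mat.of4_10, Mat.of4_11, cons_val_zero, cons_val_one, cons_val, smul_eq_mul] <;>
    field_simp <;> ring

theorem frame_neg (hφ : 0 < Real.sin φ) (a : Fin 3 → ℂ) (hz : z ∈ slitDomain φ) :
    frame φ a (-z) = Mat.flip (frame φ a z) := by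
  have h := eq_frame (φ := φ) (a := a) (F := fun z => Mat.flip (frame φ a (-z)))
    (by rw [neg_zero, frame_zero, Mat.flip_one]) (fun z hz => ?_) hz
  · rw [← h, Mat.flip_flip]
  · have h1 := (hasDerivAt_frame hφ a (neg_mem_slitDomain hz)).scomp z (hasDerivAt_neg z)
    rw [neg_one_smul, ← mul_neg, eta_neg a (ne_puncture_of_mem hz)] at h1
    have h2 := Mat.hasDerivAt_iff.1 h1
    have e : Mat.flip (frame φ a (-z)) * eta φ a z =
        Mat.flip (frame φ a (-z) * Mat.flip (eta φ a z)) := by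
      rw [Mat.flip_mul, Mat.flip_flip]
    rw [e, Mat.hasDerivAt_iff]
    intro i j
    fin_cases i <;> fin_cases j
    · exact h2 0 0
    · exact (h2 0 1).neg
    · exact (h2 1 0).neg
    · exact h2 1 1

/-- The exterior frame. -/
noncomputable def outFrame (φ : ℝ) (a : Fin 3 → ℂ) (z : ℂ) : Mat ℂ := frame φ a z⁻¹ * Mat.swap

theorem hasDerivAt_mul_const {F : ℂ → Mat ℂ} {F' : Mat ℂ} (h : HasDerivAt F F' z) (M : Mat ℂ) :
    HasDerivAt (fun w => F w * M) (F' * M) z := by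
  exact (((ContinuousLinearMap.mul ℂ (Mat ℂ)).flip M).hasFDerivAt).comp_hasDerivAt z h

theorem hasDerivAt_const_mul {F : ℂ → Mat ℂ} {F' : Mat ℂ} (h : HasDerivAt F F' z) (M : Mat ℂ) :
    HasDerivAt (fun w => M * F w) (M * F') z := by
  exact ((ContinuousLinearMap.mul ℂ (Mat ℂ) M).hasFDerivAt).comp_hasDerivAt z h

theorem hasDerivAt_outFrame (hφ : 0 < Real.sin φ) (a : Fin 3 → ℂ) (h0 : z ≠ 0)
    (hz : z⁻¹ ∈ slitDomain φ) :
    HasDerivAt (outFrame φ a) (outFrame φ a z * eta φ a z) z := by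
  have hp : ∀ l, z ≠ puncture φ l := fun l => by
    have := inv_ne_puncture (ne_puncture_of_mem hz) l
    rwa [inv_inv] at this
  have h1 := (hasDerivAt_frame hφ a hz).scomp z (hasDerivAt_inv h0)
  have h2 := hasDerivAt_mul_const h1 Mat.swap
  rw [← mul_smul_comm, eta_inv a hp h0, mul_assoc, mul_assoc, mul_assoc, Mat.swap_mul_swap,
    mul_one, ← mul_assoc] at h2
  exact h2

theorem det2_outFrame (a : Fin 3 → ℂ) (hz : z⁻¹ ∈ slitDomain φ) :
    Mat.det2 (outFrame φ a z) = -1 := by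
  rw [outFrame, Mat.det2_mul, det2_frame a hz]
  simp [Mat.det2, Mat.swap]

end Symmetries

end Lawson

/-! ### Traces of transports between two frames -/

namespace Mat

variable {A : Type*} [NormedCommRing A]

theorem adj_mul_rev (M N : Mat A) : adj (M * N) = adj N * adj M := by
  apply ext4 <;> simp [mul_apply, adj] <;> ring

theorem adj_adj (M : Mat A) : adj (adj M) = M := by
  apply ext4 <;> simp [adj]

theorem mul_adj' (M : Mat A) {d : A} (h : det2 M = d) : M * adj M = of4 d 0 0 d := by
  rw [det2] at h
  apply ext4 <;> simp [mul_apply, adj] <;> first | linear_combination h | ring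

/-- The trace. -/
def tr (M : Mat A) : A := M 0 0 + M 1 1

theorem tr_mul_comm (M N : Mat A) : tr (M * N) = tr (N * M) := by
  simp only [tr, mul_apply]; ring

/-- `T` and `T'` transport between the same end points along two paths, and `K`, `K'` are the
corresponding changes of frame. The loop `T T'⁻¹` is conjugate to `K K'⁻¹`, so the end points drop
out of the trace; the sign comes from `det W = -1`. -/
theorem tr_transport {E W K K' T T' : Mat A} (hE : det2 E = 1) (hW : det2 W = -1)
    (h : E * T = K * W) (h' : E * T' = K' * W) : tr (T * adj T') = -tr (K * adj K') := by
  have e : T = adj E * (K * W) := by rw [← h, ← mul_assoc, adj_mul hE, one_mul]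
  have e' : T' = adj E * (K' * W) := by rw [← h', ← mul_assoc, adj_mul hE, one_mul]
  have h2 : T * adj T' = adj E * (K * (W * adj W) * adj K') * E := by
    rw [e, e', adj_mul_rev, adj_mul_rev, adj_adj]
    noncomm_ring
  rw [h2, tr_mul_comm, ← mul_assoc, mul_adj hE, one_mul, mul_adj' W hW]
  simp only [tr, mul_apply, of4_00, of4_01, of4_10, of4_11, adj]
  ring

end Mat

namespace Lawson

open ContDiff

set_option linter.unusedSectionVars false

/-! ### Interior and exterior frames in the sectors -/

section Sectors

variable {φ : ℝ} {z : ℂ}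

/-- A linear form vanishing on the line through the first puncture. -/
noncomputable def wallA (φ : ℝ) (z : ℂ) : ℝ := Real.sin φ * z.re - Real.cos φ * z.im

/-- A linear form vanishing on the line through the second puncture. -/
noncomputable def wallB (φ : ℝ) (z : ℂ) : ℝ := Real.sin φ * z.re + Real.cos φ * z.im

/-- The open sectors between the rays through the punctures. -/
def sector (φ α β : ℝ) : Set ℂ := {z | 0 < α * wallA φ z ∧ 0 < β * wallB φ z}

theorem convex_sector (φ α β : ℝ) : Convex ℝ (sector φ α β) := by
  intro x hx y hy a b ha hb hab
  have key : ∀ u v : ℝ, 0 < u → 0 < v → 0 < a * u + b * v := fun u v hu hv => by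
    rcases ha.eq_or_lt with rfl | ha
    · have : b = 1 := by linarith
      rw [this]; linarith
    · have := mul_pos ha hu
      have := mul_nonneg hb hv.le
      linarith
  constructor
  · have := key _ _ hx.1 hy.1
    simp only [wallA, add_re, add_im, real_smul, re_ofReal_mul, im_ofReal_mul] at this ⊢
    linarith
  · have := key _ _ hx.2 hy.2
    simp only [wallB, add_re, add_im, real_smul, re_ofReal_mul, im_ofReal_mul] at this ⊢
    linarith

theorem mem_slitDomain_of_walls (hA : wallA φ z ≠ 0) (hB : wallB φ z ≠ 0) : z ∈ slitDomain φ := by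
  intro j σ hσ h
  rw [puncture_eq] at h
  rw [wallA] at hA
  rw [wallB] at hB
  rw [h] at hA hB
  simp only [re_ofReal_mul, im_ofReal_mul] at hA hB
  fin_cases j
  · exact hA (by simp [-ofReal_cos, -ofReal_sin]; ring)
  · exact hB (by simp [-ofReal_cos, -ofReal_sin]; ring)
  · exact hA (by simp [-ofReal_cos, -ofReal_sin]; ring)
  · exact hB (by simp [-ofReal_cos, -ofReal_sin]; ring)

theorem wallA_inv (φ : ℝ) (z : ℂ) : wallA φ z⁻¹ = wallB φ z / normSq z := by
  rw [wallA, wallB, inv_re, inv_im]; ring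

theorem wallB_inv (φ : ℝ) (z : ℂ) : wallB φ z⁻¹ = wallA φ z / normSq z := by
  rw [wallA, wallB, inv_re, inv_im]; ring

theorem ne_zero_of_wallA (hA : wallA φ z ≠ 0) : z ≠ 0 := by
  rintro rfl; exact hA (by simp [wallA])

theorem inv_mem_slitDomain_of_walls (hA : wallA φ z ≠ 0) (hB : wallB φ z ≠ 0) :
    z⁻¹ ∈ slitDomain φ := by
  have h0 : normSq z ≠ 0 := normSq_eq_zero.not.2 (ne_zero_of_wallA hA)
  exact mem_slitDomain_of_walls (by rw [wallA_inv]; exact div_ne_zero hB h0)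
    (by rw [wallB_inv]; exact div_ne_zero hA h0)

theorem mem_slitDomain_of_norm_lt (h : ‖z‖ < 1) : z ∈ slitDomain φ := by
  intro j σ hσ e
  rw [e, norm_mul, norm_puncture, mul_one, norm_real, Real.norm_eq_abs,
    abs_of_nonneg (by linarith)] at h
  linarith

theorem walls_of_mem_sector {α β : ℝ} (h : z ∈ sector φ α β) : wallA φ z ≠ 0 ∧ wallB φ z ≠ 0 :=
  ⟨fun e => by have := h.1; rw [e, mul_zero] at this; exact lt_irrefl _ this,
    fun e => by have := h.2; rw [e, mul_zero] at this; exact lt_irrefl _ this⟩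

theorem continuousAt_eta (a : Fin 3 → ℂ) (h : ∀ l, z ≠ puncture φ l) :
    ContinuousAt (eta φ a) z := by
  unfold eta
  refine tendsto_finsetSum _ fun l _ => ?_
  have hl := h l
  have h1 : ContinuousAt (fun w : ℂ => (w - puncture φ l)⁻¹) z :=
    ContinuousAt.inv₀ (by fun_prop) (sub_ne_zero.2 hl)
  exact Filter.Tendsto.smul h1 (tendsto_const_nhds (x := resid a l))

theorem transport_eq {a : Fin 3 → ℂ} {b : C(unitInterval, Mat ℂ)} {γ γ' : ℝ → ℂ} {F : ℂ → Mat ℂ}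
    (hγ : ∀ s : unitInterval, HasDerivAt γ (γ' s) s)
    (hb : ∀ s : unitInterval, b s = γ' s • eta φ a (γ s))
    (hF : ∀ s : unitInterval, HasDerivAt F (F (γ s) * eta φ a (γ s)) (γ s)) (s : unitInterval) :
    F (γ s) = F (γ 0) * odeSol b s :=
  eq_mul_odeSol (Φ := fun s => F (γ s)) (fun s => by
    have h := (hF s).scomp_hasDerivWithinAt (s : ℝ) (h := γ) (hγ s).hasDerivWithinAt (s := Icc 0 1)
    rw [← mul_smul_comm, ← hb s] at h
    exact h) s

/-- Along the segment from `z₀` to `z` both solutions are multiplied on the right by the same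
transport, so a constant left factor persists. -/
theorem eq_const_mul_of_convex {a : Fin 3 → ℂ} {S : Set ℂ} (hS : Convex ℝ S)
    (hp : ∀ z ∈ S, ∀ l, z ≠ puncture φ l) {F G : ℂ → Mat ℂ}
    (hF : ∀ z ∈ S, HasDerivAt F (F z * eta φ a z) z)
    (hG : ∀ z ∈ S, HasDerivAt G (G z * eta φ a z) z) {K : Mat ℂ} {z₀ : ℂ} (h0 : z₀ ∈ S)
    (hK : F z₀ = K * G z₀) (hz : z ∈ S) : F z = K * G z := by
  have hmem : ∀ s : unitInterval, z₀ + ((s : ℝ) : ℂ) * (z - z₀) ∈ S := fun s => by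
    have := hS h0 hz (a := 1 - s) (b := s) (by linarith [s.2.2]) s.2.1 (by ring)
    convert! this using 1
    simp only [real_smul]; push_cast; ring
  have hc : Continuous fun s : unitInterval => eta φ a (z₀ + ((s : ℝ) : ℂ) * (z - z₀)) := by
    rw [continuous_iff_continuousAt]
    intro s
    exact ContinuousAt.comp (f := fun s : unitInterval => z₀ + ((s : ℝ) : ℂ) * (z - z₀))
      (continuousAt_eta a (hp _ (hmem s))) (Continuous.continuousAt (by fun_prop))
  let b : C(unitInterval, Mat ℂ) :=
    ⟨fun s => (z - z₀) • eta φ a (z₀ + ((s : ℝ) : ℂ) * (z - z₀)), by fun_prop⟩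
  have hγ : ∀ s : unitInterval, HasDerivAt (fun s : ℝ => z₀ + (s : ℂ) * (z - z₀)) (z - z₀) (s : ℝ) :=
    fun s => by
      simpa using ((ofRealCLM.hasDerivAt (x := (s : ℝ))).mul_const (z - z₀)).const_add z₀
  have h1 := transport_eq (γ' := fun _ => z - z₀) (b := b) hγ (fun s => rfl)
    (fun s => hF _ (hmem s)) 1
  have h2 := transport_eq (γ' := fun _ => z - z₀) (b := b) hγ (fun s => rfl)
    (fun s => hG _ (hmem s)) 1
  simp only [Icc.coe_one, ofReal_one, one_mul, add_sub_cancel, ofReal_zero, zero_mul, add_zero]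
    at h1 h2
  rw [h1, h2, hK, mul_assoc]

/-- The factor relating the interior and the exterior frame in the sector of `1`. -/
noncomputable def factorOne (φ : ℝ) (a : Fin 3 → ℂ) : Mat ℂ :=
  frame φ a 1 * Mat.swap * Mat.adj (frame φ a 1)

/-- The factor relating the interior and the exterior frame in the sector of `i`. -/
noncomputable def factorI (φ : ℝ) (a : Fin 3 → ℂ) : Mat ℂ :=
  frame φ a I * Mat.swap * Mat.adj (Mat.flip (frame φ a I))

theorem frame_eq_on_sector (hφ : 0 < Real.sin φ) (a : Fin 3 → ℂ) {α β : ℝ} {K : Mat ℂ} {z₀ : ℂ}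
    (h0 : z₀ ∈ sector φ α β) (hK : frame φ a z₀ = K * outFrame φ a z₀) (hz : z ∈ sector φ α β) :
    frame φ a z = K * outFrame φ a z := by
  refine eq_const_mul_of_convex (φ := φ) (a := a) (convex_sector φ α β) (fun z hz => ?_)
    (fun z hz => ?_) (fun z hz => ?_) h0 hK hz
  · obtain ⟨hA, hB⟩ := walls_of_mem_sector hz
    exact ne_puncture_of_mem (mem_slitDomain_of_walls hA hB)
  · obtain ⟨hA, hB⟩ := walls_of_mem_sector hz
    exact hasDerivAt_frame hφ a (mem_slitDomain_of_walls hA hB)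
  · obtain ⟨hA, hB⟩ := walls_of_mem_sector hz
    exact hasDerivAt_outFrame hφ a (ne_zero_of_wallA hA) (inv_mem_slitDomain_of_walls hA hB)

/-- The constant factor is read off at `z = 1`, a fixed point of inversion. -/
theorem frame_eq_of_mem_sector_one (hφ : φ ∈ Ioo 0 (Real.pi / 2)) (a : Fin 3 → ℂ)
    (hz : z ∈ sector φ 1 1) : frame φ a z = factorOne φ a * outFrame φ a z := by
  have hs := sin_pos_of_mem hφ
  refine frame_eq_on_sector hs a (z₀ := 1) ⟨by simpa [wallA] using hs, by simpa [wallB] using hs⟩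
    ?_ hz
  have hd := det2_frame a (one_mem_slitDomain hs)
  rw [factorOne, outFrame, inv_one, mul_assoc (frame φ a 1 * Mat.swap),
    ← mul_assoc (Mat.adj (frame φ a 1)), Mat.adj_mul hd, one_mul, mul_assoc, Mat.swap_mul_swap,
    mul_one]

theorem det2_flip {A : Type*} [NormedCommRing A] (M : Mat A) : Mat.det2 (Mat.flip M) = Mat.det2 M := by
  simp [Mat.det2, Mat.flip]

/-- Inversion sends `i` to `-i`, so reading off the factor at `z = i` also uses the symmetry `z ↦
-z`; this is the origin of the `flip` in `factorI`. -/
theorem frame_eq_of_mem_sector_I (hφ : φ ∈ Ioo 0 (Real.pi / 2)) (a : Fin 3 → ℂ)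
    (hz : z ∈ sector φ (-1) 1) : frame φ a z = factorI φ a * outFrame φ a z := by
  have hc := cos_pos_of_mem hφ
  have hs := sin_pos_of_mem hφ
  refine frame_eq_on_sector hs a (z₀ := I) ⟨by simpa [wallA] using hc, by simpa [wallB] using hc⟩
    ?_ hz
  have hd := det2_frame a (I_mem_slitDomain hc)
  rw [← det2_flip] at hd
  rw [factorI, outFrame, inv_I, frame_neg hs a (I_mem_slitDomain hc),
    mul_assoc (frame φ a I * Mat.swap), ← mul_assoc (Mat.adj _), Mat.adj_mul hd, one_mul, mul_assoc,
    Mat.swap_mul_swap, mul_one]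

/-- The first puncture lies between the sectors of `1` and `i`, so up to sign and conjugation this
product is the monodromy around it. -/
theorem tr_factorOne_mul (hφ : φ ∈ Ioo 0 (Real.pi / 2)) (a : Fin 3 → ℂ) :
    Mat.tr (factorOne φ a * Mat.adj (factorI φ a)) =
      -(upFun (Real.pi / 2 - φ) (swapParam a) * loFun φ a +
        upFun φ a * loFun (Real.pi / 2 - φ) (swapParam a)) := by
  rw [factorOne, factorI, frame_one hφ, frame_I hφ, upFun, upFun, loFun, loFun]
  generalize halfMon (Real.pi / 2 - φ) (swapParam a) = M
  generalize halfMon φ a = N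
  simp only [Mat.tr, Mat.mul_apply, Mat.adj, Mat.flip, Mat.swap, twist, Mat.of4_00, Mat.of4_01,
    Mat.of4_10, Mat.of4_11]
  have hI := I_sq
  ring_nf
  simp only [hI]
  ring

end Sectors

end Lawson

namespace Lawson

open ContDiff

set_option linter.unusedSectionVars false

/-! ### Local monodromy at the first puncture -/

section Arcs

variable {φ : ℝ}

/-- The part of the potential which is regular at the first puncture. -/
noncomputable def etaReg (φ : ℝ) (a : Fin 3 → ℂ) (z : ℂ) : Mat ℂ :=
  ∑ l ∈ Finset.univ.erase 0, (z - puncture φ l)⁻¹ • resid a l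

theorem eta_eq_add_etaReg (φ : ℝ) (a : Fin 3 → ℂ) (z : ℂ) :
    eta φ a z = (z - puncture φ 0)⁻¹ • resid a 0 + etaReg φ a z := by
  rw [eta, etaReg, ← Finset.add_sum_erase _ _ (Finset.mem_univ 0)]

/-- The displacement along an arc around the first puncture. -/
noncomputable def arcStep (φ α ε s : ℝ) : ℂ := -(puncture φ 0 * (ε * exp (α * Real.pi * s * I)))

theorem norm_arcStep (φ α ε s : ℝ) : ‖arcStep φ α ε s‖ = |ε| := by
  rw [arcStep, norm_neg, norm_mul, norm_mul, norm_puncture, one_mul, norm_real, Real.norm_eq_abs]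
  have : (α * Real.pi * s * I : ℂ) = ((α * Real.pi * s : ℝ) : ℂ) * I := by push_cast; ring
  rw [this, norm_exp_ofReal_mul_I, mul_one]

theorem two_sin_le_dist (hφ : φ ∈ Ioo 0 (Real.pi / 2)) {l : Fin 4} (hl : l ≠ 0) :
    Real.sin (2 * φ) ≤ ‖puncture φ 0 - puncture φ l‖ := by
  have hs := sin_pos_of_mem hφ
  have hc := cos_pos_of_mem hφ
  have hs1 := Real.sin_le_one φ
  have hc1 := Real.cos_le_one φ
  rw [Real.sin_two_mul]
  have h1 := abs_re_le_norm (puncture φ 0 - puncture φ l)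
  have h2 := abs_im_le_norm (puncture φ 0 - puncture φ l)
  rw [puncture_eq] at h1 h2 ⊢
  fin_cases l
  · exact absurd rfl hl
  · refine le_trans ?_ (h1.trans' (le_abs_self _))
    simp [-ofReal_cos, -ofReal_sin]
    nlinarith
  · refine le_trans ?_ (h1.trans' (le_abs_self _))
    simp [-ofReal_cos, -ofReal_sin]
    nlinarith
  · refine le_trans ?_ (h2.trans' (le_abs_self _))
    simp [-ofReal_cos, -ofReal_sin]
    nlinarith

theorem arc_ne_puncture (hφ : φ ∈ Ioo 0 (Real.pi / 2)) {α ε s : ℝ} (hε : |ε| < Real.sin (2 * φ))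
    {l : Fin 4} (hl : l ≠ 0) : puncture φ 0 + arcStep φ α ε s - puncture φ l ≠ 0 := by
  intro h
  have h2 := two_sin_le_dist hφ hl
  have h3 : puncture φ 0 - puncture φ l = -arcStep φ α ε s := by linear_combination h
  rw [h3, norm_neg, norm_arcStep] at h2
  linarith

/-- The coefficient of the system along an arc of radius `ε` around the first puncture. -/
noncomputable def arcCoeff (φ : ℝ) (a : Fin 3 → ℂ) (α ε s : ℝ) : Mat ℂ :=
  (I * (α * Real.pi)) • (resid a 0 + arcStep φ α ε s • etaReg φ a (puncture φ 0 + arcStep φ α ε s))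

theorem continuous_arcCoeff (hφ : φ ∈ Ioo 0 (Real.pi / 2)) (a : Fin 3 → ℂ) (α : ℝ) {r : ℝ}
    (hr : r < Real.sin (2 * φ)) :
    Continuous fun p : Icc 0 r × unitInterval => arcCoeff φ a α p.1 p.2 := by
  have hstep : Continuous fun p : Icc 0 r × unitInterval => arcStep φ α p.1 p.2 := by
    unfold arcStep; fun_prop
  have hreg : Continuous fun p : Icc 0 r × unitInterval =>
      etaReg φ a (puncture φ 0 + arcStep φ α p.1 p.2) := by
    unfold etaReg
    refine continuous_finsetSum _ fun l hl => ?_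
    have hi : Continuous fun p : Icc 0 r × unitInterval =>
        (puncture φ 0 + arcStep φ α p.1 p.2 - puncture φ l)⁻¹ := by
      refine Continuous.inv₀ (by fun_prop) fun p => ?_
      refine arc_ne_puncture hφ ?_ (Finset.ne_of_mem_erase hl)
      rw [abs_of_nonneg p.1.2.1]
      exact p.1.2.2.trans_lt hr
    fun_prop
  unfold arcCoeff
  fun_prop

/-- The coefficient along the arcs, as a continuous family. -/
noncomputable def arcFamily (hφ : φ ∈ Ioo 0 (Real.pi / 2)) (a : Fin 3 → ℂ) (α : ℝ) {r : ℝ}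
    (hr : r < Real.sin (2 * φ)) : C(Icc (0 : ℝ) r, C(unitInterval, Mat ℂ)) :=
  ContinuousMap.curry ⟨_, continuous_arcCoeff hφ a α hr⟩

theorem arcFamily_apply (hφ : φ ∈ Ioo 0 (Real.pi / 2)) (a : Fin 3 → ℂ) (α : ℝ) {r : ℝ}
    (hr : r < Real.sin (2 * φ)) (ε : Icc (0 : ℝ) r) (s : unitInterval) :
    arcFamily hφ a α hr ε s = arcCoeff φ a α ε s := rfl

theorem hasDerivAt_arc (φ α ε s : ℝ) : HasDerivAt (fun s => puncture φ 0 + arcStep φ α ε s)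
    (I * (α * Real.pi) * arcStep φ α ε s) s := by
  have h0 : HasDerivAt (fun s : ℝ => (α * Real.pi * s * I : ℂ)) (α * Real.pi * I) s := by
    simpa using ((ofRealCLM.hasDerivAt (x := s)).const_mul (α * Real.pi : ℂ)).mul_const I
  have h := ((h0.cexp.const_mul (ε : ℂ)).const_mul (puncture φ 0)).neg.const_add (puncture φ 0)
  convert! h using 1
  rw [arcStep]; ring

/-- On an arc of radius `ε` the velocity is proportional to the displacement and cancels the simple
pole. The form `arcCoeff` of the coefficient therefore makes sense and is continuous at `ε = 0`. -/
theorem arcCoeff_eq (a : Fin 3 → ℂ) {α ε : ℝ} (hε : ε ≠ 0) (s : ℝ) :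
    arcCoeff φ a α ε s = (I * (α * Real.pi) * arcStep φ α ε s) •
      eta φ a (puncture φ 0 + arcStep φ α ε s) := by
  have h0 : arcStep φ α ε s ≠ 0 := by
    rw [← norm_ne_zero_iff, norm_arcStep]; exact abs_ne_zero.2 hε
  rw [arcCoeff, eta_eq_add_etaReg, add_sub_cancel_left, mul_smul (I * (α * Real.pi) : ℂ),
    smul_add (arcStep φ α ε s), smul_smul (arcStep φ α ε s) _ (resid a 0),
    mul_inv_cancel₀ h0, one_smul]

theorem wallA_arc (φ α ε s : ℝ) : wallA φ (puncture φ 0 + arcStep φ α ε s) =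
    ε * Real.sin (α * Real.pi * s) := by
  have e : (α * Real.pi * s * I : ℂ) = ((α * Real.pi * s : ℝ) : ℂ) * I := by push_cast; ring
  have h := Real.cos_sq_add_sin_sq φ
  rw [arcStep, puncture_eq, e, exp_mul_I, ← ofReal_cos, ← ofReal_sin, wallA]
  simp [-ofReal_cos, -ofReal_sin]
  linear_combination (ε * Real.sin (α * Real.pi * s)) * h

theorem wallB_arc_pos {α ε s : ℝ} (hε : |ε| < Real.sin (2 * φ)) :
    0 < wallB φ (puncture φ 0 + arcStep φ α ε s) := by
  have e : (α * Real.pi * s * I : ℂ) = ((α * Real.pi * s : ℝ) : ℂ) * I := by push_cast; ring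
  have h1 : wallB φ (puncture φ 0 + arcStep φ α ε s) =
      Real.sin (2 * φ) - ε * Real.sin (2 * φ + α * Real.pi * s) := by
    rw [arcStep, puncture_eq, e, exp_mul_I, ← ofReal_cos, ← ofReal_sin, wallB, Real.sin_add,
      Real.sin_two_mul, Real.cos_two_mul]
    simp [-ofReal_cos, -ofReal_sin]
    linear_combination (ε * Real.sin (α * Real.pi * s)) * Real.cos_sq_add_sin_sq φ
  rw [h1]
  have h2 : |ε * Real.sin (2 * φ + α * Real.pi * s)| ≤ |ε| := by
    rw [abs_mul]
    exact mul_le_of_le_one_right (abs_nonneg _) (Real.abs_sin_le_one _)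
  linarith [le_abs_self (ε * Real.sin (2 * φ + α * Real.pi * s))]

/-- The arc runs inside one sector from `(1 - ε) p` to `(1 + ε) p`. The interior frame is regular at
its beginning and the exterior frame at its end, and inside the sector they differ by `K`. -/
theorem frame_arc (hφ : φ ∈ Ioo 0 (Real.pi / 2)) (a : Fin 3 → ℂ) {α ε : ℝ} (hα : α = 1 ∨ α = -1)
    (h0 : 0 < ε) (hε : ε < Real.sin (2 * φ)) {K : Mat ℂ}
    (hK : ∀ z ∈ sector φ α 1, frame φ a z = K * outFrame φ a z) {b : C(unitInterval, Mat ℂ)}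
    (hb : ∀ s : unitInterval, b s = arcCoeff φ a α ε s) :
    frame φ a (puncture φ 0 * (1 - ε)) * odeSol b 1 =
      K * outFrame φ a (puncture φ 0 * (1 + ε)) := by
  have hs := sin_pos_of_mem hφ
  have hε1 : ε < 1 := hε.trans_le (Real.sin_le_one _)
  set γ : ℝ → ℂ := fun s => puncture φ 0 + arcStep φ α ε s with hγ
  have hγ0 : γ 0 = puncture φ 0 * (1 - ε) := by simp [hγ, arcStep]; ring
  have hγ1 : γ 1 = puncture φ 0 * (1 + ε) := by
    have : exp (α * Real.pi * (1 : ℝ) * I) = -1 := by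
      rcases hα with rfl | rfl
      · simp
      · simp [exp_neg]
    rw [hγ]
    simp only [arcStep, this]
    ring
  have hsec : ∀ s ∈ Ioo (0 : ℝ) 1, γ s ∈ sector φ α 1 := fun s hs => by
    refine ⟨?_, ?_⟩
    · rw [hγ, wallA_arc]
      have h1 : 0 < Real.sin (Real.pi * s) := Real.sin_pos_of_pos_of_lt_pi
        (mul_pos Real.pi_pos hs.1) (mul_lt_of_lt_one_right Real.pi_pos hs.2)
      rcases hα with rfl | rfl
      · rw [one_mul, one_mul]; positivity
      · rw [neg_one_mul, neg_one_mul, neg_mul, Real.sin_neg, mul_neg, neg_neg]; positivity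
    · rw [one_mul]
      exact wallB_arc_pos (by rwa [abs_of_pos h0])
  have hm0 : γ 0 ∈ slitDomain φ := by
    rw [hγ0]
    refine mem_slitDomain_of_norm_lt ?_
    rw [norm_mul, norm_puncture, one_mul, ← ofReal_one, ← ofReal_sub, norm_real, Real.norm_eq_abs,
      abs_of_pos (by linarith)]
    linarith
  have hm1 : (γ 1)⁻¹ ∈ slitDomain φ := by
    rw [hγ1]
    refine mem_slitDomain_of_norm_lt ?_
    rw [norm_inv, norm_mul, norm_puncture, one_mul, ← ofReal_one, ← ofReal_add, norm_real,
      Real.norm_eq_abs, abs_of_pos (by linarith)]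
    exact inv_lt_one_of_one_lt₀ (by linarith)
  have hne1 : γ 1 ≠ 0 := by
    rw [hγ1]
    refine mul_ne_zero (puncture_ne_zero φ 0) ?_
    rw [← ofReal_one, ← ofReal_add, ofReal_ne_zero]; linarith
  -- Neither frame serves the whole closed arc: the end point lies on a slit, and the inverse of the
  -- starting point does too. `f` glues the two; the descriptions agree on the open arc.
  set f : ℝ → Mat ℂ := fun s => if s ≤ 0 then frame φ a (γ s) else K * outFrame φ a (γ s) with hf
  have e1 : ∀ s ∈ Ico (0 : ℝ) 1, f s = frame φ a (γ s) := fun s hs => by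
    rw [hf]
    by_cases h : s ≤ 0
    · simp only [if_pos h]
    · simp only [if_neg h]
      exact (hK _ (hsec s ⟨not_le.1 h, hs.2⟩)).symm
  have e2 : ∀ s ∈ Ioc (0 : ℝ) 1, f s = K * outFrame φ a (γ s) := fun s hs => by
    rw [hf]
    simp only [if_neg (not_le.2 hs.1)]
  have hin : ∀ s ∈ Ico (0 : ℝ) 1, γ s ∈ slitDomain φ := fun s hs => by
    rcases eq_or_lt_of_le hs.1 with h | h
    · rw [← h]; exact hm0
    · obtain ⟨hA, hB⟩ := walls_of_mem_sector (hsec s ⟨h, hs.2⟩)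
      exact mem_slitDomain_of_walls hA hB
  have key := eq_mul_odeSol (b := b) (Φ := f) (fun s => ?_) 1
  · rw [Icc.coe_one, e2 1 ⟨one_pos, le_rfl⟩, e1 0 ⟨le_rfl, one_pos⟩, hγ0, hγ1] at key
    exact key.symm
  · rw [hb s, arcCoeff_eq a h0.ne', mul_smul_comm]
    rcases lt_or_eq_of_le s.2.2 with h | h
    · have h1 := (hasDerivAt_frame hs a (hin s ⟨s.2.1, h⟩)).scomp_hasDerivWithinAt (s : ℝ) (h := γ)
        (hasDerivAt_arc φ α ε s).hasDerivWithinAt (s := Icc 0 1)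
      rw [e1 s ⟨s.2.1, h⟩]
      refine h1.congr_of_eventuallyEq ?_ (e1 s ⟨s.2.1, h⟩)
      filter_upwards [self_mem_nhdsWithin, mem_nhdsWithin_of_mem_nhds (Iio_mem_nhds h)] with x hx hx'
      exact e1 x ⟨hx.1, hx'⟩
    · have h1 := (hasDerivAt_const_mul (hasDerivAt_outFrame hs a hne1 hm1) K)
      rw [← h] at h1
      have h2 := h1.scomp_hasDerivWithinAt (s : ℝ) (h := γ)
        (hasDerivAt_arc φ α ε s).hasDerivWithinAt (s := Icc 0 1)
      have h3 : (s : ℝ) ∈ Ioc (0 : ℝ) 1 := ⟨by rw [h]; exact one_pos, h.le⟩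
      rw [e2 s h3, mul_assoc K]
      refine h2.congr_of_eventuallyEq ?_ (e2 s h3)
      filter_upwards [self_mem_nhdsWithin, mem_nhdsWithin_of_mem_nhds (Ioi_mem_nhds h3.1)] with
        x hx hx'
      exact e2 x ⟨hx', hx.2⟩

/-- Cayley–Hamilton for trace-free matrices: all four residues square to the scalar `quadForm a`, so
for `quadForm a = τ²` their eigenvalues are `±τ`. -/
theorem resid_sq (a : Fin 3 → ℂ) (l : Fin 4) :
    resid a l * resid a l = Mat.of4 (quadForm a) 0 0 (quadForm a) := by
  have hI := I_sq
  have hs : ∀ j, formSign l j ^ 2 = 1 := fun j => by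
    fin_cases l <;> fin_cases j <;> simp [formSign]
  apply Mat.ext4 <;> simp only [Mat.mul_apply, resid, quadForm, Mat.of4_00, Mat.of4_01, Mat.of4_10,
    Mat.of4_11]
  · linear_combination I ^ 2 * a 0 ^ 2 * hs 0 + a 1 ^ 2 * hs 1 - I ^ 2 * a 2 ^ 2 * hs 2 +
      (a 0 ^ 2 - a 2 ^ 2) * hI
  · ring
  · ring
  · linear_combination I ^ 2 * a 0 ^ 2 * hs 0 + a 1 ^ 2 * hs 1 - I ^ 2 * a 2 ^ 2 * hs 2 +
      (a 0 ^ 2 - a 2 ^ 2) * hI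

/-- The coefficient is constant with scalar square, so its exponential is a cosine plus a sine times
the residue. -/
theorem odeSol_arc_zero {a : Fin 3 → ℂ} {τ : ℝ} (hτ : τ ≠ 0) (hq : quadForm a = (τ : ℂ) ^ 2)
    {α : ℝ} (hα : α ^ 2 = 1) {b : C(unitInterval, Mat ℂ)}
    (hb : ∀ s : unitInterval, b s = (I * (α * Real.pi)) • resid a 0) :
    odeSol b 1 = (Real.cos (Real.pi * τ) : ℂ) • (1 : Mat ℂ) +
      (I * α * (Real.sin (Real.pi * τ) / τ)) • resid a 0 := by
  have hτ' : (τ : ℂ) ≠ 0 := by exact_mod_cast hτ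
  have hsq := resid_sq a 0
  rw [hq] at hsq
  have key := odeSol_eq_of_hasDerivWithinAt (b := b) (Φ := fun s =>
    (Real.cos (Real.pi * τ * s) : ℂ) • (1 : Mat ℂ) +
      (I * α * (Real.sin (Real.pi * τ * s) / τ)) • resid a 0) (by simp) (fun s => ?_) 1
  · simpa [-ofReal_cos, -ofReal_sin] using key
  · have hl : HasDerivAt (fun s : ℝ => Real.pi * τ * s) (Real.pi * τ) (s : ℝ) := by
      simpa using (hasDerivAt_id (s : ℝ)).const_mul (Real.pi * τ)
    have h1 := (hl.cos.ofReal_comp).smul_const (1 : Mat ℂ)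
    have h2 := ((hl.sin.ofReal_comp).div_const (τ : ℂ)).const_mul (I * α) |>.smul_const (resid a 0)
    convert! (h1.add h2).hasDerivWithinAt using 1
    rw [hb, mul_smul_comm, add_mul, smul_mul_assoc, smul_mul_assoc, one_mul, hsq]
    have hI := I_sq
    have hα' : (α : ℂ) ^ 2 = 1 := by exact_mod_cast hα
    have hd : ∀ c : ℂ, c * (Real.pi * τ) / τ = c * Real.pi := fun c => by field_simp
    have hu : ∀ u : ℂ, u / τ * τ ^ 2 = u * τ := fun u => by field_simp
    have hαI : (I * α) ^ 2 = -1 := by rw [mul_pow, hI, hα', mul_one]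
    push_cast [-ofReal_cos, -ofReal_sin]
    rw [hd]
    generalize (Real.cos (Real.pi * τ * s) : ℂ) = c
    have hu := hu (Real.sin (Real.pi * τ * s) : ℂ)
    generalize (Real.sin (Real.pi * τ * s) : ℂ) = u at *
    generalize u / τ = w at *
    apply Mat.ext4 <;> simp only [Mat.smul_apply, Mat.add_apply, Mat.of4_00, Mat.of4_01, Mat.of4_10,
      Mat.of4_11, Mat.one_apply, smul_eq_mul, if_true, if_false, zero_ne_one,
      one_ne_zero]
    · linear_combination (Real.pi * w * τ ^ 2) * hαI - Real.pi * hu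
    · ring
    · ring
    · linear_combination (Real.pi * w * τ ^ 2) * hαI - Real.pi * hu

theorem tr_resid (a : Fin 3 → ℂ) (l : Fin 4) : resid a l 0 0 + resid a l 1 1 = 0 := by
  simp [resid]

/-- The monodromy around the first puncture. -/
theorem upFun_mul_loFun_add (hφ : φ ∈ Ioo 0 (Real.pi / 2)) {a : Fin 3 → ℂ} {τ : ℝ} (hτ : τ ≠ 0)
    (hq : quadForm a = (τ : ℂ) ^ 2) :
    upFun (Real.pi / 2 - φ) (swapParam a) * loFun φ a +
      upFun φ a * loFun (Real.pi / 2 - φ) (swapParam a) = 2 * Real.cos (2 * Real.pi * τ) := by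
  have hsin : 0 < Real.sin (2 * φ) :=
    Real.sin_pos_of_pos_of_lt_pi (by linarith [hφ.1]) (by linarith [hφ.2])
  set r := Real.sin (2 * φ) / 2 with hr
  have hr0 : 0 < r := by positivity
  have hr' : r < Real.sin (2 * φ) := by linarith
  set T : ℝ → Icc (0 : ℝ) r → Mat ℂ := fun α ε => odeSol (arcFamily hφ a α hr' ε) 1 with hT
  have hcont : ∀ α, Continuous (T α) := fun α =>
    (ContinuousMap.evalCLM (M := Mat ℂ) ℝ (1 : unitInterval)).continuous.comp
      ((contDiff_odeSol (B := Mat ℂ) ℝ).continuous.comp (arcFamily hφ a α hr').continuous)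
  have hent : ∀ α i j, Continuous fun ε => T α ε i j := fun α i j =>
    (Mat.entry (A := ℂ) ℂ i j).continuous.comp (hcont α)
  have htr : Continuous fun ε => Mat.tr (T 1 ε * Mat.adj (T (-1) ε)) := by
    have h := hent
    simp only [Mat.tr, Mat.mul_apply, Mat.adj, Mat.of4_00, Mat.of4_01, Mat.of4_10, Mat.of4_11]
    exact ((((h 1 0 0).mul (h (-1) 1 1)).add ((h 1 0 1).mul (h (-1) 1 0).neg))).add
      (((h 1 1 0).mul (h (-1) 0 1).neg).add ((h 1 1 1).mul (h (-1) 0 0)))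
  -- The two half arcs form a loop around the puncture, so the trace does not depend on the radius
  -- and is given by the two sector factors.
  have hpos : ∀ ε : Icc (0 : ℝ) r, 0 < (ε : ℝ) → Mat.tr (T 1 ε * Mat.adj (T (-1) ε)) =
      upFun (Real.pi / 2 - φ) (swapParam a) * loFun φ a +
      upFun φ a * loFun (Real.pi / 2 - φ) (swapParam a) := fun ε hε => by
    have hε2 : (ε : ℝ) < Real.sin (2 * φ) := ε.2.2.trans_lt hr'
    have hε1 : (ε : ℝ) < 1 := hε2.trans_le (Real.sin_le_one _)
    have h1 := frame_arc hφ a (Or.inl rfl) hε hε2 (fun z => frame_eq_of_mem_sector_one hφ a)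
      (arcFamily_apply hφ a 1 hr' ε)
    have h2 := frame_arc hφ a (Or.inr rfl) hε hε2 (fun z => frame_eq_of_mem_sector_I hφ a)
      (arcFamily_apply hφ a (-1) hr' ε)
    have hE : Mat.det2 (frame φ a (puncture φ 0 * (1 - ε))) = 1 := by
      refine det2_frame a (mem_slitDomain_of_norm_lt ?_)
      rw [norm_mul, norm_puncture, one_mul, ← ofReal_one, ← ofReal_sub, norm_real,
        Real.norm_eq_abs, abs_of_pos (by linarith)]
      linarith
    have hW : Mat.det2 (outFrame φ a (puncture φ 0 * (1 + ε))) = -1 := by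
      refine det2_outFrame a (mem_slitDomain_of_norm_lt ?_)
      rw [norm_inv, norm_mul, norm_puncture, one_mul, ← ofReal_one, ← ofReal_add, norm_real,
        Real.norm_eq_abs, abs_of_pos (by linarith)]
      exact inv_lt_one_of_one_lt₀ (by linarith)
    rw [Mat.tr_transport hE hW h1 h2, tr_factorOne_mul hφ, neg_neg]
  have hzero : Mat.tr (T 1 ⟨0, le_rfl, hr0.le⟩ * Mat.adj (T (-1) ⟨0, le_rfl, hr0.le⟩)) =
      2 * Real.cos (2 * Real.pi * τ) := by
    have hb : ∀ α, ∀ s : unitInterval, arcFamily hφ a α hr' ⟨0, le_rfl, hr0.le⟩ s =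
        (I * (α * Real.pi)) • resid a 0 := fun α s => by
      rw [arcFamily_apply, arcCoeff]
      have : arcStep φ α 0 s = 0 := by simp [arcStep]
      simp only [this, zero_smul, add_zero]
    have hτ' : (τ : ℂ) ≠ 0 := by exact_mod_cast hτ
    have e1 : T 1 ⟨0, le_rfl, hr0.le⟩ = _ := odeSol_arc_zero hτ hq (by norm_num) (hb 1)
    have e2 : T (-1) ⟨0, le_rfl, hr0.le⟩ = _ := odeSol_arc_zero hτ hq (by norm_num) (hb (-1))
    have hsq := resid_sq a 0
    rw [hq] at hsq
    have h00 : resid a 0 0 0 * resid a 0 0 0 + resid a 0 0 1 * resid a 0 1 0 = τ ^ 2 := by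
      rw [← Mat.mul_apply, hsq]; rfl
    have htr := tr_resid a 0
    have hw : (Real.sin (Real.pi * τ) : ℂ) = Real.sin (Real.pi * τ) / τ * τ := by field_simp
    have hcs := cos_sq_add_sin_sq_cast (Real.pi * τ)
    have h2τ : Real.cos (2 * Real.pi * τ) = 2 * Real.cos (Real.pi * τ) ^ 2 - 1 := by
      rw [← Real.cos_two_mul, mul_assoc]
    rw [e1, e2, h2τ]
    push_cast [-ofReal_cos, -ofReal_sin]
    generalize (Real.cos (Real.pi * τ) : ℂ) = c at *
    generalize (Real.sin (Real.pi * τ) : ℂ) = u at *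
    generalize u / τ = w at *
    have hI := I_sq
    have h11 : resid a 0 1 1 = -resid a 0 0 0 := by linear_combination htr
    simp only [Mat.tr, Mat.adj, Mat.mul_apply, Mat.smul_apply, Mat.add_apply, Mat.of4_00,
      Mat.of4_01, Mat.of4_10, Mat.of4_11, Mat.one_apply, smul_eq_mul, if_true,
      if_false, zero_ne_one, one_ne_zero, h11]
    rw [hw] at hcs
    linear_combination (2 * I ^ 2 * w ^ 2) * h00 + (2 * w ^ 2 * τ ^ 2) * hI - 2 * hcs
  rw [← hzero]
  -- The trace is continuous up to radius `0`, where it is `2 cos 2πτ`, and constant on the dense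
  -- set of positive radii.
  have hden : Dense {ε : Icc (0 : ℝ) r | 0 < (ε : ℝ)} := by
    rw [Metric.dense_iff]
    intro ε δ hδ
    have he := ε.2
    refine ⟨⟨min r (ε + δ / 2), ?_, min_le_left _ _⟩, ?_, ?_⟩
    · exact le_min hr0.le (by linarith [he.1])
    · rw [Metric.mem_ball, Subtype.dist_eq, Real.dist_eq, abs_lt]
      have h1 : (ε : ℝ) ≤ min r (ε + δ / 2) := le_min he.2 (by linarith)
      have h2 : min r (ε + δ / 2) ≤ ε + δ / 2 := min_le_right _ _
      constructor <;> dsimp only <;> linarith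
    · exact lt_min hr0 (by linarith [he.1])
  have := Continuous.ext_on hden htr continuous_const (fun ε hε => hpos ε hε)
  exact (congrFun this _).symm

/-- For a matrix with rows `(a, b)` and `(c, d)` one has `(a² - b²)(d² - c²) + (ac - bd)² = (ad -
bc)²`, and the determinant is one. -/
theorem upFun_mul_loFun (φ : ℝ) (a : Fin 3 → ℂ) : upFun φ a * loFun φ a = 1 - pFun φ a ^ 2 := by
  have h := det2_halfMon φ a
  rw [Mat.det2] at h
  rw [upFun, loFun, pFun]
  linear_combination (halfMon φ a 0 0 * halfMon φ a 1 1 - halfMon φ a 0 1 * halfMon φ a 1 0 + 1) * h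

/-- The function `vFun` is a square root of the negative Fricke discriminant. -/
theorem vFun_sq (hφ : φ ∈ Ioo 0 (Real.pi / 2)) {a : Fin 3 → ℂ} {τ : ℝ} (hτ : τ ≠ 0)
    (hq : quadForm a = (τ : ℂ) ^ 2) : vFun φ a ^ 2 =
      4 * Real.cos (2 * Real.pi * τ) ^ 2 - 4 * (1 - pFun φ a ^ 2) * (1 - qFun φ a ^ 2) := by
  have h1 := upFun_mul_loFun_add hφ hτ hq
  have h2 := upFun_mul_loFun φ a
  have h3 := upFun_mul_loFun (Real.pi / 2 - φ) (swapParam a)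
  rw [vFun, qFun]
  -- The square of a difference is the square of the sum minus four times the product. The sum is
  -- the local trace `2 cos 2πτ`, the product is `(1 - 𝔭²)(1 - 𝔮²)`.
  linear_combination (upFun (Real.pi / 2 - φ) (swapParam a) * loFun φ a +
      upFun φ a * loFun (Real.pi / 2 - φ) (swapParam a) + 2 * Real.cos (2 * Real.pi * τ)) * h1 -
    4 * upFun (Real.pi / 2 - φ) (swapParam a) * loFun (Real.pi / 2 - φ) (swapParam a) * h2 -
    4 * (1 - pFun φ a ^ 2) * h3

end Arcs

end Lawson

namespace Lawson

open ContDiff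

set_option linter.unusedSectionVars false

/-! ### Growth of intertwiners at a puncture -/

section Growth

/-- The point is the bound on `T`: in an eigenbasis the residue has norm exactly its eigenvalue, and
this controls the growth exponent. The matrix `A + diag(τ, -τ)` intertwines `A` with `diag(τ, -τ)`
when `τ² = t²`. -/
theorem exists_diagonalizer {A : Mat ℂ} {t : ℝ} (ht : t ≠ 0) (htr : A 0 0 + A 1 1 = 0)
    (hA : A * A = Mat.of4 ((t : ℂ) ^ 2) 0 0 ((t : ℂ) ^ 2)) :
    ∃ S T : Mat ℂ, Mat.det2 S ≠ 0 ∧ Mat.adj S * A = T * Mat.adj S ∧ A * S = S * T ∧ ‖T‖ ≤ |t| := by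
  have h11 : A 1 1 = -A 0 0 := by linear_combination htr
  have h00 : A 0 0 * A 0 0 + A 0 1 * A 1 0 = (t : ℂ) ^ 2 := by rw [← Mat.mul_apply, hA]; rfl
  have key : ∀ τ : ℂ, τ ^ 2 = (t : ℂ) ^ 2 → A 0 0 + τ ≠ 0 → ∃ S T : Mat ℂ, Mat.det2 S ≠ 0 ∧
      Mat.adj S * A = T * Mat.adj S ∧ A * S = S * T ∧ ‖T‖ ≤ |t| := by
    intro τ hτ h
    have hτ0 : τ ≠ 0 := by
      rintro rfl
      have : (t : ℂ) ^ 2 = 0 := by rw [← hτ]; ring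
      exact ht (by exact_mod_cast pow_eq_zero_iff (two_ne_zero) |>.1 this)
    have hn : ‖τ‖ = |t| := by
      have := congrArg norm hτ
      rw [norm_pow, norm_pow, norm_real, Real.norm_eq_abs] at this
      exact (pow_left_inj₀ (norm_nonneg _) (abs_nonneg _) two_ne_zero).1 this
    refine ⟨A + Mat.of4 τ 0 0 (-τ), Mat.of4 τ 0 0 (-τ), ?_, ?_, ?_, ?_⟩
    · have : Mat.det2 (A + Mat.of4 τ 0 0 (-τ)) = -2 * τ * (A 0 0 + τ) := by
        simp only [Mat.det2, Mat.add_apply, Mat.of4_00, Mat.of4_01, Mat.of4_10, Mat.of4_11, h11]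
        linear_combination -h00 + hτ
      rw [this]
      exact mul_ne_zero (mul_ne_zero (by norm_num) hτ0) h
    · apply Mat.ext4 <;> simp only [Mat.mul_apply, Mat.adj, Mat.add_apply, Mat.of4_00, Mat.of4_01,
        Mat.of4_10, Mat.of4_11, h11]
      · linear_combination -h00 + hτ
      · ring
      · ring
      · linear_combination -h00 + hτ
    · apply Mat.ext4 <;> simp only [Mat.mul_apply, Mat.add_apply, Mat.of4_00, Mat.of4_01,
        Mat.of4_10, Mat.of4_11, h11]
      · linear_combination h00 - hτ
      · ring
      · ring
      · linear_combination h00 - hτ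
    · rw [Mat.norm_le_iff]
      intro i
      fin_cases i <;> simp [hn]
  -- Since `t ≠ 0`, at least one of the signs `τ = ±t` makes the intertwining matrix invertible.
  by_cases h : A 0 0 + t = 0
  · refine key (-t) (by ring) fun h' => ht ?_
    have : (t : ℂ) = 0 := by linear_combination (h - h') / 2
    exact_mod_cast this
  · exact key t rfl h

/-- Flat sections of a tensor product of Fuchsian systems with small residues grow slowly. -/
theorem isLittleO_of_fuchsian {A B : Mat ℂ} {t : ℝ} (ht : 0 < t) (ht' : t < 1 / 8)
    (hAt : A 0 0 + A 1 1 = 0) (hA : A * A = Mat.of4 ((t : ℂ) ^ 2) 0 0 ((t : ℂ) ^ 2))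
    (hBt : B 0 0 + B 1 1 = 0) (hB : B * B = Mat.of4 ((t : ℂ) ^ 2) 0 0 ((t : ℂ) ^ 2))
    {p : ℂ} {r C : ℝ} (hr : 0 < r) {R R' Y : ℂ → Mat ℂ}
    (hR : ∀ z, ‖z - p‖ ≤ r → ‖R z‖ ≤ C) (hR' : ∀ z, ‖z - p‖ ≤ r → ‖R' z‖ ≤ C)
    (hY : ∀ z, z ≠ p → ‖z - p‖ ≤ r → HasDerivAt Y
      (Y z * ((z - p)⁻¹ • B + R' z) - ((z - p)⁻¹ • A + R z) * Y z) z) (i j : Fin 2) :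
    (fun z => Y z i j) =o[nhdsWithin p {p}ᶜ] fun z => (z - p)⁻¹ := by
  obtain ⟨S, T, hS, hSA, -, hT⟩ := exists_diagonalizer ht.ne' hAt hA
  obtain ⟨S', T', hS', -, hBS, hT'⟩ := exists_diagonalizer ht.ne' hBt hB
  rw [abs_of_pos ht] at hT hT'
  have hC : 0 ≤ C := (norm_nonneg _).trans (hR p (by simpa using hr.le))
  set c : ℂ := (Mat.det2 S * Mat.det2 S')⁻¹ with hc
  have hinv : ∀ M : Mat ℂ, M = c • (S * (Mat.adj S * M * S') * Mat.adj S') := fun M => by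
    have h1 := Mat.mul_adj' S rfl
    have h2 := Mat.mul_adj' S' rfl
    have h3 : S * (Mat.adj S * M * S') * Mat.adj S' = (S * Mat.adj S) * M * (S' * Mat.adj S') := by
      noncomm_ring
    rw [h3, h1, h2, hc]
    apply Mat.ext4 <;> simp only [Mat.mul_apply, Mat.smul_apply, Mat.of4_00, Mat.of4_01,
      Mat.of4_10, Mat.of4_11, smul_eq_mul] <;> field_simp <;> ring
  set k : ℝ := ‖c‖ * ‖S‖ * ‖Mat.adj S'‖ with hk
  have hk0 : 0 ≤ k := by positivity
  have hback : ∀ M : Mat ℂ, ‖M‖ ≤ k * ‖Mat.adj S * M * S'‖ := fun M => by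
    conv_lhs => rw [hinv M]
    refine (norm_smul_le _ _).trans ?_
    calc ‖c‖ * ‖S * (Mat.adj S * M * S') * Mat.adj S'‖
        ≤ ‖c‖ * (‖S‖ * ‖Mat.adj S * M * S'‖ * ‖Mat.adj S'‖) := by
          gcongr
          exact (norm_mul_le _ _).trans (by gcongr; exact norm_mul_le _ _)
      _ = _ := by rw [hk]; ring
  set C₁ : ℝ := 2 * ‖Mat.adj S‖ * ‖S'‖ * C * k with hC1
  have hC10 : 0 ≤ C₁ := by positivity
  -- In eigenbases of both residues the singular part of the equation for `W` has norm at most `2t /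
  -- |z - p|`.
  set W : ℂ → Mat ℂ := fun z => Mat.adj S * Y z * S' with hW
  set V : ℂ → Mat ℂ := fun z => (z - p)⁻¹ • (W z * T' - T * W z) +
    Mat.adj S * (Y z * R' z - R z * Y z) * S' with hV
  have hWd : ∀ z, z ≠ p → ‖z - p‖ ≤ r → HasDerivAt W (V z) z := fun z hz hzr => by
    have h := hasDerivAt_mul_const (hasDerivAt_const_mul (hY z hz hzr) (Mat.adj S)) S'
    convert! h using 1
    rw [hV, hW]
    have e1 : Mat.adj S * (Y z * ((z - p)⁻¹ • B + R' z) - ((z - p)⁻¹ • A + R z) * Y z) * S' =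
        (z - p)⁻¹ • (Mat.adj S * Y z * (B * S') - (Mat.adj S * A) * Y z * S') +
        Mat.adj S * (Y z * R' z - R z * Y z) * S' := by
      simp only [mul_add, add_mul, mul_sub, sub_mul, smul_mul_assoc, mul_smul_comm, smul_sub,
        mul_assoc]
      abel
    rw [e1, hBS, hSA]
    simp only [mul_assoc]
  have hVb : ∀ z, z ≠ p → ‖z - p‖ ≤ r → ‖(z - p) • V z‖ ≤ (2 * t + C₁ * ‖z - p‖) * ‖W z‖ :=
      fun z hz hzr => by
    have h0 : z - p ≠ 0 := sub_ne_zero.2 hz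
    have e : (z - p) • V z = (W z * T' - T * W z) +
        (z - p) • (Mat.adj S * (Y z * R' z - R z * Y z) * S') := by
      rw [hV]
      simp only [smul_add, smul_smul, mul_inv_cancel₀ h0, one_smul]
    rw [e]
    have h1 : ‖W z * T' - T * W z‖ ≤ 2 * t * ‖W z‖ := by
      refine (norm_sub_le _ _).trans ?_
      have h2 := (norm_mul_le (W z) T').trans (mul_le_mul_of_nonneg_left hT' (norm_nonneg _))
      have h3 := (norm_mul_le T (W z)).trans (mul_le_mul_of_nonneg_right hT (norm_nonneg _))
      linarith
    have h4 : ‖Mat.adj S * (Y z * R' z - R z * Y z) * S'‖ ≤ C₁ * ‖W z‖ := by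
      have h5 : ‖Y z * R' z - R z * Y z‖ ≤ 2 * C * ‖Y z‖ := by
        refine (norm_sub_le _ _).trans ?_
        have h2 := (norm_mul_le (Y z) (R' z)).trans
          (mul_le_mul_of_nonneg_left (hR' z hzr) (norm_nonneg _))
        have h3 := (norm_mul_le (R z) (Y z)).trans
          (mul_le_mul_of_nonneg_right (hR z hzr) (norm_nonneg _))
        linarith
      calc ‖Mat.adj S * (Y z * R' z - R z * Y z) * S'‖
          ≤ ‖Mat.adj S‖ * ‖Y z * R' z - R z * Y z‖ * ‖S'‖ :=
            (norm_mul_le _ _).trans (by gcongr; exact norm_mul_le _ _)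
        _ ≤ ‖Mat.adj S‖ * (2 * C * (k * ‖W z‖)) * ‖S'‖ := by
            gcongr
            refine h5.trans ?_
            gcongr
            exact hback (Y z)
        _ = C₁ * ‖W z‖ := by rw [hC1]; ring
    calc ‖(W z * T' - T * W z) + (z - p) • (Mat.adj S * (Y z * R' z - R z * Y z) * S')‖
        ≤ 2 * t * ‖W z‖ + ‖z - p‖ * (C₁ * ‖W z‖) := by
          refine (norm_add_le _ _).trans (add_le_add h1 ?_)
          refine (norm_smul_le _ _).trans ?_
          gcongr
      _ = _ := by ring
  -- With `t < 1/8` and this radius, `2t + C₁ |z - p| ≤ 1/2`, so the growth exponent stays below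
  -- that of a simple pole.
  set e₀ : ℝ := min r (1 / (4 * (C₁ + 1))) with he0
  have he0p : 0 < e₀ := lt_min hr (by positivity)
  have he0r : e₀ ≤ r := min_le_left _ _
  have he0C : C₁ * e₀ ≤ 1 / 4 := by
    have h1 : e₀ ≤ 1 / (4 * (C₁ + 1)) := min_le_right _ _
    have h2 : e₀ * (4 * (C₁ + 1)) ≤ 1 := by rwa [le_div_iff₀ (by positivity)] at h1
    nlinarith
  obtain ⟨M, hM⟩ : ∃ M, ∀ z ∈ Metric.sphere p e₀, ‖W z‖ ≤ M := by
    refine (isCompact_sphere p e₀).exists_bound_of_continuousOn fun z hz => ?_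
    rw [mem_sphere_iff_norm] at hz
    refine (hWd z ?_ (hz.le.trans he0r)).continuousAt.continuousWithinAt
    rintro rfl
    rw [sub_self, norm_zero] at hz
    exact he0p.ne hz
  have hWb : ∀ z, z ≠ p → ‖z - p‖ ≤ e₀ → ‖W z‖ ≤ M * Real.sqrt (e₀ / ‖z - p‖) := by
    intro z hz hze
    have hn : 0 < ‖z - p‖ := norm_pos_iff.2 (sub_ne_zero.2 hz)
    set u : ℝ := Real.log (e₀ / ‖z - p‖) with hu
    have hexp : Real.exp u = e₀ / ‖z - p‖ := Real.exp_log (by positivity)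
    have hu0 : 0 ≤ u := Real.log_nonneg ((one_le_div hn).2 hze)
    set w : ℂ := (e₀ / ‖z - p‖ : ℝ) • (z - p) with hw
    have hwn : ‖w‖ = e₀ := by
      rw [hw, norm_smul, Real.norm_eq_abs, abs_of_pos (by positivity)]
      field_simp
    have hw0 : w ≠ 0 := by rw [← norm_pos_iff, hwn]; exact he0p
    -- In logarithmic time along the radius the Fuchsian equation becomes regular, and Grönwall's
    -- inequality with constant `1/2` gives growth at most `|z - p|^(-1/2)`.
    set γ : ℝ → ℂ := fun s => p + w * exp (-(s : ℂ)) with hγ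
    have hγn : ∀ s : ℝ, ‖γ s - p‖ = e₀ * Real.exp (-s) := fun s => by
      rw [hγ]
      simp only [add_sub_cancel_left, norm_mul, hwn]
      rw [← ofReal_neg, norm_exp_ofReal]
    have hγp : ∀ s, γ s ≠ p := fun s h => by
      have := hγn s
      rw [h, sub_self, norm_zero] at this
      have h2 := mul_pos he0p (Real.exp_pos (-s))
      linarith
    have hγle : ∀ s, 0 ≤ s → ‖γ s - p‖ ≤ e₀ := fun s hs => by
      rw [hγn]
      exact mul_le_of_le_one_right he0p.le (Real.exp_le_one_iff.2 (by linarith))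
    have hγd : ∀ s : ℝ, HasDerivAt γ (-(γ s - p)) s := fun s => by
      have h1 : HasDerivAt (fun s : ℝ => -(s : ℂ)) (-1) s := (ofRealCLM.hasDerivAt (x := s)).neg
      have h2 := (h1.cexp.const_mul w).const_add p
      convert! h2 using 1
      rw [hγ]; ring
    have hd : ∀ s, 0 ≤ s → HasDerivAt (fun s => W (γ s)) (-((γ s - p) • V (γ s))) s := fun s hs => by
      have h := (hWd _ (hγp s) ((hγle s hs).trans he0r)).scomp s (hγd s)
      rw [neg_smul] at h
      exact h
    have hg := norm_le_gronwallBound_of_norm_deriv_right_le (f := fun s => W (γ s))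
      (f' := fun s => -((γ s - p) • V (γ s))) (δ := M) (K := 1 / 2) (ε := 0) (a := 0) (b := u)
      (fun s hs => (hd s hs.1).continuousAt.continuousWithinAt)
      (fun s hs => (hd s hs.1).hasDerivWithinAt) (hM _ (by
        rw [mem_sphere_iff_norm, hγn]; simp)) (fun s hs => by
        rw [norm_neg, add_zero]
        refine (hVb _ (hγp s) ((hγle s hs.1).trans he0r)).trans ?_
        gcongr
        have := mul_le_mul_of_nonneg_left (hγle s hs.1) hC10
        linarith) u ⟨hu0, le_rfl⟩
    have hγu : γ u = z := by
      have : exp (-(u : ℂ)) = ((‖z - p‖ / e₀ : ℝ) : ℂ) := by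
        rw [← ofReal_neg, ← ofReal_exp, Real.exp_neg, hexp, inv_div]
      rw [hγ]
      simp only [this, hw, real_smul]
      have h1 : (‖z - p‖ : ℂ) ≠ 0 := by exact_mod_cast hn.ne'
      have h2 : (e₀ : ℂ) ≠ 0 := by exact_mod_cast he0p.ne'
      push_cast
      field_simp
      ring
    rw [gronwallBound_ε0, sub_zero, hγu] at hg
    have hs : Real.exp (1 / 2 * u) = Real.sqrt (e₀ / ‖z - p‖) := by
      rw [← hexp, Real.sqrt_eq_rpow, ← Real.exp_mul]
      congr 1; ring
    rwa [hs] at hg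
  rw [Asymptotics.isLittleO_iff]
  intro ε hε
  have hM0 : 0 ≤ M := by
    have h1 : ‖(p + (e₀ : ℂ)) - p‖ = e₀ := by simp [abs_of_pos he0p]
    exact (norm_nonneg _).trans (hM (p + e₀) (by rw [mem_sphere_iff_norm, h1]))
  have hlim : Filter.Tendsto (fun z => k * M * Real.sqrt (e₀ * ‖z - p‖)) (nhdsWithin p {p}ᶜ)
      (nhds 0) := by
    have : Continuous fun z : ℂ => k * M * Real.sqrt (e₀ * ‖z - p‖) := by fun_prop
    have h := (this.tendsto p).mono_left (nhdsWithin_le_nhds (s := {p}ᶜ))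
    simpa using h
  have hball : ∀ᶠ z in nhdsWithin p {p}ᶜ, ‖z - p‖ ≤ e₀ := by
    refine mem_nhdsWithin_of_mem_nhds (Filter.mem_of_superset (Metric.ball_mem_nhds p he0p) ?_)
    intro z hz
    rw [mem_ball_iff_norm] at hz
    exact hz.le
  filter_upwards [hlim.eventually (gt_mem_nhds hε), hball, self_mem_nhdsWithin] with z h1 h2 h3
  have hn : 0 < ‖z - p‖ := norm_pos_iff.2 (sub_ne_zero.2 h3)
  calc ‖Y z i j‖ ≤ k * (M * Real.sqrt (e₀ / ‖z - p‖)) :=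
        (Mat.norm_entry_le _ _ _).trans ((hback (Y z)).trans (by gcongr; exact hWb z h3 h2))
    _ = (k * M * Real.sqrt (e₀ * ‖z - p‖)) * ‖z - p‖⁻¹ := by
        have : e₀ / ‖z - p‖ = (e₀ * ‖z - p‖) / ‖z - p‖ ^ 2 := by field_simp
        rw [this, Real.sqrt_div' _ (by positivity), Real.sqrt_sq hn.le]
        field_simp
    _ ≤ ε * ‖(z - p)⁻¹‖ := by rw [norm_inv]; gcongr

end Growth

end Lawson

/-! ### Differentiation of adjugates and removable singularities -/

namespace Mat

variable {A : Type*} [NormedCommRing A]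

theorem adj_flip (M : Mat A) : adj (flip M) = flip (adj M) := by
  apply ext4 <;> simp [adj, flip]

theorem adj_of_trace {M : Mat A} (h : M 0 0 + M 1 1 = 0) : adj M = -M := by
  apply ext4 <;> simp only [adj, neg_apply, of4_00, of4_01, of4_10, of4_11]
  · linear_combination h
  · linear_combination h

theorem hasDerivAt_adj {F : ℂ → Mat ℂ} {F' : Mat ℂ} {z : ℂ} (h : HasDerivAt F F' z) :
    HasDerivAt (fun w => adj (F w)) (adj F') z := by
  have h' := hasDerivAt_iff.1 h
  rw [hasDerivAt_iff]
  intro i j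
  fin_cases i <;> fin_cases j
  · exact h' 1 1
  · exact (h' 0 1).neg
  · exact (h' 1 0).neg
  · exact h' 0 0

end Mat

/-- Isolated singularities weaker than simple poles can be removed simultaneously. -/
theorem exists_entire_of_isLittleO (S : Finset ℂ) : ∀ f : ℂ → ℂ,
    (∀ z ∉ S, DifferentiableAt ℂ f z) →
    (∀ p ∈ S, f =o[nhdsWithin p {p}ᶜ] fun z => (z - p)⁻¹) →
    ∃ g : ℂ → ℂ, Differentiable ℂ g ∧ ∀ z ∉ S, g z = f z := by
  induction S using Finset.induction_on with
  | empty => exact fun f hf _ => ⟨f, fun z => hf z (by simp), fun _ _ => rfl⟩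
  | insert p S hp ih =>
    intro f hf ho
    set f' := Function.update f p ((nhdsWithin p {p}ᶜ).limUnder f) with hf'
    have hopen : IsOpen ((S : Set ℂ)ᶜ) := S.finite_toSet.isClosed.isOpen_compl
    have hpU : (S : Set ℂ)ᶜ ∈ nhds p := hopen.mem_nhds (by simpa using hp)
    have hd : DifferentiableOn ℂ f' (S : Set ℂ)ᶜ := by
      refine differentiableOn_update_limUnder_of_isLittleO hpU (fun z hz => ?_) ?_
      · refine (hf z ?_).differentiableWithinAt
        simp only [Finset.mem_insert, not_or]
        exact ⟨hz.2, by simpa using hz.1⟩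
      · refine (ho p (Finset.mem_insert_self _ _)).sub ?_
        refine (Asymptotics.isLittleO_const_left.2 (Or.inr ?_))
        have h1 : Filter.Tendsto (fun z : ℂ => (z - p)⁻¹) (nhdsWithin p {p}ᶜ)
            (Bornology.cobounded ℂ) := by
          refine Filter.tendsto_inv₀_nhdsNE_zero.comp ?_
          refine tendsto_nhdsWithin_iff.2 ⟨?_, ?_⟩
          · have : Continuous fun z : ℂ => z - p := by fun_prop
            have h := (this.tendsto p).mono_left (nhdsWithin_le_nhds (s := {p}ᶜ))
            simpa using h
          · filter_upwards [self_mem_nhdsWithin] with z hz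
            exact sub_ne_zero.2 hz
        exact tendsto_norm_cobounded_atTop.comp h1
    obtain ⟨g, hg, hgf⟩ := ih f' (fun z hz => hd.differentiableAt (hopen.mem_nhds (by simpa using hz)))
      (fun q hq => by
        refine (ho q (Finset.mem_insert_of_mem hq)).congr' ?_ Filter.EventuallyEq.rfl
        have hqp : q ≠ p := fun e => hp (e ▸ hq)
        filter_upwards [mem_nhdsWithin_of_mem_nhds (isOpen_ne.mem_nhds hqp)] with z hz
        exact (Function.update_of_ne hz _ _).symm)
    refine ⟨g, hg, fun z hz => ?_⟩
    rw [Finset.mem_insert, not_or] at hz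
    rw [hgf z hz.2, hf', Function.update_of_ne hz.1]

namespace Lawson

open ContDiff

set_option linter.unusedSectionVars false

/-! ### Rigidity: the monodromy determines the potential -/

section Intertwiner

variable {φ : ℝ} {z : ℂ} {a a' : Fin 3 → ℂ} {δ : Mat ℂ}

/-- The intertwiner of two systems on the slit plane. -/
noncomputable def innerTwine (φ : ℝ) (a a' : Fin 3 → ℂ) (δ : Mat ℂ) (z : ℂ) : Mat ℂ :=
  Mat.adj (frame φ a z) * δ * frame φ a' z

/-- The intertwiner of two systems near infinity. -/
noncomputable def outerTwine (φ : ℝ) (a a' : Fin 3 → ℂ) (δ : Mat ℂ) (z : ℂ) : Mat ℂ :=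
  -(Mat.adj (outFrame φ a z) * δ * outFrame φ a' z)

theorem hasDerivAt_twine {F G : ℂ → Mat ℂ} (hF : HasDerivAt F (F z * eta φ a z) z)
    (hG : HasDerivAt G (G z * eta φ a' z) z) (δ : Mat ℂ) :
    HasDerivAt (fun w => Mat.adj (F w) * δ * G w)
      (Mat.adj (F z) * δ * G z * eta φ a' z - eta φ a z * (Mat.adj (F z) * δ * G z)) z := by
  have h1 := hasDerivAt_mul_const (Mat.hasDerivAt_adj hF) δ
  have h2 := h1.mul hG
  convert! h2 using 1
  rw [Mat.adj_mul_rev, Mat.adj_of_trace (eta_trace φ a z)]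
  noncomm_ring

theorem hasDerivAt_innerTwine (hs : 0 < Real.sin φ) (hz : z ∈ slitDomain φ) :
    HasDerivAt (innerTwine φ a a' δ)
      (innerTwine φ a a' δ z * eta φ a' z - eta φ a z * innerTwine φ a a' δ z) z :=
  hasDerivAt_twine (hasDerivAt_frame hs a hz) (hasDerivAt_frame hs a' hz) δ

theorem hasDerivAt_outerTwine (hs : 0 < Real.sin φ) (h0 : z ≠ 0) (hz : z⁻¹ ∈ slitDomain φ) :
    HasDerivAt (outerTwine φ a a' δ)
      (outerTwine φ a a' δ z * eta φ a' z - eta φ a z * outerTwine φ a a' δ z) z := by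
  have h := (hasDerivAt_twine (hasDerivAt_outFrame hs a h0 hz) (hasDerivAt_outFrame hs a' h0 hz)
    δ).neg
  convert! h using 1
  rw [outerTwine]
  noncomm_ring

/-- An intertwiner of the factors passes from the interior to the exterior frames; `adj K * K = -1`
produces the sign built into `outerTwine`. -/
theorem adj_mul_mul_eq {K K' P P' : Mat ℂ} (hK : Mat.det2 K = -1) (h : K * δ = δ * K') :
    Mat.adj (K * P) * δ * (K' * P') = -(Mat.adj P * δ * P') := by
  have h1 : Mat.adj K * K = -1 := by
    rw [Mat.det2] at hK
    apply Mat.ext4 <;> simp [Mat.mul_apply, Mat.adj, Mat.one_apply, Mat.neg_apply] <;>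
      first | linear_combination hK | ring
  rw [Mat.adj_mul_rev]
  calc Mat.adj P * Mat.adj K * δ * (K' * P') = Mat.adj P * Mat.adj K * (δ * K') * P' := by
        noncomm_ring
    _ = Mat.adj P * (Mat.adj K * K) * δ * P' := by rw [← h]; noncomm_ring
    _ = _ := by rw [h1]; noncomm_ring

theorem det2_adj {A : Type*} [NormedCommRing A] (M : Mat A) :
    Mat.det2 (Mat.adj M) = Mat.det2 M := by
  simp [Mat.det2, Mat.adj]; ring

theorem det2_swap {A : Type*} [NormedCommRing A] : Mat.det2 (Mat.swap : Mat A) = -1 := by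
  simp [Mat.det2, Mat.swap]

theorem innerTwine_neg (hs : 0 < Real.sin φ) (hδ : Mat.flip δ = δ) (hz : z ∈ slitDomain φ) :
    innerTwine φ a a' δ (-z) = Mat.flip (innerTwine φ a a' δ z) := by
  rw [innerTwine, innerTwine, frame_neg hs a hz, frame_neg hs a' hz, Mat.flip_mul, Mat.flip_mul,
    hδ, Mat.adj_flip]

theorem outerTwine_neg (hs : 0 < Real.sin φ) (hδ : Mat.flip δ = δ) (hz : z⁻¹ ∈ slitDomain φ) :
    outerTwine φ a a' δ (-z) = Mat.flip (outerTwine φ a a' δ z) := by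
  have hsw : (Mat.swap : Mat ℂ) = -Mat.flip Mat.swap := by
    apply Mat.ext4 <;> simp [Mat.flip, Mat.swap, Mat.neg_apply]
  have e : ∀ a, outFrame φ a (-z) = -Mat.flip (outFrame φ a z) := fun a => by
    rw [outFrame, outFrame, inv_neg, frame_neg hs a hz, Mat.flip_mul]
    nth_rewrite 1 [hsw]
    rw [mul_neg]
  have hn : ∀ M : Mat ℂ, Mat.adj (-M) = -Mat.adj M := fun M => by
    apply Mat.ext4 <;> simp [Mat.adj, Mat.neg_apply]
  have hfn : ∀ M : Mat ℂ, Mat.flip (-M) = -Mat.flip M := fun M => by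
    apply Mat.ext4 <;> simp [Mat.flip, Mat.neg_apply]
  rw [outerTwine, outerTwine, e, e, hn, Mat.adj_flip, hfn, Mat.flip_mul, Mat.flip_mul, hδ]
  noncomm_ring

/-- The hypotheses on the factors give agreement in the sectors of `1` and `i`. The opposite sectors
follow from `z ↦ -z`, which requires `δ` to be diagonal, that is `flip δ = δ`. -/
theorem innerTwine_eq_outerTwine (hφ : φ ∈ Ioo 0 (Real.pi / 2)) (hδ : Mat.flip δ = δ)
    (h1 : factorOne φ a * δ = δ * factorOne φ a') (hI : factorI φ a * δ = δ * factorI φ a')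
    (hA : wallA φ z ≠ 0) (hB : wallB φ z ≠ 0) :
    innerTwine φ a a' δ z = outerTwine φ a a' δ z := by
  have hs := sin_pos_of_mem hφ
  have hc := cos_pos_of_mem hφ
  have d1 : Mat.det2 (factorOne φ a) = -1 := by
    rw [factorOne, Mat.det2_mul, Mat.det2_mul, det2_adj, det2_frame a (one_mem_slitDomain hs),
      det2_swap]; ring
  have dI : Mat.det2 (factorI φ a) = -1 := by
    rw [factorI, Mat.det2_mul, Mat.det2_mul, det2_adj, det2_flip,
      det2_frame a (I_mem_slitDomain hc), det2_swap]; ring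
  have key : ∀ z : ℂ, wallA φ z ≠ 0 → 0 < wallB φ z →
      innerTwine φ a a' δ z = outerTwine φ a a' δ z := by
    intro z hA hB
    rcases lt_or_gt_of_ne hA with hA | hA
    · have hz : z ∈ sector φ (-1) 1 := ⟨by linarith, by linarith⟩
      rw [innerTwine, outerTwine, frame_eq_of_mem_sector_I hφ a hz,
        frame_eq_of_mem_sector_I hφ a' hz, adj_mul_mul_eq dI hI]
    · have hz : z ∈ sector φ 1 1 := ⟨by linarith, by linarith⟩
      rw [innerTwine, outerTwine, frame_eq_of_mem_sector_one hφ a hz,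
        frame_eq_of_mem_sector_one hφ a' hz, adj_mul_mul_eq d1 h1]
  rcases lt_or_gt_of_ne hB with hB' | hB'
  · have eA : wallA φ (-z) = -wallA φ z := by rw [wallA, wallA, neg_re, neg_im]; ring
    have eB : wallB φ (-z) = -wallB φ z := by rw [wallB, wallB, neg_re, neg_im]; ring
    have h := key (-z) (by rw [eA]; exact neg_ne_zero.2 hA) (by rw [eB]; linarith)
    rw [innerTwine_neg hs hδ (mem_slitDomain_of_walls hA hB),
      outerTwine_neg hs hδ (inv_mem_slitDomain_of_walls hA hB)] at h
    rw [← Mat.flip_flip (innerTwine φ a a' δ z), h, Mat.flip_flip]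
  · exact key z hA hB'

/-- The punctures come in opposite pairs, so outside the unit circle the lines through them are
covered by the slits. -/
theorem walls_ne_zero (hz : z ∈ slitDomain φ) (hn : 1 < ‖z‖) : wallA φ z ≠ 0 ∧ wallB φ z ≠ 0 := by
  have h := Real.cos_sq_add_sin_sq φ
  have key : ∀ (j k : Fin 4), puncture φ k = -puncture φ j → ∀ x : ℝ, z ≠ x * puncture φ j := by
    intro j k hjk x e
    have hx : 1 < |x| := by
      rw [e, norm_mul, norm_puncture, mul_one, norm_real, Real.norm_eq_abs] at hn
      exact hn
    rcases lt_abs.1 hx with hx | hx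
    · exact hz j x hx.le e
    · refine hz k (-x) hx.le ?_
      rw [e, hjk]; push_cast; ring
  constructor
  · intro hA
    rw [wallA] at hA
    refine key 0 2 (neg_puncture φ 0).symm (Real.cos φ * z.re + Real.sin φ * z.im) ?_
    rw [puncture_eq]
    apply Complex.ext <;> simp [-ofReal_cos, -ofReal_sin]
    · linear_combination (-z.re) * h + Real.sin φ * hA
    · linear_combination (-z.im) * h - Real.cos φ * hA
  · intro hB
    rw [wallB] at hB
    refine key 1 3 (neg_puncture φ 1).symm (-Real.cos φ * z.re + Real.sin φ * z.im) ?_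
    rw [puncture_eq]
    apply Complex.ext <;> simp [-ofReal_cos, -ofReal_sin]
    · linear_combination (-z.re) * h + Real.sin φ * hB
    · linear_combination (-z.im) * h + Real.cos φ * hB

theorem one_lt_norm_of_notMem (hz : z ∉ slitDomain φ) (hp : ∀ l, z ≠ puncture φ l) : 1 < ‖z‖ := by
  simp only [slitDomain, mem_ofPred_eq, not_forall, not_not] at hz
  obtain ⟨j, σ, hσ, e⟩ := hz
  have h1 : σ ≠ 1 := by
    rintro rfl
    exact hp j (by rw [e, ofReal_one, one_mul])
  rw [e, norm_mul, norm_puncture, mul_one, norm_real, Real.norm_eq_abs]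
  exact (lt_of_le_of_ne hσ (Ne.symm h1)).trans_le (le_abs_self σ)

open Classical in
/-- The intertwiner of two systems with the same monodromy. -/
noncomputable def twine (φ : ℝ) (a a' : Fin 3 → ℂ) (δ : Mat ℂ) (z : ℂ) : Mat ℂ :=
  if z ∈ slitDomain φ then innerTwine φ a a' δ z else outerTwine φ a a' δ z

theorem inv_mem_slitDomain_of_one_lt (h : 1 < ‖z‖) : z⁻¹ ∈ slitDomain φ :=
  mem_slitDomain_of_norm_lt (by rw [norm_inv]; exact inv_lt_one_of_one_lt₀ h)

theorem twine_eq_outerTwine (hφ : φ ∈ Ioo 0 (Real.pi / 2)) (hδ : Mat.flip δ = δ)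
    (h1 : factorOne φ a * δ = δ * factorOne φ a') (hI : factorI φ a * δ = δ * factorI φ a')
    (hz : 1 < ‖z‖) : twine φ a a' δ z = outerTwine φ a a' δ z := by
  rw [twine]
  split_ifs with h
  · obtain ⟨hA, hB⟩ := walls_ne_zero h hz
    exact innerTwine_eq_outerTwine hφ hδ h1 hI hA hB
  · rfl

/-- Points on the slits other than the punctures have modulus above one, where the exterior
description is regular; hence `twine` is single valued and holomorphic off the punctures. -/
theorem hasDerivAt_twine_of_ne (hφ : φ ∈ Ioo 0 (Real.pi / 2)) (hδ : Mat.flip δ = δ)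
    (h1 : factorOne φ a * δ = δ * factorOne φ a') (hI : factorI φ a * δ = δ * factorI φ a')
    (hz : ∀ l, z ≠ puncture φ l) : HasDerivAt (twine φ a a' δ)
      (twine φ a a' δ z * eta φ a' z - eta φ a z * twine φ a a' δ z) z := by
  have hs := sin_pos_of_mem hφ
  by_cases h : z ∈ slitDomain φ
  · have e : ∀ w ∈ slitDomain φ, twine φ a a' δ w = innerTwine φ a a' δ w := fun w hw => if_pos hw
    rw [e z h]
    refine (hasDerivAt_innerTwine hs h).congr_of_eventuallyEq ?_
    filter_upwards [(isOpen_slitDomain φ).mem_nhds h] with w hw using e w hw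
  · have hn := one_lt_norm_of_notMem h hz
    have h0 : z ≠ 0 := by rintro rfl; rw [norm_zero] at hn; linarith
    rw [twine_eq_outerTwine hφ hδ h1 hI hn]
    refine (hasDerivAt_outerTwine hs h0 (inv_mem_slitDomain_of_one_lt hn)).congr_of_eventuallyEq ?_
    have ho : IsOpen {w : ℂ | 1 < ‖w‖} := isOpen_lt continuous_const continuous_norm
    filter_upwards [ho.mem_nhds hn] with w hw using twine_eq_outerTwine hφ hδ h1 hI hw

theorem puncture_injective (hφ : φ ∈ Ioo 0 (Real.pi / 2)) : Function.Injective (puncture φ) := by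
  have hs := sin_pos_of_mem hφ
  have hc := cos_pos_of_mem hφ
  intro j k h
  have hr := congrArg re h
  have hi := congrArg im h
  rw [puncture_eq] at hr hi
  fin_cases j <;> fin_cases k <;> first | rfl | (exfalso; simp [-ofReal_cos, -ofReal_sin] at hr hi; linarith)

theorem eta_eq_add_sum (φ : ℝ) (a : Fin 3 → ℂ) (l : Fin 4) (z : ℂ) : eta φ a z =
    (z - puncture φ l)⁻¹ • resid a l +
      ∑ k ∈ Finset.univ.erase l, (z - puncture φ k)⁻¹ • resid a k := by
  rw [eta, ← Finset.add_sum_erase _ _ (Finset.mem_univ l)]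

theorem continuousAt_sum_erase (hφ : φ ∈ Ioo 0 (Real.pi / 2)) (a : Fin 3 → ℂ) (l : Fin 4) :
    ContinuousAt (fun z => ∑ k ∈ Finset.univ.erase l, (z - puncture φ k)⁻¹ • resid a k)
      (puncture φ l) := by
  refine tendsto_finsetSum _ fun k hk => ?_
  have h1 : ContinuousAt (fun w : ℂ => (w - puncture φ k)⁻¹) (puncture φ l) :=
    ContinuousAt.inv₀ (by fun_prop)
      (sub_ne_zero.2 ((puncture_injective hφ).ne (Finset.ne_of_mem_erase hk).symm))
  exact Filter.Tendsto.smul h1 (tendsto_const_nhds (x := resid a k))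

theorem isLittleO_twine (hφ : φ ∈ Ioo 0 (Real.pi / 2)) {t : ℝ} (ht : 0 < t) (ht' : t < 1 / 8)
    (hq : quadForm a = (t : ℂ) ^ 2) (hq' : quadForm a' = (t : ℂ) ^ 2) (hδ : Mat.flip δ = δ)
    (h1 : factorOne φ a * δ = δ * factorOne φ a') (hI : factorI φ a * δ = δ * factorI φ a')
    (l : Fin 4) (i j : Fin 2) : (fun z => twine φ a a' δ z i j)
      =o[nhdsWithin (puncture φ l) {puncture φ l}ᶜ] fun z => (z - puncture φ l)⁻¹ := by
  have c1 := continuousAt_sum_erase hφ a l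
  have c2 := continuousAt_sum_erase hφ a' l
  have e1 := c1.norm.eventually (gt_mem_nhds (lt_add_one _))
  have e2 := c2.norm.eventually (gt_mem_nhds (lt_add_one _))
  have e3 : ∀ᶠ z in nhds (puncture φ l), ∀ k, k ≠ l → z ≠ puncture φ k :=
    Filter.eventually_all.2 fun k => by
      by_cases hk : k = l
      · exact Filter.Eventually.of_forall fun z h => absurd hk h
      · filter_upwards [isOpen_ne.mem_nhds ((puncture_injective hφ).ne (Ne.symm hk))] with z hz _
        exact hz
  obtain ⟨r, hr, h⟩ := Metric.nhds_basis_closedBall.eventually_iff.1 (e1.and (e2.and e3))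
  have hmem : ∀ z, ‖z - puncture φ l‖ ≤ r → z ∈ Metric.closedBall (puncture φ l) r := fun z hz => by
    rwa [mem_closedBall_iff_norm]
  have s1 := resid_sq a l
  have s2 := resid_sq a' l
  rw [hq] at s1
  rw [hq'] at s2
  refine isLittleO_of_fuchsian ht ht' (tr_resid a l) s1 (tr_resid a' l) s2 hr
    (C := max (‖∑ k ∈ Finset.univ.erase l, (puncture φ l - puncture φ k)⁻¹ • resid a k‖ + 1)
      (‖∑ k ∈ Finset.univ.erase l, (puncture φ l - puncture φ k)⁻¹ • resid a' k‖ + 1))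
    (R := fun z => ∑ k ∈ Finset.univ.erase l, (z - puncture φ k)⁻¹ • resid a k)
    (R' := fun z => ∑ k ∈ Finset.univ.erase l, (z - puncture φ k)⁻¹ • resid a' k)
    (fun z hz => (h (hmem z hz)).1.le.trans (le_max_left _ _))
    (fun z hz => (h (hmem z hz)).2.1.le.trans (le_max_right _ _)) (fun z hz hzr => ?_) i j
  have hz' : ∀ k, z ≠ puncture φ k := fun k => by
    by_cases hk : k = l
    · rwa [hk]
    · exact (h (hmem z hzr)).2.2 k hk
  have hd := hasDerivAt_twine_of_ne hφ hδ h1 hI hz'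
  rwa [eta_eq_add_sum φ a' l, eta_eq_add_sum φ a l] at hd

/-- An algebraic intertwiner of the monodromies intertwines the potentials. -/
theorem eta_mul_eq (hφ : φ ∈ Ioo 0 (Real.pi / 2)) {t : ℝ} (ht : 0 < t) (ht' : t < 1 / 8)
    (hq : quadForm a = (t : ℂ) ^ 2) (hq' : quadForm a' = (t : ℂ) ^ 2) (hδ : Mat.flip δ = δ)
    (h1 : factorOne φ a * δ = δ * factorOne φ a') (hI : factorI φ a * δ = δ * factorI φ a')
    (hz : z ∈ slitDomain φ) : eta φ a z * δ = δ * eta φ a' z := by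
  have hs := sin_pos_of_mem hφ
  have hconst : ∀ i j, ∀ w ∈ slitDomain φ, twine φ a a' δ w i j = δ i j := by
    intro i j
    obtain ⟨g, hg, hgf⟩ := exists_entire_of_isLittleO (Finset.univ.image (puncture φ))
      (fun z => twine φ a a' δ z i j) (fun z hz => by
        have hz' : ∀ l, z ≠ puncture φ l := fun l e => hz (by
          rw [e]; exact Finset.mem_image_of_mem _ (Finset.mem_univ l))
        exact (Mat.hasDerivAt_iff.1 (hasDerivAt_twine_of_ne hφ hδ h1 hI hz') i j).differentiableAt)
      (fun p hp => by
        obtain ⟨l, -, rfl⟩ := Finset.mem_image.1 hp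
        exact isLittleO_twine hφ ht ht' hq hq' hδ h1 hI l i j)
    have hgf' : ∀ w, (∀ l, w ≠ puncture φ l) → g w = twine φ a a' δ w i j := fun w hw => by
      refine hgf w fun hm => ?_
      obtain ⟨l, -, e⟩ := Finset.mem_image.1 hm
      exact hw l e.symm
    -- The exterior frames are regular in `1/z`, so the limit at infinity exists. With the
    -- convention `0⁻¹ = 0`, the value `outFrame φ a 0` stands for the one at infinity.
    have hlim : Filter.Tendsto g (Filter.cocompact ℂ)
        (nhds ((-(Mat.adj (outFrame φ a 0) * δ * outFrame φ a' 0)) i j)) := by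
      have hinv : Filter.Tendsto (fun z : ℂ => z⁻¹) (Filter.cocompact ℂ) (nhds 0) :=
        Filter.tendsto_inv₀_cobounded.mono_left (by rw [Metric.cobounded_eq_cocompact])
      have hc : ContinuousAt (fun w : ℂ => (-(Mat.adj (frame φ a w * Mat.swap) * δ *
          (frame φ a' w * Mat.swap)) : Mat ℂ) i j) 0 := by
        have hm := zero_mem_slitDomain φ
        have d1 := hasDerivAt_mul_const (hasDerivAt_frame hs a hm) Mat.swap
        have d2 := hasDerivAt_mul_const (hasDerivAt_frame hs a' hm) Mat.swap
        have d3 := ((hasDerivAt_mul_const (Mat.hasDerivAt_adj d1) δ).mul d2).neg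
        exact (Mat.hasDerivAt_iff.1 d3 i j).continuousAt
      have h0 : (-(Mat.adj (outFrame φ a 0) * δ * outFrame φ a' 0)) i j =
          (fun w : ℂ => (-(Mat.adj (frame φ a w * Mat.swap) * δ *
          (frame φ a' w * Mat.swap)) : Mat ℂ) i j) 0 := by
        simp only [outFrame, _root_.inv_zero]
      rw [h0]
      refine (hc.tendsto.comp hinv).congr' ?_
      have hev : ∀ᶠ z : ℂ in Filter.cocompact ℂ, 1 < ‖z‖ := by
        rw [← Metric.cobounded_eq_cocompact]
        exact tendsto_norm_cobounded_atTop.eventually (Filter.eventually_gt_atTop 1)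
      filter_upwards [hev] with w hw
      rw [hgf' w (fun l e => by rw [e, norm_puncture] at hw; exact lt_irrefl _ hw),
        twine_eq_outerTwine hφ hδ h1 hI hw]
      rfl
    -- Liouville: an entire function with a finite limit at infinity is constant; its value is the
    -- one at `0`, where both frames are the identity.
    have hcst := fun w => hg.apply_eq_of_tendsto_cocompact w hlim
    have hm := zero_mem_slitDomain φ
    have h00 : twine φ a a' δ 0 = δ := by
      rw [twine, if_pos hm, innerTwine, frame_zero, frame_zero, mul_one]
      have : Mat.adj (1 : Mat ℂ) = 1 := by apply Mat.ext4 <;> simp [Mat.adj, Mat.one_apply]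
      rw [this, one_mul]
    intro w hw
    rw [← hgf' w (ne_puncture_of_mem hw), hcst w, ← hcst 0, hgf' 0 (ne_puncture_of_mem hm), h00]
  have hd := hasDerivAt_twine_of_ne hφ hδ h1 hI (ne_puncture_of_mem hz)
  have e : ∀ w ∈ slitDomain φ, twine φ a a' δ w = δ := fun w hw => Mat.ext fun i j => hconst i j w hw
  have hd' : HasDerivAt (twine φ a a' δ) 0 z := by
    refine (hasDerivAt_const z δ).congr_of_eventuallyEq ?_
    filter_upwards [(isOpen_slitDomain φ).mem_nhds hz] with w hw using e w hw
  have := hd.unique hd'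
  rw [e z hz] at this
  exact (sub_eq_zero.1 this).symm

end Intertwiner

end Lawson

namespace Lawson

open ContDiff

set_option linter.unusedSectionVars false

/-! ### The system with parameter (0, 0, τ) and rigidity at λ = 1 -/

section Symmetric

variable {φ : ℝ}

theorem odeSol_mul_comm {b : C(unitInterval, Mat ℂ)} {N : Mat ℂ} (h : ∀ s, b s * N = N * b s) :
    odeSol b 1 * N = N * odeSol b 1 := by
  have key := eq_mul_odeSol (b := b) (Φ := fun s => unitExtend (odeSol b) s * N) (fun s => by
    have h1 := hasDerivWithinAt_odeSol b s
    have h2 := (((ContinuousLinearMap.mul ℝ (Mat ℂ)).flip N).hasFDerivAt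
      (x := unitExtend (odeSol b) s)).comp_hasDerivWithinAt (s : ℝ) h1
    convert! h2 using 1
    have e : unitExtend (odeSol b) s = odeSol b s := unitExtend_coe _ _
    rw [e, mul_assoc, ← h, ← mul_assoc]
    rfl) 1
  have e0 := unitExtend_coe (odeSol b) 0
  have e1 := unitExtend_coe (odeSol b) 1
  rw [odeSol_zero] at e0
  rw [Icc.coe_zero] at e0
  rw [Icc.coe_one] at e1
  rw [Icc.coe_one, e0, e1, one_mul] at key
  exact key

theorem odeSol_flip (b b' : C(unitInterval, Mat ℂ)) (h : ∀ s, b' s = Mat.flip (b s)) :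
    odeSol b' 1 = Mat.flip (odeSol b 1) := by
  have key := odeSol_eq_of_hasDerivWithinAt (b := b')
    (Φ := fun s => Mat.flip (unitExtend (odeSol b) s)) (by
      have e0 := unitExtend_coe (odeSol b) 0
      rw [odeSol_zero, Icc.coe_zero] at e0
      rw [e0, Mat.flip_one]) (fun s => by
    have h1 := Mat.hasDerivWithinAt_iff.1 (hasDerivWithinAt_odeSol b s)
    have e : unitExtend (odeSol b) s = odeSol b s := unitExtend_coe _ _
    rw [e, h, ← Mat.flip_mul, Mat.hasDerivWithinAt_iff]
    intro i j
    fin_cases i <;> fin_cases j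
    · exact h1 0 0
    · exact (h1 0 1).neg
    · exact (h1 1 0).neg
    · exact h1 1 1) 1
  have e1 := unitExtend_coe (odeSol b) 1
  rw [Icc.coe_one] at e1
  rw [key, Icc.coe_one, e1]

/-- All values of the coefficient commute with the permutation matrix, hence so does the transport.
-/
theorem halfMon_second (φ : ℝ) (τ : ℂ) :
    halfMon φ ![0, τ, 0] 1 1 = halfMon φ ![0, τ, 0] 0 0 ∧
    halfMon φ ![0, τ, 0] 1 0 = halfMon φ ![0, τ, 0] 0 1 := by
  have h := odeSol_mul_comm (b := axisCoeff ℝ φ ![0, τ, 0]) (N := Mat.swap) (fun s => by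
    rw [axisCoeff_apply]
    apply Mat.ext4 <;> simp [Mat.mul_apply, Mat.swap])
  have h0 := congrArg (fun M : Mat ℂ => M 0 0) h
  have h1 := congrArg (fun M : Mat ℂ => M 0 1) h
  simp only [Mat.mul_apply, Mat.swap, Mat.of4_00, Mat.of4_01, Mat.of4_10, Mat.of4_11, mul_zero,
    mul_one, one_mul, zero_mul, zero_add, add_zero] at h0 h1
  exact ⟨h1.symm, h0.symm⟩

/-- All values of the coefficient commute with a rotation by a right angle, hence so does the
transport. -/
theorem halfMon_third (φ : ℝ) (τ : ℂ) :
    halfMon φ ![0, 0, τ] 1 1 = halfMon φ ![0, 0, τ] 0 0 ∧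
    halfMon φ ![0, 0, τ] 1 0 = -halfMon φ ![0, 0, τ] 0 1 := by
  have h := odeSol_mul_comm (b := axisCoeff ℝ φ ![0, 0, τ]) (N := Mat.of4 0 1 (-1) 0) (fun s => by
    rw [axisCoeff_apply]
    apply Mat.ext4 <;> simp [Mat.mul_apply])
  have h0 := congrArg (fun M : Mat ℂ => M 0 0) h
  have h1 := congrArg (fun M : Mat ℂ => M 0 1) h
  simp only [Mat.mul_apply, Mat.of4_00, Mat.of4_01, Mat.of4_10, Mat.of4_11, mul_zero,
    mul_one, one_mul, zero_mul, zero_add, add_zero, mul_neg] at h0 h1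
  exact ⟨h1.symm, h0.symm⟩

theorem pFun_third_neg (φ : ℝ) (τ : ℂ) : pFun φ ![0, 0, -τ] = -pFun φ ![0, 0, τ] := by
  have h := odeSol_flip (axisCoeff ℝ φ ![0, 0, τ]) (axisCoeff ℝ φ ![0, 0, -τ]) (fun s => by
    rw [axisCoeff_apply, axisCoeff_apply]
    apply Mat.ext4 <;> simp [Mat.flip])
  rw [pFun, pFun, halfMon, h, halfMon]
  simp only [Mat.flip, Mat.of4_00, Mat.of4_01, Mat.of4_10, Mat.of4_11]
  ring

theorem swapParam_third (τ : ℂ) : swapParam ![0, 0, τ] = ![0, τ, 0] := by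
  funext k
  fin_cases k <;> simp [swapParam]

/-- The half traces of the system whose parameter is proportional to `(0, 0, 1)`. -/
theorem halfTraces_third (hφ : φ ∈ Ioo 0 (Real.pi / 2)) {τ : ℝ} (hτ : τ ≠ 0) :
    qFun φ ![0, 0, (τ : ℂ)] = 0 ∧
    upFun (Real.pi / 2 - φ) (swapParam ![0, 0, (τ : ℂ)]) = 1 ∧
    loFun (Real.pi / 2 - φ) (swapParam ![0, 0, (τ : ℂ)]) = 1 ∧
    upFun φ ![0, 0, (τ : ℂ)] = Real.cos (2 * Real.pi * τ) ∧
    loFun φ ![0, 0, (τ : ℂ)] = Real.cos (2 * Real.pi * τ) := by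
  have h2 := halfMon_second (Real.pi / 2 - φ) τ
  have h3 := halfMon_third φ τ
  have d := det2_halfMon (Real.pi / 2 - φ) ![0, (τ : ℂ), 0]
  rw [Mat.det2, h2.1, h2.2] at d
  have hq : quadForm ![0, 0, (τ : ℂ)] = (τ : ℂ) ^ 2 := by simp [quadForm]
  have hsum := upFun_mul_loFun_add hφ hτ hq
  have hu : upFun (Real.pi / 2 - φ) (swapParam ![0, 0, (τ : ℂ)]) = 1 := by
    rw [swapParam_third, upFun]; linear_combination d
  have hl : loFun (Real.pi / 2 - φ) (swapParam ![0, 0, (τ : ℂ)]) = 1 := by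
    rw [swapParam_third, loFun, h2.1, h2.2]; linear_combination d
  have hul : upFun φ ![0, 0, (τ : ℂ)] = loFun φ ![0, 0, (τ : ℂ)] := by
    rw [upFun, loFun, h3.1, h3.2]; ring
  rw [hu, hl, hul] at hsum
  refine ⟨?_, hu, hl, ?_, ?_⟩
  · rw [qFun, swapParam_third, pFun, h2.1, h2.2]; ring
  · rw [hul]; linear_combination hsum / 2
  · linear_combination hsum / 2

theorem factorOne_eq (hφ : φ ∈ Ioo 0 (Real.pi / 2)) (a : Fin 3 → ℂ) :
    factorOne φ a = Mat.of4 (-pFun φ a) (upFun φ a) (loFun φ a) (pFun φ a) := by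
  rw [factorOne, frame_one hφ, pFun, upFun, loFun]
  apply Mat.ext4 <;> simp only [Mat.mul_apply, Mat.adj, Mat.swap, Mat.of4_00, Mat.of4_01,
    Mat.of4_10, Mat.of4_11] <;> ring

theorem factorI_eq (hφ : φ ∈ Ioo 0 (Real.pi / 2)) (a : Fin 3 → ℂ) :
    factorI φ a = Mat.of4 (-(I * qFun φ a)) (upFun (Real.pi / 2 - φ) (swapParam a))
      (loFun (Real.pi / 2 - φ) (swapParam a)) (-(I * qFun φ a)) := by
  have hI := I_sq
  rw [factorI, frame_I hφ, qFun, pFun, upFun, loFun]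
  generalize halfMon (Real.pi / 2 - φ) (swapParam a) = M
  apply Mat.ext4 <;> simp only [Mat.mul_apply, Mat.adj, Mat.swap, Mat.flip, twist, Mat.of4_00,
    Mat.of4_01, Mat.of4_10, Mat.of4_11]
  · ring
  · linear_combination ((M 0 1) ^ 2) * hI
  · linear_combination ((M 1 0) ^ 2) * hI
  · ring

/-- The only system with small parameters, vanishing `q` and vanishing discriminant is
proportional to the symmetric one. -/
theorem eq_zero_of_qFun_eq_zero (hφ : φ ∈ Ioo 0 (Real.pi / 2)) {a : Fin 3 → ℂ} {t : ℝ} (ht : 0 < t)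
    (ht' : t < 1 / 8) (hq : quadForm a = (t : ℂ) ^ 2) (h0 : qFun φ a = 0) (hv : vFun φ a = 0) :
    a 0 = 0 ∧ a 1 = 0 := by
  have hs := sin_pos_of_mem hφ
  have hc := cos_pos_of_mem hφ
  have h1 := upFun_mul_loFun_add hφ ht.ne' hq
  have h2 := upFun_mul_loFun φ a
  have h3 : _ = 1 - qFun φ a ^ 2 := upFun_mul_loFun (Real.pi / 2 - φ) (swapParam a)
  rw [h0] at h3
  rw [vFun] at hv
  -- The vanishing of `𝔮` and `v` forces `𝔭² = 1 - cos² 2πt` for both systems. Replacing `t` by `-t`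
  -- reverses the sign of `𝔭` for the parameter `(0, 0, t)`, so one sign of `τ` matches.
  obtain ⟨τ, hτ, hcos, hp⟩ : ∃ τ : ℝ, (τ : ℂ) ^ 2 = (t : ℂ) ^ 2 ∧
      Real.cos (2 * Real.pi * τ) = Real.cos (2 * Real.pi * t) ∧ pFun φ a = pFun φ ![0, 0, (τ : ℂ)] := by
    obtain ⟨k0, k1, k2, k3, k4⟩ := halfTraces_third hφ ht.ne'
    have k5 := upFun_mul_loFun φ ![0, 0, (t : ℂ)]
    rw [k3, k4] at k5
    have e : (pFun φ a - pFun φ ![0, 0, (t : ℂ)]) * (pFun φ a + pFun φ ![0, 0, (t : ℂ)]) = 0 := by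
      generalize upFun (Real.pi / 2 - φ) (swapParam a) = A' at *
      generalize loFun (Real.pi / 2 - φ) (swapParam a) = B' at *
      generalize upFun φ a = A at *
      generalize loFun φ a = B at *
      generalize (Real.cos (2 * Real.pi * t) : ℂ) = κ at *
      have e1 : A' * B = κ := by linear_combination h1 / 2 + hv / 2
      have e2 : A * B' = κ := by linear_combination h1 / 2 - hv / 2
      have e3 : A * B = κ ^ 2 := by linear_combination (A * B') * e1 + κ * e2 - A * B * h3
      linear_combination h2 - k5 - e3
    rcases mul_eq_zero.1 e with e | e
    · exact ⟨t, rfl, rfl, by linear_combination e⟩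
    · refine ⟨-t, by push_cast; ring, by rw [mul_neg, Real.cos_neg], ?_⟩
      rw [ofReal_neg, pFun_third_neg]
      linear_combination e
  have hτ0 : τ ≠ 0 := by
    rintro rfl
    have : (t : ℂ) ^ 2 = 0 := by rw [← hτ]; simp
    exact ht.ne' (by exact_mod_cast pow_eq_zero_iff (two_ne_zero) |>.1 this)
  obtain ⟨k0, k1, k2, k3, k4⟩ := halfTraces_third hφ hτ0
  rw [hcos] at k3 k4
  have hq' : quadForm ![0, 0, (τ : ℂ)] = (t : ℂ) ^ 2 := by simp [quadForm, hτ]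
  -- The explicit factors of the two systems differ by a diagonal rescaling, whose ratio is the
  -- upper entry belonging to the imaginary axis.
  have key : ∀ z ∈ slitDomain φ, _ := fun z hz => eta_mul_eq (φ := φ) (a := a)
    (a' := ![0, 0, (τ : ℂ)]) (δ := Mat.of4 (upFun (Real.pi / 2 - φ) (swapParam a)) 0 0 1)
    hφ ht ht' hq hq' (by apply Mat.ext4 <;> simp [Mat.flip]) (by
      rw [factorOne_eq hφ, factorOne_eq hφ, k3, k4, ← hp]
      generalize upFun (Real.pi / 2 - φ) (swapParam a) = A' at *
      generalize loFun (Real.pi / 2 - φ) (swapParam a) = B' at *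
      generalize upFun φ a = A at *
      generalize loFun φ a = B at *
      generalize (Real.cos (2 * Real.pi * t) : ℂ) = κ at *
      have e1 : A' * B = κ := by linear_combination h1 / 2 + hv / 2
      have e2 : A * B' = κ := by linear_combination h1 / 2 - hv / 2
      apply Mat.ext4 <;> simp only [Mat.mul_apply, Mat.of4_00, Mat.of4_01, Mat.of4_10, Mat.of4_11]
      · ring
      · linear_combination A' * e2 - A * h3
      · linear_combination e1
      · ring) (by
      rw [factorI_eq hφ, factorI_eq hφ, k0, k1, k2, h0]
      apply Mat.ext4 <;> simp only [Mat.mul_apply, Mat.of4_00, Mat.of4_01, Mat.of4_10, Mat.of4_11]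
      · ring
      · ring
      · linear_combination h3
      · ring) hz
  have hs' : (Real.sin φ : ℂ) ≠ 0 := by exact_mod_cast hs.ne'
  have hc' : (Real.cos φ : ℂ) ≠ 0 := by exact_mod_cast hc.ne'
  have m1 := one_mem_slitDomain hs
  have m0 := zero_mem_slitDomain φ
  have D0 : formDen φ 0 = 1 := by rw [formDen]; ring
  have D1 : formDen φ 1 = 4 * Real.sin φ ^ 2 := by rw [formDen]; ring
  -- Evaluating the intertwining relation at `z = 0` and `z = 1` isolates the individual parameters.
  have f0 := key 0 m0
  have f1 := key 1 m1
  rw [eta_entries, eta_entries, omega_eq (ne_puncture_of_mem m0), D0] at f0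
  rw [eta_entries, eta_entries, omega_eq (ne_puncture_of_mem m1), D1] at f1
  have g0 := congrArg (fun M : Mat ℂ => M 0 1) f0
  have g1 := congrArg (fun M : Mat ℂ => M 0 1) f1
  have g2 := congrArg (fun M : Mat ℂ => M 1 1) f1
  simp only [Mat.mul_apply, Mat.of4_00, Mat.of4_01, Mat.of4_10, Mat.of4_11, cons_val_zero,
    cons_val_one, cons_val] at g0 g1 g2
  have hI := I_ne_zero
  constructor
  · field_simp at g2
    simpa [-ofReal_cos, -ofReal_sin, hs.ne', hc.ne'] using g2
  · generalize (upFun (Real.pi / 2 - φ) (swapParam a)) = A' at *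
    have e1 : a 2 = A' * τ := by
      field_simp at g1
      ring_nf at g1
      simp only [I_sq] at g1
      have g3 : (8 * Real.sin φ : ℂ) * (a 2 - A' * τ) = 0 := by linear_combination -g1
      rcases mul_eq_zero.1 g3 with h | h
      · exact absurd h (mul_ne_zero (by norm_num) hs')
      · linear_combination h
    rw [e1] at g0
    have : a 1 * (4 * Real.cos φ) = 0 := by linear_combination -g0
    rcases mul_eq_zero.1 this with h | h
    · exact h
    · exact absurd h (mul_ne_zero (by norm_num) hc')

end Symmetric

end Lawson

namespace Lawson

open ContDiff

set_option linter.unusedSectionVars false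

/-! ### First order expansion of v and uniform estimates -/

section Uniform

variable {A : Type*} [NormedCommRing A] [NormedAlgebra ℝ A] [CompleteSpace A]

/-- The first order remainder of `upFun`. -/
noncomputable def upRem (φ τ : ℝ) (a : Fin 3 → A) : A :=
  2 * halfRem ℝ φ τ a 0 0 + τ • (halfRem ℝ φ τ a 0 0 ^ 2 - halfRem ℝ φ τ a 0 1 ^ 2)

/-- The first order remainder of `loFun`. -/
noncomputable def loRem (φ τ : ℝ) (a : Fin 3 → A) : A :=
  2 * halfRem ℝ φ τ a 1 1 + τ • (halfRem ℝ φ τ a 1 1 ^ 2 - halfRem ℝ φ τ a 1 0 ^ 2)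

theorem upFun_smul (φ τ : ℝ) (a : Fin 3 → A) : upFun φ (τ • a) = 1 + τ • upRem φ τ a := by
  rw [upFun, halfMon_smul ℝ, upRem]
  simp only [Mat.add_apply, Mat.smul_apply, Mat.one_apply]
  simp only [if_true, Fin.isValue, zero_ne_one, if_false, zero_add]
  simp only [Algebra.smul_def]
  ring

theorem loFun_smul (φ τ : ℝ) (a : Fin 3 → A) : loFun φ (τ • a) = 1 + τ • loRem φ τ a := by
  rw [loFun, halfMon_smul ℝ, loRem]
  simp only [Mat.add_apply, Mat.smul_apply, Mat.one_apply]
  simp only [if_true, Fin.isValue, one_ne_zero, if_false, zero_add]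
  simp only [Algebra.smul_def]
  ring

/-- The quotient `vFun φ (τ a) / τ`. -/
noncomputable def vRem (φ τ : ℝ) (a : Fin 3 → A) : A :=
  upRem (Real.pi / 2 - φ) τ (swapParam a) + loRem φ τ a - upRem φ τ a -
    loRem (Real.pi / 2 - φ) τ (swapParam a) +
    τ • (upRem (Real.pi / 2 - φ) τ (swapParam a) * loRem φ τ a -
      upRem φ τ a * loRem (Real.pi / 2 - φ) τ (swapParam a))

theorem vFun_smul (φ τ : ℝ) (a : Fin 3 → A) : vFun φ (τ • a) = τ • vRem φ τ a := by
  rw [vFun, swapParam_smul, upFun_smul, upFun_smul, loFun_smul, loFun_smul, vRem]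
  simp only [Algebra.smul_def]
  ring

/-- The real axis contributes `4(π - 2φ)` and the imaginary axis `8φ`, so the angle drops out. -/
theorem vRem_zero {φ : ℝ} (hφ : φ ∈ Ioo 0 (Real.pi / 2)) (a : Fin 3 → A) :
    vRem φ 0 a = (4 * Real.pi) • a 0 := by
  obtain ⟨h1, h2, -⟩ := halfRem_zero ℝ hφ a
  obtain ⟨h3, h4, -⟩ := halfRem_zero ℝ (compl_mem hφ) (swapParam a)
  have e : swapParam a 0 = -a 0 := rfl
  simp only [vRem, upRem, loRem, zero_smul, add_zero, h1, h2, h3, h4, e]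
  simp only [Algebra.smul_def, map_sub, map_mul, map_ofNat]
  have h5 : (algebraMap ℝ A) (Real.pi / 2) * 2 = (algebraMap ℝ A) Real.pi := by
    rw [← map_ofNat (algebraMap ℝ A) 2, ← map_mul]; congr 1; ring
  generalize (algebraMap ℝ A) (Real.pi / 2) = h at *
  rw [← h5]
  ring

theorem contDiff_upRem (φ : ℝ) : ContDiff ℝ ω fun x : ℝ × (Fin 3 → A) => upRem φ x.1 x.2 := by
  have h := contDiff_entry_halfRem (A := A) ℝ φ
  exact (contDiff_const.mul (h 0 0)).add (contDiff_fst.smul (((h 0 0).pow 2).sub ((h 0 1).pow 2)))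

theorem contDiff_loRem (φ : ℝ) : ContDiff ℝ ω fun x : ℝ × (Fin 3 → A) => loRem φ x.1 x.2 := by
  have h := contDiff_entry_halfRem (A := A) ℝ φ
  exact (contDiff_const.mul (h 1 1)).add (contDiff_fst.smul (((h 1 1).pow 2).sub ((h 1 0).pow 2)))

theorem contDiff_vRem (φ : ℝ) : ContDiff ℝ ω fun x : ℝ × (Fin 3 → A) => vRem φ x.1 x.2 := by
  have hs : ContDiff ℝ ω fun x : ℝ × (Fin 3 → A) => (x.1, swapParam x.2) :=
    contDiff_fst.prodMk ((contDiff_swapParam ℝ).comp contDiff_snd)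
  have h1 : ContDiff ℝ ω ((fun x : ℝ × (Fin 3 → A) => upRem (Real.pi / 2 - φ) x.1 x.2) ∘
    fun x : ℝ × (Fin 3 → A) => (x.1, swapParam x.2)) := (contDiff_upRem _).comp hs
  have h2 : ContDiff ℝ ω ((fun x : ℝ × (Fin 3 → A) => loRem (Real.pi / 2 - φ) x.1 x.2) ∘
    fun x : ℝ × (Fin 3 → A) => (x.1, swapParam x.2)) := (contDiff_loRem _).comp hs
  have h3 := contDiff_upRem (A := A) φ
  have h4 := contDiff_loRem (A := A) φ
  exact (((h1.add h4).sub h3).sub h2).add (contDiff_fst.smul ((h1.mul h4).sub (h3.mul h2)))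

/-- Uniformity comes from compactness of balls in `ℂ³`. It is applied to the values `X(λ)`, so
bounds on them suffice and no bound in the Wiener norm is required. -/
theorem exists_forall_norm_sub_le {f : ℝ × (Fin 3 → ℂ) → ℂ} (hf : Continuous f) (R : ℝ) {η : ℝ}
    (hη : 0 < η) : ∃ ε > 0, ∀ t : ℝ, |t| < ε → ∀ X : Fin 3 → ℂ, ‖X‖ ≤ R →
      ‖f (t, X) - f (0, X)‖ ≤ η := by
  have h := (isCompact_closedBall (0 : Fin 3 → ℂ) R).eventually_forall_of_forall_eventually
    (x₀ := (0 : ℝ)) (P := fun t X => ‖f (t, X) - f (0, X)‖ < η) (fun X _ => by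
      have hc : Continuous fun z : ℝ × (Fin 3 → ℂ) => ‖f (z.1, z.2) - f (0, z.2)‖ := by fun_prop
      refine hc.continuousAt.eventually (gt_mem_nhds ?_)
      simpa using hη)
  obtain ⟨ε, hε, h⟩ := Metric.eventually_nhds_iff.1 h
  exact ⟨ε, hε, fun t ht X hX => (h (by simpa using ht) X (by simpa using hX)).le⟩

/-- The first order behaviour of the traces is uniform on bounded sets. -/
theorem exists_uniform_traces {φ : ℝ} (hφ : φ ∈ Ioo 0 (Real.pi / 2)) (R : ℝ) {η : ℝ}
    (hη : 0 < η) : ∃ ε > 0, ∀ t : ℝ, |t| < ε → ∀ X : Fin 3 → ℂ, ‖X‖ ≤ R →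
      ‖pRem ℝ φ t X - 2 * Real.pi * X 2‖ ≤ η ∧ ‖qRem ℝ φ t X - 2 * Real.pi * X 1‖ ≤ η ∧
      ‖vRem φ t X - 4 * Real.pi * X 0‖ ≤ η := by
  obtain ⟨ε₁, h1, H1⟩ := exists_forall_norm_sub_le
    (contDiff_pRem (A := ℂ) ℝ φ).continuous R hη
  obtain ⟨ε₂, h2, H2⟩ := exists_forall_norm_sub_le
    (contDiff_qRem (A := ℂ) ℝ φ).continuous R hη
  obtain ⟨ε₃, h3, H3⟩ := exists_forall_norm_sub_le
    (contDiff_vRem (A := ℂ) φ).continuous R hη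
  refine ⟨min ε₁ (min ε₂ ε₃), lt_min h1 (lt_min h2 h3), fun t ht X hX => ?_⟩
  have k1 := H1 t (ht.trans_le (min_le_left _ _)) X hX
  have k2 := H2 t (ht.trans_le ((min_le_right _ _).trans (min_le_left _ _))) X hX
  have k3 := H3 t (ht.trans_le ((min_le_right _ _).trans (min_le_right _ _))) X hX
  simp only [pRem_zero ℝ hφ, qRem_zero ℝ hφ, vRem_zero hφ, Complex.real_smul] at k1 k2 k3
  push_cast at k1 k2 k3
  exact ⟨k1, k2, k3⟩

/-- If `f x` exceeded `a`, it would exceed `b`, and by the intermediate value theorem `f` would take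
the value `b`, which the hypothesis excludes. -/
theorem le_of_bootstrap {f : ℝ → ℝ} {x₀ x a b : ℝ} (hx : x₀ ≤ x) (hf : ContinuousOn f (Icc x₀ x))
    (h0 : f x₀ ≤ a) (hab : a < b) (h : ∀ y ∈ Icc x₀ x, f y ≤ b → f y ≤ a) : f x ≤ a := by
  by_contra! hlt
  have hb : b < f x := by
    by_contra! hle
    exact absurd (h x ⟨hx, le_rfl⟩ hle) (not_le.2 hlt)
  obtain ⟨y, hy, e⟩ := intermediate_value_Icc hx hf ⟨h0.trans hab.le, hb.le⟩
  have := h y hy e.le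
  linarith

end Uniform

end Lawson

/-! ### Reality on the unit circle -/

namespace WienerSpace

variable {ρ : ℝ} [hρ : Fact (1 < ρ)]

theorem continuousOn_eval (u : WienerSpace ρ) : ContinuousOn u.eval {l | InAnnulus ρ l} := by
  refine continuousOn_tsum (fun k l hl => ?_) u.summable_coeff (fun k l hl => u.norm_term_le hl k)
  exact (continuousAt_const.mul (continuousAt_zpow₀ l k (Or.inl hl.ne_zero))).continuousWithinAt

theorem inv_eq_conj {l : ℂ} (hl : ‖l‖ = 1) : l⁻¹ = (starRingEnd ℂ) l := by
  rw [Complex.inv_def, Complex.normSq_eq_norm_sq, hl]; simp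

theorem eval_inv_of_norm_one (u : WienerSpace ρ) {l : ℂ} (hl : ‖l‖ = 1) :
    u.eval l⁻¹ = (starRingEnd ℂ) (u.eval l) := by
  rw [inv_eq_conj hl, eval_conj]

/-- Real coefficients give `u(conj λ) = conj u(λ)`, and on the unit circle `λ⁻¹` is the conjugate of
`λ`. -/
theorem refl_eq_self_iff (u : WienerSpace ρ) :
    refl u = u ↔ ∀ l : ℂ, ‖l‖ = 1 → (u.eval l).im = 0 := by
  constructor
  · intro h l hl
    have := eval_inv_of_norm_one u hl
    rw [← eval_refl, h] at this
    exact Complex.conj_eq_iff_im.1 this.symm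
  · intro h
    refine eq_of_eval_eq_on_unit_circle fun l hl => ?_
    rw [eval_refl, eval_inv_of_norm_one u hl]
    exact Complex.conj_eq_iff_im.2 (h l hl)

theorem eval_re_eq_zero {u : WienerSpace ρ} (h : refl u = -u) {l : ℂ} (hl : ‖l‖ = 1) :
    (u.eval l).re = 0 := by
  have := eval_inv_of_norm_one u hl
  rw [← eval_refl, h, eval_neg _ (inAnnulus_of_norm_one hl)] at this
  have := congrArg re this
  simp only [neg_re, conj_re] at this
  linarith

end WienerSpace

/-! ### A priori bounds for solutions -/

namespace WienerSpace

open Lawson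

set_option linter.unusedSectionVars false

variable {ρ : ℝ} [hρ : Fact (1 < ρ)]

/-- The values of a triple of Laurent series. -/
noncomputable def evalAt (X : Fin 3 → WienerSpace ρ) (l : ℂ) : Fin 3 → ℂ := fun j => (X j).eval l

theorem evalAt_apply (X : Fin 3 → WienerSpace ρ) (l : ℂ) (j : Fin 3) :
    evalAt X l j = (X j).eval l := rfl

theorem evalAt_smul (t : ℝ) (X : Fin 3 → WienerSpace ρ) {l : ℂ} (hl : InAnnulus ρ l) :
    (fun j => evalCLM l hl ((t • X) j)) = t • evalAt X l := by
  funext j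
  exact (evalCLM l hl).map_smul t (X j)

theorem evalCLM_one {l : ℂ} (hl : InAnnulus ρ l) : evalCLM l hl (1 : WienerSpace ρ) = 1 :=
  eval_one l

theorem evalCLM_mul {l : ℂ} (hl : InAnnulus ρ l) (u v : WienerSpace ρ) :
    evalCLM l hl (u * v) = evalCLM l hl u * evalCLM l hl v := eval_mul u v hl

theorem eval_pFun (φ t : ℝ) (X : Fin 3 → WienerSpace ρ) {l : ℂ} (hl : InAnnulus ρ l) :
    (pFun φ (t • X)).eval l = pFun φ (t • evalAt X l) := by
  rw [← evalCLM_apply l hl, map_pFun _ (evalCLM_one hl) (evalCLM_mul hl), evalAt_smul]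

theorem eval_qFun (φ t : ℝ) (X : Fin 3 → WienerSpace ρ) {l : ℂ} (hl : InAnnulus ρ l) :
    (qFun φ (t • X)).eval l = qFun φ (t • evalAt X l) := by
  rw [← evalCLM_apply l hl, map_qFun _ (evalCLM_one hl) (evalCLM_mul hl), evalAt_smul]

theorem eval_vFun (φ t : ℝ) (X : Fin 3 → WienerSpace ρ) {l : ℂ} (hl : InAnnulus ρ l) :
    (vFun φ (t • X)).eval l = vFun φ (t • evalAt X l) := by
  rw [← evalCLM_apply l hl, map_vFun _ (evalCLM_one hl) (evalCLM_mul hl), evalAt_smul]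

theorem quadForm_smul (t : ℝ) (a : Fin 3 → ℂ) : quadForm (t • a) = (t : ℂ) ^ 2 * quadForm a := by
  simp only [quadForm, Pi.smul_apply, Complex.real_smul]; ring

theorem quadForm_evalAt {X : Fin 3 → WienerSpace ρ} (h : quadForm X = 1) {l : ℂ}
    (hl : InAnnulus ρ l) : quadForm (evalAt X l) = 1 := by
  have := eval_quadForm X hl
  rw [h, eval_one] at this
  exact this.symm

/-- The solutions of the monodromy problem, in terms of symmetries of the trace functions. -/
structure HasSymmetricTraces (φ t : ℝ) (X : Fin 3 → WienerSpace ρ) : Prop where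
  quad : quadForm X = 1
  refl_p : refl (pFun φ (t • X)) = pFun φ (t • X)
  refl_q : refl (qFun φ (t • X)) = qFun φ (t • X)
  refl_v : refl (vFun φ (t • X)) = -vFun φ (t • X)
  q_one : qFun φ (t • evalAt X 1) = 0

variable {φ t : ℝ} {X : Fin 3 → WienerSpace ρ}

theorem smul_pFun_eq (hp : refl (pFun φ (t • X)) = pFun φ (t • X))
    (hq : refl (qFun φ (t • X)) = qFun φ (t • X)) {l : ℂ} (hl : InAnnulus ρ l) :
    pFun φ (t • evalAt X l⁻¹) = pFun φ (t • evalAt X l) ∧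
    qFun φ (t • evalAt X l⁻¹) = qFun φ (t • evalAt X l) := by
  constructor
  · rw [← eval_pFun φ t X hl, ← eval_pFun φ t X hl.inv, ← eval_refl, hp]
  · rw [← eval_qFun φ t X hl, ← eval_qFun φ t X hl.inv, ← eval_refl, hq]

/-- If the discriminant is positive at `i`, then its square root is antisymmetric. -/
theorem refl_vFun (hφ : φ ∈ Ioo 0 (Real.pi / 2)) (ht : t ≠ 0) (hK : quadForm X = 1)
    (hp : refl (pFun φ (t • X)) = pFun φ (t • X)) (hq : refl (qFun φ (t • X)) = qFun φ (t • X))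
    (hI : (vFun φ (t • evalAt X I) ^ 2).re < 0) :
    refl (vFun φ (t • X)) = -vFun φ (t • X) := by
  -- `v²` is expressed by `𝔭²` and `𝔮²`, hence symmetric; in a domain its root is then symmetric or
  -- antisymmetric.
  have hsq : (refl (vFun φ (t • X)) - vFun φ (t • X)) * (refl (vFun φ (t • X)) + vFun φ (t • X)) = 0 := by
    refine eq_of_eval_eq_on_unit_circle fun l hl => ?_
    have hl := inAnnulus_of_norm_one (ρ := ρ) hl
    have hQ : ∀ {l : ℂ}, InAnnulus ρ l → quadForm (t • evalAt X l) = (t : ℂ) ^ 2 := fun hl => by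
      rw [quadForm_smul, quadForm_evalAt hK hl, mul_one]
    rw [eval_mul _ _ hl, eval_sub _ _ hl, eval_add _ _ hl, eval_refl, eval_zero,
      eval_vFun φ t X hl, eval_vFun φ t X hl.inv]
    have h1 := vFun_sq hφ ht (hQ hl)
    have h2 := vFun_sq hφ ht (hQ hl.inv)
    obtain ⟨e1, e2⟩ := smul_pFun_eq hp hq hl
    rw [e1, e2] at h2
    linear_combination h2 - h1
  rcases eq_zero_or_eq_zero_of_mul hsq with h | h
  · exfalso
    -- A symmetric `v` would be real at `i`, contradicting `v(i)² < 0`.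
    have hn : ‖(I : ℂ)‖ = 1 := by simp
    have h1 := (refl_eq_self_iff _).1 (sub_eq_zero.1 h) I hn
    rw [eval_vFun φ t X (inAnnulus_of_norm_one hn)] at h1
    rw [sq, mul_re, h1] at hI
    nlinarith [mul_self_nonneg (vFun φ (t • evalAt X I)).re]
  · exact eq_neg_of_add_eq_zero_left h

namespace HasSymmetricTraces

variable (h : HasSymmetricTraces φ t X)

include h

/-- At the fixed point `λ = 1` antisymmetry forces `v = 0`, so the rigidity result applies; the
normalization of the quadratic form leaves the sign of the third component. -/
theorem evalAt_one (hφ : φ ∈ Ioo 0 (Real.pi / 2)) (ht : 0 < t) (ht' : t < 1 / 8) :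
    (X 0).eval 1 = 0 ∧ (X 1).eval 1 = 0 ∧ (X 2).eval 1 ^ 2 = 1 := by
  have h1 := one_inAnnulus (ρ := ρ)
  have hQ := quadForm_evalAt h.quad h1
  have hv : vFun φ (t • evalAt X 1) = 0 := by
    have e := congrArg (fun u => u.eval 1) h.refl_v
    simp only [eval_refl, _root_.inv_one, eval_neg _ h1, eval_vFun φ t X h1] at e
    linear_combination e / 2
  obtain ⟨e0, e1⟩ := eq_zero_of_qFun_eq_zero hφ (a := t • evalAt X 1) ht ht'
    (by rw [quadForm_smul, hQ, mul_one]) h.q_one hv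
  have ht0 : (t : ℂ) ≠ 0 := by exact_mod_cast ht.ne'
  simp only [Pi.smul_apply, Complex.real_smul, mul_eq_zero, ht0, false_or, evalAt_apply] at e0 e1
  refine ⟨e0, e1, ?_⟩
  rw [quadForm] at hQ
  simp only [evalAt_apply, e0, e1] at hQ
  linear_combination hQ

theorem rem_inv (ht : t ≠ 0) {l : ℂ} (hl : InAnnulus ρ l) :
    pRem ℝ φ t (evalAt X l⁻¹) = pRem ℝ φ t (evalAt X l) ∧
    qRem ℝ φ t (evalAt X l⁻¹) = qRem ℝ φ t (evalAt X l) ∧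
    vRem φ t (evalAt X l⁻¹) = -vRem φ t (evalAt X l) := by
  obtain ⟨h1, h2⟩ := smul_pFun_eq h.refl_p h.refl_q hl
  have h3 : vFun φ (t • evalAt X l⁻¹) = -vFun φ (t • evalAt X l) := by
    rw [← eval_vFun φ t X hl, ← eval_vFun φ t X hl.inv, ← eval_refl, h.refl_v, eval_neg _ hl]
  rw [pFun_smul ℝ, pFun_smul ℝ] at h1
  rw [qFun_smul ℝ, qFun_smul ℝ] at h2
  rw [vFun_smul, vFun_smul, ← smul_neg] at h3
  exact ⟨smul_right_injective _ ht h1, smul_right_injective _ ht h2, smul_right_injective _ ht h3⟩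

/-- Bounds for the traces on the unit circle. -/
theorem norm_rem_le (hφ : φ ∈ Ioo 0 (Real.pi / 2)) (ht : 0 < t) {l : ℂ} (hl : ‖l‖ = 1)
    (hp1 : ‖t • pRem ℝ φ t (evalAt X l)‖ ≤ 1) (hq1 : ‖t • qRem ℝ φ t (evalAt X l)‖ ≤ 1) :
    ‖pRem ℝ φ t (evalAt X l)‖ ≤ 2 * Real.pi ∧ ‖qRem ℝ φ t (evalAt X l)‖ ≤ 2 * Real.pi := by
  have hl' := inAnnulus_of_norm_one (ρ := ρ) hl
  have hp := (refl_eq_self_iff _).1 h.refl_p l hl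
  have hq := (refl_eq_self_iff _).1 h.refl_q l hl
  have hv := eval_re_eq_zero h.refl_v hl
  have hsq := vFun_sq hφ ht.ne' (a := t • evalAt X l)
    (by rw [quadForm_smul, quadForm_evalAt h.quad hl', mul_one])
  rw [eval_pFun φ t X hl'] at hp
  rw [eval_qFun φ t X hl'] at hq
  rw [eval_vFun φ t X hl'] at hv
  rw [← pFun_smul ℝ] at hp1
  rw [← qFun_smul ℝ] at hq1
  have hnp : ‖pFun φ (t • evalAt X l)‖ = t * ‖pRem ℝ φ t (evalAt X l)‖ := by
    rw [pFun_smul ℝ, norm_smul, Real.norm_eq_abs, abs_of_pos ht]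
  have hnq : ‖qFun φ (t • evalAt X l)‖ = t * ‖qRem ℝ φ t (evalAt X l)‖ := by
    rw [qFun_smul ℝ, norm_smul, Real.norm_eq_abs, abs_of_pos ht]
  have real_eq : ∀ z : ℂ, z.im = 0 → z = (z.re : ℂ) := fun z hz => by
    apply Complex.ext <;> simp [hz]
  set p := pFun φ (t • evalAt X l)
  set q := qFun φ (t • evalAt X l)
  set v := vFun φ (t • evalAt X l)
  clear_value p q v
  rw [real_eq p hp] at hp1 hnp
  rw [real_eq q hq] at hq1 hnq
  rw [norm_real, Real.norm_eq_abs] at hp1 hq1 hnp hnq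
  -- An antisymmetric `v` is imaginary on the unit circle, so the discriminant is nonnegative there.
  have key : (1 - p.re ^ 2) * (1 - q.re ^ 2) ≥ Real.cos (2 * Real.pi * t) ^ 2 := by
    have h1 := congrArg re hsq
    rw [real_eq p hp, real_eq q hq] at h1
    have e : (v ^ 2).re = -(v.im ^ 2) := by rw [sq, mul_re, hv]; ring
    rw [e] at h1
    have e2 : (4 * (Real.cos (2 * Real.pi * t) : ℂ) ^ 2 - 4 * (1 - (p.re : ℂ) ^ 2) * (1 - (q.re : ℂ) ^ 2)) =
        ((4 * Real.cos (2 * Real.pi * t) ^ 2 - 4 * (1 - p.re ^ 2) * (1 - q.re ^ 2) : ℝ) : ℂ) := by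
      push_cast; ring
    rw [e2, ofReal_re] at h1
    nlinarith [sq_nonneg v.im]
  have hpi := Real.pi_pos
  have hs := Real.sin_sq_add_cos_sq (2 * Real.pi * t)
  have hsin : |Real.sin (2 * Real.pi * t)| ≤ 2 * Real.pi * t := by
    have h0 : 0 ≤ 2 * Real.pi * t := by positivity
    exact Real.abs_sin_le_abs.trans (abs_of_nonneg h0).le
  -- The crude bounds exclude the case of two negative factors; both factors then lie in `[0, 1]`,
  -- and each is at least `cos² 2πt`.
  have hp2 : p.re ^ 2 ≤ 1 := (sq_le_one_iff_abs_le_one _).2 hp1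
  have hq2 : q.re ^ 2 ≤ 1 := (sq_le_one_iff_abs_le_one _).2 hq1
  have b1 : p.re ^ 2 ≤ Real.sin (2 * Real.pi * t) ^ 2 := by nlinarith [sq_nonneg q.re]
  have b2 : q.re ^ 2 ≤ Real.sin (2 * Real.pi * t) ^ 2 := by nlinarith [sq_nonneg p.re]
  have c1 := (sq_le_sq.1 b1).trans hsin
  have c2 := (sq_le_sq.1 b2).trans hsin
  rw [hnp] at c1
  rw [hnq] at c2
  constructor
  · exact le_of_mul_le_mul_left (c1.trans (by linarith)) ht
  · exact le_of_mul_le_mul_left (c2.trans (by linarith)) ht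

end HasSymmetricTraces

theorem norm_evalAt_le_iff {X : Fin 3 → WienerSpace ρ} {l : ℂ} {M : ℝ} (hM : 0 ≤ M) :
    ‖evalAt X l‖ ≤ M ↔ ∀ j, ‖(X j).eval l‖ ≤ M := pi_norm_le_iff_of_nonneg hM

theorem continuousOn_evalAt (X : Fin 3 → WienerSpace ρ) :
    ContinuousOn (evalAt X) {l | InAnnulus ρ l} :=
  continuousOn_pi.2 fun j => continuousOn_eval (X j)

/-- A priori bounds on the unit circle. -/
theorem exists_circle_bound (hφ : φ ∈ Ioo 0 (Real.pi / 2)) : ∃ ε > 0, ∀ t ∈ Ioo 0 ε,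
    ∀ X : Fin 3 → WienerSpace ρ, HasSymmetricTraces φ t X → ∀ l : ℂ, ‖l‖ = 1 →
      ‖evalAt X l‖ ≤ 2 := by
  obtain ⟨ε, hε, H⟩ := exists_uniform_traces hφ 3 (η := 1 / 2) (by norm_num)
  refine ⟨min ε (1 / 30), lt_min hε (by norm_num), fun t ht X h l hl => ?_⟩
  have ht1 : |t| < ε := by rw [abs_of_pos ht.1]; exact ht.2.trans_le (min_le_left _ _)
  have ht2 : t < 1 / 30 := ht.2.trans_le (min_le_right _ _)
  have hpi := Real.pi_pos
  have hpi3 := Real.pi_gt_three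
  have hpi4 := Real.pi_le_four
  have hnpi : ‖(2 * Real.pi : ℂ)‖ = 2 * Real.pi := by
    rw [norm_mul, norm_real, Real.norm_eq_abs, abs_of_pos hpi]; simp
  -- The bound `3` makes the traces at most `1`, which activates the discriminant inequality. It
  -- yields `11/10` for the second and third components, and the quadratic relation bounds the first
  -- by the root of `2 · (11/10)² + 1 < 4`.
  have step : ∀ l : ℂ, ‖l‖ = 1 → ‖evalAt X l‖ ≤ 3 → ‖evalAt X l‖ ≤ 2 := by
    intro l hl hb
    obtain ⟨e1, e2, -⟩ := H t ht1 (evalAt X l) hb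
    have hb' := (norm_evalAt_le_iff (by norm_num)).1 hb
    have small : ∀ P x : ℂ, ‖P - 2 * Real.pi * x‖ ≤ 1 / 2 → ‖x‖ ≤ 3 → ‖t • P‖ ≤ 1 := by
      intro P x hP hx
      have h1 : ‖P‖ ≤ 1 / 2 + 2 * Real.pi * 3 := by
        calc ‖P‖ = ‖(P - 2 * Real.pi * x) + 2 * Real.pi * x‖ := by rw [sub_add_cancel]
          _ ≤ _ := (norm_add_le _ _).trans (add_le_add hP (by
            rw [norm_mul, hnpi]; gcongr))
      rw [norm_smul, Real.norm_eq_abs, abs_of_pos ht.1]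
      calc t * ‖P‖ ≤ (1 / 30) * (1 / 2 + 2 * 4 * 3) := by
            gcongr
            exact h1.trans (by linarith)
        _ ≤ 1 := by norm_num
    have large : ∀ P x : ℂ, ‖P - 2 * Real.pi * x‖ ≤ 1 / 2 → ‖P‖ ≤ 2 * Real.pi → ‖x‖ ≤ 11 / 10 := by
      intro P x hP hx
      have h1 : ‖(2 * Real.pi * x : ℂ)‖ ≤ 2 * Real.pi + 1 / 2 := by
        calc ‖(2 * Real.pi * x : ℂ)‖ = ‖P - (P - 2 * Real.pi * x)‖ := by rw [sub_sub_cancel]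
          _ ≤ _ := (norm_sub_le _ _).trans (add_le_add hx hP)
      rw [norm_mul, hnpi] at h1
      nlinarith [norm_nonneg x]
    obtain ⟨f1, f2⟩ := h.norm_rem_le hφ ht.1 hl (small _ _ e1 (hb' 2)) (small _ _ e2 (hb' 1))
    have g2 := large _ _ e1 f1
    have g1 := large _ _ e2 f2
    have hQ := quadForm_evalAt h.quad (inAnnulus_of_norm_one hl)
    have g0 : ‖evalAt X l 0‖ ≤ 2 := by
      have e : evalAt X l 0 ^ 2 = evalAt X l 1 ^ 2 + evalAt X l 2 ^ 2 - 1 := by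
        rw [quadForm] at hQ; linear_combination -hQ
      have e' : ‖evalAt X l 0‖ ^ 2 ≤ ‖evalAt X l 1‖ ^ 2 + ‖evalAt X l 2‖ ^ 2 + 1 := by
        rw [← norm_pow, e, ← norm_pow, ← norm_pow]
        refine (norm_sub_le _ _).trans (add_le_add (norm_add_le _ _) (by simp))
      nlinarith [norm_nonneg (evalAt X l 0), norm_nonneg (evalAt X l 1), norm_nonneg (evalAt X l 2)]
    rw [norm_evalAt_le_iff (by norm_num)]
    intro j
    fin_cases j
    · exact g0
    · exact g1.trans (by norm_num)
    · exact g2.trans (by norm_num)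
  have harg : exp (l.arg * I) = l := by
    have := norm_mul_exp_arg_mul_I l
    rwa [hl, ofReal_one, one_mul] at this
  have hunit : ∀ x : ℝ, ‖exp ((x * l.arg : ℝ) * I)‖ = 1 := fun x => norm_exp_ofReal_mul_I _
  -- The bound propagates along the unit circle from `λ = 1`, where the values are known.
  have key := le_of_bootstrap (f := fun x : ℝ => ‖evalAt X (exp ((x * l.arg : ℝ) * I))‖) (x₀ := 0)
    (x := 1) (a := 2) (b := 3) zero_le_one ?_ ?_ (by norm_num) (fun y _ hy => step _ (hunit y) hy)
  · simpa [harg] using key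
  · refine ContinuousOn.norm ((continuousOn_evalAt X).comp ?_ ?_)
    · fun_prop
    · intro x _; exact inAnnulus_of_norm_one (hunit x)
  · obtain ⟨x0, x1, x2⟩ := h.evalAt_one hφ ht.1 (by linarith)
    have e : exp (((0 : ℝ) * l.arg : ℝ) * I) = 1 := by simp
    simp only [e]
    rw [norm_evalAt_le_iff (by norm_num)]
    intro j
    fin_cases j
    · change ‖(X 0).eval 1‖ ≤ 2
      rw [x0]; simp
    · change ‖(X 1).eval 1‖ ≤ 2
      rw [x1]; simp
    · change ‖(X 2).eval 1‖ ≤ 2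
      have := congrArg norm x2
      rw [norm_pow, norm_one] at this
      nlinarith [norm_nonneg ((X 2).eval 1)]

/-- Solutions are almost symmetric on the whole annulus. -/
theorem exists_almost_symmetric (hφ : φ ∈ Ioo 0 (Real.pi / 2)) {η : ℝ} (hη : 0 < η) :
    ∃ ε > 0, ∀ t ∈ Ioo 0 ε, ∀ (X : Fin 3 → WienerSpace ρ) (s : ℝ), HasPoles φ X s →
      HasSymmetricTraces φ t X → ∀ l : ℂ, InAnnulus ρ l →
        ‖(X 0).eval l + (X 0).eval l⁻¹‖ ≤ η ∧ ‖(X 1).eval l - (X 1).eval l⁻¹‖ ≤ η ∧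
        ‖(X 2).eval l - (X 2).eval l⁻¹‖ ≤ η := by
  have hρ1 := hρ.out
  have hρ0 := rho_pos (ρ := ρ)
  obtain ⟨ε₁, hε₁, H₁⟩ := exists_circle_bound (ρ := ρ) hφ
  obtain ⟨ε₂, hε₂, H₂⟩ := exists_uniform_traces hφ (4 * ρ) (η := min η 1) (lt_min hη one_pos)
  refine ⟨min ε₁ ε₂, lt_min hε₁ hε₂, fun t ht X s hX h => ?_⟩
  have hcirc := H₁ t ⟨ht.1, ht.2.trans_le (min_le_left _ _)⟩ X h
  have ht2 : |t| < ε₂ := by rw [abs_of_pos ht.1]; exact ht.2.trans_le (min_le_right _ _)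
  have hpi3 := Real.pi_gt_three
  have hpi := Real.pi_pos
  have hdiv : ∀ (c : ℝ) (P x y : ℂ), 2 ≤ c → ‖P - c * x‖ ≤ min η 1 → ‖P - c * y‖ ≤ min η 1 →
      ‖x - y‖ ≤ min η 1 := by
    intro c P x y hc h1 h2
    have e : (c : ℂ) * (x - y) = (P - c * y) - (P - c * x) := by ring
    have h3 : ‖(c : ℂ) * (x - y)‖ ≤ 2 * min η 1 := by
      rw [e]; exact (norm_sub_le _ _).trans (by linarith)
    rw [norm_mul, norm_real, Real.norm_eq_abs, abs_of_pos (by linarith)] at h3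
    nlinarith [norm_nonneg (x - y)]
  have almost : ∀ l : ℂ, InAnnulus ρ l → ‖evalAt X l‖ ≤ 4 * ρ → ‖evalAt X l⁻¹‖ ≤ 4 * ρ →
      ‖(X 0).eval l + (X 0).eval l⁻¹‖ ≤ min η 1 ∧ ‖(X 1).eval l - (X 1).eval l⁻¹‖ ≤ min η 1 ∧
        ‖(X 2).eval l - (X 2).eval l⁻¹‖ ≤ min η 1 := by
    intro l hl b1 b2
    obtain ⟨p1, q1, v1⟩ := H₂ t ht2 _ b1
    obtain ⟨p2, q2, v2⟩ := H₂ t ht2 _ b2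
    obtain ⟨ep, eq, ev⟩ := h.rem_inv ht.1.ne' hl
    rw [ep] at p2
    rw [eq] at q2
    rw [ev] at v2
    refine ⟨?_, ?_, ?_⟩
    · have := hdiv (4 * Real.pi) (vRem φ t (evalAt X l)) (evalAt X l 0) (-(evalAt X l⁻¹ 0))
        (by linarith) (by push_cast; exact v1) (by
          rw [← norm_neg]
          convert! v2 using 2
          push_cast; ring)
      rwa [sub_neg_eq_add] at this
    · exact hdiv (2 * Real.pi) _ _ _ (by linarith) (by push_cast; exact q1) (by push_cast; exact q2)
    · exact hdiv (2 * Real.pi) _ _ _ (by linarith) (by push_cast; exact p1) (by push_cast; exact p2)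
  -- Inside the circle `λ X` is holomorphic, so the maximum principle gives `|λ X| ≤ 2`, and `|λ| ≥
  -- ρ⁻¹`.
  have hin : ∀ l : ℂ, InAnnulus ρ l → ‖l‖ ≤ 1 → ‖evalAt X l‖ ≤ 2 * ρ := by
    intro l hl hl1
    rw [norm_evalAt_le_iff (by positivity)]
    intro j
    have h1 := norm_mul_eval_le_of_pole (hX.1 j) (M := 2)
      (fun l hl => (norm_evalAt_le_iff (by norm_num)).1 (hcirc l hl) j) hl1 hl.ne_zero
    rw [norm_mul] at h1
    have h2 : ρ⁻¹ * ‖(X j).eval l‖ ≤ 2 := (by gcongr; exact hl.1 : _ ≤ _).trans h1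
    rwa [inv_mul_le_iff₀ hρ0, mul_comm] at h2
  -- Outside, a bound by `4ρ` makes `X(m)` differ from `±X(1/m)` by at most `1`; the latter is at
  -- most `2ρ`, so the bound improves to `3ρ` and propagates radially from the unit circle.
  have hout : ∀ l : ℂ, InAnnulus ρ l → 1 ≤ ‖l‖ → ‖evalAt X l‖ ≤ 3 * ρ := by
    intro l hl hl1
    have h0 : (‖l‖ : ℂ) ≠ 0 := by
      rw [ofReal_ne_zero]; linarith
    have hn : ∀ x : ℝ, x ∈ Icc 1 ‖l‖ → ‖(x : ℂ) * (l / ‖l‖)‖ = x := fun x hx => by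
      rw [norm_mul, norm_div, norm_real, norm_real, norm_norm, div_self (by linarith), mul_one,
        Real.norm_eq_abs, abs_of_nonneg (by linarith [hx.1])]
    have hann : ∀ x : ℝ, x ∈ Icc 1 ‖l‖ → InAnnulus ρ ((x : ℂ) * (l / ‖l‖)) := fun x hx => by
      rw [InAnnulus, hn x hx]
      exact ⟨(inv_le_one_of_one_le₀ hρ1.le).trans hx.1, hx.2.trans hl.2⟩
    have key := le_of_bootstrap (f := fun x : ℝ => ‖evalAt X ((x : ℂ) * (l / ‖l‖))‖) (x₀ := 1)
      (x := ‖l‖) (a := 3 * ρ) (b := 4 * ρ) hl1 ?_ ?_ (by linarith) (fun y hy hb => ?_)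
    · have e : (‖l‖ : ℂ) * (l / ‖l‖) = l := by field_simp
      simpa only [e] using key
    · refine ContinuousOn.norm ((continuousOn_evalAt X).comp ?_ hann)
      fun_prop
    · refine (hcirc _ (hn 1 ⟨le_rfl, hl1⟩)).trans (by linarith)
    · set m : ℂ := (y : ℂ) * (l / ‖l‖) with hm
      have hma := hann y hy
      have hmi : ‖m⁻¹‖ ≤ 1 := by
        rw [norm_inv, hn y hy]; exact inv_le_one_of_one_le₀ hy.1
      have hb2 := hin _ hma.inv hmi
      obtain ⟨a0, a1, a2⟩ := almost m hma hb (hb2.trans (by linarith))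
      have hb2' := (norm_evalAt_le_iff (by positivity)).1 hb2
      have hmin : min η 1 ≤ 1 := min_le_right _ _
      have tri : ∀ x y : ℂ, ‖x - y‖ ≤ min η 1 → ‖y‖ ≤ 2 * ρ → ‖x‖ ≤ 3 * ρ := fun x y hxy hy => by
        calc ‖x‖ = ‖(x - y) + y‖ := by rw [sub_add_cancel]
          _ ≤ _ := norm_add_le _ _
          _ ≤ 3 * ρ := by linarith
      rw [norm_evalAt_le_iff (by positivity)]
      intro j
      fin_cases j
      · refine tri _ (-((X 0).eval m⁻¹)) (by rw [sub_neg_eq_add]; exact a0) ?_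
        rw [norm_neg]; exact hb2' 0
      · exact tri _ _ a1 (hb2' 1)
      · exact tri _ _ a2 (hb2' 2)
  have hall : ∀ l : ℂ, InAnnulus ρ l → ‖evalAt X l‖ ≤ 4 * ρ := fun l hl => by
    rcases le_total ‖l‖ 1 with h1 | h1
    · exact (hin l hl h1).trans (by linarith)
    · exact (hout l hl h1).trans (by linarith)
  intro l hl
  obtain ⟨a0, a1, a2⟩ := almost l hl (hall l hl) (hall _ hl.inv)
  have hmin : min η 1 ≤ η := min_le_left _ _
  exact ⟨a0.trans hmin, a1.trans hmin, a2.trans hmin⟩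

end WienerSpace

/-! ### Closeness to the central solution -/

namespace WienerSpace

open Lawson

set_option linter.unusedSectionVars false

variable {ρ : ℝ} [hρ : Fact (1 < ρ)]

theorem norm_le_of_abs_coeff_le {u v : WienerSpace ρ} (h : ∀ k, |u.coeff k| ≤ |v.coeff k|) :
    ‖u‖ ≤ ‖v‖ := by
  rw [norm_eq, norm_eq]
  exact u.summable_coeff.tsum_le_tsum
    (fun k => mul_le_mul_of_nonneg_right (h k) (pow_nonneg rho_pos.le _)) v.summable_coeff

theorem norm_tri_le (a b d : ℝ) : ‖(tri a b d : WienerSpace ρ)‖ ≤ |a| * ρ + |b| + |d| * ρ := by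
  rw [tri]
  refine (norm_add_le _ _).trans (add_le_add ((norm_add_le _ _).trans ?_) ?_) <;>
    simp [norm_single]

/-- Series with a simple pole are controlled by their polar part, their constant coefficient and
their asymmetry. -/
theorem norm_sub_tri_le {u D : WienerSpace ρ} {σ : ℝ} (hu : ∀ k < -1, u.coeff k = 0)
    (hD : ∀ k, 0 < k → D.coeff k = u.coeff k - σ * u.coeff (-k)) :
    ‖u - tri (u.coeff (-1)) (u.coeff 0) (σ * u.coeff (-1))‖ ≤ ‖D‖ := by
  refine norm_le_of_abs_coeff_le fun k => ?_
  rw [coeff_sub, coeff_tri]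
  by_cases h1 : k = -1
  · rw [if_pos h1, h1, sub_self, abs_zero]; exact abs_nonneg _
  by_cases h2 : k = 0
  · rw [if_neg h1, if_pos h2, h2, sub_self, abs_zero]; exact abs_nonneg _
  by_cases h3 : k = 1
  · rw [if_neg h1, if_neg h2, if_pos h3, hD k (by omega), h3]
  rw [if_neg h1, if_neg h2, if_neg h3]
  rcases lt_or_ge k (-1) with h | h
  · rw [hu k h, sub_zero, abs_zero]; exact abs_nonneg _
  · rw [hD k (by omega), hu (-k) (by omega), mul_zero]

theorem abs_sumCLM_le (u : WienerSpace ρ) : |sumCLM u| ≤ ‖u‖ := by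
  have h := norm_eval_le u (one_inAnnulus (ρ := ρ))
  rwa [← ofReal_sumCLM, norm_real] at h

/-- With the residues prescribed, the `λ⁻¹` coefficient of the quadratic equation is a linear
relation among the constant terms. -/
theorem coeff_neg_one_quadForm {φ s : ℝ} {X : Fin 3 → WienerSpace ρ} (hs : s ≠ 0)
    (hX : HasPoles φ X s) (hK : quadForm X = 1) :
    (X 0).coeff 0 + Real.sin φ * (X 1).coeff 0 + Real.cos φ * (X 2).coeff 0 = 0 := by
  have h := congrArg (fun u => u.coeff (-1)) hK
  have m := fun j => (coeff_mul_of_pole (hX.1 j) (hX.1 j)).2.2.1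
  have p0 : poleCoeff φ 0 = 1 / 2 := rfl
  have p1 : poleCoeff φ 1 = -(1 / 2) * Real.sin φ := rfl
  have p2 : poleCoeff φ 2 = -(1 / 2) * Real.cos φ := rfl
  simp only [quadForm_eq, coeff_add, coeff_neg, m, hX.2, coeff_one, p0, p1, p2] at h
  norm_num at h
  have h' : s * ((X 0).coeff 0 + Real.sin φ * (X 1).coeff 0 + Real.cos φ * (X 2).coeff 0) = 0 := by
    linear_combination -h
  exact (mul_eq_zero.1 h').resolve_left hs

/-- Inserting the approximate constant terms into the linear relation gives `(S² + c²)(s - c) + c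
e`, up to `3M`, so `s - c + c e` is small. For `e = 2` it would be `s + c > c > 3M`; this is where
positivity of `s` is used. -/
theorem abs_le_of_near_linear {S c s e M y0 y1 y2 : ℝ} (hS : 0 < S) (hS1 : S ≤ 1) (hc : 0 < c)
    (hc1 : c ≤ 1) (h : S ^ 2 + c ^ 2 = 1) (hs : 0 < s) (hM : 3 * M < c) (he : e = 0 ∨ e = 2)
    (r0 : |0 - y0| ≤ M) (r1 : |0 - (y1 - S * (s - c))| ≤ M) (r2 : |e - (y2 - c * (s - c))| ≤ M)
    (lin : y0 + S * y1 + c * y2 = 0) :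
    e = 0 ∧ |s - c| ≤ 3 * M ∧ |y0| ≤ 4 * M ∧ |y1| ≤ 4 * M ∧ |y2| ≤ 4 * M := by
  have hM0 : 0 ≤ M := (abs_nonneg _).trans r0
  have key : s - c + c * e = (0 - y0) + S * (0 - (y1 - S * (s - c))) +
      c * (e - (y2 - c * (s - c))) := by
    linear_combination (-(s - c)) * h + lin
  have hb : |s - c + c * e| ≤ 3 * M := by
    rw [key]
    refine (abs_add_three _ _ _).trans ?_
    rw [abs_mul, abs_mul, abs_of_pos hS, abs_of_pos hc]
    have h1 := mul_le_of_le_one_left (abs_nonneg (0 - (y1 - S * (s - c)))) hS1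
    have h2 := mul_le_of_le_one_left (abs_nonneg (e - (y2 - c * (s - c)))) hc1
    linarith
  have e0 : e = 0 := by
    refine he.resolve_right fun h2 => ?_
    rw [h2] at hb
    linarith [(abs_le.1 hb).2]
  subst e0
  rw [mul_zero, add_zero] at hb
  have h1 : |S * (s - c)| ≤ 3 * M := by
    rw [abs_mul, abs_of_pos hS]
    exact (mul_le_of_le_one_left (abs_nonneg _) hS1).trans hb
  have h2 : |c * (s - c)| ≤ 3 * M := by
    rw [abs_mul, abs_of_pos hc]
    exact (mul_le_of_le_one_left (abs_nonneg _) hc1).trans hb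
  rw [abs_le] at r0 r1 r2 h1 h2
  refine ⟨rfl, hb, abs_le.2 ⟨?_, ?_⟩, abs_le.2 ⟨?_, ?_⟩, abs_le.2 ⟨?_, ?_⟩⟩ <;> linarith

/-- Solutions are close to the central one. -/
theorem exists_near_central {φ : ℝ} (hφ : φ ∈ Ioo 0 (Real.pi / 2)) {ρ' : ℝ} [hρ' : Fact (1 < ρ')]
    (hlt : ρ' < ρ) {δ : ℝ} (hδ : 0 < δ) : ∃ ε > 0, ∀ t ∈ Ioo 0 ε,
    ∀ (X : Fin 3 → WienerSpace ρ) (s : ℝ), 0 < s → HasPoles φ X s → HasSymmetricTraces φ t X →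
      ‖((fun j => incl hlt.le (X j) : Fin 3 → WienerSpace ρ'), s) - (centralX φ, Real.cos φ)‖ < δ := by
  have hc := cos_pos_of_mem hφ
  have hs := sin_pos_of_mem hφ
  have hρ0 := rho_pos (ρ := ρ')
  set S : ℝ := ∑' k : ℤ, (ρ' / ρ) ^ k.natAbs with hS
  have hS0 : 0 ≤ S := tsum_nonneg fun k => pow_nonneg (div_nonneg hρ0.le rho_pos.le) _
  -- The first condition makes the final estimate smaller than `δ`, the second excludes the wrong
  -- sign of the third component at `λ = 1`.
  obtain ⟨η, hη, hη1, hη2⟩ : ∃ η > 0, η * S * (5 + 6 * ρ') < δ ∧ 3 * (η * S) < Real.cos φ := by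
    have hc1 : Filter.Tendsto (fun η : ℝ => η * S * (5 + 6 * ρ')) (nhdsWithin 0 (Ioi 0)) (nhds 0) := by
      have : Continuous fun η : ℝ => η * S * (5 + 6 * ρ') := by fun_prop
      simpa using (this.tendsto 0).mono_left (nhdsWithin_le_nhds (s := Ioi 0))
    have hc2 : Filter.Tendsto (fun η : ℝ => 3 * (η * S)) (nhdsWithin 0 (Ioi 0)) (nhds 0) := by
      have : Continuous fun η : ℝ => 3 * (η * S) := by fun_prop
      simpa using (this.tendsto 0).mono_left (nhdsWithin_le_nhds (s := Ioi 0))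
    obtain ⟨η, h1, h2, h3⟩ := ((hc1.eventually (gt_mem_nhds hδ)).and
      ((hc2.eventually (gt_mem_nhds hc)).and self_mem_nhdsWithin)).exists
    exact ⟨η, h3, h1, h2⟩
  obtain ⟨ε, hε, H⟩ := exists_almost_symmetric (ρ := ρ) hφ hη
  refine ⟨min ε (1 / 8), lt_min hε (by norm_num), fun t ht X s hs0 hX h => ?_⟩
  have hsym := H t ⟨ht.1, ht.2.trans_le (min_le_left _ _)⟩ X s hX h
  obtain ⟨x0, x1, x2⟩ := h.evalAt_one hφ ht.1 (ht.2.trans_le (min_le_right _ _))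
  set M := η * S with hM
  have hM0 : 0 ≤ M := by positivity
  set d := s - Real.cos φ with hd
  set u : Fin 3 → WienerSpace ρ' := fun j => incl hlt.le (X j) - centralX φ j with hu
  have hucoeff : ∀ j k, (u j).coeff k = (X j).coeff k - (centralX φ j : WienerSpace ρ').coeff k :=
    fun j k => by rw [hu]; exact (coeff_sub _ _ _).trans (by rw [coeff_incl])
  have hC := hasPoles_centralX (ρ := ρ') φ
  have hpole : ∀ j, ∀ k < -1, (u j).coeff k = 0 := fun j k hk => by
    rw [hucoeff, hX.1 j k hk, hC.1 j k hk, sub_zero]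
  have hres : ∀ j, (u j).coeff (-1) = d * poleCoeff φ j := fun j => by
    rw [hucoeff, hX.2, hC.2, hd]; ring
  set σ : Fin 3 → ℝ := ![-1, 1, 1] with hσ
  have hcsym : ∀ j k, (centralX φ j : WienerSpace ρ').coeff k =
      σ j * (centralX φ j : WienerSpace ρ').coeff (-k) := by
    intro j k
    have e1 : ∀ a b : ℝ, (tri a b a : WienerSpace ρ').coeff k = (tri a b a : WienerSpace ρ').coeff (-k) :=
      fun a b => by rw [← coeff_refl, refl_tri]
    fin_cases j
    · change (tri (Real.cos φ / 2) 0 (-Real.cos φ / 2) : WienerSpace ρ').coeff k =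
        -1 * (tri (Real.cos φ / 2) 0 (-Real.cos φ / 2) : WienerSpace ρ').coeff (-k)
      rw [coeff_tri, coeff_tri]
      by_cases h1 : k = -1
      · subst h1; norm_num; ring
      by_cases h2 : k = 0
      · subst h2; norm_num
      by_cases h3 : k = 1
      · subst h3; norm_num; ring
      rw [if_neg h1, if_neg h2, if_neg h3, if_neg (by omega), if_neg (by omega), if_neg (by omega)]
      ring
    · exact (e1 _ _).trans (one_mul _).symm
    · exact (e1 _ _).trans (one_mul _).symm
  -- `D` is the defect of the expected parity of each component. It is small in supremum on the
  -- larger annulus, hence in norm on the smaller one.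
  set D : Fin 3 → WienerSpace ρ' := fun j => incl hlt.le (X j - σ j • refl (X j)) with hD
  have hDcoeff : ∀ j k, (D j).coeff k = (u j).coeff k - σ j * (u j).coeff (-k) := fun j k => by
    rw [hD, hucoeff, hucoeff]
    refine (coeff_incl _ _ _).trans ?_
    rw [coeff_sub, coeff_smul, coeff_refl]
    have := hcsym j k
    linear_combination this
  have hDnorm : ∀ j, ‖D j‖ ≤ M := fun j => by
    refine norm_incl_le hlt _ fun l hl => ?_
    rw [eval_sub _ _ hl, eval_smul _ _ hl, eval_refl]
    obtain ⟨s0, s1, s2⟩ := hsym l hl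
    fin_cases j
    · change ‖(X 0).eval l - ((-1 : ℝ) : ℂ) * (X 0).eval l⁻¹‖ ≤ η
      convert! s0 using 2
      push_cast; ring
    · change ‖(X 1).eval l - ((1 : ℝ) : ℂ) * (X 1).eval l⁻¹‖ ≤ η
      convert! s1 using 2
      push_cast; ring
    · change ‖(X 2).eval l - ((1 : ℝ) : ℂ) * (X 2).eval l⁻¹‖ ≤ η
      convert! s2 using 2
      push_cast; ring
  have hrem : ∀ j, ‖u j - tri ((u j).coeff (-1)) ((u j).coeff 0) (σ j * (u j).coeff (-1))‖ ≤ M :=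
    fun j => (norm_sub_tri_le (hpole j) fun k _ => hDcoeff j k).trans (hDnorm j)
  have hsum : ∀ j, |sumCLM (u j) - ((u j).coeff (-1) * (1 + σ j) + (u j).coeff 0)| ≤ M := fun j => by
    have h1 := (abs_sumCLM_le _).trans (hrem j)
    rw [map_sub, sumCLM_tri] at h1
    convert! h1 using 2
    ring
  have hev : ∀ j, (sumCLM (u j) : ℂ) = (X j).eval 1 - (centralX φ j : WienerSpace ρ').eval 1 :=
    fun j => by
      rw [ofReal_sumCLM, ← eval_incl hlt.le (X j)]
      exact eval_sub _ _ one_inAnnulus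
  have hev0 : sumCLM (u 0) = 0 := by
    have := hev 0
    rw [x0, eval_centralX_zero] at this
    apply ofReal_injective
    rw [this]; simp
  have hev1 : sumCLM (u 1) = 0 := by
    have := hev 1
    rw [x1, eval_centralX_one] at this
    apply ofReal_injective
    rw [this]; norm_num
  -- The third component is `±1` at `λ = 1` and the central one is `-1`, so the difference is `0` or
  -- `2`.
  obtain ⟨e, he, hev2⟩ : ∃ e : ℝ, (e = 0 ∨ e = 2) ∧ sumCLM (u 2) = e := by
    refine ⟨sumCLM (u 2), ?_, rfl⟩
    have h2 := hev 2
    rw [eval_centralX_two] at h2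
    have h3 : (X 2).eval 1 = (sumCLM (u 2) : ℂ) - 1 := by rw [h2]; norm_num
    rw [h3] at x2
    have h4 : (sumCLM (u 2) - 1) ^ 2 = 1 := by exact_mod_cast x2
    have h5 : sumCLM (u 2) * (sumCLM (u 2) - 2) = 0 := by linear_combination h4
    exact (mul_eq_zero.1 h5).imp id sub_eq_zero.1
  have r0 := hsum 0
  have r1 := hsum 1
  have r2 := hsum 2
  have p0 : poleCoeff φ 0 = 1 / 2 := rfl
  have p1 : poleCoeff φ 1 = -(1 / 2) * Real.sin φ := rfl
  have p2 : poleCoeff φ 2 = -(1 / 2) * Real.cos φ := rfl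
  have σ0 : σ 0 = -1 := rfl
  have σ1 : σ 1 = 1 := rfl
  have σ2 : σ 2 = 1 := rfl
  rw [hev0, hres, σ0] at r0
  rw [hev1, hres, p1, σ1] at r1
  rw [hev2, hres, p2, σ2] at r2
  have lin : (u 0).coeff 0 + Real.sin φ * (u 1).coeff 0 + Real.cos φ * (u 2).coeff 0 = 0 := by
    have l1 := coeff_neg_one_quadForm hs0.ne' hX h.quad
    have l2 := coeff_neg_one_quadForm hc.ne' hC (quadForm_centralX φ)
    rw [hucoeff, hucoeff, hucoeff]
    linear_combination l1 - l2
  rw [show d * poleCoeff φ 0 * (1 + -1) + (u 0).coeff 0 = (u 0).coeff 0 by ring] at r0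
  rw [show d * (-(1 / 2) * Real.sin φ) * (1 + 1) + (u 1).coeff 0 =
    (u 1).coeff 0 - Real.sin φ * d by ring] at r1
  rw [show d * (-(1 / 2) * Real.cos φ) * (1 + 1) + (u 2).coeff 0 =
    (u 2).coeff 0 - Real.cos φ * d by ring] at r2
  obtain ⟨e0, hd3, hy0, hy1, hy2⟩ := abs_le_of_near_linear hs (Real.sin_le_one φ) hc
    (Real.cos_le_one φ) (Real.sin_sq_add_cos_sq φ) hs0 hη2 he r0 r1 r2 lin
  have hy : ∀ j, |(u j).coeff 0| ≤ 4 * M := by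
    intro j; fin_cases j <;> assumption
  have hpc : ∀ j, |poleCoeff φ j| ≤ 1 := by
    intro j; fin_cases j
    · change |poleCoeff φ 0| ≤ 1
      rw [p0]; norm_num
    · change |poleCoeff φ 1| ≤ 1
      rw [p1, abs_le]; constructor <;> linarith [Real.sin_le_one φ]
    · change |poleCoeff φ 2| ≤ 1
      rw [p2, abs_le]; constructor <;> linarith [Real.cos_le_one φ]
  have hσ1 : ∀ j, |σ j| = 1 := by
    intro j; fin_cases j <;> simp [hσ]
  have hr : ∀ j, |(u j).coeff (-1)| ≤ 3 * M := fun j => by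
    rw [hres, abs_mul]
    exact (mul_le_of_le_one_right (abs_nonneg _) (hpc j)).trans hd3
  have hun : ∀ j, ‖u j‖ ≤ M * (5 + 6 * ρ') := fun j => by
    have h1 := norm_le_insert' (u j) (tri ((u j).coeff (-1)) ((u j).coeff 0)
      (σ j * (u j).coeff (-1)))
    have h2 := norm_tri_le (ρ := ρ') ((u j).coeff (-1)) ((u j).coeff 0) (σ j * (u j).coeff (-1))
    rw [abs_mul, hσ1, one_mul] at h2
    have h3 := hrem j
    have h4 := mul_le_mul_of_nonneg_right (hr j) hρ0.le
    have h5 := hy j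
    linarith
  have hδ' : M * (5 + 6 * ρ') < δ := hη1
  rw [Prod.norm_def]
  refine max_lt ?_ ?_
  · exact (pi_norm_lt_iff hδ).2 fun j => (hun j).trans_lt hδ'
  · refine lt_of_le_of_lt (hd3.trans ?_) hδ'
    nlinarith

end WienerSpace

/-! ### The problem in terms of traces, and uniqueness -/

namespace WienerSpace

open Lawson

set_option linter.unusedSectionVars false

variable {ρ : ℝ} [hρ : Fact (1 < ρ)]

theorem eval_real_smul (c : ℝ) (u : WienerSpace ρ) (l : ℂ) : (c • u).eval l = c * u.eval l := by
  rw [eval, eval, ← tsum_mul_left]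
  refine tsum_congr fun k => ?_
  rw [coeff_smul]; push_cast; ring

/-- The equations of the monodromy problem in terms of the trace functions. -/
structure SolvesTraces (φ t : ℝ) (X : Fin 3 → WienerSpace ρ) (s : ℝ) : Prop where
  poles : HasPoles φ X s
  quad : quadForm X = 1
  refl_p : refl (pFun φ (t • X)) = pFun φ (t • X)
  refl_q : refl (qFun φ (t • X)) = qFun φ (t • X)
  q_one : qFun φ (t • evalAt X 1) = 0

variable {φ t s : ℝ} {X : Fin 3 → WienerSpace ρ}

theorem refl_smul_iff (ht : t ≠ 0) (u : WienerSpace ρ) : refl (t • u) = t • u ↔ refl u = u := by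
  rw [map_smul]
  exact (smul_right_injective _ ht).eq_iff

theorem qFun_evalAt_one (φ t : ℝ) (X : Fin 3 → WienerSpace ρ) :
    qFun φ (t • evalAt X 1) = ((t * sumCLM (qRem ℝ φ t X) : ℝ) : ℂ) := by
  rw [← eval_qFun φ t X one_inAnnulus, ← ofReal_sumCLM, qFun_smul ℝ, map_smul, smul_eq_mul]

theorem SolvesTraces.of_monEq (h : monEq φ (t, X, s) = 0) : SolvesTraces φ t X s := by
  obtain ⟨h1, h2, h3, h4, h5⟩ := (monEq_eq_zero_iff φ t s X).1 h
  refine ⟨h1, h2, ?_, ?_, ?_⟩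
  · rw [pFun_smul ℝ, map_smul, h3]
  · rw [qFun_smul ℝ, map_smul, h4]
  · rw [qFun_evalAt_one, h5, mul_zero, ofReal_zero]

theorem SolvesTraces.monEq_eq_zero (h : SolvesTraces φ t X s) (ht : t ≠ 0) :
    monEq φ (t, X, s) = 0 := by
  have h3 := h.refl_p
  have h4 := h.refl_q
  have h5 := h.q_one
  rw [pFun_smul ℝ, refl_smul_iff ht] at h3
  rw [qFun_smul ℝ, refl_smul_iff ht] at h4
  rw [qFun_evalAt_one, ofReal_eq_zero] at h5
  exact (monEq_eq_zero_iff φ t s X).2 ⟨h.poles, h.quad, h3, h4, (mul_eq_zero.1 h5).resolve_left ht⟩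

/-- All conditions concern coefficients or values on the unit circle, which do not change with the
radius. -/
theorem SolvesTraces.incl {ρ' : ℝ} [hρ' : Fact (1 < ρ')] (hle : ρ' ≤ ρ) (h : SolvesTraces φ t X s) :
    SolvesTraces φ t (fun j => WienerSpace.incl hle (X j) : Fin 3 → WienerSpace ρ') s := by
  have he : ∀ l, evalAt (fun j => WienerSpace.incl hle (X j) : Fin 3 → WienerSpace ρ') l =
      evalAt X l := fun l => funext fun j => eval_incl hle (X j) l
  have hr : ∀ {l : ℂ}, ‖l‖ = 1 → InAnnulus ρ l := inAnnulus_of_norm_one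
  have hr' : ∀ {l : ℂ}, ‖l‖ = 1 → InAnnulus ρ' l := inAnnulus_of_norm_one
  refine ⟨⟨fun j k hk => ?_, fun j => ?_⟩, ?_, ?_, ?_, ?_⟩
  · exact (coeff_incl hle (X j) k).trans (h.poles.1 j k hk)
  · exact (coeff_incl hle (X j) (-1)).trans (h.poles.2 j)
  · refine eq_of_eval_eq_on_unit_circle fun l hl => ?_
    rw [eval_quadForm _ (hr' hl), eval_one, ← quadForm_evalAt h.quad (hr hl), ← he]
    rfl
  · rw [refl_eq_self_iff]
    intro l hl
    rw [eval_pFun φ t _ (hr' hl), he, ← eval_pFun φ t X (hr hl)]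
    exact (refl_eq_self_iff _).1 h.refl_p l hl
  · rw [refl_eq_self_iff]
    intro l hl
    rw [eval_qFun φ t _ (hr' hl), he, ← eval_qFun φ t X (hr hl)]
    exact (refl_eq_self_iff _).1 h.refl_q l hl
  · rw [he]; exact h.q_one

theorem SolvesTraces.hasSymmetricTraces (h : SolvesTraces φ t X s) (hφ : φ ∈ Ioo 0 (Real.pi / 2))
    (ht : t ≠ 0) (hI : (vFun φ (t • evalAt X I) ^ 2).re < 0) : HasSymmetricTraces φ t X :=
  ⟨h.quad, h.refl_p, h.refl_q, refl_vFun hφ ht h.quad h.refl_p h.refl_q hI, h.q_one⟩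

/-- The normalization of the quadratic form extends to the punctured disk. -/
theorem quadForm_evalAt_of_pole (hX : ∀ j, ∀ k < -1, (X j).coeff k = 0) (hK : quadForm X = 1) {l : ℂ}
    (h0 : l ≠ 0) (hl : ‖l‖ < ρ) : quadForm (evalAt X l) = 1 := by
  have hρ1 := hρ.out
  have hd := fun j => differentiableOn_eval (coeff_single_mul_of_pole (hX j))
  have hev := fun j (l : ℂ) (h : l ≠ 0) => eval_single_mul (X j) h
  have hf : DifferentiableOn ℂ (fun l => quadForm fun j => (single 1 1 * X j).eval l)
      (Metric.ball 0 ρ) := (((hd 0).pow 2).neg.add ((hd 1).pow 2)).add ((hd 2).pow 2)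
  have hg : DifferentiableOn ℂ (fun l : ℂ => l ^ 2) (Metric.ball 0 ρ) := by fun_prop
  have hq : ∀ l : ℂ, l ≠ 0 → (quadForm fun j => (single 1 1 * X j).eval l) =
      l ^ 2 * quadForm (evalAt X l) := fun l h => by
    simp only [quadForm, hev _ l h, evalAt]; ring
  -- After multiplication by `λ²` both sides are holomorphic on the whole disk; they agree near `1`,
  -- inside the annulus of convergence, hence everywhere.
  have hloc : (fun l => quadForm fun j => (single 1 1 * X j).eval l) =ᶠ[nhds 1]
      fun l : ℂ => l ^ 2 := by
    have hU : {l : ℂ | ρ⁻¹ < ‖l‖ ∧ ‖l‖ < ρ} ∈ nhds (1 : ℂ) := by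
      refine IsOpen.mem_nhds ((isOpen_lt continuous_const continuous_norm).inter
        (isOpen_lt continuous_norm continuous_const)) ?_
      simpa using ⟨inv_lt_one_of_one_lt₀ hρ1, hρ1⟩
    filter_upwards [hU] with l hl
    have hA : InAnnulus ρ l := ⟨hl.1.le, hl.2.le⟩
    rw [hq l hA.ne_zero, quadForm_evalAt hK hA, mul_one]
  have h := (hf.analyticOnNhd Metric.isOpen_ball).eqOn_of_preconnected_of_eventuallyEq
    (hg.analyticOnNhd Metric.isOpen_ball) (convex_ball (0 : ℂ) ρ).isPreconnected
    (by simpa using hρ1) hloc (show l ∈ Metric.ball 0 ρ by simpa using hl)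
  have h' : l ^ 2 * quadForm (evalAt X l) = l ^ 2 * 1 := by rw [← hq l h0, mul_one]; exact h
  exact mul_left_cancel₀ (pow_ne_zero 2 h0) h'

/-! ### Translation between the monodromy problem and the traces -/

section Monodromy

variable {x : Fin 3 → WienerSpace ρ} {F : ℂ → ℂ → Matrix (Fin 2) (Fin 2) ℂ}

/-- The scale `s` and the series `x` enter the potential only through `s • x`, which is why the
product is taken as unknown. -/
theorem frame_arg (s t : ℝ) (x : Fin 3 → WienerSpace ρ) (l : ℂ) :
    (fun j => (s : ℂ) * t * (x j).eval l) = t • evalAt (s • x) l := by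
  funext j
  change _ = t • (s • x j).eval l
  rw [eval_real_smul, Complex.real_smul]; ring

theorem calK_eq_quadForm (x : Fin 3 → WienerSpace ρ) (s : ℝ) (l : ℂ) :
    calK x s l = quadForm (evalAt (s • x) l) := by
  simp only [calK, quadForm, evalAt, Pi.smul_apply, eval_real_smul]; ring

/-- The half traces only involve the values at `1` and `i`, which lie in the slit plane where the
frame is unique; the choice of `G` elsewhere is irrelevant. -/
theorem halfTraces_eq (hφ : φ ∈ Ioo 0 (Real.pi / 2)) {l : ℂ} {G : ℂ → Matrix (Fin 2) (Fin 2) ℂ}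
    (h : IsFrame φ t x s l G) : halfTraceP G = pFun φ (t • evalAt (s • x) l) ∧
      halfTraceQ G = qFun φ (t • evalAt (s • x) l) := by
  rw [← frame_arg]
  exact ⟨halfTraceP_eq hφ (h.eq_frame (one_mem_slitDomain (sin_pos_of_mem hφ))),
    halfTraceQ_eq hφ (h.eq_frame (I_mem_slitDomain (cos_pos_of_mem hφ)))⟩

theorem frickeDiscriminant_eq (hφ : φ ∈ Ioo 0 (Real.pi / 2)) (ht : t ≠ 0) {l : ℂ}
    {G : ℂ → Matrix (Fin 2) (Fin 2) ℂ} (h : IsFrame φ t x s l G) (hK : calK x s l = 1) :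
    frickeDiscriminant t G = -vFun φ (t • evalAt (s • x) l) ^ 2 := by
  obtain ⟨hp, hq⟩ := halfTraces_eq hφ h
  rw [calK_eq_quadForm] at hK
  rw [vFun_sq hφ ht (by rw [quadForm_smul, hK, mul_one]), frickeDiscriminant, hp, hq]
  ring

theorem norm_lt_of_norm_one {l : ℂ} (hl : ‖l‖ = 1) : 0 < ‖l‖ ∧ ‖l‖ < ρ := by
  rw [hl]; exact ⟨one_pos, hρ.out⟩

theorem solvesTraces_of_isMonodromySolution (hφ : φ ∈ Ioo 0 (Real.pi / 2))
    (h : IsMonodromySolution φ t x s F) : SolvesTraces φ t (s • x) s := by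
  have hr : ∀ {l : ℂ}, ‖l‖ = 1 → InAnnulus ρ l := inAnnulus_of_norm_one
  have hF : ∀ {l : ℂ}, ‖l‖ = 1 → IsFrame φ t x s l (F l) := fun {l} hl =>
    h.frame l (norm_lt_of_norm_one (ρ := ρ) hl).1 (norm_lt_of_norm_one hl).2
  refine ⟨⟨fun j k hk => ?_, fun j => ?_⟩, ?_, ?_, ?_, ?_⟩
  · rw [Pi.smul_apply, coeff_smul, h.pole_order j k hk, mul_zero]
  · rw [Pi.smul_apply, coeff_smul, h.residue j]
  · refine eq_of_eval_eq_on_unit_circle fun l hl => ?_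
    rw [eval_quadForm _ (hr hl), eval_one]
    exact (calK_eq_quadForm x s l).symm.trans
      (h.calK_eq l (norm_lt_of_norm_one (ρ := ρ) hl).1 (norm_lt_of_norm_one hl).2)
  · rw [refl_eq_self_iff]
    intro l hl
    rw [eval_pFun φ t _ (hr hl), ← (halfTraces_eq hφ (hF hl)).1]
    exact h.p_real l hl
  · rw [refl_eq_self_iff]
    intro l hl
    rw [eval_qFun φ t _ (hr hl), ← (halfTraces_eq hφ (hF hl)).2]
    exact h.q_real l hl
  · rw [← (halfTraces_eq hφ (hF (l := 1) (by simp))).2]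
    exact h.q_one

theorem exists_isMonodromySolution (hφ : φ ∈ Ioo 0 (Real.pi / 2)) (hs : 0 < s)
    (h : SolvesTraces φ t (s • x) s) : ∃ F, IsMonodromySolution φ t x s F := by
  have hr : ∀ {l : ℂ}, ‖l‖ = 1 → InAnnulus ρ l := inAnnulus_of_norm_one
  have hF := fun l => isFrame_frame (t := t) (r := s) (sin_pos_of_mem hφ) x l
  refine ⟨fun l => frame φ fun j => s * t * (x j).eval l, hs, fun j k hk => ?_, fun j => ?_,
    fun l _ _ => hF l, fun l hl => ?_, fun l hl => ?_, ?_, fun l h0 hl => ?_⟩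
  · have := h.poles.1 j k hk
    rw [Pi.smul_apply, coeff_smul] at this
    exact (mul_eq_zero.1 this).resolve_left hs.ne'
  · have := h.poles.2 j
    rw [Pi.smul_apply, coeff_smul] at this
    exact mul_left_cancel₀ hs.ne' this
  · rw [(halfTraces_eq hφ (hF l)).1, ← eval_pFun φ t _ (hr hl)]
    exact (refl_eq_self_iff _).1 h.refl_p l hl
  · rw [(halfTraces_eq hφ (hF l)).2, ← eval_qFun φ t _ (hr hl)]
    exact (refl_eq_self_iff _).1 h.refl_q l hl
  · rw [(halfTraces_eq hφ (hF 1)).2]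
    exact h.q_one
  · rw [calK_eq_quadForm]
    exact quadForm_evalAt_of_pole h.poles.1 h.quad (norm_pos_iff.1 h0) hl

end Monodromy

/-- Solutions with positive discriminant are unique for small parameters. -/
theorem exists_unique_solvesTraces (ρ : ℝ) [hρ : Fact (1 < ρ)] (hφ : φ ∈ Ioo 0 (Real.pi / 2)) :
    ∃ ε > 0, ∀ t ∈ Ioo 0 ε, ∀ (X Y : Fin 3 → WienerSpace ρ) (r s : ℝ), 0 < r → 0 < s →
      SolvesTraces φ t X r → SolvesTraces φ t Y s → (vFun φ (t • evalAt X I) ^ 2).re < 0 →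
      (vFun φ (t • evalAt Y I) ^ 2).re < 0 → X = Y ∧ r = s := by
  have hρ1 := hρ.out
  -- Closeness to the central solution is available only with a loss of radius, so local uniqueness
  -- is applied in the space of radius `ρ'`. The inclusion preserves coefficients and is injective.
  set ρ' := (1 + ρ) / 2 with hρ'
  have hlt : ρ' < ρ := by rw [hρ']; linarith
  have : Fact (1 < ρ') := ⟨by rw [hρ']; linarith⟩
  obtain ⟨ψ, ε₁, δ, h1, hδ, -, -, -, huniq⟩ := exists_analytic_branch (ρ := ρ') hφ
  obtain ⟨ε₂, h2, hnear⟩ := exists_near_central (ρ := ρ) hφ hlt hδ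
  refine ⟨min ε₁ ε₂, lt_min h1 h2, fun t ht X Y r s hr hs hX hY hXI hYI => ?_⟩
  have ht0 := ht.1
  have ht1 : t ∈ Ioo (-ε₁) ε₁ := ⟨by linarith, ht.2.trans_le (min_le_left _ _)⟩
  have ht2 : t ∈ Ioo 0 ε₂ := ⟨ht0, ht.2.trans_le (min_le_right _ _)⟩
  have key : ∀ (Z : Fin 3 → WienerSpace ρ) (q : ℝ), 0 < q → SolvesTraces φ t Z q →
      (vFun φ (t • evalAt Z I) ^ 2).re < 0 →
      ψ t = (fun j => incl hlt.le (Z j), q) := fun Z q hq hZ hI =>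
    huniq t ht1 _ (hnear t ht2 Z q hq hZ.poles (hZ.hasSymmetricTraces hφ ht0.ne' hI))
      ((hZ.incl hlt.le).monEq_eq_zero ht0.ne')
  have e := (key X r hr hX hXI).symm.trans (key Y s hs hY hYI)
  rw [Prod.mk.injEq] at e
  refine ⟨funext fun j => ext_coeff fun k => ?_, e.2⟩
  rw [← coeff_incl hlt.le (X j) k, ← coeff_incl hlt.le (Y j) k]
  exact congrArg (fun u => WienerSpace.coeff u k) (congrFun e.1 j)

/-- The discriminant is positive along a branch through the central solution. -/
theorem eventually_vFun_sq_neg (hφ : φ ∈ Ioo 0 (Real.pi / 2)) {X : ℝ → Fin 3 → WienerSpace ρ}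
    (hX : ContinuousAt X 0) (h0 : X 0 = centralX φ) : ∀ᶠ t in nhds (0 : ℝ), t ≠ 0 →
      (vFun φ (t • evalAt (X t) I) ^ 2).re < 0 := by
  have hI : InAnnulus ρ I := inAnnulus_of_norm_one (by simp)
  have hc := cos_pos_of_mem hφ
  have hev : ContinuousAt (fun t => evalAt (X t) I) 0 := by
    refine continuousAt_pi.2 fun j => ?_
    have h1 : ContinuousAt (fun t => X t j) 0 := (continuousAt_pi.1 hX) j
    exact ContinuousAt.comp (g := fun u : WienerSpace ρ => evalCLM I hI u)
      (evalCLM I hI).continuous.continuousAt h1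
  have hv : ContinuousAt (fun t => (vRem φ t (evalAt (X t) I) ^ 2).re) 0 := by
    have h1 : ContinuousAt (fun t : ℝ => (t, evalAt (X t) I)) 0 := continuousAt_id.prodMk hev
    have hc : Continuous (fun x : ℝ × (Fin 3 → ℂ) => vRem φ x.1 x.2) := (contDiff_vRem φ).continuous
    have h2 : ContinuousAt ((fun x : ℝ × (Fin 3 → ℂ) => vRem φ x.1 x.2) ∘
      fun t : ℝ => (t, evalAt (X t) I)) 0 := hc.continuousAt.comp h1
    exact continuous_re.continuousAt.comp (h2.pow 2)
  have hneg : (vRem φ 0 (evalAt (X 0) I) ^ 2).re < 0 := by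
    -- At `λ = i` the first central component is purely imaginary, equal to `-i cos φ`.
    rw [vRem_zero hφ, h0, evalAt_apply, eval_centralX_zero]
    have e : ((4 * Real.pi) • ((Real.cos φ : ℂ) / 2 * I⁻¹ - (Real.cos φ : ℂ) / 2 * I)) ^ 2 =
        ((-(4 * Real.pi * Real.cos φ) ^ 2 : ℝ) : ℂ) := by
      rw [Complex.inv_I, Complex.real_smul]
      push_cast [-ofReal_cos]
      linear_combination ((4 * Real.pi * Real.cos φ : ℂ)) ^ 2 * I_sq
    rw [e, ofReal_re]
    have := Real.pi_pos
    have : 0 < 4 * Real.pi * Real.cos φ := by positivity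
    nlinarith
  filter_upwards [hv.eventually (gt_mem_nhds hneg)] with t ht ht0
  have h1 : vFun φ (t • evalAt (X t) I) ^ 2 =
      ((t ^ 2 : ℝ) : ℂ) * vRem φ t (evalAt (X t) I) ^ 2 := by
    rw [vFun_smul, Complex.real_smul]; push_cast; ring
  rw [h1, re_ofReal_mul]
  exact mul_neg_of_pos_of_neg (by positivity) ht

end WienerSpace

theorem mainTheorem7 (φ : ℝ) (hφ : φ ∈ Set.Ioo 0 (Real.pi / 2)) (ρ : ℝ) [hρ : Fact (1 < ρ)] :
    ∃ ε : ℝ, 0 < ε ∧ ∃ (x : ℝ → Fin 3 → WienerSpace ρ) (r : ℝ → ℝ),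
      AnalyticOnNhd ℝ (fun t => (x t, r t)) (Set.Ioo (-ε) ε) ∧
      (∀ t ∈ Set.Ico 0 ε, ∃ F, Lawson.IsMonodromySolution φ t (x t) (r t) F) ∧
      (∀ t ∈ Set.Ioo 0 ε, ∀ (y : Fin 3 → WienerSpace ρ) (s : ℝ),
        (∃ F, Lawson.IsMonodromySolution φ t y s F ∧
          0 < (Lawson.frickeDiscriminant t (F Complex.I)).re) ↔ y = x t ∧ s = r t) ∧
      (∀ l : ℂ, l ≠ 0 →
        (x 0 0).eval l = (1 - l ^ 2) / (2 * l) ∧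
        (x 0 1).eval l = -(Real.sin φ : ℂ) * ((l - 1) ^ 2 / (2 * l)) ∧
        (x 0 2).eval l =
          -(1 / (Real.cos φ : ℂ)) - (Real.cos φ : ℂ) * ((l - 1) ^ 2 / (2 * l))) ∧
      r 0 = Real.cos φ := by
  have hc := Lawson.cos_pos_of_mem hφ
  obtain ⟨ψ, ε₁, -, h1, -, hψ0, han, hsol, -⟩ := WienerSpace.exists_analytic_branch (ρ := ρ) hφ
  obtain ⟨ε₂, h2, huniq⟩ := WienerSpace.exists_unique_solvesTraces ρ hφ
  have hcont : ContinuousAt ψ 0 := (han 0 ⟨by linarith, h1⟩).continuousAt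
  have hpos : ∀ᶠ t in nhds (0 : ℝ), 0 < (ψ t).2 :=
    (continuous_snd.continuousAt.comp hcont).eventually (lt_mem_nhds (by
      simp only [Function.comp, hψ0]; exact hc))
  have hX : ContinuousAt (fun t => (ψ t).1) 0 := continuous_fst.continuousAt.comp hcont
  have hneg := WienerSpace.eventually_vFun_sq_neg hφ hX (by rw [hψ0])
  -- Near `t = 0` the branch keeps a positive scale, and for `t ≠ 0` a positive discriminant at `i`,
  -- since both hold to leading order.
  obtain ⟨ε₃, h3, H⟩ := Metric.eventually_nhds_iff.1 (hpos.and hneg)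
  have hε : ∀ t ∈ Set.Ioo (-min ε₁ (min ε₂ ε₃)) (min ε₁ (min ε₂ ε₃)),
      t ∈ Set.Ioo (-ε₁) ε₁ ∧ t < ε₂ ∧ dist t 0 < ε₃ := fun t ht => by
    have := abs_lt.2 ht
    rw [lt_min_iff, lt_min_iff] at this
    refine ⟨abs_lt.1 this.1, (le_abs_self t).trans_lt this.2.1, ?_⟩
    rw [Real.dist_0_eq_abs]; exact this.2.2
  have hp : 0 < min ε₁ (min ε₂ ε₃) := lt_min h1 (lt_min h2 h3)
  generalize min ε₁ (min ε₂ ε₃) = ε at hε hp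
  have hr : ∀ t ∈ Set.Ioo (-ε) ε, 0 < (ψ t).2 := fun t ht => (H (hε t ht).2.2).1
  have hsmul : ∀ t ∈ Set.Ioo (-ε) ε, (ψ t).2 • ((ψ t).2⁻¹ • (ψ t).1) = (ψ t).1 := fun t ht =>
    smul_inv_smul₀ (hr t ht).ne' _
  have hst : ∀ t ∈ Set.Ioo (-ε) ε, WienerSpace.SolvesTraces φ t (ψ t).1 (ψ t).2 := fun t ht =>
    .of_monEq (hsol t (hε t ht).1)
  have hex : ∀ t ∈ Set.Ioo (-ε) ε, ∃ F, Lawson.IsMonodromySolution φ t ((ψ t).2⁻¹ • (ψ t).1)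
      (ψ t).2 F := fun t ht =>
    WienerSpace.exists_isMonodromySolution hφ (hr t ht) (by rw [hsmul t ht]; exact hst t ht)
  have hI : 0 < ‖Complex.I‖ ∧ ‖Complex.I‖ < ρ := WienerSpace.norm_lt_of_norm_one (by simp)
  have hdisc : ∀ {t s : ℝ} {y : Fin 3 → WienerSpace ρ} {F}, t ≠ 0 →
      Lawson.IsMonodromySolution φ t y s F → (Lawson.frickeDiscriminant t (F Complex.I)).re =
        -(Lawson.vFun φ (t • WienerSpace.evalAt (s • y) Complex.I) ^ 2).re := fun ht h => by
    rw [WienerSpace.frickeDiscriminant_eq hφ ht (h.frame _ hI.1 hI.2) (h.calK_eq _ hI.1 hI.2),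
      Complex.neg_re]
  -- The branch is in terms of `X = r x`; dividing by the positive analytic function `r` recovers
  -- `x`.
  refine ⟨ε, hp, fun t => (ψ t).2⁻¹ • (ψ t).1, fun t => (ψ t).2, fun t ht => ?_, fun t ht => ?_,
    fun t ht y s => ⟨?_, ?_⟩, ?_, ?_⟩
  · have hψ := han t (hε t ht).1
    have hfst : AnalyticAt ℝ (fun t => (ψ t).1) t := analyticAt_fst.comp hψ
    have hsnd : AnalyticAt ℝ (fun t => (ψ t).2) t := analyticAt_snd.comp hψ
    exact ((hsnd.inv (hr t ht).ne').smul hfst).prod hsnd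
  · exact hex t ⟨by linarith [ht.1], ht.2⟩
  · rintro ⟨F, hF, hΔ⟩
    have ht' : t ∈ Set.Ioo (-ε) ε := ⟨by linarith [ht.1], ht.2⟩
    rw [hdisc ht.1.ne' hF, Left.neg_pos_iff] at hΔ
    obtain ⟨e1, e2⟩ := huniq t ⟨ht.1, (hε t ht').2.1⟩ _ _ _ _ hF.r_pos (hr t ht')
      (WienerSpace.solvesTraces_of_isMonodromySolution hφ hF) (hst t ht') hΔ
      ((H (hε t ht').2.2).2 ht.1.ne')
    refine ⟨?_, e2⟩
    change y = (ψ t).2⁻¹ • (ψ t).1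
    rw [← e1, ← e2, inv_smul_smul₀ hF.r_pos.ne']
  · rintro ⟨rfl, rfl⟩
    have ht' : t ∈ Set.Ioo (-ε) ε := ⟨by linarith [ht.1], ht.2⟩
    obtain ⟨F, hF⟩ := hex t ht'
    refine ⟨F, hF, ?_⟩
    rw [hdisc ht.1.ne' hF, hsmul t ht', Left.neg_pos_iff]
    exact (H (hε t ht').2.2).2 ht.1.ne'
  · intro l hl
    have hc0 : (Real.cos φ : ℂ) ≠ 0 := Complex.ofReal_ne_zero.2 hc.ne'
    have e : ∀ j, (((ψ 0).2⁻¹ • (ψ 0).1) j).eval l =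
        (Real.cos φ : ℂ)⁻¹ * (WienerSpace.centralX φ j : WienerSpace ρ).eval l := fun j => by
      rw [Pi.smul_apply, WienerSpace.eval_real_smul, hψ0, Complex.ofReal_inv]
    refine ⟨?_, ?_, ?_⟩
    · rw [e, WienerSpace.eval_centralX_zero]
      field_simp
    · rw [e, WienerSpace.eval_centralX_one]
      field_simp
      ring
    · rw [e, WienerSpace.eval_centralX_two]
      field_simp
      ring
  · simp only [hψ0]
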